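/- Let $k$ be a field, $N\ge 1$, $q\in k$ with $q\neq 0$, $q^2\neq 1$, and let $z\in k$ satisfy $z^N=q^{-1}$. Let $H=\mathrm{SL}_q(N)$ be the $k$-algebra generated by $x_{ij}$ ($1\le i,j\le N$) with relations \[ x_{im}x_{in}=q\,x_{in}x_{im}\ (n<m),\qquad x_{jm}x_{im}=q\,x_{im}x_{jm}\ (i<j), \] \[ x_{jn}x_{im}=x_{im}x_{jn},\qquad x_{jm}x_{in}-x_{in}x_{jm}=(q-q^{-1})x_{im}x_{jn}\quad(i<j,\ n<m), \] \[ \sum_{p\in S_N}(-q)^{-\ell(p)}x_{1p(1)}\cdots x_{Np(N)}=1, \] where $\ell(p)$ is the number of inversions of $p$. It is a Hopf algebra with $\Delta(x_{ij})=\sum_m x_{im}\otimes x_{mj}$, $\varepsilon(x_{ij})=\delta_{ij}$, and it has a coquasitriangular structure, i.e. a convolution-invertible bilinear form $\sigma:H\times H\to k$ with $\sigma(hh',g)=\sigma(h,g_1)\sigma(h',g_2)$, $\sigma(g,hh')=\sigma(g_2,h)\sigma(g_1,h')$, $\sigma(1,h)=\sigma(h,1)=\varepsilon(h)$, $\sigma(h_1,g_1)h_2g_2=g_1h_1\sigma(h_2,g_2)$,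 such that \[ \sigma(x_{im},x_{jn})=z\bigl(q^{\delta_{ij}}\delta_{mi}\delta_{nj}+[i<j](q-q^{-1})\delta_{mj}\delta_{ni}\bigr). \] Let $H^*$ have the convolution product $(fg)(h)=f(h_1)g(h_2)$ with unit $\varepsilon$, and let $H^0\subset H^*$ be the finite dual, a Hopf algebra with $f(ab)=f_1(a)f_2(b)$, $\varepsilon(f)=f(1)$, $S(f)=f\circ S$. Put $l_h=\sigma(-,h)$, $r_h=\sigma(h,-)$, $H_l=\{l_h\mid h\in H\}$, $H_r=\{r_h\mid h\in H\}$, $l_{ij}=l_{x_{ij}}$, $r_{ij}=r_{x_{ij}}$, and, for $1\le i\le N$, $1\le s\le N-1$, \[ \widehat K_i=l_{ii},\quad \widehat K_i^{-1}=l_{ii}\circ S,\quad E_s=l_{s+1,s+1}^{-1}\,l_{s+1,s},\quad F_s=(q-q^{-1})^{-2}\,r_{ss}^{-1}\,r_{s,s+1}, \] where $l_{ii}^{-1}=l_{ii}\circ S$ and $r_{ii}^{-1}=r_{ii}\circ S$. Then $H_l$, $H_r$ and $H_\sigma:=H_lH_r=H_rH_l$ are sub-Hopf algebras of $H^0$.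 As algebras, $H_l$ is generated by the $\widehat K_i^{\pm1}$ and $E_s$, $H_r$ by the $\widehat K_i^{\pm1}$ and $F_s$, and $H_\sigma$ by the $\widehat K_i^{\pm1}$, $E_s$ and $F_s$. These elements satisfy \begin{gather*} \widehat K_i\widehat K_j=\widehat K_j\widehat K_i,\quad \widehat K_i\widehat K_i^{-1}=\widehat K_i^{-1}\widehat K_i=\varepsilon,\quad \widehat K_1\cdots\widehat K_N=\varepsilon,\tag{1}\\ \widehat K_iE_t\widehat K_i^{-1}=q^{\delta_{i,t}-\delta_{i,t+1}}E_t,\quad E_tE_s=E_sE_t\ (|s-t|>1),\\ E_s^2E_t-(q+q^{-1})E_sE_tE_s+E_tE_s^2=0\ (|s-t|=1),\tag{2}\\ \widehat K_iF_t\widehat K_i^{-1}=q^{\delta_{i,t+1}-\delta_{i,t}}F_t,\quad F_tF_s=F_sF_t\ (|s-t|>1),\\ F_s^2F_t-(q+q^{-1})F_sF_tF_s+F_tF_s^2=0\ (|s-t|=1),\tag{3}\\ E_sF_t-F_tE_s=\delta_{st}(q-q^{-1})^{-1}\bigl(\widehat K_s\widehat K_{s+1}^{-1}-\widehat K_s^{-1}\widehat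 K_{s+1}\bigr),\tag{4} \end{gather*} and the Hopf structure is \begin{gather*} \Delta(\widehat K_i^{\pm1})=\widehat K_i^{\pm1}\otimes\widehat K_i^{\pm1},\quad \varepsilon(\widehat K_i^{\pm1})=1,\quad S(\widehat K_i^{\pm1})=\widehat K_i^{\mp1},\\ \Delta(E_s)=\varepsilon\otimes E_s+E_s\otimes\widehat K_{s+1}^{-1}\widehat K_s,\quad \varepsilon(E_s)=0,\quad S(E_s)=-E_s\widehat K_s^{-1}\widehat K_{s+1},\\ \Delta(F_s)=F_s\otimes\varepsilon+\widehat K_{s+1}\widehat K_s^{-1}\otimes F_s,\quad \varepsilon(F_s)=0,\quad S(F_s)=-\widehat K_s\widehat K_{s+1}^{-1}F_s. \end{gather*} Let $U_q^{\mathrm{ext}}(\mathrm{sl}_N)$ be the algebra presented by generators $\widehat K_i^{\pm1},E_s,F_s$ and relations (1)--(4), and let its Borel algebras be those presented by $\widehat K_i^{\pm1},E_s$ with (1), (2), respectively by $\widehat K_i^{\pm1},F_s$ with (1), (3). All three are Hopf algebras by the formulas above, and sending generators to generators defines surjective Hopf algebra maps from $U_q^{\mathrm{ext}}(\mathrm{sl}_N)$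 onto $H_\sigma$ and from the two Borel algebras onto $H_l$ and $H_r$, respectively. If $q$ is not a root of unity, these three maps are isomorphisms. -/

import Mathlib

open scoped TensorProduct

noncomputable section

/-! ### Hopf algebra structures on a given algebra, and morphisms between them -/

/-- A Hopf algebra structure on the `k`-algebra `A` (whose algebra structure is already given). -/
structure HopfStructure (k A : Type*) [Field k] [Ring A] [Algebra k A] where
  /-- the comultiplication -/
  Δ : A →ₐ[k] A ⊗[k] A
  /-- the counit -/
  ε : A →ₐ[k] k
  /-- the antipode -/
  S : A →ₗ[k] A
  coassoc : (Algebra.TensorProduct.assoc k k k A A A).toAlgHom.comp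
      ((Algebra.TensorProduct.map Δ (.id k A)).comp Δ)
      = (Algebra.TensorProduct.map (.id k A) Δ).comp Δ
  counit_left : (Algebra.TensorProduct.map ε (.id k A)).comp Δ
      = (Algebra.TensorProduct.lid k A).symm
  counit_right : (Algebra.TensorProduct.map (.id k A) ε).comp Δ
      = (Algebra.TensorProduct.rid k k A).symm
  antipode_left : LinearMap.mul' k A ∘ₗ S.rTensor A ∘ₗ Δ.toLinearMap
      = Algebra.linearMap k A ∘ₗ ε.toLinearMap
  antipode_right : LinearMap.mul' k A ∘ₗ S.lTensor A ∘ₗ Δ.toLinearMap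
      = Algebra.linearMap k A ∘ₗ ε.toLinearMap

namespace HopfStructure

variable {k A B : Type*} [Field k] [Ring A] [Algebra k A] [Ring B] [Algebra k B]

/-- The Hopf algebra in the sense of Mathlib. -/
abbrev toHopfAlgebra (D : HopfStructure k A) : HopfAlgebra k A :=
  { Bialgebra.ofAlgHom D.Δ D.ε D.coassoc D.counit_left D.counit_right with
    antipode := D.S
    mul_antipode_rTensor_comul := D.antipode_left
    mul_antipode_lTensor_comul := D.antipode_right }

/-- Morphisms of Hopf algebras. -/
structure IsHom (DA : HopfStructure k A) (DB : HopfStructure k B) (f : A →ₐ[k] B) : Prop where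
  map_comul : ∀ a, DB.Δ (f a) = Algebra.TensorProduct.map f f (DA.Δ a)
  map_counit : ∀ a, DB.ε (f a) = DA.ε a
  map_antipode : ∀ a, DB.S (f a) = f (DA.S a)

/-! ### The convolution algebra `H^*`, the finite dual and its sub-Hopf algebras -/

/-- The linear dual `H^*`, with the convolution product `(f g)(h) = f(h₁) g(h₂)` and unit `ε`. -/
def Dual (_ : HopfStructure k A) : Type _ := WithConv (A →ₗ[k] k)

instance (D : HopfStructure k A) : Ring D.Dual :=
  letI := D.toHopfAlgebra
  inferInstanceAs (Ring (WithConv (A →ₗ[k] k)))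

instance (D : HopfStructure k A) : Algebra k D.Dual :=
  letI := D.toHopfAlgebra
  inferInstanceAs (Algebra k (WithConv (A →ₗ[k] k)))

/-- A linear form, seen as an element of the convolution algebra. -/
def toDual (D : HopfStructure k A) : (A →ₗ[k] k) →ₗ[k] D.Dual where
  toFun f := WithConv.toConv f
  map_add' _ _ := rfl
  map_smul' _ _ := rfl

/-- The linear form underlying an element of the convolution algebra. -/
def form (D : HopfStructure k A) : D.Dual →ₗ[k] (A →ₗ[k] k) where
  toFun f := WithConv.ofConv f
  map_add' _ _ := rfl
  map_smul' _ _ := rfl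

theorem form_injective (D : HopfStructure k A) : Function.Injective D.form :=
  fun _ _ h => WithConv.ofConv_injective h

@[simp] theorem form_toDual (D : HopfStructure k A) (f : A →ₗ[k] k) :
    D.form (D.toDual f) = f := rfl

theorem form_mul (D : HopfStructure k A) (f g : D.Dual) (a : A) :
    D.form (f * g) a = LinearMap.mul' k k (TensorProduct.map (D.form f) (D.form g) (D.Δ a)) :=
  rfl

theorem form_algebraMap (D : HopfStructure k A) (c : k) (a : A) :
    D.form (algebraMap k D.Dual c) a = c * D.ε a := rfl

/-- The finite dual `H^0`: the forms that vanish on a two-sided ideal of finite codimension. -/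
def finiteDual (D : HopfStructure k A) : Set D.Dual :=
  {f | ∃ I : Ideal A, I.IsTwoSided ∧ Module.Finite k (A ⧸ I.restrictScalars k) ∧
    ∀ a ∈ I, D.form f a = 0}

/-- For a subalgebra `U` of `H^*`, the value `u(a) v(b)` on `a, b ∈ H` of the tensor `u ⊗ v`. -/
def evalTensor (D : HopfStructure k A) (U : Subalgebra k D.Dual) (a b : A) : U ⊗[k] U →ₗ[k] k :=
  LinearMap.mul' k k ∘ₗ TensorProduct.map
    (LinearMap.applyₗ a ∘ₗ D.form ∘ₗ U.val.toLinearMap)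
    (LinearMap.applyₗ b ∘ₗ D.form ∘ₗ U.val.toLinearMap)

/-- The subalgebra `U` of `H^*` with the Hopf structure `DU` is a sub-Hopf algebra of `H^0`:
it lies in `H^0` and carries the structure of `H^0`, that is,
`Δ(f) = f₁ ⊗ f₂` with `f(ab) = f₁(a) f₂(b)`, `ε(f) = f(1)` and `S(f) = f ∘ S`. -/
structure IsSubHopf (D : HopfStructure k A) (U : Subalgebra k D.Dual)
    (DU : HopfStructure k U) : Prop where
  le_finiteDual : (U : Set D.Dual) ⊆ D.finiteDual
  comul : ∀ (f : U) (a b : A), D.evalTensor U a b (DU.Δ f) = D.form f (a * b)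
  counit : ∀ f : U, DU.ε f = D.form f 1
  antipode : ∀ (f : U) (a : A), D.form (DU.S f) a = D.form f (D.S a)

end HopfStructure

/-! ### Coquasitriangular Hopf algebras and the algebras `H_l`, `H_r`, `H_σ` -/

section CQT

variable {k H : Type*} [Field k] [Ring H] [Algebra k H]

/-- The map `h ⊗ g ↦ (h₁ ⊗ g₁) ⊗ (h₂ ⊗ g₂)`. -/
def HopfStructure.split (D : HopfStructure k H) (h g : H) : (H ⊗[k] H) ⊗[k] (H ⊗[k] H) :=
  TensorProduct.tensorTensorTensorComm k H H H H (D.Δ h ⊗ₜ[k] D.Δ g)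

/-- A coquasitriangular structure `σ` on the Hopf algebra `(H, D)`. -/
structure CQT (D : HopfStructure k H) where
  /-- the bilinear form -/
  σ : H →ₗ[k] H →ₗ[k] k
  /-- `σ(hh', g) = σ(h, g₁) σ(h', g₂)` -/
  mul_left : ∀ h h' g, σ (h * h') g =
    LinearMap.mul' k k (TensorProduct.map (σ h) (σ h') (D.Δ g))
  /-- `σ(g, hh') = σ(g₂, h) σ(g₁, h')` -/
  mul_right : ∀ g h h', σ g (h * h') =
    LinearMap.mul' k k (TensorProduct.map (σ.flip h') (σ.flip h) (D.Δ g))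
  one_left : ∀ h, σ 1 h = D.ε h
  one_right : ∀ h, σ h 1 = D.ε h
  /-- `σ` is invertible under convolution:
  `σ(h₁, g₁) τ(h₂, g₂) = ε(h) ε(g) = τ(h₁, g₁) σ(h₂, g₂)` for some bilinear form `τ`. -/
  exists_inv : ∃ τ : H →ₗ[k] H →ₗ[k] k, ∀ h g,
    LinearMap.mul' k k (TensorProduct.map (TensorProduct.lift σ) (TensorProduct.lift τ)
      (D.split h g)) = D.ε h * D.ε g ∧
    LinearMap.mul' k k (TensorProduct.map (TensorProduct.lift τ) (TensorProduct.lift σ)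
      (D.split h g)) = D.ε h * D.ε g
  /-- `σ(h₁, g₁) h₂ g₂ = g₁ h₁ σ(h₂, g₂)` -/
  braid : ∀ h g,
    TensorProduct.lid k H (TensorProduct.map (TensorProduct.lift σ) (LinearMap.mul' k H)
      (D.split h g)) =
    TensorProduct.rid k H (TensorProduct.map
      (LinearMap.mul' k H ∘ₗ (TensorProduct.comm k H H).toLinearMap) (TensorProduct.lift σ)
      (D.split h g))

namespace CQT

variable {D : HopfStructure k H} (C : CQT D)

/-- `r_h = σ(h, -)` -/
def r : H →ₗ[k] D.Dual := D.toDual ∘ₗ C.σ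

/-- `l_h = σ(-, h)` -/
def l : H →ₗ[k] D.Dual := D.toDual ∘ₗ C.σ.flip

theorem l_mul (x y : H) : C.l (x * y) = C.l y * C.l x :=
  D.form_injective (LinearMap.ext fun a => C.mul_right a x y)

theorem r_mul (x y : H) : C.r (x * y) = C.r x * C.r y :=
  D.form_injective (LinearMap.ext fun a => C.mul_left x y a)

theorem algebraMap_eq_l (c : k) : algebraMap k D.Dual c = C.l (c • 1) := by
  apply D.form_injective
  ext a
  simp [l, HopfStructure.form_algebraMap, C.one_right]

theorem algebraMap_eq_r (c : k) : algebraMap k D.Dual c = C.r (c • 1) := by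
  apply D.form_injective
  ext a
  simp [r, HopfStructure.form_algebraMap, C.one_left]

/-- `H_l = {l_h | h ∈ H}` -/
def Hl : Subalgebra k D.Dual where
  carrier := Set.range C.l
  mul_mem' := by
    rintro _ _ ⟨x, rfl⟩ ⟨y, rfl⟩
    exact ⟨y * x, C.l_mul y x⟩
  add_mem' := by
    rintro _ _ ⟨x, rfl⟩ ⟨y, rfl⟩
    exact ⟨x + y, map_add _ x y⟩
  algebraMap_mem' c := ⟨c • 1, (C.algebraMap_eq_l c).symm⟩

/-- `H_r = {r_h | h ∈ H}` -/
def Hr : Subalgebra k D.Dual where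
  carrier := Set.range C.r
  mul_mem' := by
    rintro _ _ ⟨x, rfl⟩ ⟨y, rfl⟩
    exact ⟨x * y, C.r_mul x y⟩
  add_mem' := by
    rintro _ _ ⟨x, rfl⟩ ⟨y, rfl⟩
    exact ⟨x + y, map_add _ x y⟩
  algebraMap_mem' c := ⟨c • 1, (C.algebraMap_eq_r c).symm⟩

/-- The subalgebra `H_σ` of `H^*` generated by `H_l` and `H_r`. (The theorem also states that it
is the product `H_l H_r = H_r H_l`.) -/
def Hsigma : Subalgebra k D.Dual := C.Hl ⊔ C.Hr

end CQT

end CQT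

/-! ### The algebra `SL_q(N)`, `N = n + 1`; the index set `{1, …, N}` is `Fin (n + 1)` -/

/-- The number of inversions of a permutation. -/
def inversions {N : ℕ} (p : Equiv.Perm (Fin N)) : ℕ :=
  (Finset.univ.filter fun a : Fin N × Fin N => a.1 < a.2 ∧ p a.2 < p a.1).card

section SLq

variable {k : Type*} [Field k]

/-- The free generators `x_{ij}`. -/
def freeX (k : Type*) [Field k] (n : ℕ) (i j : Fin (n + 1)) :
    FreeAlgebra k (Fin (n + 1) × Fin (n + 1)) := FreeAlgebra.ι k (i, j)

/-- The defining relations of `SL_q(N)`. -/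
inductive SLqRel (n : ℕ) (q : k) : FreeAlgebra k (Fin (n + 1) × Fin (n + 1)) →
    FreeAlgebra k (Fin (n + 1) × Fin (n + 1)) → Prop
  | row (i m l : Fin (n + 1)) (h : l < m) : SLqRel n q
      (freeX k n i m * freeX k n i l) (q • (freeX k n i l * freeX k n i m))
  | col (i j m : Fin (n + 1)) (h : i < j) : SLqRel n q
      (freeX k n j m * freeX k n i m) (q • (freeX k n i m * freeX k n j m))
  | comm (i j l m : Fin (n + 1)) (h : i < j) (h' : l < m) : SLqRel n q
      (freeX k n j l * freeX k n i m) (freeX k n i m * freeX k n j l)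
  | cross (i j l m : Fin (n + 1)) (h : i < j) (h' : l < m) : SLqRel n q
      (freeX k n j m * freeX k n i l - freeX k n i l * freeX k n j m)
      ((q - q⁻¹) • (freeX k n i m * freeX k n j l))
  | det : SLqRel n q
      (∑ p : Equiv.Perm (Fin (n + 1)), ((-q)⁻¹) ^ inversions p •
        (List.ofFn fun i => freeX k n i (p i)).prod) 1

/-- The algebra `SL_q(n + 1)`. -/
def SLq (n : ℕ) (q : k) : Type _ := RingQuot (SLqRel n q)

instance (n : ℕ) (q : k) : Ring (SLq n q) := inferInstanceAs (Ring (RingQuot (SLqRel n q)))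

instance (n : ℕ) (q : k) : Algebra k (SLq n q) :=
  inferInstanceAs (Algebra k (RingQuot (SLqRel n q)))

/-- The generators `x_{ij}` of `SL_q(N)`. -/
def SLq.x (n : ℕ) (q : k) (i j : Fin (n + 1)) : SLq n q :=
  RingQuot.mkAlgHom k (SLqRel n q) (freeX k n i j)

/-! The elements `K̂_i`, `K̂_i⁻¹`, `E_s`, `F_s` of the convolution algebra of `SL_q(N)`.
For `s : Fin n`, the indices `s`, `s + 1` in `{1, …, N}` are `s.castSucc`, `s.succ`. -/

namespace CQT

variable {n : ℕ} {q : k} {D : HopfStructure k (SLq n q)} (C : CQT D)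

/-- `K̂_i = l_{ii}` -/
def K (i : Fin (n + 1)) : D.Dual := C.l (SLq.x n q i i)

/-- `K̂_i⁻¹ = l_{ii}⁻¹ = l_{ii} ∘ S` -/
def Kinv (i : Fin (n + 1)) : D.Dual := D.toDual (D.form (C.l (SLq.x n q i i)) ∘ₗ D.S)

/-- `E_s = l_{s+1,s+1}⁻¹ l_{s+1,s}` -/
def E (s : Fin n) : D.Dual := C.Kinv s.succ * C.l (SLq.x n q s.succ s.castSucc)

/-- `F_s = (q - q⁻¹)⁻² r_{ss}⁻¹ r_{s,s+1}`, where `r_{ss}⁻¹ = r_{ss} ∘ S` -/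
def F (s : Fin n) : D.Dual :=
  ((q - q⁻¹) ^ 2)⁻¹ •
    (D.toDual (D.form (C.r (SLq.x n q s.castSucc s.castSucc)) ∘ₗ D.S) *
      C.r (SLq.x n q s.castSucc s.succ))

end CQT

end SLq

/-! ### The extended quantized enveloping algebra and its Borel parts, by presentations -/

/-- Generators of `U_q^ext(sl_N)`. -/
inductive UGen (n : ℕ) : Type
  | K (i : Fin (n + 1))
  | Kinv (i : Fin (n + 1))
  | E (s : Fin n)
  | F (s : Fin n)

/-- Generators of a Borel part: the `K̂_i^{±1}` and either the `E_s` or the `F_s`. -/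
inductive BGen (n : ℕ) : Type
  | K (i : Fin (n + 1))
  | Kinv (i : Fin (n + 1))
  | X (s : Fin n)

section Relations

variable {k A : Type*} [Field k] [Ring A] [Algebra k A] {n : ℕ}

/-- The relations among the `K̂_i` and their inverses. -/
inductive TorusRel (K Kinv : Fin (n + 1) → A) : A → A → Prop
  | comm (i j) : TorusRel K Kinv (K i * K j) (K j * K i)
  | mul_inv (i) : TorusRel K Kinv (K i * Kinv i) 1
  | inv_mul (i) : TorusRel K Kinv (Kinv i * K i) 1
  | prod : TorusRel K Kinv (List.ofFn K).prod 1

/-- The relations of the `E_s` with the `K̂_i` and among themselves. -/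
inductive ERel (q : k) (K Kinv : Fin (n + 1) → A) (E : Fin n → A) : A → A → Prop
  | conj (i : Fin (n + 1)) (t : Fin n) : ERel q K Kinv E (K i * E t * Kinv i)
      (q ^ ((if i = t.castSucc then 1 else 0) - (if i = t.succ then 1 else 0) : ℤ) • E t)
  | comm (s t : Fin n) (h : 1 < |(s : ℤ) - (t : ℤ)|) : ERel q K Kinv E (E t * E s) (E s * E t)
  | serre (s t : Fin n) (h : |(s : ℤ) - (t : ℤ)| = 1) : ERel q K Kinv E
      (E s ^ 2 * E t - (q + q⁻¹) • (E s * E t * E s) + E t * E s ^ 2) 0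

/-- The relations of the `F_s` with the `K̂_i` and among themselves. -/
inductive FRel (q : k) (K Kinv : Fin (n + 1) → A) (F : Fin n → A) : A → A → Prop
  | conj (i : Fin (n + 1)) (t : Fin n) : FRel q K Kinv F (K i * F t * Kinv i)
      (q ^ ((if i = t.succ then 1 else 0) - (if i = t.castSucc then 1 else 0) : ℤ) • F t)
  | comm (s t : Fin n) (h : 1 < |(s : ℤ) - (t : ℤ)|) : FRel q K Kinv F (F t * F s) (F s * F t)
  | serre (s t : Fin n) (h : |(s : ℤ) - (t : ℤ)| = 1) : FRel q K Kinv F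
      (F s ^ 2 * F t - (q + q⁻¹) • (F s * F t * F s) + F t * F s ^ 2) 0

/-- The commutation relation between the `E_s` and the `F_t`. -/
inductive EFRel (q : k) (K Kinv : Fin (n + 1) → A) (E F : Fin n → A) : A → A → Prop
  | mk (s t : Fin n) : EFRel q K Kinv E F (E s * F t - F t * E s)
      (if s = t then (q - q⁻¹)⁻¹ • (K s.castSucc * Kinv s.succ - Kinv s.castSucc * K s.succ)
        else 0)

/-- `Δ`, `ε`, `S` on the `K̂_i^{±1}`. -/
structure TorusHopf (D : HopfStructure k A) (K Kinv : Fin (n + 1) → A) : Prop where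
  comul_K : ∀ i, D.Δ (K i) = K i ⊗ₜ[k] K i
  comul_Kinv : ∀ i, D.Δ (Kinv i) = Kinv i ⊗ₜ[k] Kinv i
  counit_K : ∀ i, D.ε (K i) = 1
  counit_Kinv : ∀ i, D.ε (Kinv i) = 1
  antipode_K : ∀ i, D.S (K i) = Kinv i
  antipode_Kinv : ∀ i, D.S (Kinv i) = K i

/-- `Δ`, `ε`, `S` on the `E_s`. -/
structure EHopf (D : HopfStructure k A) (K Kinv : Fin (n + 1) → A) (E : Fin n → A) : Prop where
  comul : ∀ s, D.Δ (E s) = 1 ⊗ₜ[k] E s + E s ⊗ₜ[k] (Kinv s.succ * K s.castSucc)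
  counit : ∀ s, D.ε (E s) = 0
  antipode : ∀ s, D.S (E s) = -(E s * Kinv s.castSucc * K s.succ)

/-- `Δ`, `ε`, `S` on the `F_s`. -/
structure FHopf (D : HopfStructure k A) (K Kinv : Fin (n + 1) → A) (F : Fin n → A) : Prop where
  comul : ∀ s, D.Δ (F s) = F s ⊗ₜ[k] 1 + (K s.succ * Kinv s.castSucc) ⊗ₜ[k] F s
  counit : ∀ s, D.ε (F s) = 0
  antipode : ∀ s, D.S (F s) = -(K s.castSucc * Kinv s.succ * F s)

end Relations

section Presented

variable {k : Type*} [Field k]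

/-- The defining relations of `U_q^ext(sl_N)`, in the free algebra. -/
def UextRel (n : ℕ) (q : k) (a b : FreeAlgebra k (UGen n)) : Prop :=
  let K i := FreeAlgebra.ι k (UGen.K (n := n) i)
  let Kinv i := FreeAlgebra.ι k (UGen.Kinv (n := n) i)
  let E s := FreeAlgebra.ι k (UGen.E (n := n) s)
  let F s := FreeAlgebra.ι k (UGen.F (n := n) s)
  TorusRel K Kinv a b ∨ ERel q K Kinv E a b ∨ FRel q K Kinv F a b ∨ EFRel q K Kinv E F a b

/-- The algebra `U_q^ext(sl_{n+1})`. -/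
def Uext (n : ℕ) (q : k) : Type _ := RingQuot (UextRel n q)

instance (n : ℕ) (q : k) : Ring (Uext n q) := inferInstanceAs (Ring (RingQuot (UextRel n q)))

instance (n : ℕ) (q : k) : Algebra k (Uext n q) :=
  inferInstanceAs (Algebra k (RingQuot (UextRel n q)))

/-- The generators of `U_q^ext(sl_{n+1})`. -/
def Uext.gen (n : ℕ) (q : k) (g : UGen n) : Uext n q :=
  RingQuot.mkAlgHom k (UextRel n q) (FreeAlgebra.ι k g)

/-- The defining relations of the Borel part generated by the `K̂_i^{±1}` and the `E_s`. -/
def BorelERel (n : ℕ) (q : k) (a b : FreeAlgebra k (BGen n)) : Prop :=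
  let K i := FreeAlgebra.ι k (BGen.K (n := n) i)
  let Kinv i := FreeAlgebra.ι k (BGen.Kinv (n := n) i)
  let E s := FreeAlgebra.ι k (BGen.X (n := n) s)
  TorusRel K Kinv a b ∨ ERel q K Kinv E a b

/-- The Borel algebra generated by the `K̂_i^{±1}` and the `E_s`. -/
def BorelE (n : ℕ) (q : k) : Type _ := RingQuot (BorelERel n q)

instance (n : ℕ) (q : k) : Ring (BorelE n q) := inferInstanceAs (Ring (RingQuot (BorelERel n q)))

instance (n : ℕ) (q : k) : Algebra k (BorelE n q) :=
  inferInstanceAs (Algebra k (RingQuot (BorelERel n q)))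

/-- The generators of `BorelE n q`. -/
def BorelE.gen (n : ℕ) (q : k) (g : BGen n) : BorelE n q :=
  RingQuot.mkAlgHom k (BorelERel n q) (FreeAlgebra.ι k g)

/-- The defining relations of the Borel part generated by the `K̂_i^{±1}` and the `F_s`. -/
def BorelFRel (n : ℕ) (q : k) (a b : FreeAlgebra k (BGen n)) : Prop :=
  let K i := FreeAlgebra.ι k (BGen.K (n := n) i)
  let Kinv i := FreeAlgebra.ι k (BGen.Kinv (n := n) i)
  let F s := FreeAlgebra.ι k (BGen.X (n := n) s)
  TorusRel K Kinv a b ∨ FRel q K Kinv F a b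

/-- The Borel algebra generated by the `K̂_i^{±1}` and the `F_s`. -/
def BorelF (n : ℕ) (q : k) : Type _ := RingQuot (BorelFRel n q)

instance (n : ℕ) (q : k) : Ring (BorelF n q) := inferInstanceAs (Ring (RingQuot (BorelFRel n q)))

instance (n : ℕ) (q : k) : Algebra k (BorelF n q) :=
  inferInstanceAs (Algebra k (RingQuot (BorelFRel n q)))

/-- The generators of `BorelF n q`. -/
def BorelF.gen (n : ℕ) (q : k) (g : BGen n) : BorelF n q :=
  RingQuot.mkAlgHom k (BorelFRel n q) (FreeAlgebra.ι k g)

end Presented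

end

/-! The algebra H. With the matrix R of type A the quadratic relations read R T₁T₂ = T₂T₁ R
(`IsQuantum.isRTT`, `IsRTT.isQuantum`), a form that survives matrix products with commuting entries
and inversion (`IsRTT.tensor`, `IsRTT.op_inverse`). The rows of T act as generators of a q-exterior
algebra (`minorOp_sq`, `minorOp_anti`); sorting words in them gives `qdet_rows`, and hence a
group-like determinant and cofactor inverses on both sides. So H is a Hopf algebra. By the
Yang–Baxter equation zR is a representation of H, with determinant 1 because z^N = q⁻¹. Its
coefficients r_{im} again satisfy the relations of H, now inside H^* (`isRTT_rMatrix`), so h ↦ r_h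
is an algebra map and σ(h, g) = r_h(g). The remaining axioms of σ are linear in each argument and
are checked on entries of tensor products of the vector corepresentation, which span H
(`span_corepEntries`).

Relations and generators. For the weight relations, the far commutation relations, the Serre
relations and the E-F relations, the difference of the two sides is a skew-primitive form, and a
skew-primitive form that vanishes on the x_{ij} is zero (`eq_zero_of_skew`). So these relations
reduce to a computation of coproducts and an identity of N × N matrices, in which E_s and F_s are
multiples of matrix units. The same coproduct computations make the presented algebras Hopf
algebras. A commutator in the cross relation produces l_{ij} from entries closer to the diagonal
(`Hl_eq`, `Hr_eq`), and the commutation relations allow the two Borel parts to be exchanged, so that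
H_σ = H_l H_r = H_r H_l.

Injectivity on a Borel algebra. H^* acts on the noncommutative polynomials in N letters. Operators
stripping an outer letter are almost derivations for this action. The algebra of the E_s is spanned
by ordered products of root vectors, and stripping lowers the exponent of a root vector by one, with
a coefficient that is a q²-integer times a unit. This coefficient is nonzero when q is not a root of
unity, so an element acting by zero vanishes (`eq_zero_of_mem_pbwSpan`). Stripping also multiplies a
torus monomial by a character of the free monoid on the letters, and distinct characters are
linearly independent. The F_s are treated by reversing the alphabet and stripping on the right.

Injectivity on the whole algebra. Conjugation by a suitable torus element in the first tensor factor
grades U ⊗ U by height. The lowest term of Δ(fκe), with f a product of the F_s, κ a torus monomial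
and e a product of the E_s, is fκ ⊗ κe; it lies in the tensor product of the Borel algebras and
determines fκe. A Hopf map that is injective on both Borel algebras is therefore injective
(`eq_zero_of_map_comul`). -/

noncomputable section

/-! ### Hopf algebra structures from generators -/

namespace HopfStructure

variable {k A B : Type*} [Field k] [Ring A] [Algebra k A] [Ring B] [Algebra k B]

section Antipode

variable (S : A →ₐ[k] Aᵐᵒᵖ)

/-- The anti-multiplicative linear map underlying a morphism to the opposite algebra. -/
def antiLinear : A →ₗ[k] A := (MulOpposite.opLinearEquiv k).symm.toLinearMap ∘ₗ S.toLinearMap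

theorem antiLinear_apply (a : A) : antiLinear S a = (S a).unop := rfl

theorem antiLinear_mul (a b : A) : antiLinear S (a * b) = antiLinear S b * antiLinear S a := by
  simp [antiLinear_apply]

/-- Because S reverses products, a factor c ⊗ d on the right wraps around the value S(t₁)t₂. If that
value is a scalar it can be pulled out, which is why the antipode axiom passes from two elements to
their product. -/
theorem mul'_rTensor_anti_mul (t : A ⊗[k] A) (c d : A) :
    LinearMap.mul' k A ((antiLinear S).rTensor A (t * c ⊗ₜ d)) =
      antiLinear S c * LinearMap.mul' k A ((antiLinear S).rTensor A t) * d := by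
  induction t with
  | zero => simp
  | tmul u v => simp [antiLinear_mul, mul_assoc]
  | add x y hx hy => simp only [add_mul, map_add, hx, hy, mul_add]

theorem mul'_lTensor_anti_mul (t : A ⊗[k] A) (c d : A) :
    LinearMap.mul' k A ((antiLinear S).lTensor A (c ⊗ₜ d * t)) =
      c * LinearMap.mul' k A ((antiLinear S).lTensor A t) * antiLinear S d := by
  induction t with
  | zero => simp
  | tmul u v => simp [antiLinear_mul, mul_assoc]
  | add x y hx hy => simp only [add_mul, map_add, hx, hy, mul_add]

variable {S}

theorem antipode_left_of_adjoin {G : Set A} (hG : Algebra.adjoin k G = ⊤)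
    (Δ : A →ₐ[k] A ⊗[k] A) (ε : A →ₐ[k] k)
    (h : ∀ g ∈ G, LinearMap.mul' k A ((antiLinear S).rTensor A (Δ g)) = algebraMap k A (ε g))
    (a : A) : LinearMap.mul' k A ((antiLinear S).rTensor A (Δ a)) = algebraMap k A (ε a) := by
  have ha : a ∈ Algebra.adjoin k G := hG ▸ Algebra.mem_top
  induction ha using Algebra.adjoin_induction with
  | mem x hx => exact h x hx
  | algebraMap c =>
    simp [Algebra.TensorProduct.algebraMap_apply, antiLinear_apply]
  | add x y _ _ hx hy => simp only [map_add, hx, hy]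
  | mul x y _ _ hx hy =>
    have key : ∀ t : A ⊗[k] A, LinearMap.mul' k A ((antiLinear S).rTensor A (Δ x * t)) =
        ε x • LinearMap.mul' k A ((antiLinear S).rTensor A t) := by
      intro t
      induction t with
      | zero => simp
      | tmul c d => rw [mul'_rTensor_anti_mul, hx]; simp [← Algebra.commutes, Algebra.smul_def,
          mul_assoc]
      | add x y hx hy => simp only [mul_add, map_add, hx, hy, smul_add]
    rw [map_mul, key, hy, map_mul, map_mul, Algebra.smul_def]

theorem antipode_right_of_adjoin {G : Set A} (hG : Algebra.adjoin k G = ⊤)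
    (Δ : A →ₐ[k] A ⊗[k] A) (ε : A →ₐ[k] k)
    (h : ∀ g ∈ G, LinearMap.mul' k A ((antiLinear S).lTensor A (Δ g)) = algebraMap k A (ε g))
    (a : A) : LinearMap.mul' k A ((antiLinear S).lTensor A (Δ a)) = algebraMap k A (ε a) := by
  have ha : a ∈ Algebra.adjoin k G := hG ▸ Algebra.mem_top
  induction ha using Algebra.adjoin_induction with
  | mem x hx => exact h x hx
  | algebraMap c =>
    simp [Algebra.TensorProduct.algebraMap_apply, antiLinear_apply]
  | add x y _ _ hx hy => simp only [map_add, hx, hy]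
  | mul x y _ _ hx hy =>
    have key : ∀ t : A ⊗[k] A, LinearMap.mul' k A ((antiLinear S).lTensor A (t * Δ y)) =
        ε y • LinearMap.mul' k A ((antiLinear S).lTensor A t) := by
      intro t
      induction t with
      | zero => simp
      | tmul c d => rw [mul'_lTensor_anti_mul, hy]; simp [← Algebra.commutes, Algebra.smul_def,
          mul_assoc]
      | add x y hx hy => simp only [add_mul, map_add, hx, hy, smul_add]
    rw [map_mul, key, hx, map_mul, map_mul, Algebra.smul_def, Algebra.commutes]

end Antipode

/-- A Hopf structure whose axioms are checked on algebra generators. -/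
def ofGenerators (G : Set A) (hG : Algebra.adjoin k G = ⊤)
    (Δ : A →ₐ[k] A ⊗[k] A) (ε : A →ₐ[k] k) (S : A →ₐ[k] Aᵐᵒᵖ)
    (coassoc : ∀ g ∈ G, Algebra.TensorProduct.assoc k k k A A A
      (Algebra.TensorProduct.map Δ (.id k A) (Δ g)) =
        Algebra.TensorProduct.map (.id k A) Δ (Δ g))
    (counit_left : ∀ g ∈ G, Algebra.TensorProduct.map ε (.id k A) (Δ g) = 1 ⊗ₜ g)
    (counit_right : ∀ g ∈ G, Algebra.TensorProduct.map (.id k A) ε (Δ g) = g ⊗ₜ 1)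
    (antipode_left : ∀ g ∈ G,
      LinearMap.mul' k A ((antiLinear S).rTensor A (Δ g)) = algebraMap k A (ε g))
    (antipode_right : ∀ g ∈ G,
      LinearMap.mul' k A ((antiLinear S).lTensor A (Δ g)) = algebraMap k A (ε g)) :
    HopfStructure k A where
  Δ := Δ
  ε := ε
  S := antiLinear S
  coassoc := AlgHom.ext_of_adjoin_eq_top hG coassoc
  counit_left := AlgHom.ext_of_adjoin_eq_top hG counit_left
  counit_right := AlgHom.ext_of_adjoin_eq_top hG counit_right
  antipode_left := LinearMap.ext fun a => antipode_left_of_adjoin hG Δ ε antipode_left a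
  antipode_right := LinearMap.ext fun a => antipode_right_of_adjoin hG Δ ε antipode_right a

variable (D : HopfStructure k A)

theorem S_mul (a b : A) : D.S (a * b) = D.S b * D.S a :=
  letI := D.toHopfAlgebra
  HopfAlgebra.antipode_mul_antidistrib (R := k) a b

theorem S_one : D.S 1 = 1 :=
  letI := D.toHopfAlgebra
  HopfAlgebra.antipode_one (R := k)

end HopfStructure

/-! ### Tensor products of spaces of functions -/

section TensorFunctions

variable {k V W X Y : Type*} [Field k] [AddCommGroup V] [Module k V] [AddCommGroup W] [Module k W]

/-- Tensors of functions, as functions of two variables. -/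
def tensorEval (f : X → V →ₗ[k] k) (g : Y → W →ₗ[k] k) (x : X) (y : Y) : V ⊗[k] W →ₗ[k] k :=
  LinearMap.mul' k k ∘ₗ TensorProduct.map (f x) (g y)

@[simp] theorem tensorEval_tmul (f : X → V →ₗ[k] k) (g : Y → W →ₗ[k] k) (x : X) (y : Y)
    (v : V) (w : W) : tensorEval f g x y (v ⊗ₜ w) = f x v * g y w := rfl

/-- Expand the tensor along a basis of W. Applying f x to the coefficients gives a vector of W
killed by all g y, hence zero; so each coefficient is killed by all f x. No finiteness of V or W
enters. -/
theorem tensorEval_separating {f : X → V →ₗ[k] k} {g : Y → W →ₗ[k] k}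
    (hf : ∀ v, (∀ x, f x v = 0) → v = 0) (hg : ∀ w, (∀ y, g y w = 0) → w = 0)
    (t : V ⊗[k] W) (h : ∀ x y, tensorEval f g x y t = 0) : t = 0 := by
  classical
  let b := Module.Basis.ofVectorSpace k W
  obtain ⟨c, rfl⟩ := (TensorProduct.equivFinsuppOfBasisRight (M := V) b).symm.surjective t
  rw [TensorProduct.equivFinsuppOfBasisRight_symm_apply] at h ⊢
  have hc : ∀ i, c i = 0 := by
    intro i
    refine hf _ fun x => ?_
    have hx : (c.mapRange (f x) (map_zero _)).sum (fun i a => a • b i) = 0 := by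
      refine hg _ fun y => ?_
      rw [Finsupp.sum_mapRange_index (by simp)]
      simpa [Finsupp.sum, map_sum] using h x y
    have := b.repr.symm.injective (a₁ := c.mapRange (f x) (map_zero _)) (a₂ := 0) (by
      rw [map_zero, Module.Basis.repr_symm_apply, Finsupp.linearCombination_apply, hx])
    simpa using DFunLike.congr_fun this i
  have : c = 0 := Finsupp.ext hc
  simp [this]

theorem tensorEval_ext {f : X → V →ₗ[k] k} {g : Y → W →ₗ[k] k}
    (hf : ∀ v, (∀ x, f x v = 0) → v = 0) (hg : ∀ w, (∀ y, g y w = 0) → w = 0)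
    {t t' : V ⊗[k] W} (h : ∀ x y, tensorEval f g x y t = tensorEval f g x y t') : t = t' :=
  sub_eq_zero.1 (tensorEval_separating hf hg _ fun x y => by rw [map_sub, h, sub_self])

end TensorFunctions

/-! ### Sub-Hopf algebras of the finite dual -/

namespace HopfStructure

variable {k A : Type*} [Field k] [Ring A] [Algebra k A] (D : HopfStructure k A)

theorem form_one (a : A) : D.form 1 a = D.ε a := by
  simpa using D.form_algebraMap 1 a

/-- The value of an element of a subspace of `H^*` at a point. -/
def evalAt (U : Subalgebra k D.Dual) (a : A) : U →ₗ[k] k :=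
  LinearMap.applyₗ a ∘ₗ D.form ∘ₗ U.val.toLinearMap

@[simp] theorem evalAt_apply (U : Subalgebra k D.Dual) (a : A) (u : U) :
    D.evalAt U a u = D.form u a := rfl

theorem evalAt_separating (U : Subalgebra k D.Dual) (u : U) (h : ∀ a, D.evalAt U a u = 0) :
    u = 0 :=
  Subtype.ext (D.form_injective (LinearMap.ext fun a => by simpa using h a))

@[simp] theorem evalTensor_tmul (U : Subalgebra k D.Dual) (a b : A) (u v : U) :
    D.evalTensor U a b (u ⊗ₜ v) = D.form u a * D.form v b := rfl

theorem evalTensor_ext {U : Subalgebra k D.Dual} {t t' : U ⊗[k] U}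
    (h : ∀ a b, D.evalTensor U a b t = D.evalTensor U a b t') : t = t' :=
  tensorEval_ext (D.evalAt_separating U) (D.evalAt_separating U) h

theorem form_mul_of_comul {ι : Type*} {s : Finset ι} {u v : ι → A} {a : A}
    (h : D.Δ a = ∑ i ∈ s, u i ⊗ₜ v i) (f g : D.Dual) :
    D.form (f * g) a = ∑ i ∈ s, D.form f (u i) * D.form g (v i) := by
  rw [form_mul, h]; simp

theorem exists_comul (a : A) : ∃ s : Finset (A × A), D.Δ a = ∑ i ∈ s, i.1 ⊗ₜ i.2 :=
  TensorProduct.exists_finset _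

theorem comul_mul_eq {ι κ : Type*} {s : Finset ι} {r : Finset κ} {u v : ι → A} {u' v' : κ → A}
    {a b : A} (h : D.Δ a = ∑ i ∈ s, u i ⊗ₜ v i) (h' : D.Δ b = ∑ i ∈ r, u' i ⊗ₜ v' i) :
    D.Δ (a * b) = ∑ i ∈ s ×ˢ r, (u i.1 * u' i.2) ⊗ₜ (v i.1 * v' i.2) := by
  rw [map_mul, h, h', Finset.sum_mul_sum, Finset.sum_product]
  simp [Algebra.TensorProduct.tmul_mul_tmul]

theorem evalTensor_mul (U : Subalgebra k D.Dual) {ι κ : Type*} {s : Finset ι} {r : Finset κ}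
    {u v : ι → A} {u' v' : κ → A} {a b : A} (h : D.Δ a = ∑ i ∈ s, u i ⊗ₜ v i)
    (h' : D.Δ b = ∑ i ∈ r, u' i ⊗ₜ v' i) (t t' : U ⊗[k] U) :
    D.evalTensor U a b (t * t') = ∑ i ∈ s, ∑ j ∈ r,
      D.evalTensor U (u i) (u' j) t * D.evalTensor U (v i) (v' j) t' := by
  induction t with
  | zero => simp
  | add x y hx hy => simp only [add_mul, map_add, hx, hy, Finset.sum_add_distrib]
  | tmul f g =>
    induction t' with
    | zero => simp
    | add x y hx hy => simp only [mul_add, map_add, hx, hy, Finset.sum_add_distrib]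
    | tmul f' g' =>
      rw [Algebra.TensorProduct.tmul_mul_tmul, evalTensor_tmul]
      push_cast
      rw [D.form_mul_of_comul h, D.form_mul_of_comul h', Finset.sum_mul_sum]
      refine Finset.sum_congr rfl fun i _ => Finset.sum_congr rfl fun j _ => ?_
      simp only [evalTensor_tmul]; ring

section SubHopf

variable (U : Subalgebra k D.Dual)

/-- `t ∈ U ⊗ U` is a coproduct of the form `f`. -/
def IsCoproduct (f : D.Dual) (t : U ⊗[k] U) : Prop :=
  ∀ a b, D.evalTensor U a b t = D.form f (a * b)

variable {U}

-- Tensors over U are determined by their values, so a coproduct picked by choice is automatically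
-- additive, homogeneous and multiplicative. All explicit formulas for Δ on generators later follow
-- from this uniqueness.
variable {D} in
theorem IsCoproduct.unique {f : D.Dual} {t t' : U ⊗[k] U} (h : D.IsCoproduct U f t)
    (h' : D.IsCoproduct U f t') : t = t' :=
  D.evalTensor_ext fun a b => (h a b).trans (h' a b).symm

variable {D} in
theorem IsCoproduct.add {f g : D.Dual} {t t' : U ⊗[k] U} (h : D.IsCoproduct U f t)
    (h' : D.IsCoproduct U g t') : D.IsCoproduct U (f + g) (t + t') := fun a b => by
  rw [map_add, h, h', map_add, LinearMap.add_apply]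

variable {D} in
theorem IsCoproduct.smul {f : D.Dual} {t : U ⊗[k] U} (c : k) (h : D.IsCoproduct U f t) :
    D.IsCoproduct U (c • f) (c • t) := fun a b => by
  rw [map_smul, h, map_smul, LinearMap.smul_apply]

variable {D} in
theorem IsCoproduct.mul {f g : D.Dual} {t t' : U ⊗[k] U} (h : D.IsCoproduct U f t)
    (h' : D.IsCoproduct U g t') : D.IsCoproduct U (f * g) (t * t') := fun a b => by
  obtain ⟨s, hs⟩ := D.exists_comul a
  obtain ⟨r, hr⟩ := D.exists_comul b
  rw [D.evalTensor_mul U hs hr, D.form_mul_of_comul (D.comul_mul_eq hs hr), Finset.sum_product]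
  exact Finset.sum_congr rfl fun i _ => Finset.sum_congr rfl fun j _ => by rw [h, h']

theorem isCoproduct_algebraMap (c : k) :
    D.IsCoproduct U (algebraMap k D.Dual c) (algebraMap k _ c) := fun a b => by
  rw [Algebra.TensorProduct.algebraMap_apply, evalTensor_tmul, form_algebraMap, map_mul]
  simp [form_algebraMap, form_one, mul_assoc]

theorem exists_isCoproduct_of_adjoin {G : Set D.Dual} (hG : U = Algebra.adjoin k G)
    (h : ∀ g ∈ G, ∃ t, D.IsCoproduct U g t) (f : D.Dual) (hf : f ∈ U) :
    ∃ t, D.IsCoproduct U f t := by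
  have hf' : f ∈ Algebra.adjoin k G := hG ▸ hf
  induction hf' using Algebra.adjoin_induction with
  | mem x hx => exact h x hx
  | algebraMap c => exact ⟨_, D.isCoproduct_algebraMap c⟩
  | add x y hx' hy' hx hy =>
    obtain ⟨t, ht⟩ := hx (hG ▸ hx')
    obtain ⟨t', ht'⟩ := hy (hG ▸ hy')
    exact ⟨_, ht.add ht'⟩
  | mul x y hx' hy' hx hy =>
    obtain ⟨t, ht⟩ := hx (hG ▸ hx')
    obtain ⟨t', ht'⟩ := hy (hG ▸ hy')
    exact ⟨_, ht.mul ht'⟩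

variable (hΔ : ∀ f ∈ U, ∃ t, D.IsCoproduct U f t)

/-- The comultiplication on a subalgebra of the dual all of whose elements have coproducts. -/
def subComul : U →ₐ[k] U ⊗[k] U :=
  have h (f : U) : D.IsCoproduct U f (hΔ f f.2).choose := (hΔ f f.2).choose_spec
  AlgHom.ofLinearMap
    { toFun := fun f => (hΔ f f.2).choose
      map_add' := fun f g => (h (f + g)).unique ((h f).add (h g))
      map_smul' := fun c f => (h (c • f)).unique ((h f).smul c) }
    ((h 1).unique (by
      have := D.isCoproduct_algebraMap (U := U) 1
      rwa [map_one, map_one] at this))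
    (fun f g => (h (f * g)).unique ((h f).mul (h g)))

theorem isCoproduct_subComul (f : U) : D.IsCoproduct U f (D.subComul hΔ f) :=
  (hΔ f f.2).choose_spec

/-- The counit `f ↦ f(1)`. -/
def subCounit (U : Subalgebra k D.Dual) : U →ₐ[k] k :=
  AlgHom.ofLinearMap (D.evalAt U 1) (by simp [form_one]) (fun f g => by
    have h : D.Δ 1 = ∑ _i ∈ {()}, (1 : A) ⊗ₜ (1 : A) := by simp [Algebra.TensorProduct.one_def]
    simp [D.form_mul_of_comul h])

theorem subCounit_apply (f : U) : D.subCounit U f = D.form f 1 := rfl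

/-- The form `f ∘ S`. -/
def dualS : D.Dual →ₗ[k] D.Dual := D.toDual ∘ₗ LinearMap.lcomp k k D.S ∘ₗ D.form

@[simp] theorem form_dualS (f : D.Dual) (a : A) : D.form (D.dualS f) a = D.form f (D.S a) := rfl

variable (hS : ∀ f ∈ U, D.dualS f ∈ U)

/-- The antipode `f ↦ f ∘ S` on a stable subalgebra. -/
def subS : U →ₗ[k] U := D.dualS.restrict (p := Subalgebra.toSubmodule U)
    (q := Subalgebra.toSubmodule U) hS

theorem form_subS (f : U) (a : A) : D.form (D.subS hS f) a = D.form f (D.S a) := rfl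

theorem form_mul'_map (f g : U →ₗ[k] U) (t : U ⊗[k] U) (a : A) {ι : Type*} {s : Finset ι}
    {u v : ι → A} (h : D.Δ a = ∑ i ∈ s, u i ⊗ₜ v i) :
    D.form (LinearMap.mul' k U (TensorProduct.map f g t)) a =
      ∑ i ∈ s, D.evalTensor U (u i) (v i) (TensorProduct.map f g t) := by
  induction t with
  | zero => simp
  | add x y hx hy => simp only [map_add, Subalgebra.coe_add, LinearMap.add_apply, hx, hy,
      Finset.sum_add_distrib]
  | tmul x y => simp [D.form_mul_of_comul h]

theorem evalTensor_rTensor_subS (t : U ⊗[k] U) (a b : A) :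
    D.evalTensor U a b ((D.subS hS).rTensor U t) = D.evalTensor U (D.S a) b t := by
  induction t with
  | zero => simp
  | add x y hx hy => simp only [map_add, hx, hy]
  | tmul x y => simp [form_subS]

theorem evalTensor_lTensor_subS (t : U ⊗[k] U) (a b : A) :
    D.evalTensor U a b ((D.subS hS).lTensor U t) = D.evalTensor U a (D.S b) t := by
  induction t with
  | zero => simp
  | add x y hx hy => simp only [map_add, hx, hy]
  | tmul x y => simp [form_subS]

/-- A subalgebra of the dual that has coproducts and is stable under `f ↦ f ∘ S`,
as a Hopf algebra. -/
def subHopf : HopfStructure k U where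
  Δ := D.subComul hΔ
  ε := D.subCounit U
  S := D.subS hS
  coassoc := by
    refine AlgHom.ext fun f => ?_
    -- The triple tensors are tested at a and the pair (b, c); both sides then evaluate to f(abc).
    refine tensorEval_ext (g := fun p : A × A => D.evalTensor U p.1 p.2)
      (D.evalAt_separating U) (fun w hw => D.evalTensor_ext fun a b => ?_) fun a p => ?_
    · simpa using hw (a, b)
    · obtain ⟨b, c⟩ := p
      have h₁ : ∀ t : U ⊗[k] U, tensorEval (D.evalAt U) (fun p : A × A => D.evalTensor U p.1 p.2)
          a (b, c) (Algebra.TensorProduct.assoc k k k U U U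
            (Algebra.TensorProduct.map (D.subComul hΔ) (.id k U) t)) =
          D.evalTensor U (a * b) c t := by
        intro t
        induction t with
        | zero => simp
        | add x y hx hy => simp only [map_add, hx, hy]
        | tmul x y =>
          have h₂ : ∀ s : U ⊗[k] U, tensorEval (D.evalAt U)
              (fun p : A × A => D.evalTensor U p.1 p.2) a (b, c)
              (Algebra.TensorProduct.assoc k k k U U U (s ⊗ₜ y)) =
              D.evalTensor U a b s * D.form y c := by
            intro s
            induction s with
            | zero => simp
            | add x y hx hy => simp only [map_add, TensorProduct.add_tmul, hx, hy, add_mul]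
            | tmul x y => simp [mul_assoc]
          simp only [Algebra.TensorProduct.map_tmul, h₂, evalTensor_tmul, AlgHom.id_apply]
          rw [D.isCoproduct_subComul hΔ]
      have h₃ : ∀ t : U ⊗[k] U, tensorEval (D.evalAt U) (fun p : A × A => D.evalTensor U p.1 p.2)
          a (b, c) (Algebra.TensorProduct.map (.id k U) (D.subComul hΔ) t) =
          D.evalTensor U a (b * c) t := by
        intro t
        induction t with
        | zero => simp
        | add x y hx hy => simp only [map_add, hx, hy]
        | tmul x y =>
          simp only [Algebra.TensorProduct.map_tmul, AlgHom.id_apply, tensorEval_tmul,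
            evalTensor_tmul, evalAt_apply]
          rw [D.isCoproduct_subComul hΔ]
      refine (h₁ _).trans (Eq.trans ?_ (h₃ _).symm)
      exact (D.isCoproduct_subComul hΔ f (a * b) c).trans
        ((congrArg _ (mul_assoc a b c)).trans (D.isCoproduct_subComul hΔ f a (b * c)).symm)
  counit_left := by
    refine AlgHom.ext fun f => (Algebra.TensorProduct.lid k U).injective ?_
    refine Subtype.ext (D.form_injective (LinearMap.ext fun a => ?_))
    have h : ∀ t : U ⊗[k] U, D.form (Algebra.TensorProduct.lid k U
        (Algebra.TensorProduct.map (D.subCounit U) (.id k U) t)) a = D.evalTensor U 1 a t := by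
      intro t
      induction t with
      | zero => simp
      | add x y hx hy => simp only [map_add, Subalgebra.coe_add, LinearMap.add_apply, hx, hy]
      | tmul x y => simp [subCounit_apply]
    refine (h _).trans ((D.isCoproduct_subComul hΔ f 1 a).trans ?_)
    rw [one_mul]
    exact congrArg (fun u : U => D.form u a)
      ((Algebra.TensorProduct.lid k U).apply_symm_apply f).symm
  counit_right := by
    refine AlgHom.ext fun f => (Algebra.TensorProduct.rid k k U).injective ?_
    refine Subtype.ext (D.form_injective (LinearMap.ext fun a => ?_))
    have h : ∀ t : U ⊗[k] U, D.form (Algebra.TensorProduct.rid k k U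
        (Algebra.TensorProduct.map (.id k U) (D.subCounit U) t)) a = D.evalTensor U a 1 t := by
      intro t
      induction t with
      | zero => simp
      | add x y hx hy => simp only [map_add, Subalgebra.coe_add, LinearMap.add_apply, hx, hy]
      | tmul x y => simp [subCounit_apply, mul_comm]
    refine (h _).trans ((D.isCoproduct_subComul hΔ f a 1).trans ?_)
    rw [mul_one]
    exact congrArg (fun u : U => D.form u a)
      ((Algebra.TensorProduct.rid k k U).apply_symm_apply f).symm
  antipode_left := by
    refine LinearMap.ext fun f => Subtype.ext (D.form_injective (LinearMap.ext fun a => ?_))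
    obtain ⟨s, hs⟩ := D.exists_comul a
    have h := D.form_mul'_map (D.subS hS) .id (D.subComul hΔ f) a hs
    refine h.trans ?_
    have h₂ : ∑ i ∈ s, D.S i.1 * i.2 = algebraMap k A (D.ε a) := by
      simpa [hs] using LinearMap.congr_fun D.antipode_left a
    change ∑ i ∈ s, D.evalTensor U i.1 i.2 ((D.subS hS).rTensor U _) = _
    -- The left side has become the sum of the values f(S(a₁)a₂), which is f(ε(a)1).
    simp only [evalTensor_rTensor_subS, (D.isCoproduct_subComul hΔ f) _ _]
    rw [← map_sum, h₂]
    simp [Algebra.algebraMap_eq_smul_one, subCounit_apply, form_one, mul_comm]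
  antipode_right := by
    refine LinearMap.ext fun f => Subtype.ext (D.form_injective (LinearMap.ext fun a => ?_))
    obtain ⟨s, hs⟩ := D.exists_comul a
    have h := D.form_mul'_map .id (D.subS hS) (D.subComul hΔ f) a hs
    refine h.trans ?_
    have h₂ : ∑ i ∈ s, i.1 * D.S i.2 = algebraMap k A (D.ε a) := by
      simpa [hs] using LinearMap.congr_fun D.antipode_right a
    change ∑ i ∈ s, D.evalTensor U i.1 i.2 ((D.subS hS).lTensor U _) = _
    simp only [evalTensor_lTensor_subS, (D.isCoproduct_subComul hΔ f) _ _]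
    rw [← map_sum, h₂]
    simp [Algebra.algebraMap_eq_smul_one, subCounit_apply, form_one, mul_comm]

theorem isSubHopf_subHopf (hU : (U : Set D.Dual) ⊆ D.finiteDual) :
    D.IsSubHopf U (D.subHopf hΔ hS) where
  le_finiteDual := hU
  comul f := D.isCoproduct_subComul hΔ f
  counit _ := rfl
  antipode _ _ := rfl

end SubHopf

end HopfStructure

/-! ### Matrix corepresentations -/

namespace HopfStructure

section Corep

variable {k A : Type*} [Field k] [Ring A] [Algebra k A] (D : HopfStructure k A)
variable {I J : Type*} [Fintype I] [DecidableEq I] [Fintype J] [DecidableEq J]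

/-- A matrix corepresentation: `Δ(u_{ij}) = ∑ u_{im} ⊗ u_{mj}` and `ε(u_{ij}) = δ_{ij}`. -/
structure IsCorep (u : I → I → A) : Prop where
  comul : ∀ i j, D.Δ (u i j) = ∑ m, u i m ⊗ₜ u m j
  counit : ∀ i j, D.ε (u i j) = if i = j then 1 else 0

/-- The product of two matrices with commuting index sets. -/
def tensorMatrix (u : I → I → A) (v : J → J → A) (p q : I × J) : A := u p.1 q.1 * v p.2 q.2

variable {D}

theorem IsCorep.one : D.IsCorep (fun _ _ : Unit => (1 : A)) where
  comul _ _ := by simp [Algebra.TensorProduct.one_def]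
  counit _ _ := by simp

theorem IsCorep.mul {u : I → I → A} {v : J → J → A} (hu : D.IsCorep u) (hv : D.IsCorep v) :
    D.IsCorep (tensorMatrix u v) where
  comul p q := by
    rw [tensorMatrix, map_mul, hu.comul, hv.comul, Finset.sum_mul_sum, Fintype.sum_prod_type]
    simp [tensorMatrix]
  counit p q := by
    rw [tensorMatrix, map_mul, hu.counit, hv.counit]
    simp only [Prod.ext_iff, ite_and]
    split_ifs <;> simp

theorem IsCorep.form_mul {u : I → I → A} (hu : D.IsCorep u) (f g : D.Dual) (i j : I) :
    D.form (f * g) (u i j) = ∑ m, D.form f (u i m) * D.form g (u m j) :=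
  D.form_mul_of_comul (hu.comul i j) f g

theorem IsCorep.S_mul {u : I → I → A} (hu : D.IsCorep u) (i j : I) :
    ∑ m, D.S (u i m) * u m j = if i = j then 1 else 0 := by
  have := LinearMap.congr_fun D.antipode_left (u i j)
  simp only [LinearMap.comp_apply, AlgHom.toLinearMap_apply, hu.comul, hu.counit] at this
  simpa using this

theorem IsCorep.mul_S {u : I → I → A} (hu : D.IsCorep u) (i j : I) :
    ∑ m, u i m * D.S (u m j) = if i = j then 1 else 0 := by
  have := LinearMap.congr_fun D.antipode_right (u i j)
  simp only [LinearMap.comp_apply, AlgHom.toLinearMap_apply, hu.comul, hu.counit] at this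
  simpa using this

theorem eq_of_matrix_inverse {R : Type*} [Ring R] {p s s' : I → I → R}
    (h : ∀ i j, ∑ m, s i m * p m j = if i = j then 1 else 0)
    (h' : ∀ i j, ∑ m, p i m * s' m j = if i = j then 1 else 0) : s = s' := by
  have h₁ : Matrix.of s * Matrix.of p = 1 := by
    ext i j
    simp [Matrix.mul_apply, h, Matrix.one_apply]
  have h₂ : Matrix.of p * Matrix.of s' = 1 := by
    ext i j
    simp [Matrix.mul_apply, h', Matrix.one_apply]
  exact Matrix.of.injective (left_inv_eq_right_inv h₁ h₂)

/-- Both sides are inverse to the matrix Δ(u): the left one because Δ is a homomorphism, the right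
one by direct multiplication. A left inverse equals a right inverse. -/
theorem IsCorep.comul_S {u : I → I → A} (hu : D.IsCorep u) (i j : I) :
    D.Δ (D.S (u i j)) = ∑ m, D.S (u m j) ⊗ₜ D.S (u i m) := by
  refine congrFun (congrFun (eq_of_matrix_inverse (p := fun i j => D.Δ (u i j))
    (s := fun i j => D.Δ (D.S (u i j)))
    (s' := fun i j => ∑ m, D.S (u m j) ⊗ₜ D.S (u i m)) (fun i j => ?_) fun i j => ?_) i) j
  · simp only [← map_mul, ← map_sum, hu.S_mul]
    split_ifs <;> simp
  · simp only [hu.comul, Finset.sum_mul_sum, Algebra.TensorProduct.tmul_mul_tmul]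
    rw [Finset.sum_comm]
    have h' : ∀ a : I, ∑ x, ∑ b, (u i a * D.S (u b j)) ⊗ₜ[k] (u a x * D.S (u x b)) =
        (u i a * D.S (u a j)) ⊗ₜ[k] 1 := by
      intro a
      rw [Finset.sum_comm]
      simp only [← TensorProduct.tmul_sum, hu.mul_S]
      rw [Finset.sum_eq_single a] <;> simp +contextual [eq_comm]
    simp only [h', ← TensorProduct.sum_tmul, hu.mul_S]
    split_ifs <;> simp [Algebra.TensorProduct.one_def]

theorem IsCorep.dualS_mul {u : I → I → A} (hu : D.IsCorep u) (f g : D.Dual) (i j : I) :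
    D.form (D.dualS (f * g)) (u i j) = D.form (D.dualS g * D.dualS f) (u i j) := by
  rw [form_dualS, D.form_mul_of_comul (hu.comul_S i j), hu.form_mul]
  simp [mul_comm]

end Corep

section Generated

variable {k A : Type*} [Field k] [Ring A] [Algebra k A] {D : HopfStructure k A}
variable {I₀ : Type} [Fintype I₀] [DecidableEq I₀] {x : I₀ → I₀ → A}

/-- The entries of the matrix corepresentations that have the property `P`. -/
def corepEntries (D : HopfStructure k A)
    (P : ∀ (I : Type) [Fintype I] [DecidableEq I], (I → I → A) → Prop) : Set A :=
  {a | ∃ (I : Type) (_ : Fintype I) (_ : DecidableEq I) (u : I → I → A),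
    D.IsCorep u ∧ P I u ∧ ∃ i j, a = u i j}

/-- A product of entries of u and v is an entry of their tensor product, so matrix corepresentations
exhaust A linearly. The property `P` lets a statement that is stable under tensor products be
carried along; linear identities are then proved on entries only. -/
theorem span_corepEntries (hx : D.IsCorep x)
    (hgen : Algebra.adjoin k (Set.range fun p : I₀ × I₀ => x p.1 p.2) = ⊤)
    (P : ∀ (I : Type) [Fintype I] [DecidableEq I], (I → I → A) → Prop)
    (h₁ : P Unit fun _ _ => 1) (hX : P I₀ x)
    (hmul : ∀ (I J : Type) [Fintype I] [DecidableEq I] [Fintype J] [DecidableEq J]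
      (u : I → I → A) (v : J → J → A), D.IsCorep u → D.IsCorep v → P I u → P J v →
      P (I × J) (tensorMatrix u v)) :
    Submodule.span k (D.corepEntries P) = ⊤ := by
  refine eq_top_iff.2 fun a _ => ?_
  have ha : a ∈ Algebra.adjoin k (Set.range fun p : I₀ × I₀ => x p.1 p.2) :=
    hgen ▸ Algebra.mem_top
  have hone : (1 : A) ∈ Submodule.span k (D.corepEntries P) :=
    Submodule.subset_span ⟨Unit, inferInstance, inferInstance, _, IsCorep.one, h₁, (), (), rfl⟩
  induction ha using Algebra.adjoin_induction with
  | mem a ha =>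
    obtain ⟨p, rfl⟩ := ha
    exact Submodule.subset_span ⟨I₀, _, _, x, hx, hX, p.1, p.2, rfl⟩
  | algebraMap c =>
    rw [Algebra.algebraMap_eq_smul_one]
    exact Submodule.smul_mem _ _ hone
  | add a b _ _ ha hb => exact add_mem (ha trivial) (hb trivial)
  | mul a b _ _ ha hb =>
    have h := Submodule.mul_mem_mul (ha trivial) (hb trivial)
    rw [Submodule.span_mul_span] at h
    refine Submodule.span_mono ?_ h
    rintro _ ⟨a, ⟨I, _, _, u, hu, hPu, i, j, rfl⟩, b, ⟨J, _, _, v, hv, hPv, i', j', rfl⟩, rfl⟩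
    exact ⟨I × J, inferInstance, inferInstance, tensorMatrix u v, hu.mul hv,
      hmul I J u v hu hv hPu hPv, (i, i'), (j, j'), rfl⟩

theorem span_corepEntries_true (hx : D.IsCorep x)
    (hgen : Algebra.adjoin k (Set.range fun p : I₀ × I₀ => x p.1 p.2) = ⊤) :
    Submodule.span k (D.corepEntries fun _ _ _ _ => True) = ⊤ :=
  span_corepEntries hx hgen _ trivial trivial fun _ _ _ _ _ _ _ _ _ _ _ _ => trivial

/-- The identity is linear in its argument, and on the entries of a corepresentation it is the
formula for Δ ∘ S. -/
theorem dualS_mul (hx : D.IsCorep x)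
    (hgen : Algebra.adjoin k (Set.range fun p : I₀ × I₀ => x p.1 p.2) = ⊤) (f g : D.Dual) :
    D.dualS (f * g) = D.dualS g * D.dualS f := by
  refine D.form_injective (LinearMap.ext_on (span_corepEntries_true hx hgen) ?_)
  rintro _ ⟨I, _, _, u, hu, -, i, j, rfl⟩
  exact hu.dualS_mul f g i j

theorem dualS_algebraMap (c : k) : D.dualS (algebraMap k D.Dual c) = algebraMap k D.Dual c := by
  refine D.form_injective (LinearMap.ext fun a => ?_)
  rw [form_dualS, form_algebraMap, form_algebraMap]
  let := D.toHopfAlgebra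
  exact congrArg (c * ·) (HopfAlgebra.counit_antipode (R := k) a)

theorem dualS_mem_of_adjoin (hx : D.IsCorep x)
    (hgen : Algebra.adjoin k (Set.range fun p : I₀ × I₀ => x p.1 p.2) = ⊤)
    {U : Subalgebra k D.Dual} {G : Set D.Dual} (hG : U = Algebra.adjoin k G)
    (h : ∀ g ∈ G, D.dualS g ∈ U) (f : D.Dual) (hf : f ∈ U) : D.dualS f ∈ U := by
  have hf' : f ∈ Algebra.adjoin k G := hG ▸ hf
  clear hf
  induction hf' using Algebra.adjoin_induction with
  | mem g hg => exact h g hg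
  | algebraMap c => rw [dualS_algebraMap]; exact U.algebraMap_mem c
  | add a b _ _ ha hb => rw [map_add]; exact add_mem ha hb
  | mul a b _ _ ha hb => rw [dualS_mul hx hgen]; exact mul_mem hb ha

end Generated

/-! ### Coefficients of finite-dimensional representations -/

section Coefficients

universe u v
variable {k : Type u} {A : Type v} [Field k] [Ring A] [Algebra k A] (D : HopfStructure k A)

/-- The form `f` is a coefficient of a finite-dimensional representation of `A`. -/
def IsCoefficient (f : D.Dual) : Prop :=
  ∃ (M : Type u) (_ : Ring M) (_ : Algebra k M) (_ : Module.Finite k M) (φ : A →ₐ[k] M)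
    (c : M →ₗ[k] k), D.form f = c ∘ₗ φ.toLinearMap

variable {D}

/-- The kernel of the representation is the required two-sided ideal, since the quotient embeds in
the finite-dimensional algebra. Unlike ideals, coefficients are easy to add and multiply: direct
products and tensor products of representations do it. -/
theorem IsCoefficient.mem_finiteDual {f : D.Dual} (h : D.IsCoefficient f) :
    f ∈ D.finiteDual := by
  obtain ⟨M, _, _, _, φ, c, hc⟩ := h
  refine ⟨RingHom.ker φ, inferInstance, ?_, fun a ha => ?_⟩
  · exact Module.Finite.of_injective _
      (LinearMap.ker_eq_bot.1 (Submodule.ker_liftQ_eq_bot ((RingHom.ker φ).restrictScalars k)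
        φ.toLinearMap (fun a ha => ha) fun a ha => ha))
  · rw [hc]
    simp [(RingHom.mem_ker).1 ha]

theorem IsCoefficient.add {f g : D.Dual} (hf : D.IsCoefficient f) (hg : D.IsCoefficient g) :
    D.IsCoefficient (f + g) := by
  obtain ⟨M, _, _, _, φ, c, hc⟩ := hf
  obtain ⟨M', _, _, _, φ', c', hc'⟩ := hg
  refine ⟨M × M', inferInstance, inferInstance, inferInstance, φ.prod φ', c.coprod c', ?_⟩
  ext a
  simp [hc, hc']

theorem IsCoefficient.mul {f g : D.Dual} (hf : D.IsCoefficient f) (hg : D.IsCoefficient g) :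
    D.IsCoefficient (f * g) := by
  obtain ⟨M, _, _, _, φ, c, hc⟩ := hf
  obtain ⟨M', _, _, _, φ', c', hc'⟩ := hg
  refine ⟨M ⊗[k] M', inferInstance, inferInstance, inferInstance,
    (Algebra.TensorProduct.map φ φ').comp D.Δ, LinearMap.mul' k k ∘ₗ TensorProduct.map c c', ?_⟩
  ext a
  obtain ⟨s, hs⟩ := D.exists_comul a
  rw [D.form_mul_of_comul hs]
  simp [hs, hc, hc']

theorem isCoefficient_algebraMap (c : k) : D.IsCoefficient (algebraMap k D.Dual c) :=
  ⟨k, inferInstance, inferInstance, inferInstance, D.ε, c • .id, by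
    ext a; simp [form_algebraMap]⟩

theorem adjoin_subset_finiteDual {G : Set D.Dual} (hG : ∀ g ∈ G, D.IsCoefficient g) :
    (Algebra.adjoin k G : Set D.Dual) ⊆ D.finiteDual := by
  intro f hf
  refine IsCoefficient.mem_finiteDual ?_
  induction hf using Algebra.adjoin_induction with
  | mem g hg => exact hG g hg
  | algebraMap c => exact isCoefficient_algebraMap c
  | add _ _ _ _ ha hb => exact ha.add hb
  | mul _ _ _ _ ha hb => exact ha.mul hb

end Coefficients

end HopfStructure

/-! ### Quantum matrices and the `R`-matrix -/

section QuantumMatrix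

variable {k : Type*} [Field k] {N : ℕ}

/-- The `R`-matrix of type `A`, without its normalization. -/
def Rmat (q : k) (i a j b : Fin N) : k :=
  (if i = j then q else 1) * (if a = i then 1 else 0) * (if b = j then 1 else 0) +
    (if i < j then q - q⁻¹ else 0) * (if a = j then 1 else 0) * (if b = i then 1 else 0)

section Sums

variable {M : Type*} [AddCommGroup M] [Module k M]

theorem sum_Rmat_left (q : k) (i j : Fin N) (f : Fin N → Fin N → M) :
    ∑ a, ∑ b, Rmat q i a j b • f a b =
      (if i = j then q else 1) • f i j + (if i < j then q - q⁻¹ else 0) • f j i := by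
  simp only [Rmat, add_smul, Finset.sum_add_distrib, mul_ite, mul_one, mul_zero, ite_smul,
    zero_smul, Finset.sum_ite_eq', Finset.mem_univ, if_true]

theorem sum_Rmat_right (q : k) (m l : Fin N) (f : Fin N → Fin N → M) :
    ∑ a, ∑ b, Rmat q a m b l • f a b =
      (if m = l then q else 1) • f m l + (if l < m then q - q⁻¹ else 0) • f l m := by
  simp only [Rmat, add_smul, Finset.sum_add_distrib]
  congr 1
  · rw [Finset.sum_eq_single m _ (by simp), Finset.sum_eq_single l _ (by simp)]
    · simp
    · intro b _ hb; simp [hb.symm]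
    · intro a _ ha; simp [ha.symm]
  · rw [Finset.sum_eq_single l _ (by simp), Finset.sum_eq_single m _ (by simp)]
    · simp
    · intro b _ hb; simp [hb.symm]
    · intro a _ ha; simp [ha.symm]

end Sums

variable {A : Type*} [Ring A] [Algebra k A]

/-- The quadratic relations between the entries of a quantum matrix. -/
structure IsQuantum (q : k) (x : Fin N → Fin N → A) : Prop where
  row : ∀ i m l, l < m → x i m * x i l = q • (x i l * x i m)
  col : ∀ i j m, i < j → x j m * x i m = q • (x i m * x j m)
  comm : ∀ i j l m, i < j → l < m → x j l * x i m = x i m * x j l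
  cross : ∀ i j l m, i < j → l < m →
    x j m * x i l - x i l * x j m = (q - q⁻¹) • (x i m * x j l)

/-- The `RTT` form of the quadratic relations. -/
def IsRTT (q : k) (x : Fin N → Fin N → A) : Prop :=
  ∀ i j m l, ∑ a, ∑ b, Rmat q i a j b • (x a m * x b l) =
    ∑ a, ∑ b, Rmat q a m b l • (x j b * x i a)

/-- Each row and each column of R has at most two nonzero entries, one diagonal and one crossing, so
the double sums collapse to two terms. The quadratic relations are the cases of this identity
according to the order of the indices. -/
theorem isRTT_iff_reduced {q : k} {x : Fin N → Fin N → A} :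
    IsRTT q x ↔ ∀ i j m l,
      (if i = j then q else 1) • (x i m * x j l) +
        (if i < j then q - q⁻¹ else 0) • (x j m * x i l) =
      (if m = l then q else 1) • (x j l * x i m) +
        (if l < m then q - q⁻¹ else 0) • (x j m * x i l) := by
  simp only [IsRTT, sum_Rmat_left q _ _ fun a b => x a _ * x b _,
    sum_Rmat_right q _ _ fun a b => x _ b * x _ a]

theorem IsQuantum.isRTT {q : k} (hq : q ≠ 0) {x : Fin N → Fin N → A} (h : IsQuantum q x) :
    IsRTT q x := by
  rw [isRTT_iff_reduced]
  intro i j m l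
  rcases lt_trichotomy i j with hij | rfl | hij <;> rcases lt_trichotomy m l with hm | rfl | hm
  · have := h.cross i j m l hij hm
    simp only [hij, hij.ne, hm.ne, hm.not_gt, if_true, if_false, one_smul, zero_smul, add_zero]
    rw [h.comm i j m l hij hm, ← this]; abel
  · simp only [hij, hij.ne, if_true, if_false, lt_irrefl, h.col i j m hij]
    match_scalars
    field_simp
    ring
  · simp only [hij, hij.ne, hm.ne', hm, if_true, if_false, one_smul]
    rw [h.comm i j l m hij hm]
  · simp [hm.ne, hm.not_gt, h.row i l m hm]
  · simp
  · simp only [hm.ne', hm, if_true, if_false, lt_irrefl, h.row i m l hm]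
    match_scalars
    field_simp
    ring
  · simp [hij.ne', hij.not_gt, hm.ne, hm.not_gt, h.comm j i m l hij hm]
  · simp [hij.ne', hij.not_gt, h.col j i m hij]
  · have := h.cross j i l m hij hm
    simp only [hij.ne', hij.not_gt, hm.ne', hm, if_true, if_false, one_smul, zero_smul, add_zero]
    rw [h.comm j i l m hij hm |>.symm] at this
    rw [h.comm j i l m hij hm |>.symm, ← this]; abel

theorem IsRTT.isQuantum {q : k} {x : Fin N → Fin N → A} (h : IsRTT q x) :
    IsQuantum q x := by
  rw [isRTT_iff_reduced] at h
  have hcomm : ∀ i j l m, i < j → l < m → x j l * x i m = x i m * x j l := by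
    intro i j l m hij hm
    simpa [hij.ne', hij.not_gt, hm.ne, hm.not_gt] using h j i l m
  refine ⟨fun i m l hm => ?_, fun i j m hij => ?_, hcomm, fun i j l m hij hm => ?_⟩
  · simpa [hm.ne, hm.not_gt, eq_comm] using h i i l m
  · simpa [hij.ne', hij.not_gt] using h j i m m
  · have := h i j l m
    simp only [hij, hij.ne, hm.ne, hm.not_gt, if_true, if_false, one_smul, zero_smul,
      add_zero] at this
    rw [← this, hcomm i j l m hij hm]; abel

theorem IsQuantum.transpose {q : k} {x : Fin N → Fin N → A} (h : IsQuantum q x) :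
    IsQuantum q fun i j => x j i where
  row i m l hl := h.col l m i hl
  col i j m hi := h.row m j i hi
  comm i j l m hi hl := (h.comm l m i j hl hi).symm
  cross i j l m hi hl := by rw [h.cross l m i j hl hi, h.comm l m i j hl hi]

/-- R is moved first past the two factors from x, then past the two factors from y, which commute
with them. This is why the comultiplication respects the quadratic relations. -/
theorem IsRTT.tensor {B : Type*} [Ring B] [Algebra k B] {q : k} {x : Fin N → Fin N → A}
    {y : Fin N → Fin N → B} (hx : IsRTT q x) (hy : IsRTT q y) :
    IsRTT q fun i j => ∑ m, x i m ⊗ₜ[k] y m j := by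
  intro i j m l
  simp only [Finset.sum_mul_sum, Algebra.TensorProduct.tmul_mul_tmul, Finset.smul_sum]
  calc ∑ a, ∑ b, ∑ c, ∑ d, Rmat q i a j b • ((x a c * x b d) ⊗ₜ[k] (y c m * y d l))
      = ∑ c, ∑ d, (∑ a, ∑ b, Rmat q i a j b • (x a c * x b d)) ⊗ₜ[k] (y c m * y d l) := by
        simp only [TensorProduct.sum_tmul, TensorProduct.smul_tmul']
        rw [Finset.sum_congr rfl fun a _ => Finset.sum_comm, Finset.sum_comm]
        refine Finset.sum_congr rfl fun c _ => ?_
        rw [Finset.sum_congr rfl fun a _ => Finset.sum_comm, Finset.sum_comm]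
    _ = ∑ c, ∑ d, (∑ a, ∑ b, Rmat q a c b d • (x j b * x i a)) ⊗ₜ[k] (y c m * y d l) := by
        simp only [hx i j _ _]
    _ = ∑ b, ∑ a, (x j b * x i a) ⊗ₜ[k] (∑ c, ∑ d, Rmat q a c b d • (y c m * y d l)) := by
        simp only [TensorProduct.sum_tmul, TensorProduct.tmul_sum, TensorProduct.tmul_smul,
          TensorProduct.smul_tmul']
        rw [Finset.sum_congr rfl fun c _ => Finset.sum_comm, Finset.sum_comm]
        rw [Finset.sum_congr rfl fun a _ => Finset.sum_congr rfl fun c _ => Finset.sum_comm,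
          Finset.sum_congr rfl fun a _ => Finset.sum_comm, Finset.sum_comm]
    _ = ∑ b, ∑ a, (x j b * x i a) ⊗ₜ[k] (∑ c, ∑ d, Rmat q c m d l • (y b d * y a c)) := by
        simp only [hy _ _ m l]
    _ = _ := by
        simp only [TensorProduct.tmul_sum, TensorProduct.tmul_smul]
        rw [Finset.sum_congr rfl fun a _ => Finset.sum_comm, Finset.sum_comm]
        refine Finset.sum_congr rfl fun c _ => ?_
        rw [Finset.sum_congr rfl fun a _ => Finset.sum_comm, Finset.sum_comm]


/-! ### Words in `q`-exterior generators -/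

section Words

variable {E : Type*} [Ring E] [Algebra k E] {ν : k} {ξ : Fin N → E}

/-- The sign of a word: the power of `ν` that counts inversions, or `0` if a letter is repeated. -/
def wordSign (ν : k) : List (Fin N) → k
  | [] => 1
  | j :: L => if j ∈ L then 0 else ν ^ (L.toFinset.filter (· < j)).card * wordSign ν L

/-- The ordered product over a set of indices. -/
def orderedProd (ξ : Fin N → E) (S : Finset (Fin N)) : E := (S.sort.map ξ).prod

/-- Bringing ξ j to its place costs one factor ν for each smaller letter that it passes; meeting an
equal letter gives zero. The induction removes the smallest letter of S. -/
theorem mul_orderedProd (hsq : ∀ i, ξ i * ξ i = 0)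
    (hanti : ∀ i j, i < j → ξ j * ξ i = ν • (ξ i * ξ j)) (j : Fin N) (S : Finset (Fin N)) :
    ξ j * orderedProd ξ S =
      if j ∈ S then 0 else ν ^ (S.filter (· < j)).card • orderedProd ξ (insert j S) := by
  induction S using Finset.induction_on_min with
  | empty => simp [orderedProd]
  | insert i S hi ih =>
    have hiS : i ∉ S := fun h => lt_irrefl _ (hi i h)
    have hs : orderedProd ξ (insert i S) = ξ i * orderedProd ξ S := by
      rw [orderedProd, Finset.sort_insert _ (fun b hb => (hi b hb).le) hiS]; simp [orderedProd]
    rcases lt_trichotomy j i with hj | rfl | hj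
    · have hjS : j ∉ insert i S := by
        rw [Finset.mem_insert]
        rintro (rfl | h)
        · exact lt_irrefl _ hj
        · exact lt_asymm hj (hi j h)
      have hlt : ∀ b ∈ insert i S, j < b := by
        intro b hb
        rcases Finset.mem_insert.1 hb with rfl | hb
        · exact hj
        · exact hj.trans (hi b hb)
      rw [if_neg hjS, Finset.filter_eq_empty_iff.2 fun b hb => (hlt b hb).not_gt, orderedProd,
        orderedProd, Finset.sort_insert _ (fun b hb => (hlt b hb).le) hjS]
      simp
    · rw [if_pos (Finset.mem_insert_self _ _), hs, ← mul_assoc, hsq, zero_mul]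
    · rw [hs, ← mul_assoc, hanti i j hj, smul_mul_assoc, mul_assoc, ih]
      by_cases hjS : j ∈ S
      · simp [hjS]
      · have hins : insert j (insert i S) = insert i (insert j S) := Finset.insert_comm _ _ _
        have hi' : ∀ b ∈ insert j S, i < b := by
          intro b hb
          rcases Finset.mem_insert.1 hb with rfl | hb
          · exact hj
          · exact hi b hb
        have hs' : orderedProd ξ (insert i (insert j S)) = ξ i * orderedProd ξ (insert j S) := by
          rw [orderedProd, Finset.sort_insert _ (fun b hb => (hi' b hb).le)
            fun h => lt_irrefl _ (hi' i h)]
          simp [orderedProd]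
        rw [if_neg hjS, if_neg (by simp [hjS, hj.ne']), hins, hs', Finset.filter_insert,
          if_pos hj, Finset.card_insert_of_notMem (by simp [hiS]), mul_smul_comm, smul_smul,
          pow_succ']

theorem word_prod (hsq : ∀ i, ξ i * ξ i = 0)
    (hanti : ∀ i j, i < j → ξ j * ξ i = ν • (ξ i * ξ j)) (L : List (Fin N)) :
    (L.map ξ).prod = wordSign ν L • orderedProd ξ L.toFinset := by
  induction L with
  | nil => simp [wordSign, orderedProd]
  | cons j L ih =>
    rw [List.map_cons, List.prod_cons, ih, mul_smul_comm, mul_orderedProd hsq hanti, wordSign]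
    by_cases hj : j ∈ L
    · simp [hj]
    · simp [hj, smul_smul, mul_comm]

theorem wordSign_eq_zero {L : List (Fin N)} (h : ¬ L.Nodup) : wordSign ν L = 0 := by
  induction L with
  | nil => simp at h
  | cons j L ih =>
    rw [wordSign]
    by_cases hj : j ∈ L
    · simp [hj]
    · rw [List.nodup_cons] at h
      simp [ih (fun h' => h ⟨hj, h'⟩)]

theorem wordSign_ne_zero (hν : ν ≠ 0) {L : List (Fin N)} (h : L.Nodup) : wordSign ν L ≠ 0 := by
  induction L with
  | nil => simp [wordSign]
  | cons j L ih =>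
    rw [List.nodup_cons] at h
    simp [wordSign, h.1, ih h.2, hν]

theorem wordSign_ofFn {m : ℕ} (g : Fin m → Fin N) (hg : Function.Injective g) :
    wordSign ν (List.ofFn g) =
      ν ^ (Finset.univ.filter fun a : Fin m × Fin m => a.1 < a.2 ∧ g a.2 < g a.1).card := by
  induction m with
  | zero => simp [wordSign]
  | succ m ih =>
    have h0 : g 0 ∉ List.ofFn fun i => g i.succ := by
      simp only [List.mem_ofFn, not_exists]
      exact fun i h => Fin.succ_ne_zero i (hg h)
    rw [List.ofFn_succ, wordSign, if_neg h0, ih (fun i => g i.succ) (hg.comp (Fin.succ_injective m)),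
      ← pow_add]
    congr 1
    rw [Finset.card_filter, Finset.card_filter, Finset.card_filter, Fintype.sum_prod_type,
      Fintype.sum_prod_type, Fin.sum_univ_succ, Fin.sum_univ_succ]
    have h1 : (List.ofFn fun i => g i.succ).toFinset =
        Finset.univ.map ⟨fun i : Fin m => g i.succ, hg.comp (Fin.succ_injective m)⟩ := by
      ext; simp
    rw [h1, Finset.sum_map]
    simp only [Fin.sum_univ_succ]
    simp

end Words

end QuantumMatrix

/-! ### Quantum minors -/

section Minors

variable {k : Type*} [Field k] {N : ℕ} {A : Type*} [Ring A] [Algebra k A]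

/-- Left multiplication by `∑ⱼ x_{ij} θ_j` in the `q`-exterior algebra with coefficients in `A`. -/
def minorOp (ν : k) (x : Fin N → Fin N → A) (i : Fin N) :
    Module.End k (Finset (Fin N) → A) where
  toFun φ S := ∑ j ∈ S, ν ^ (S.filter (· < j)).card • (x i j * φ (S.erase j))
  map_add' φ ψ := by
    ext S
    simp [mul_add, Finset.sum_add_distrib]
  map_smul' c φ := by
    ext S
    simp [Finset.smul_sum, smul_comm c]

theorem minorOp_apply (ν : k) (x : Fin N → Fin N → A) (i : Fin N) (φ : Finset (Fin N) → A)
    (S : Finset (Fin N)) : minorOp ν x i φ S =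
      ∑ j ∈ S, ν ^ (S.filter (· < j)).card • (x i j * φ (S.erase j)) := rfl

theorem sum_erase_eq_sum_lt {M : Type*} [AddCommGroup M] (S : Finset (Fin N))
    (G : Fin N → Fin N → M) : ∑ c ∈ S, ∑ d ∈ S.erase c, G c d =
      ∑ c ∈ S, ∑ d ∈ S, if c < d then G c d + G d c else 0 := by
  have h : ∀ c ∈ S, ∑ d ∈ S.erase c, G c d =
      (∑ d ∈ S, if c < d then G c d else 0) + ∑ d ∈ S, if d < c then G c d else 0 := by
    intro c hc
    rw [← Finset.sum_add_distrib, ← Finset.add_sum_erase S _ hc]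
    simp only [lt_irrefl, if_false, add_zero, zero_add]
    refine Finset.sum_congr rfl fun d hd => ?_
    rcases lt_or_gt_of_ne (Finset.ne_of_mem_erase hd) with h | h <;> simp [h, h.not_gt]
  rw [Finset.sum_congr rfl h, Finset.sum_add_distrib,
    Finset.sum_comm (f := fun c d => if d < c then G c d else 0), ← Finset.sum_add_distrib]
  refine Finset.sum_congr rfl fun c _ => ?_
  rw [← Finset.sum_add_distrib]
  refine Finset.sum_congr rfl fun d _ => ?_
  split_ifs <;> simp

/-- The two orders of removing c < d from S are grouped together. They differ by one factor ν,
because c counts among the letters below d only as long as it has not been removed; what remains is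
a 2 × 2 quantum minor. -/
theorem minorOp_minorOp (ν : k) (x : Fin N → Fin N → A) (i j : Fin N)
    (φ : Finset (Fin N) → A) (S : Finset (Fin N)) :
    minorOp ν x i (minorOp ν x j φ) S = ∑ c ∈ S, ∑ d ∈ S, if c < d then
      ν ^ ((S.filter (· < c)).card + ((S.erase c).filter (· < d)).card) •
        ((x i c * x j d + ν • (x i d * x j c)) * φ ((S.erase c).erase d)) else 0 := by
  simp only [minorOp_apply, Finset.mul_sum, Finset.smul_sum]
  rw [sum_erase_eq_sum_lt]
  refine Finset.sum_congr rfl fun c hc => Finset.sum_congr rfl fun d hd => ?_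
  split_ifs with hcd
  · have h₁ : ((S.erase d).filter (· < c)).card = (S.filter (· < c)).card := by
      rw [Finset.filter_erase, Finset.erase_eq_of_notMem]
      simp [hcd.not_gt]
    have h₂ : (S.filter (· < d)).card = ((S.erase c).filter (· < d)).card + 1 := by
      rw [Finset.filter_erase, Finset.card_erase_add_one]
      simp [hc, hcd]
    rw [h₁, h₂, Finset.erase_right_comm (a := d)]
    simp only [add_mul, smul_add, mul_smul_comm, smul_smul, smul_mul_assoc, mul_assoc]
    congr 2 <;> ring
  · rfl

variable {q : k} {x : Fin N → Fin N → A}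

/-- The row relation makes the 2 × 2 minor with equal rows vanish exactly for ν = (-q)⁻¹. Together
with `minorOp_anti`, the rows of a quantum matrix satisfy the relations of q-exterior generators, so
`word_prod` applies to them. -/
theorem minorOp_sq (hq : q ≠ 0) (hx : IsQuantum q x) (i : Fin N) :
    minorOp (-q)⁻¹ x i * minorOp (-q)⁻¹ x i = 0 := by
  refine LinearMap.ext fun φ => funext fun S => ?_
  rw [Module.End.mul_apply, minorOp_minorOp]
  refine Finset.sum_eq_zero fun c _ => Finset.sum_eq_zero fun d _ => ?_
  split_ifs with h
  · rw [hx.row i d c h, smul_smul, ← neg_inv, neg_mul, inv_mul_cancel₀ hq]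
    simp
  · rfl

theorem minorOp_anti (hq : q ≠ 0) (hx : IsQuantum q x) (i j : Fin N) (hij : i < j) :
    minorOp (-q)⁻¹ x j * minorOp (-q)⁻¹ x i =
      (-q)⁻¹ • (minorOp (-q)⁻¹ x i * minorOp (-q)⁻¹ x j) := by
  refine LinearMap.ext fun φ => funext fun S => ?_
  rw [Module.End.mul_apply, minorOp_minorOp, LinearMap.smul_apply, Module.End.mul_apply,
    Pi.smul_apply, minorOp_minorOp, Finset.smul_sum]
  refine Finset.sum_congr rfl fun c _ => ?_
  rw [Finset.smul_sum]
  refine Finset.sum_congr rfl fun d _ => ?_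
  split_ifs with h
  · have h₁ : x j c * x i d + (-q)⁻¹ • (x j d * x i c) =
        (-q)⁻¹ • (x i c * x j d + (-q)⁻¹ • (x i d * x j c)) := by
      rw [hx.comm i j c d hij h, sub_eq_iff_eq_add.1 (hx.cross i j c d hij h)]
      match_scalars <;> field_simp
      ring
    rw [h₁, smul_mul_assoc, smul_comm]
  · simp

/-- The quantum minor with the rows `L` and the columns `S`. -/
def minor (ν : k) (x : Fin N → Fin N → A) (L : List (Fin N)) : Finset (Fin N) → A :=
  (L.map (minorOp ν x)).prod fun S => if S = ∅ then 1 else 0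

theorem minor_nil (ν : k) (x : Fin N → Fin N → A) (S : Finset (Fin N)) :
    minor ν x [] S = if S = ∅ then 1 else 0 := rfl

theorem minor_cons (ν : k) (x : Fin N → Fin N → A) (i : Fin N) (L : List (Fin N))
    (S : Finset (Fin N)) : minor ν x (i :: L) S =
      ∑ j ∈ S, ν ^ (S.filter (· < j)).card • (x i j * minor ν x L (S.erase j)) := by
  rw [minor, List.map_cons, List.prod_cons, Module.End.mul_apply, minorOp_apply, minor]

theorem sum_fin_cons {M : Type*} [AddCommMonoid M] {m : ℕ} {ι : Type*} [Fintype ι]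
    (F : (Fin (m + 1) → ι) → M) : ∑ g, F g = ∑ j, ∑ g : Fin m → ι, F (Fin.cons j g) := by
  rw [← Equiv.sum_comp (Fin.consEquiv fun _ => ι), Fintype.sum_prod_type]
  rfl

theorem sum_fin_snoc {M : Type*} [AddCommMonoid M] {m : ℕ} {ι : Type*} [Fintype ι]
    (F : (Fin (m + 1) → ι) → M) :
    ∑ g, F g = ∑ j, ∑ g : Fin m → ι, F (Fin.snoc (α := fun _ => ι) g j) := by
  rw [← Equiv.sum_comp (Fin.snocEquiv fun _ => ι), Fintype.sum_prod_type]
  rfl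

theorem minor_eq_sum (ν : k) (x : Fin N → Fin N → A) {m : ℕ} (f : Fin m → Fin N)
    (S : Finset (Fin N)) : minor ν x (List.ofFn f) S =
      ∑ g : Fin m → Fin N, (if (List.ofFn g).toFinset = S then wordSign ν (List.ofFn g) else 0) •
        (List.ofFn fun a => x (f a) (g a)).prod := by
  induction m generalizing S with
  | zero => simp [minor_nil, wordSign, eq_comm]
  | succ m ih =>
    rw [List.ofFn_succ, minor_cons, sum_fin_cons, ← Finset.sum_subset (Finset.subset_univ S)]
    · refine Finset.sum_congr rfl fun j hj => ?_
      rw [ih, Finset.mul_sum, Finset.smul_sum]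
      refine Finset.sum_congr rfl fun g _ => ?_
      simp only [List.ofFn_succ, Fin.cons_zero, Fin.cons_succ, List.prod_cons, mul_smul_comm,
        smul_smul]
      congr 1
      rw [List.toFinset_cons, wordSign]
      by_cases hg : (List.ofFn g).toFinset = S.erase j
      · have hjg : j ∉ List.ofFn g := by
          rw [← List.mem_toFinset, hg]; simp
        rw [if_pos hg, if_pos (by rw [hg, Finset.insert_erase hj]), if_neg hjg, hg,
          Finset.filter_erase, Finset.erase_eq_of_notMem (by simp)]
      · rw [if_neg hg, mul_zero]
        split_ifs with h₁ h₂
        · rfl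
        · exact absurd (by rw [← h₁, Finset.erase_insert (by simpa using h₂)]) hg
        · rfl
    · intro j _ hj
      refine Finset.sum_eq_zero fun g _ => ?_
      rw [if_neg, zero_smul]
      rintro rfl
      simp at hj

theorem ofFn_toFinset_univ {g : Fin N → Fin N} (h : (List.ofFn g).Nodup) :
    (List.ofFn g).toFinset = Finset.univ := by
  rw [← Finset.card_eq_iff_eq_univ, List.toFinset_card_of_nodup h]
  simp

theorem minor_univ_eq_sum (ν : k) (x : Fin N → Fin N → A) (f : Fin N → Fin N) :
    minor ν x (List.ofFn f) Finset.univ = ∑ g : Fin N → Fin N, wordSign ν (List.ofFn g) •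
        (List.ofFn fun a => x (f a) (g a)).prod := by
  rw [minor_eq_sum]
  refine Finset.sum_congr rfl fun g _ => ?_
  by_cases h : (List.ofFn g).Nodup
  · rw [if_pos (ofFn_toFinset_univ h)]
  · rw [wordSign_eq_zero h]; simp

/-- The quantum determinant. -/
def qdet (ν : k) (x : Fin N → Fin N → A) : A :=
  ∑ g : Fin N → Fin N, wordSign ν (List.ofFn g) • (List.ofFn fun a => x a (g a)).prod

theorem qdet_eq_minor (ν : k) (x : Fin N → Fin N → A) :
    qdet ν x = minor ν x (List.ofFn id) Finset.univ := by
  rw [minor_univ_eq_sum]; rfl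

/-- Words with a repeated letter have sign zero, so the sum may run over all maps instead of
permutations. In that form it factors when products of sums are expanded. -/
theorem sum_perm_eq_qdet (ν : k) (x : Fin N → Fin N → A) :
    ∑ p : Equiv.Perm (Fin N), ν ^ inversions p • (List.ofFn fun i => x i (p i)).prod =
      qdet ν x := by
  refine Finset.sum_of_injOn (fun p : Equiv.Perm (Fin N) => (p : Fin N → Fin N))
    (fun p _ p' _ h => DFunLike.coe_injective h) (fun _ _ => Finset.mem_coe.2 (Finset.mem_univ _))
    (fun g _ hg => ?_) (fun p _ => ?_)
  · rw [wordSign_eq_zero, zero_smul]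
    intro h
    rw [List.nodup_ofFn] at h
    exact hg ⟨Equiv.ofBijective g (Finite.injective_iff_bijective.1 h), by simp, rfl⟩
  · rw [wordSign_ofFn _ p.injective]
    rfl

/-- The left side is the minor with rows f. Sorting the word of row operators turns it into the sign
of f times an ordered product that is the same for every permutation; a repeated row gives zero.
This one identity yields the multiplicativity of the determinant, the cofactor expansions and the
determinant of the inverse. -/
theorem qdet_rows (hq : q ≠ 0) (hx : IsQuantum q x) (f : Fin N → Fin N) :
    ∑ g : Fin N → Fin N, wordSign (-q)⁻¹ (List.ofFn g) • (List.ofFn fun a => x (f a) (g a)).prod =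
      wordSign (-q)⁻¹ (List.ofFn f) • qdet (-q)⁻¹ x := by
  have key : ∀ L : List (Fin N), minor (-q)⁻¹ x L Finset.univ = wordSign (-q)⁻¹ L •
      (orderedProd (minorOp (-q)⁻¹ x) L.toFinset fun S => if S = ∅ then 1 else 0)
        Finset.univ := by
    intro L
    rw [minor, word_prod (k := k) (ν := (-q)⁻¹) (minorOp_sq hq hx) (minorOp_anti hq hx)]
    rfl
  have hid : wordSign (-q)⁻¹ (List.ofFn (id : Fin N → Fin N)) = 1 := by
    rw [wordSign_ofFn _ Function.injective_id, Finset.filter_eq_empty_iff.2]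
    · simp
    · rintro ⟨a, b⟩ -
      simp only [id]
      exact fun h => lt_asymm h.1 h.2
  rw [← minor_univ_eq_sum, qdet_eq_minor, key, key, hid, one_smul]
  by_cases h : (List.ofFn f).Nodup
  · rw [ofFn_toFinset_univ h, ofFn_toFinset_univ (List.nodup_ofFn.2 Function.injective_id)]
  · rw [wordSign_eq_zero h, zero_smul, zero_smul]

/-! Symmetry of the minors under transposition. -/

theorem toFinset_erase_of_nodup {L : List (Fin N)} (h : L.Nodup) (c : Fin N) :
    (L.erase c).toFinset = L.toFinset.erase c := by
  ext; simp [h.mem_erase_iff]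

/-- Expand along the first row i, and in the terms with a column c other than the first column j
expand again along j. This leaves a double sum of x_{ic} x_{dj} times a minor two sizes smaller. The
transposed expansion gives the same sum with x_{dj} x_{ic}, and these entries commute since i < d
and j < c. Only this one relation is needed. -/
theorem minor_transpose (ν : k)
    (hcomm : ∀ i j l m, i < j → l < m → x j l * x i m = x i m * x j l) :
    ∀ (n : ℕ) (L L' : List (Fin N)), L.length = n → L'.length = n →
      L.Pairwise (· < ·) → L'.Pairwise (· < ·) →
      minor ν x L L'.toFinset = minor ν (fun i j => x j i) L' L.toFinset := by
  intro n
  induction n using Nat.strong_induction_on with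
  | _ n ih =>
    rintro (_ | ⟨i, L⟩) (_ | ⟨j, L'⟩) hL hL' hs hs'
    · rfl
    · simp only [List.length_nil, List.length_cons] at hL hL'; omega
    · simp only [List.length_nil, List.length_cons] at hL hL'; omega
    rw [List.pairwise_cons] at hs hs'
    simp only [List.length_cons] at hL hL'
    have expand : ∀ (y : Fin N → Fin N → A) (i j : Fin N) (L L' : List (Fin N)),
        (∀ b ∈ L', j < b) → minor ν y (i :: L) (j :: L').toFinset =
          y i j * minor ν y L L'.toFinset + ∑ c ∈ L'.toFinset,
            ν ^ ((L'.toFinset.filter (· < c)).card + 1) •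
              (y i c * minor ν y L (insert j (L'.toFinset.erase c))) := by
      intro y i j L L' hj
      have hjL : j ∉ L'.toFinset := fun h => lt_irrefl _ (hj j (by simpa using h))
      rw [minor_cons, List.toFinset_cons, Finset.sum_insert hjL]
      congr 1
      · rw [Finset.erase_insert hjL, Finset.filter_eq_empty_iff.2]
        · simp
        · intro b hb
          rcases Finset.mem_insert.1 hb with rfl | hb
          · exact lt_irrefl _
          · exact (hj b (by simpa using hb)).not_gt
      · refine Finset.sum_congr rfl fun c hc => ?_
        have hjc : j < c := hj c (by simpa using hc)
        rw [Finset.filter_insert, if_pos hjc, Finset.card_insert_of_notMem (by simp [hjL]),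
          Finset.erase_insert_of_ne hjc.ne]
    have first : ∀ (y : Fin N → Fin N → A) (j : Fin N) (L : List (Fin N)) (S : Finset (Fin N)),
        minor ν y (j :: L) S = ∑ c ∈ S, ν ^ (S.filter (· < c)).card •
          (y j c * minor ν y L (S.erase c)) := fun y j L S => minor_cons ν y j L S
    have nd : L.Nodup := hs.2.imp fun h => h.ne
    have nd' : L'.Nodup := hs'.2.imp fun h => h.ne
    have step : ∀ c ∈ L'.toFinset, minor ν x L (insert j (L'.toFinset.erase c)) =
        ∑ d ∈ L.toFinset, ν ^ (L.toFinset.filter (· < d)).card •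
          (x d j * minor ν (fun i j => x j i) (L'.erase c) (L.erase d).toFinset) := by
      intro c hc
      have hset : insert j (L'.toFinset.erase c) = (j :: L'.erase c).toFinset := by
        rw [List.toFinset_cons, toFinset_erase_of_nodup nd']
      have hc' : c ∈ L' := by simpa using hc
      have hp := List.length_pos_of_mem hc'
      rw [hset, ih (n - 1) (by omega) L (j :: L'.erase c) (by omega)
        (by rw [List.length_cons, List.length_erase_of_mem hc']; omega) hs.2, first]
      · exact Finset.sum_congr rfl fun d _ => by rw [← toFinset_erase_of_nodup nd]
      · exact List.pairwise_cons.2 ⟨fun b hb => hs'.1 b (List.mem_of_mem_erase hb),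
          hs'.2.sublist List.erase_sublist⟩
    have step' : ∀ d ∈ L.toFinset, minor ν (fun i j => x j i) L' (insert i (L.toFinset.erase d)) =
        ∑ c ∈ L'.toFinset, ν ^ (L'.toFinset.filter (· < c)).card •
          (x i c * minor ν x (L.erase d) (L'.erase c).toFinset) := by
      intro d hd
      have hset : insert i (L.toFinset.erase d) = (i :: L.erase d).toFinset := by
        rw [List.toFinset_cons, toFinset_erase_of_nodup nd]
      have hd' : d ∈ L := by simpa using hd
      have hp := List.length_pos_of_mem hd'
      rw [hset, ← ih (n - 1) (by omega) (i :: L.erase d) L'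
        (by rw [List.length_cons, List.length_erase_of_mem hd']; omega) (by omega) _ hs'.2, first]
      · exact Finset.sum_congr rfl fun c _ => by rw [← toFinset_erase_of_nodup nd']
      · exact List.pairwise_cons.2 ⟨fun b hb => hs.1 b (List.mem_of_mem_erase hb),
          hs.2.sublist List.erase_sublist⟩
    rw [expand x i j L L' hs'.1, expand (fun i j => x j i) j i L' L hs.1,
      ih (n - 1) (by omega) L L' (by omega) (by omega) hs.2 hs'.2]
    congr 1
    refine (Finset.sum_congr rfl fun c hc => by
      rw [step c hc, Finset.mul_sum, Finset.smul_sum]).trans (Finset.sum_comm.trans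
      (Finset.sum_congr rfl fun d hd => ?_))
    rw [step' d hd, Finset.mul_sum, Finset.smul_sum]
    refine Finset.sum_congr rfl fun c hc => ?_
    have hd' : d ∈ L := by simpa using hd
    have hc' : c ∈ L' := by simpa using hc
    rw [ih (n - 2) (by have := List.length_pos_of_mem hd'; omega) (L.erase d) (L'.erase c)
      (by rw [List.length_erase_of_mem hd']; omega) (by rw [List.length_erase_of_mem hc']; omega)
      (hs.2.sublist List.erase_sublist) (hs'.2.sublist List.erase_sublist)]
    simp only [mul_smul_comm, smul_smul, ← mul_assoc,
      hcomm i d j c (hs.1 d hd') (hs'.1 c hc')]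
    congr 1
    ring

theorem qdet_transpose (hx : IsQuantum q x) (ν : k) :
    qdet ν (fun i j => x j i) = qdet ν x := by
  have hs : (List.ofFn (id : Fin N → Fin N)).Pairwise (· < ·) := by
    rw [List.pairwise_ofFn]; exact fun _ _ h => h
  have hu := ofFn_toFinset_univ (N := N) (List.nodup_ofFn.2 Function.injective_id)
  have := minor_transpose ν hx.comm N (List.ofFn id) (List.ofFn id) (by simp) (by simp) hs hs
  rw [hu] at this
  rw [qdet_eq_minor, qdet_eq_minor, this]

end Minors

/-! ### The Hopf algebra `SL_q(N)` -/

section Inverse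

variable {k : Type*} [Field k] {N : ℕ} {A : Type*} [Ring A] [Algebra k A]

theorem wordSign_id (ν : k) : wordSign ν (List.ofFn (id : Fin N → Fin N)) = 1 := by
  rw [wordSign_ofFn _ Function.injective_id, Finset.filter_eq_empty_iff.2]
  · simp
  · rintro ⟨a, b⟩ -
    exact fun h => lt_asymm h.1 h.2

theorem map_qdet {B : Type*} [Ring B] [Algebra k B] (φ : A →ₐ[k] B) (ν : k)
    (x : Fin N → Fin N → A) : φ (qdet ν x) = qdet ν fun i j => φ (x i j) := by
  simp only [qdet, map_sum, map_smul, map_list_prod, List.map_ofFn]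
  rfl

theorem prod_ofFn_sum {m : ℕ} {ι : Type*} [Fintype ι] (y : Fin m → ι → A) :
    (List.ofFn fun a => ∑ j, y a j).prod = ∑ g : Fin m → ι, (List.ofFn fun a => y a (g a)).prod := by
  induction m with
  | zero => simp
  | succ m ih =>
    rw [sum_fin_cons]
    simp only [List.ofFn_succ, List.prod_cons, ih, Fin.cons_zero, Fin.cons_succ]
    rw [Finset.sum_mul_sum]

theorem prod_ofFn_tmul {B : Type*} [Ring B] [Algebra k B] {m : ℕ} (y : Fin m → A) (z : Fin m → B) :
    (List.ofFn fun a => y a ⊗ₜ[k] z a).prod = (List.ofFn y).prod ⊗ₜ (List.ofFn z).prod := by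
  induction m with
  | zero => simp [Algebra.TensorProduct.one_def]
  | succ m ih => simp [List.ofFn_succ, ih]

/-- After expanding, the inner sum over the columns of y is the determinant of y with rows permuted
by the intermediate word f, so `qdet_rows` turns it into the sign of f. -/
theorem qdet_tensor {B : Type*} [Ring B] [Algebra k B] {q : k} (hq : q ≠ 0)
    (x : Fin N → Fin N → A) {y : Fin N → Fin N → B} (hy : IsQuantum q y) :
    qdet (-q)⁻¹ (fun i j => ∑ m, x i m ⊗ₜ[k] y m j) =
      qdet (-q)⁻¹ x ⊗ₜ[k] qdet (-q)⁻¹ y := by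
  rw [qdet]
  simp only [prod_ofFn_sum, prod_ofFn_tmul, Finset.smul_sum]
  rw [Finset.sum_comm]
  simp only [← TensorProduct.tmul_smul, ← TensorProduct.tmul_sum]
  conv_rhs => rw [qdet, TensorProduct.sum_tmul]
  refine Finset.sum_congr rfl fun f _ => ?_
  rw [qdet_rows hq hy f, TensorProduct.tmul_smul, TensorProduct.smul_tmul']

variable {n : ℕ} {q : k} {x : Fin (n + 1) → Fin (n + 1) → A}

/-- The inverse is the cofactor matrix. Applying `qdet_rows` to the word consisting of i followed by
all rows except a gives Σ_j x_{ij} times a cofactor: for i = a the nonzero sign `w a`, and otherwise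
zero because a row is repeated. -/
theorem exists_right_inverse (hq : q ≠ 0) (hx : IsQuantum q x) (hdet : qdet (-q)⁻¹ x = 1) :
    ∃ y : Fin (n + 1) → Fin (n + 1) → A, ∀ i j, ∑ m, x i m * y m j = if i = j then 1 else 0 := by
  have hν : (-q)⁻¹ ≠ 0 := inv_ne_zero (neg_ne_zero.2 hq)
  let w (a : Fin (n + 1)) : k := wordSign (-q)⁻¹ (List.ofFn (Fin.cons a a.succAbove))
  refine ⟨fun j a => (w a)⁻¹ • ∑ g : Fin n → Fin (n + 1),
    wordSign (-q)⁻¹ (List.ofFn (Fin.cons j g : Fin (n + 1) → Fin (n + 1))) •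
      (List.ofFn fun b => x (a.succAbove b) (g b)).prod, fun i a => ?_⟩
  have h := qdet_rows hq hx (Fin.cons i a.succAbove)
  rw [sum_fin_cons, hdet] at h
  simp only [List.ofFn_succ, Fin.cons_zero, Fin.cons_succ, List.prod_cons] at h
  simp only [mul_smul_comm, Finset.mul_sum, ← Finset.smul_sum]
  simp only [List.ofFn_succ, Fin.cons_zero, Fin.cons_succ]
  rw [h, smul_smul]
  split_ifs with hia
  · subst hia
    have : w i ≠ 0 := wordSign_ne_zero hν (List.nodup_ofFn.2
      (Fin.cons_injective_iff.2 ⟨by simp, Fin.succAbove_right_injective⟩))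
    simp only [w, List.ofFn_succ, Fin.cons_zero, Fin.cons_succ] at this ⊢
    rw [inv_mul_cancel₀ this, one_smul]
  · obtain ⟨b, rfl⟩ := Fin.exists_succAbove_eq hia
    rw [wordSign_eq_zero, mul_zero, zero_smul]
    simp [List.nodup_cons]

/-- The same expansion, for the transposed matrix and with the extra letter placed last: then x_{ji}
stands on the right of the cofactor. -/
theorem exists_left_inverse (hq : q ≠ 0) (hx : IsQuantum q x) (hdet : qdet (-q)⁻¹ x = 1) :
    ∃ y : Fin (n + 1) → Fin (n + 1) → A, ∀ i j, ∑ m, y i m * x m j = if i = j then 1 else 0 := by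
  have hν : (-q)⁻¹ ≠ 0 := inv_ne_zero (neg_ne_zero.2 hq)
  let w (a i : Fin (n + 1)) : k := wordSign (-q)⁻¹
    (List.ofFn (Fin.snoc (α := fun _ => Fin (n + 1)) a.succAbove i))
  refine ⟨fun a i => (w a a)⁻¹ • ∑ g : Fin n → Fin (n + 1),
    wordSign (-q)⁻¹ (List.ofFn (Fin.snoc (α := fun _ => Fin (n + 1)) g i)) •
      (List.ofFn fun b => x (g b) (a.succAbove b)).prod, fun a i => ?_⟩
  have h := qdet_rows hq hx.transpose (Fin.snoc (α := fun _ => Fin (n + 1)) a.succAbove i)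
  rw [sum_fin_snoc, qdet_transpose hx, hdet] at h
  have hprod : ∀ (j : Fin (n + 1)) (g : Fin n → Fin (n + 1)), (List.ofFn fun b =>
      x (Fin.snoc (α := fun _ => Fin (n + 1)) g j b)
        (Fin.snoc (α := fun _ => Fin (n + 1)) a.succAbove i b)).prod =
      (List.ofFn fun b => x (g b) (a.succAbove b)).prod * x j i := by
    intro j g
    rw [List.ofFn_succ']
    simp
  simp only [hprod] at h
  simp only [smul_mul_assoc, Finset.sum_mul, ← Finset.smul_sum]
  rw [h, smul_smul]
  split_ifs with hia
  · subst hia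
    have : w a a ≠ 0 := wordSign_ne_zero hν (List.nodup_ofFn.2
      (Fin.snoc_injective_iff.2 ⟨Fin.succAbove_right_injective, by simp⟩))
    rw [inv_mul_cancel₀ this, one_smul]
  · obtain ⟨b, rfl⟩ := Fin.exists_succAbove_eq (Ne.symm hia)
    rw [wordSign_eq_zero, mul_zero, zero_smul]
    rw [List.nodup_ofFn]
    intro hinj
    have := @hinj b.castSucc (Fin.last n) (by simp)
    exact (Fin.castSucc_lt_last b).ne this

/-- Multiplying R T₁T₂ = T₂T₁ R by the inverses on both sides gives the same relation for the
inverse matrix with all products reversed, that is, over the opposite algebra. -/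
theorem IsRTT.op_inverse {q : k} {x y : Fin N → Fin N → A} (hx : IsRTT q x)
    (h₁ : ∀ i j, ∑ m, x i m * y m j = if i = j then 1 else 0)
    (h₂ : ∀ i j, ∑ m, y i m * x m j = if i = j then 1 else 0) :
    IsRTT q fun i j => MulOpposite.op (y i j) := by
  let R : Matrix (Fin N × Fin N) (Fin N × Fin N) A := Matrix.of fun p r => algebraMap k A (Rmat q p.1 r.1 p.2 r.2)
  let X : Matrix (Fin N × Fin N) (Fin N × Fin N) A := Matrix.of fun p r => x p.1 r.1 * x p.2 r.2
  let X' : Matrix (Fin N × Fin N) (Fin N × Fin N) A := Matrix.of fun p r => x p.2 r.2 * x p.1 r.1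
  let Y : Matrix (Fin N × Fin N) (Fin N × Fin N) A := Matrix.of fun p r => y p.2 r.2 * y p.1 r.1
  let Y' : Matrix (Fin N × Fin N) (Fin N × Fin N) A := Matrix.of fun p r => y p.1 r.1 * y p.2 r.2
  have hRX : R * X = X' * R := by
    ext ⟨i, j⟩ ⟨m, l⟩
    have := hx i j m l
    simp only [Matrix.mul_apply, Fintype.sum_prod_type, R, X, X', Matrix.of_apply]
    simp only [Algebra.smul_def] at this
    rw [this]
    exact Finset.sum_congr rfl fun a _ => Finset.sum_congr rfl fun b _ => Algebra.commutes _ _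
  have hXY : X * Y = 1 := by
    ext ⟨i, j⟩ ⟨m, l⟩
    simp only [Matrix.mul_apply, Fintype.sum_prod_type, X, Y, Matrix.of_apply, Matrix.one_apply,
      Prod.mk.injEq]
    have : ∀ a b, x i a * x j b * (y b l * y a m) = x i a * (x j b * y b l) * y a m :=
      fun a b => by simp only [mul_assoc]
    simp only [this, ← Finset.mul_sum, ← Finset.sum_mul, h₁]
    by_cases hj : j = l <;> simp [hj, h₁]
  have hYX : Y' * X' = 1 := by
    ext ⟨i, j⟩ ⟨m, l⟩
    simp only [Matrix.mul_apply, Fintype.sum_prod_type, X', Y', Matrix.of_apply, Matrix.one_apply,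
      Prod.mk.injEq]
    have : ∀ a b, y i a * y j b * (x b l * x a m) = y i a * (y j b * x b l) * x a m :=
      fun a b => by simp only [mul_assoc]
    simp only [this, ← Finset.mul_sum, ← Finset.sum_mul, h₂]
    by_cases hj : j = l <;> simp [hj, h₂]
  have key : Y' * R = R * Y := by
    calc Y' * R = Y' * (R * X) * Y := by rw [mul_assoc, mul_assoc, hXY, mul_one]
      _ = R * Y := by rw [hRX, ← mul_assoc, hYX, one_mul]
  intro i j m l
  refine MulOpposite.unop_injective ?_
  have := congrFun (congrFun key (i, j)) (m, l)
  simp only [Matrix.mul_apply, Fintype.sum_prod_type, R, Y, Y', Matrix.of_apply] at this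
  simp only [← Algebra.commutes, ← Algebra.smul_def] at this
  simp only [Finset.unop_sum, MulOpposite.unop_smul, MulOpposite.unop_mul, MulOpposite.unop_op]
  exact this.symm

/-- In the opposite algebra the y-factors are multiplied in reverse, so y and x with equal position
meet in the middle and cancel one pair at a time. -/
theorem sum_op_prod_mul_prod {x y : Fin N → Fin N → A}
    (h₂ : ∀ i j, ∑ m, y i m * x m j = if i = j then 1 else 0) {m : ℕ} (h g : Fin m → Fin N) :
    ∑ f : Fin m → Fin N, (List.ofFn fun a => MulOpposite.op (y (h a) (f a))).prod.unop *
      (List.ofFn fun a => x (f a) (g a)).prod = if h = g then 1 else 0 := by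
  induction m with
  | zero => simp [Subsingleton.elim h g]
  | succ m ih =>
    rw [sum_fin_cons, Finset.sum_comm]
    simp only [List.ofFn_succ, Fin.cons_zero, Fin.cons_succ, List.prod_cons, MulOpposite.unop_mul,
      MulOpposite.unop_op]
    have : ∀ (a : A) (b : A) (j : Fin N), a * y (h 0) j * (x j (g 0) * b) =
        a * (y (h 0) j * x j (g 0)) * b := fun a b j => by simp only [mul_assoc]
    simp only [this, ← Finset.sum_mul, ← Finset.mul_sum, h₂]
    by_cases h0 : h 0 = g 0
    · simp only [h0, if_true, mul_one, ih]
      congr 1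
      rw [← Fin.cons_self_tail h, ← Fin.cons_self_tail g, Fin.cons_inj]
      simp only [h0, true_and, eq_iff_iff]
      rfl
    · rw [if_neg fun e => h0 (congrFun e 0)]
      simp [h0]

/-- Each sign in the determinant of y is replaced by the determinant of x with permuted rows, using
`qdet_rows` and det x = 1. Then the y-factors cancel against the x-factors and only the identity
column word survives. -/
theorem qdet_op_inverse (hq : q ≠ 0) (hx : IsQuantum q x) (hdet : qdet (-q)⁻¹ x = 1)
    {y : Fin (n + 1) → Fin (n + 1) → A}
    (h₂ : ∀ i j, ∑ m, y i m * x m j = if i = j then 1 else 0) :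
    qdet (-q)⁻¹ (fun i j => MulOpposite.op (y i j)) = 1 := by
  refine MulOpposite.unop_injective ?_
  have hrow := qdet_rows hq hx
  simp only [hdet] at hrow
  have key : ∑ f : Fin (n + 1) → Fin (n + 1),
      (List.ofFn fun a => MulOpposite.op (y a (f a))).prod.unop *
        (wordSign (-q)⁻¹ (List.ofFn f) • (1 : A)) = 1 := by
    simp only [← hrow, Finset.mul_sum]
    rw [Finset.sum_comm]
    simp only [mul_smul_comm, ← Finset.smul_sum]
    have := fun g => sum_op_prod_mul_prod h₂ (id : Fin (n + 1) → Fin (n + 1)) g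
    simp only [id] at this
    simp only [this]
    rw [Finset.sum_eq_single id]
    · rw [wordSign_id, if_pos rfl, one_smul]
    · intro g _ hg
      rw [if_neg (fun e => hg e.symm), smul_zero]
    · simp
  simpa [qdet, Finset.unop_sum] using key

end Inverse

namespace SLq

variable {k : Type*} [Field k] (n : ℕ) (q : k)

/-- The canonical map from the free algebra. -/
def mk : FreeAlgebra k (Fin (n + 1) × Fin (n + 1)) →ₐ[k] SLq n q := RingQuot.mkAlgHom k (SLqRel n q)

theorem mk_freeX (i j : Fin (n + 1)) : mk n q (freeX k n i j) = x n q i j := rfl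

theorem mk_rel {a b : FreeAlgebra k (Fin (n + 1) × Fin (n + 1))} (h : SLqRel n q a b) :
    mk n q a = mk n q b :=
  RingQuot.mkAlgHom_rel k h

theorem isQuantum : IsQuantum q (x n q) where
  row i m l h := by simpa [mk_freeX] using mk_rel n q (.row i m l h)
  col i j m h := by simpa [mk_freeX] using mk_rel n q (.col i j m h)
  comm i j l m h h' := by simpa [mk_freeX] using mk_rel n q (.comm i j l m h h')
  cross i j l m h h' := by simpa [mk_freeX] using mk_rel n q (.cross i j l m h h')

theorem qdet_x : qdet (-q)⁻¹ (x n q) = 1 := by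
  have := mk_rel n q .det
  rw [sum_perm_eq_qdet, map_qdet, map_one] at this
  exact this

theorem adjoin_x : Algebra.adjoin k (Set.range fun p : Fin (n + 1) × Fin (n + 1) =>
    x n q p.1 p.2) = ⊤ := by
  have h : (mk n q).range = ⊤ :=
    AlgHom.range_eq_top _ |>.2 (RingQuot.mkAlgHom_surjective k (SLqRel n q))
  rw [← h, ← Algebra.map_top, ← FreeAlgebra.adjoin_range_ι, AlgHom.map_adjoin, ← Set.range_comp]
  rfl

variable {n q}
variable {B : Type*} [Ring B] [Algebra k B]

/-- The universal property of `SL_q(N)`. -/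
def lift {y : Fin (n + 1) → Fin (n + 1) → B} (hy : IsQuantum q y) (hdet : qdet (-q)⁻¹ y = 1) :
    SLq n q →ₐ[k] B :=
  RingQuot.liftAlgHom k (s := SLqRel n q) ⟨FreeAlgebra.lift k fun p => y p.1 p.2, by
    intro a b h
    have hX : ∀ i j, FreeAlgebra.lift k (fun p : Fin (n + 1) × Fin (n + 1) => y p.1 p.2)
      (freeX k n i j) = y i j := fun i j => by simp [freeX]
    induction h with
    | row i m l h => simpa [hX] using hy.row i m l h
    | col i j m h => simpa [hX] using hy.col i j m h
    | comm i j l m h h' => simpa [hX] using hy.comm i j l m h h'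
    | cross i j l m h h' => simpa [hX] using hy.cross i j l m h h'
    | det => rw [sum_perm_eq_qdet, map_qdet, map_one]; simpa only [hX] using hdet⟩

@[simp] theorem lift_x {y : Fin (n + 1) → Fin (n + 1) → B} (hy : IsQuantum q y)
    (hdet : qdet (-q)⁻¹ y = 1) (i j : Fin (n + 1)) : lift hy hdet (x n q i j) = y i j := by
  have : lift hy hdet (x n q i j) = FreeAlgebra.lift k (fun p : Fin (n + 1) × Fin (n + 1) =>
      y p.1 p.2) (freeX k n i j) := RingQuot.liftAlgHom_mkAlgHom_apply k _ _ _
  rw [this]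
  simp [freeX]

theorem isQuantum_comul (hq : q ≠ 0) : IsQuantum q fun i j : Fin (n + 1) =>
    ∑ m, x n q i m ⊗ₜ[k] x n q m j :=
  (((isQuantum n q).isRTT hq).tensor ((isQuantum n q).isRTT hq)).isQuantum

theorem qdet_comul (hq : q ≠ 0) :
    qdet (-q)⁻¹ (fun i j : Fin (n + 1) => ∑ m, x n q i m ⊗ₜ[k] x n q m j) = 1 := by
  rw [qdet_tensor hq _ (isQuantum n q), qdet_x]
  rfl

theorem isQuantum_counit : IsQuantum q fun i j : Fin (n + 1) => if i = j then (1 : k) else 0 where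
  row i m l h := by
    by_cases h₁ : i = m
    · simp [h₁, h.ne']
    · simp [h₁]
  col i j m h := by
    by_cases h₁ : i = m
    · subst h₁
      simp [h.ne']
    · simp [h₁]
  comm i j l m _ _ := mul_comm _ _
  cross i j l m h h' := by
    by_cases h₁ : i = m <;> by_cases h₂ : j = l <;> simp [h₁, h₂, mul_comm]
    exact absurd (h₁ ▸ h₂ ▸ h) h'.not_gt

theorem qdet_counit (ν : k) :
    qdet ν (fun i j : Fin (n + 1) => if i = j then (1 : k) else 0) = 1 := by
  rw [qdet, Finset.sum_eq_single id]
  · rw [wordSign_id, one_smul, List.prod_ofFn]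
    simp
  · intro g _ hg
    obtain ⟨a, ha⟩ := Function.ne_iff.1 hg
    rw [List.prod_ofFn, Finset.prod_eq_zero (Finset.mem_univ a) (if_neg (Ne.symm ha)), smul_zero]
  · simp

theorem exists_inverse (hq : q ≠ 0) : ∃ y : Fin (n + 1) → Fin (n + 1) → SLq n q,
    (∀ i j, ∑ m, x n q i m * y m j = if i = j then 1 else 0) ∧
    ∀ i j, ∑ m, y i m * x n q m j = if i = j then 1 else 0 := by
  obtain ⟨y, hy⟩ := exists_right_inverse hq (isQuantum n q) (qdet_x n q)
  obtain ⟨y', hy'⟩ := exists_left_inverse hq (isQuantum n q) (qdet_x n q)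
  obtain rfl := HopfStructure.eq_of_matrix_inverse hy' hy
  exact ⟨y', hy, hy'⟩

/-- The inverse of the matrix of generators. -/
def y (hq : q ≠ 0) : Fin (n + 1) → Fin (n + 1) → SLq n q := (exists_inverse hq).choose

theorem x_mul_y (hq : q ≠ 0) (i j : Fin (n + 1)) :
    ∑ m, x n q i m * y hq m j = if i = j then 1 else 0 := (exists_inverse hq).choose_spec.1 i j

theorem y_mul_x (hq : q ≠ 0) (i j : Fin (n + 1)) :
    ∑ m, y hq i m * x n q m j = if i = j then 1 else 0 := (exists_inverse hq).choose_spec.2 i j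

/-- The comultiplication of `SL_q(N)`. -/
def comulHom (hq : q ≠ 0) : SLq n q →ₐ[k] SLq n q ⊗[k] SLq n q :=
  lift (isQuantum_comul hq) (qdet_comul hq)

/-- The counit of `SL_q(N)`. -/
def counitHom : SLq n q →ₐ[k] k := lift isQuantum_counit (qdet_counit _)

/-- The antipode of `SL_q(N)`. -/
def antipodeHom (hq : q ≠ 0) : SLq n q →ₐ[k] (SLq n q)ᵐᵒᵖ :=
  lift (((isQuantum n q).isRTT hq).op_inverse (x_mul_y hq) (y_mul_x hq)).isQuantum
    (qdet_op_inverse hq (isQuantum n q) (qdet_x n q) (y_mul_x hq))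

/-- The Hopf algebra `SL_q(N)`. -/
def hopf (hq : q ≠ 0) : HopfStructure k (SLq n q) :=
  HopfStructure.ofGenerators _ (adjoin_x n q) (comulHom hq) counitHom (antipodeHom hq)
    (by
      rintro _ ⟨⟨i, j⟩, rfl⟩
      simp only [comulHom, lift_x, map_sum, Algebra.TensorProduct.map_tmul, AlgHom.id_apply,
        TensorProduct.sum_tmul, TensorProduct.tmul_sum, Algebra.TensorProduct.assoc_tmul]
      exact Finset.sum_comm)
    (by
      rintro _ ⟨⟨i, j⟩, rfl⟩
      simp only [comulHom, counitHom, lift_x, map_sum, Algebra.TensorProduct.map_tmul,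
        AlgHom.id_apply]
      rw [Finset.sum_eq_single i] <;> simp +contextual [eq_comm])
    (by
      rintro _ ⟨⟨i, j⟩, rfl⟩
      simp only [comulHom, counitHom, lift_x, map_sum, Algebra.TensorProduct.map_tmul,
        AlgHom.id_apply]
      rw [Finset.sum_eq_single j] <;> simp +contextual [eq_comm])
    (by
      rintro _ ⟨⟨i, j⟩, rfl⟩
      simp only [comulHom, counitHom, lift_x, map_sum, LinearMap.rTensor_tmul,
        LinearMap.mul'_apply, HopfStructure.antiLinear_apply, antipodeHom, MulOpposite.unop_op]
      rw [y_mul_x]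
      split_ifs <;> simp)
    (by
      rintro _ ⟨⟨i, j⟩, rfl⟩
      simp only [comulHom, counitHom, lift_x, map_sum, LinearMap.lTensor_tmul,
        LinearMap.mul'_apply, HopfStructure.antiLinear_apply, antipodeHom, MulOpposite.unop_op]
      rw [x_mul_y]
      split_ifs <;> simp)

theorem isCorep (hq : q ≠ 0) : (hopf (n := n) hq).IsCorep (x n q) where
  comul i j := lift_x _ _ i j
  counit i j := lift_x _ _ i j

end SLq

/-! ### The Yang–Baxter equation -/

section YangBaxter

variable {k : Type*} [Field k] {N : ℕ}

/-- The Kronecker delta. -/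
def kron (k : Type*) [Field k] (a b : Fin N) : k := if a = b then 1 else 0

/-- The diagonal coefficients of the `R`-matrix. -/
def diagCoef (q : k) (i j : Fin N) : k := if i = j then q else 1

/-- The off-diagonal coefficients of the `R`-matrix. -/
def offCoef (q : k) (i j : Fin N) : k := if i < j then q - q⁻¹ else 0

theorem diagCoef_self (q : k) (i : Fin N) : diagCoef q i i = q := if_pos rfl
theorem diagCoef_of_lt (q : k) {i j : Fin N} (h : i < j) : diagCoef q i j = 1 := if_neg h.ne
theorem diagCoef_of_gt (q : k) {i j : Fin N} (h : j < i) : diagCoef q i j = 1 := if_neg h.ne'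
theorem offCoef_self (q : k) (i : Fin N) : offCoef q i i = 0 := if_neg (lt_irrefl i)
theorem offCoef_of_lt (q : k) {i j : Fin N} (h : i < j) : offCoef q i j = q - q⁻¹ := if_pos h
theorem offCoef_of_gt (q : k) {i j : Fin N} (h : j < i) : offCoef q i j = 0 := if_neg h.not_gt

theorem Rmat_eq (q : k) (i a j b : Fin N) : Rmat q i a j b =
    diagCoef q i j * kron k a i * kron k b j + offCoef q i j * kron k a j * kron k b i := rfl

theorem sum_Rmat_mul_left (q : k) (i j : Fin N) (f : Fin N → Fin N → k) :
    ∑ a, ∑ b, Rmat q i a j b * f a b = diagCoef q i j * f i j + offCoef q i j * f j i :=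
  sum_Rmat_left q i j f

theorem sum_Rmat_fst (q : k) (i j l : Fin N) (f : Fin N → k) :
    ∑ a, Rmat q i a j l * f a =
      diagCoef q i j * kron k l j * f i + offCoef q i j * kron k l i * f j := by
  simp only [Rmat_eq, add_mul, Finset.sum_add_distrib]
  congr 1
  · rw [Finset.sum_eq_single i] <;> simp +contextual [kron]
  · rw [Finset.sum_eq_single j] <;> simp +contextual [kron]

theorem sum_Rmat_snd (q : k) (i m j : Fin N) (f : Fin N → k) :
    ∑ b, Rmat q i m j b * f b =
      diagCoef q i j * kron k m i * f j + offCoef q i j * kron k m j * f i := by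
  simp only [Rmat_eq, add_mul, Finset.sum_add_distrib]
  congr 1
  · rw [Finset.sum_eq_single j] <;> simp +contextual [kron]
  · rw [Finset.sum_eq_single i] <;> simp +contextual [kron]

/-- The two-term sums reduce both sides to a few products of Kronecker deltas. For each consistent
order of i, j and v the rest is a polynomial identity in q and q⁻¹. This form serves the vector
representation; `yangBaxter'` serves the forms r_{im}. -/
theorem yangBaxter (q : k) (hq : q ≠ 0) (i j v m l u : Fin N) :
    ∑ a, ∑ b, Rmat q i a j b * ∑ w, Rmat q v w b l * Rmat q w u a m =
      ∑ w, ∑ a, Rmat q v w i a * ∑ b, Rmat q w u j b * Rmat q a m b l := by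
  have hinv := mul_inv_cancel₀ hq
  rw [sum_Rmat_mul_left, sum_Rmat_mul_left]
  simp only [sum_Rmat_fst, sum_Rmat_snd]
  simp only [Rmat_eq]
  rcases lt_trichotomy i j with h₁ | h₁ | h₁ <;> rcases lt_trichotomy i v with h₂ | h₂ | h₂ <;>
    rcases lt_trichotomy j v with h₃ | h₃ | h₃
  all_goals first
    -- Among the 27 combinations of comparisons only those coming from an actual order of three
    -- indices survive.
    | (exfalso; order)
    | (subst_vars
       simp only [*, diagCoef_self, diagCoef_of_lt, diagCoef_of_gt, offCoef_self, offCoef_of_lt,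
         offCoef_of_gt]
       first | ring1 | grind)

theorem yangBaxter' (q : k) (hq : q ≠ 0) (i j u v m l : Fin N) :
    ∑ a, ∑ b, Rmat q i a j b * ∑ w, Rmat q a m u w * Rmat q b l w v =
      ∑ b, ∑ w, Rmat q j b u w * ∑ a, Rmat q i a w v * Rmat q a m b l := by
  have hinv := mul_inv_cancel₀ hq
  rw [sum_Rmat_mul_left, sum_Rmat_mul_left]
  simp only [sum_Rmat_fst, sum_Rmat_snd]
  simp only [Rmat_eq]
  rcases lt_trichotomy i j with h₁ | h₁ | h₁ <;> rcases lt_trichotomy i u with h₂ | h₂ | h₂ <;>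
    rcases lt_trichotomy j u with h₃ | h₃ | h₃
  all_goals first
    | (exfalso; order)
    | (subst_vars
       simp only [*, diagCoef_self, diagCoef_of_lt, diagCoef_of_gt, offCoef_self, offCoef_of_lt,
         offCoef_of_gt]
       first | ring1 | grind)

end YangBaxter

/-! ### Triangular quantum matrices -/

section Triangular

variable {k : Type*} [Field k] {N : ℕ} {A : Type*} [Ring A] [Algebra k A]

theorem qdet_eq_prod_diag (ν : k) (x : Fin N → Fin N → A)
    (h : ∀ g : Fin N → Fin N, Function.Injective g → g ≠ id → ∃ a, x a (g a) = 0) :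
    qdet ν x = (List.ofFn fun a => x a a).prod := by
  rw [qdet, Finset.sum_eq_single id]
  · rw [wordSign_id, one_smul]
    rfl
  · intro g _ hg
    by_cases hi : Function.Injective g
    · obtain ⟨a, ha⟩ := h g hi hg
      rw [List.prod_eq_zero ((List.mem_ofFn' _ _).2 ⟨a, ha⟩), smul_zero]
    · rw [wordSign_eq_zero (fun h => hi (List.nodup_ofFn.1 h)), zero_smul]
  · simp

theorem eq_id_of_injective_of_le {g : Fin N → Fin N} (hg : Function.Injective g)
    (h : ∀ a, g a ≤ a) : g = id := by
  funext a
  induction a using WellFoundedLT.induction with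
  | ind a ih =>
    refine le_antisymm (h a) (not_lt.1 fun hlt => ?_)
    exact hlt.ne (hg (ih _ hlt))

theorem eq_id_of_injective_of_ge {g : Fin N → Fin N} (hg : Function.Injective g)
    (h : ∀ a, a ≤ g a) : g = id := by
  funext a
  induction a using WellFoundedGT.induction with
  | ind a ih =>
    refine le_antisymm (not_lt.1 fun hlt => ?_) (h a)
    exact hlt.ne' (hg (ih _ hlt))

theorem qdet_lower (ν : k) (x : Fin N → Fin N → A) (h : ∀ a b, a < b → x a b = 0) :
    qdet ν x = (List.ofFn fun a => x a a).prod := by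
  refine qdet_eq_prod_diag ν x fun g hg hne => ?_
  by_contra hc
  push Not at hc
  exact hne (eq_id_of_injective_of_le hg fun a => not_lt.1 fun hlt => hc a (h _ _ hlt))

theorem qdet_upper (ν : k) (x : Fin N → Fin N → A) (h : ∀ a b, b < a → x a b = 0) :
    qdet ν x = (List.ofFn fun a => x a a).prod := by
  refine qdet_eq_prod_diag ν x fun g hg hne => ?_
  by_contra hc
  push Not at hc
  exact hne (eq_id_of_injective_of_ge hg fun a => not_lt.1 fun hlt => hc a (h _ _ hlt))

/-- Here the normalization of z enters: every diagonal entry collects z^N and exactly one factor q.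
-/
theorem prod_diagonal_eq_one {n : ℕ} {q z : k} (hq : q ≠ 0) (hz : z ^ (n + 1) = q⁻¹) :
    (List.ofFn fun j : Fin (n + 1) =>
      Matrix.diagonal fun u : Fin (n + 1) => z * if u = j then q else 1).prod = 1 := by
  have h := map_list_prod (Matrix.diagonalRingHom (Fin (n + 1)) k)
    (List.ofFn fun (j : Fin (n + 1)) (u : Fin (n + 1)) => z * if u = j then q else 1)
  rw [List.map_ofFn] at h
  refine h.symm.trans ?_
  have : (List.ofFn fun (j : Fin (n + 1)) (u : Fin (n + 1)) => z * if u = j then q else 1).prod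
      = 1 := by
    rw [List.prod_ofFn]
    funext u
    rw [Finset.prod_apply, Finset.prod_mul_distrib, Finset.prod_const, Finset.prod_ite_eq]
    simp [hz, hq]
  rw [this, map_one]

end Triangular

/-! ### Characters and representations given by matrices of forms -/

namespace HopfStructure

section Reps

variable {k A : Type*} [Field k] [Ring A] [Algebra k A] (D : HopfStructure k A)
variable {I J : Type*} [Fintype I] [DecidableEq I] [Fintype J] [DecidableEq J]

/-- The form `f` is multiplicative. -/
structure IsCharacter (f : D.Dual) : Prop where
  mul : ∀ a b, D.form f (a * b) = D.form f a * D.form f b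
  one : D.form f 1 = 1

/-- The matrix `f` of forms is the transpose of a representation. -/
structure IsRep (f : I → I → D.Dual) : Prop where
  mul : ∀ i m a b, D.form (f i m) (a * b) = ∑ c, D.form (f c m) a * D.form (f i c) b
  one : ∀ i m, D.form (f i m) 1 = if i = m then 1 else 0

variable {D}

theorem form_mul_eq_of_comul {a b : A} {ι κ : Type*} {s : Finset ι} {r : Finset κ}
    {u v : ι → A} {u' v' : κ → A} (h : D.Δ a = ∑ i ∈ s, u i ⊗ₜ v i)
    (h' : D.Δ b = ∑ i ∈ r, u' i ⊗ₜ v' i) (f g : D.Dual) :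
    D.form (f * g) (a * b) =
      ∑ i ∈ s, ∑ j ∈ r, D.form f (u i * u' j) * D.form g (v i * v' j) := by
  rw [D.form_mul_of_comul (D.comul_mul_eq h h'), Finset.sum_product]

theorem form_mul_one (f g : D.Dual) : D.form (f * g) 1 = D.form f 1 * D.form g 1 := by
  rw [D.form_mul, map_one, Algebra.TensorProduct.one_def, TensorProduct.map_tmul,
    LinearMap.mul'_apply]

theorem sum_comm_four {M ι₁ ι₂ ι₃ ι₄ : Type*} [AddCommMonoid M] (s₁ : Finset ι₁) (s₂ : Finset ι₂)
    (s₃ : Finset ι₃) (s₄ : Finset ι₄) (F : ι₁ → ι₂ → ι₃ → ι₄ → M) :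
    ∑ i ∈ s₁, ∑ j ∈ s₂, ∑ c ∈ s₃, ∑ d ∈ s₄, F i j c d =
      ∑ c ∈ s₃, ∑ d ∈ s₄, ∑ i ∈ s₁, ∑ j ∈ s₂, F i j c d := by
  calc _ = ∑ i ∈ s₁, ∑ c ∈ s₃, ∑ j ∈ s₂, ∑ d ∈ s₄, F i j c d :=
        Finset.sum_congr rfl fun i _ => Finset.sum_comm
    _ = ∑ c ∈ s₃, ∑ i ∈ s₁, ∑ j ∈ s₂, ∑ d ∈ s₄, F i j c d := Finset.sum_comm
    _ = ∑ c ∈ s₃, ∑ i ∈ s₁, ∑ d ∈ s₄, ∑ j ∈ s₂, F i j c d :=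
        Finset.sum_congr rfl fun c _ => Finset.sum_congr rfl fun i _ => Finset.sum_comm
    _ = _ := Finset.sum_congr rfl fun c _ => Finset.sum_comm

theorem IsRep.tensor {f : I → I → D.Dual} {g : J → J → D.Dual} (hf : D.IsRep f)
    (hg : D.IsRep g) : D.IsRep fun p p' : I × J => f p.1 p'.1 * g p.2 p'.2 where
  mul p p' a b := by
    obtain ⟨s, hs⟩ := D.exists_comul a
    obtain ⟨r, hr⟩ := D.exists_comul b
    rw [form_mul_eq_of_comul hs hr]
    simp only [hf.mul, hg.mul, Finset.sum_mul_sum, D.form_mul_of_comul hs,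
      D.form_mul_of_comul hr, Fintype.sum_prod_type]
    rw [sum_comm_four]
    simp only [mul_mul_mul_comm]
  one p p' := by
    rw [form_mul_one, hf.one, hg.one]
    simp only [Prod.ext_iff]
    split_ifs <;> simp_all

theorem IsRep.tensor_swap {f : I → I → D.Dual} {g : J → J → D.Dual} (hf : D.IsRep f)
    (hg : D.IsRep g) : D.IsRep fun p p' : I × J => g p.2 p'.2 * f p.1 p'.1 where
  mul p p' a b := by
    refine ((hg.tensor hf).mul (p.2, p.1) (p'.2, p'.1) a b).trans ?_
    exact Fintype.sum_equiv (Equiv.prodComm J I) _ _ fun _ => rfl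
  one p p' := by
    rw [form_mul_one, hf.one, hg.one]
    simp only [Prod.ext_iff]
    split_ifs <;> simp_all

/-- The elements at which M intertwines two representations form a subalgebra. Hence matrix
identities between forms, such as the RTT relation in the dual, have to be checked on generators
only. -/
theorem IsRep.intertwine {f g : I → I → D.Dual} (hf : D.IsRep f) (hg : D.IsRep g)
    (M : I → I → k) {G : Set A} (hG : Algebra.adjoin k G = ⊤)
    (h : ∀ a ∈ G, ∀ i m, ∑ c, M i c * D.form (f c m) a = ∑ c, M c m * D.form (g i c) a)
    (i m : I) : ∑ c, M i c • f c m = ∑ c, M c m • g i c := by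
  have key : ∀ a i m, ∑ c, M i c * D.form (f c m) a = ∑ c, M c m * D.form (g i c) a := by
    intro a
    have ha : a ∈ Algebra.adjoin k G := hG ▸ Algebra.mem_top
    induction ha using Algebra.adjoin_induction with
    | mem a ha => exact h a ha
    | algebraMap r =>
      intro i m
      simp only [Algebra.algebraMap_eq_smul_one, map_smul, hf.one, hg.one, smul_eq_mul]
      rw [Finset.sum_eq_single m, Finset.sum_eq_single i] <;> simp +contextual [eq_comm]
    | add a b _ _ ha hb =>
      intro i m
      simp only [map_add, mul_add, Finset.sum_add_distrib, ha, hb]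
    | mul a b _ _ ha hb =>
      intro i m
      simp only [hf.mul, hg.mul, Finset.mul_sum]
      calc ∑ c, ∑ d, M i c * (D.form (f d m) a * D.form (f c d) b)
          = ∑ d, D.form (f d m) a * ∑ c, M i c * D.form (f c d) b := by
            rw [Finset.sum_comm]
            simp only [Finset.mul_sum]
            exact Finset.sum_congr rfl fun d _ => Finset.sum_congr rfl fun c _ => by ring
        _ = ∑ c, D.form (g i c) b * ∑ d, M c d * D.form (f d m) a := by
            simp only [hb, Finset.mul_sum]
            rw [Finset.sum_comm]
            exact Finset.sum_congr rfl fun d _ => Finset.sum_congr rfl fun c _ => by ring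
        _ = ∑ c, ∑ d, M c m * (D.form (g d c) a * D.form (g i d) b) := by
            simp only [ha, Finset.mul_sum]
            rw [Finset.sum_comm]
            exact Finset.sum_congr rfl fun d _ => Finset.sum_congr rfl fun c _ => by ring
  apply D.form_injective
  ext a
  simpa using key a i m

theorem IsCharacter.isRep_unit {f : D.Dual} (hf : D.IsCharacter f) :
    D.IsRep fun _ _ : Unit => f where
  mul _ _ a b := by simp [hf.mul]
  one _ _ := by simp [hf.one]

theorem IsCharacter.one' : D.IsCharacter (1 : D.Dual) where
  mul a b := by simp [D.form_one]
  one := by simp [D.form_one]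

theorem IsCharacter.mul' {f g : D.Dual} (hf : D.IsCharacter f) (hg : D.IsCharacter g) :
    D.IsCharacter (f * g) where
  mul a b := by simpa using (hf.isRep_unit.tensor hg.isRep_unit).mul ((), ()) ((), ()) a b
  one := by rw [form_mul_one, hf.one, hg.one, one_mul]

theorem IsCharacter.list_prod (L : List D.Dual) (h : ∀ f ∈ L, D.IsCharacter f) :
    D.IsCharacter L.prod := by
  induction L with
  | nil => exact IsCharacter.one'
  | cons f L ih =>
    rw [List.prod_cons]
    exact (h f (by simp)).mul' (ih fun g hg => h g (by simp [hg]))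

theorem IsCharacter.ext {f g : D.Dual} (hf : D.IsCharacter f) (hg : D.IsCharacter g) {G : Set A}
    (hG : Algebra.adjoin k G = ⊤) (h : ∀ a ∈ G, D.form f a = D.form g a) : f = g := by
  have := hf.isRep_unit.intertwine hg.isRep_unit (fun _ _ => 1) hG
    (fun a ha _ _ => by simp [h a ha]) () ()
  simpa using this

/-- Triangular matrices form a subalgebra, so a representation that is triangular on generators is
triangular. Its diagonal entries are then characters (`isCharacter_diag`), which gives the
group-like elements l_{ii} and r_{ii}. -/
theorem IsRep.eq_zero_of_gt [LinearOrder I] {f : I → I → D.Dual} (hf : D.IsRep f) {G : Set A}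
    (hG : Algebra.adjoin k G = ⊤) (h : ∀ a ∈ G, ∀ i m, m < i → D.form (f i m) a = 0)
    {i m : I} (him : m < i) : f i m = 0 := by
  have key : ∀ a i m, m < i → D.form (f i m) a = 0 := by
    intro a
    have ha : a ∈ Algebra.adjoin k G := hG ▸ Algebra.mem_top
    induction ha using Algebra.adjoin_induction with
    | mem a ha => exact h a ha
    | algebraMap r =>
      intro i m him
      rw [Algebra.algebraMap_eq_smul_one, map_smul, hf.one, if_neg him.ne', smul_zero]
    | add a b _ _ ha hb =>
      intro i m him
      rw [map_add, ha _ _ him, hb _ _ him, add_zero]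
    | mul a b _ _ ha hb =>
      intro i m him
      rw [hf.mul]
      refine Finset.sum_eq_zero fun c _ => ?_
      rcases lt_or_ge m c with hc | hc
      · rw [ha _ _ hc, zero_mul]
      · rw [hb _ _ (hc.trans_lt him), mul_zero]
  apply D.form_injective
  ext a
  simpa using key a i m him

theorem IsRep.isCharacter_diag [LinearOrder I] {f : I → I → D.Dual} (hf : D.IsRep f)
    (h : ∀ i m, m < i → f i m = 0) (i : I) : D.IsCharacter (f i i) where
  mul a b := by
    rw [hf.mul, Finset.sum_eq_single i]
    · intro c _ hc
      rcases lt_or_gt_of_ne hc with hc | hc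
      · rw [h i c hc, map_zero, LinearMap.zero_apply, mul_zero]
      · rw [h c i hc, map_zero, LinearMap.zero_apply, zero_mul]
    · simp
  one := by rw [hf.one, if_pos rfl]

/-- Evaluation of forms at the entries of a corepresentation. -/
def IsCorep.evalHom {u : I → I → A} (hu : D.IsCorep u) : D.Dual →ₐ[k] Matrix I I k :=
  AlgHom.ofLinearMap
    { toFun f := Matrix.of fun i j => D.form f (u i j)
      map_add' _ _ := rfl
      map_smul' _ _ := rfl }
    (by
      ext i j
      exact ((D.form_one _).trans (hu.counit i j)).trans Matrix.one_apply.symm)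
    (fun f g => by
      ext i j
      rw [Matrix.mul_apply]
      exact hu.form_mul f g i j)

theorem IsCorep.evalHom_apply {u : I → I → A} (hu : D.IsCorep u) (f : D.Dual) (i j : I) :
    hu.evalHom f i j = D.form f (u i j) := rfl

end Reps

end HopfStructure

/-! ### The coquasitriangular structure of `SL_q(N)` -/

namespace SLq

section Form

variable {k : Type*} [Field k] {n : ℕ} {q z : k}

/-- The image of `x_{jl}` under the vector representation. -/
def vecMatrix (q z : k) (j l : Fin (n + 1)) : Matrix (Fin (n + 1)) (Fin (n + 1)) k :=
  Matrix.of fun m i => z * Rmat q i m j l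

theorem isRTT_vecMatrix (hq : q ≠ 0) : IsRTT q (vecMatrix (n := n) q z) := by
  intro i j m l
  ext u v
  simp only [Matrix.sum_apply, Matrix.smul_apply, Matrix.mul_apply, vecMatrix, Matrix.of_apply,
    smul_eq_mul]
  have h := congrArg (fun c => z * z * c) (yangBaxter q hq i j v m l u)
  simp only [Finset.mul_sum] at h
  simp only [Finset.mul_sum]
  convert h using 1
  · exact Finset.sum_congr rfl fun a _ => Finset.sum_congr rfl fun b _ =>
      Finset.sum_congr rfl fun w _ => by ring
  · rw [Finset.sum_congr rfl fun a _ => Finset.sum_comm, Finset.sum_comm]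
    exact Finset.sum_congr rfl fun w _ => Finset.sum_congr rfl fun a _ =>
      Finset.sum_congr rfl fun b _ => by ring

/-- The matrix of matrices is triangular, so its determinant is the product of the diagonal blocks,
which are diagonal matrices. -/
theorem qdet_vecMatrix (hq : q ≠ 0) (hz : z ^ (n + 1) = q⁻¹) :
    qdet (-q)⁻¹ (vecMatrix (n := n) q z) = 1 := by
  rw [qdet_lower, ← prod_diagonal_eq_one hq hz]
  · congr 2
    funext j
    ext m i
    by_cases h : m = i
    · subst h
      simp +contextual [vecMatrix, Rmat_eq, kron, diagCoef, offCoef]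
    · simp +contextual [vecMatrix, Rmat_eq, kron, diagCoef, offCoef, h]
  · intro j l hjl
    ext m i
    simp only [vecMatrix, Rmat_eq, kron, offCoef, Matrix.of_apply, hjl.ne', if_false, mul_zero,
      zero_add, Matrix.zero_apply]
    by_cases h : l = i
    · rw [if_neg (h ▸ hjl.not_gt)]
      ring
    · rw [if_neg h, mul_zero, mul_zero]

/-- The vector representation of `SL_q(N)`. -/
def vecRep (hq : q ≠ 0) (hz : z ^ (n + 1) = q⁻¹) :
    SLq n q →ₐ[k] Matrix (Fin (n + 1)) (Fin (n + 1)) k :=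
  lift (isRTT_vecMatrix (z := z) hq).isQuantum (qdet_vecMatrix hq hz)

/-- The forms `r_{im}`. -/
def rMatrix (hq : q ≠ 0) (hz : z ^ (n + 1) = q⁻¹) (i m : Fin (n + 1)) : (hopf (n := n) hq).Dual :=
  (hopf hq).toDual (Matrix.entryLinearMap k k m i ∘ₗ (vecRep hq hz).toLinearMap)

theorem form_rMatrix (hq : q ≠ 0) (hz : z ^ (n + 1) = q⁻¹) (i m : Fin (n + 1)) (a : SLq n q) :
    (hopf hq).form (rMatrix hq hz i m) a = vecRep hq hz a m i := rfl

theorem form_rMatrix_x (hq : q ≠ 0) (hz : z ^ (n + 1) = q⁻¹) (i m j l : Fin (n + 1)) :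
    (hopf hq).form (rMatrix hq hz i m) (x n q j l) = z * Rmat q i m j l := by
  rw [form_rMatrix, vecRep, lift_x]
  rfl

theorem isRep_rMatrix (hq : q ≠ 0) (hz : z ^ (n + 1) = q⁻¹) :
    (hopf (n := n) hq).IsRep (rMatrix hq hz) where
  mul i m a b := by simp only [form_rMatrix, map_mul, Matrix.mul_apply]
  one i m := by simp only [form_rMatrix, map_one, Matrix.one_apply, eq_comm]

/-- The RTT relation for convolution products of the r_{im} says that R intertwines the two tensor
squares of the vector representation. At a generator this is the Yang–Baxter equation. -/
theorem isRTT_rMatrix (hq : q ≠ 0) (hz : z ^ (n + 1) = q⁻¹) :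
    IsRTT q (rMatrix (n := n) hq hz) := by
  intro i j m l
  have hr := isRep_rMatrix (n := n) hq hz
  have h := (hr.tensor hr).intertwine (hr.tensor_swap hr)
    (fun p p' => Rmat q p.1 p'.1 p.2 p'.2) (adjoin_x n q) ?_ (i, j) (m, l)
  · simpa only [Fintype.sum_prod_type] using h
  rintro _ ⟨⟨u, v⟩, rfl⟩ ⟨i, j⟩ ⟨m, l⟩
  simp only [(isCorep hq).form_mul, form_rMatrix_x, Fintype.sum_prod_type]
  have h := congrArg (fun c => z * z * c) (yangBaxter' q hq i j u v m l)
  simp only [Finset.mul_sum] at h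
  simp only [Finset.mul_sum]
  convert h using 1
  · exact Finset.sum_congr rfl fun a _ => Finset.sum_congr rfl fun b _ =>
      Finset.sum_congr rfl fun w _ => by ring
  · rw [Finset.sum_comm]
    refine Finset.sum_congr rfl fun b _ => ?_
    rw [Finset.sum_comm]
    exact Finset.sum_congr rfl fun w _ => Finset.sum_congr rfl fun a _ => by ring

theorem rMatrix_eq_zero (hq : q ≠ 0) (hz : z ^ (n + 1) = q⁻¹) {i m : Fin (n + 1)} (h : m < i) :
    rMatrix hq hz i m = 0 := by
  refine (isRep_rMatrix hq hz).eq_zero_of_gt (adjoin_x n q) ?_ h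
  rintro _ ⟨⟨j, l⟩, rfl⟩ i m h
  simp only [form_rMatrix_x, Rmat_eq, kron, offCoef, h.ne, if_false, mul_zero, zero_mul, zero_add]
  by_cases h' : m = j
  · rw [if_neg (h' ▸ h.not_gt)]
    ring
  · rw [if_neg h']
    ring

theorem isCharacter_rMatrix (hq : q ≠ 0) (hz : z ^ (n + 1) = q⁻¹) (i : Fin (n + 1)) :
    (hopf hq).IsCharacter (rMatrix hq hz i i) :=
  (isRep_rMatrix hq hz).isCharacter_diag (fun _ _ h => rMatrix_eq_zero hq hz h) i

theorem prod_rMatrix (hq : q ≠ 0) (hz : z ^ (n + 1) = q⁻¹) :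
    (List.ofFn fun i => rMatrix (n := n) hq hz i i).prod = 1 := by
  refine (HopfStructure.IsCharacter.list_prod _ ?_).ext .one' (adjoin_x n q) ?_
  · intro f hf
    obtain ⟨i, rfl⟩ := (List.mem_ofFn' _ _).1 hf
    exact isCharacter_rMatrix hq hz i
  · rintro _ ⟨⟨u, v⟩, rfl⟩
    have h : (isCorep hq).evalHom (List.ofFn fun i => rMatrix (n := n) hq hz i i).prod = 1 := by
      rw [map_list_prod, List.map_ofFn, ← prod_diagonal_eq_one hq hz]
      congr 2
      funext i
      ext u v
      simp only [Function.comp, HopfStructure.IsCorep.evalHom_apply, form_rMatrix_x, Rmat_eq]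
      by_cases h : u = v
      · subst h
        simp +contextual [kron, diagCoef, offCoef, eq_comm]
      · simp +contextual [kron, diagCoef, offCoef, h, Ne.symm h]
    have h' := congrFun (congrFun h u) v
    rw [HopfStructure.IsCorep.evalHom_apply] at h'
    rw [h', (hopf hq).form_one, (isCorep hq).counit, Matrix.one_apply]

/-- The map `h ↦ r_h`. -/
def rHom (hq : q ≠ 0) (hz : z ^ (n + 1) = q⁻¹) : SLq n q →ₐ[k] (hopf (n := n) hq).Dual :=
  lift (isRTT_rMatrix hq hz).isQuantum
    ((qdet_upper _ _ fun _ _ h => rMatrix_eq_zero hq hz h).trans (prod_rMatrix hq hz))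

theorem rHom_x (hq : q ≠ 0) (hz : z ^ (n + 1) = q⁻¹) (i m : Fin (n + 1)) :
    rHom hq hz (x n q i m) = rMatrix hq hz i m := lift_x _ _ _ _

end Form

end SLq

/-! ### Corepresentations braided by a bilinear form. -/

namespace HopfStructure

section Braid

variable {k A : Type*} [Field k] [Ring A] [Algebra k A] {D : HopfStructure k A}

theorem split_eq {ι κ : Type*} {s : Finset ι} {r : Finset κ}
    {u v : ι → A} {u' v' : κ → A} {a b : A} (h : D.Δ a = ∑ i ∈ s, u i ⊗ₜ v i)
    (h' : D.Δ b = ∑ i ∈ r, u' i ⊗ₜ v' i) :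
    D.split a b = ∑ i ∈ s, ∑ j ∈ r, (u i ⊗ₜ u' j) ⊗ₜ (v i ⊗ₜ v' j) := by
  simp only [split, h, h', TensorProduct.sum_tmul, TensorProduct.tmul_sum, map_sum,
    TensorProduct.tensorTensorTensorComm_tmul]
  exact Finset.sum_comm

theorem split_mem_linear (D : HopfStructure k A) :
    ∃ f : A →ₗ[k] A →ₗ[k] (A ⊗[k] A) ⊗[k] (A ⊗[k] A), ∀ a b, f a b = D.split a b :=
  ⟨((TensorProduct.mk k (A ⊗[k] A) (A ⊗[k] A)).compl₁₂ D.Δ.toLinearMap D.Δ.toLinearMap).compr₂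
    (TensorProduct.tensorTensorTensorComm k A A A A).toLinearMap, fun _ _ => rfl⟩

variable (σ : A →ₗ[k] A →ₗ[k] k)

/-- The two corepresentations `u`, `v` are intertwined by `σ`. -/
def Braided {I J : Type*} [Fintype I] [Fintype J] (u : I → I → A) (v : J → J → A) : Prop :=
  ∀ i m j l, ∑ a, ∑ b, σ (u i a) (v j b) • (u a m * v b l) =
    ∑ a, ∑ b, σ (u a m) (v b l) • (v j b * u i a)

variable {σ}
variable {I I' J J' : Type*} [Fintype I] [Fintype J] [Fintype I'] [Fintype J']

/-- A hexagon argument: by `hσ` the crossing of a product with v is two successive crossings, so v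
is moved first past u' and then past u. -/
theorem Braided.tensor_left {u : I → I → A} {u' : I' → I' → A} {v : J → J → A}
    (hu : Braided σ u v) (hu' : Braided σ u' v)
    (hσ : ∀ a b j l, σ (a * b) (v j l) = ∑ c, σ a (v j c) * σ b (v c l)) :
    Braided σ (tensorMatrix u u') v := by
  rintro ⟨i, i'⟩ ⟨m, m'⟩ j l
  simp only [tensorMatrix, hσ, Fintype.sum_prod_type, Finset.sum_smul]
  calc ∑ a, ∑ a', ∑ b, ∑ c, (σ (u i a) (v j c) * σ (u' i' a') (v c b)) •
        (u a m * u' a' m' * v b l)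
      = ∑ a, ∑ c, σ (u i a) (v j c) • (u a m *
          ∑ a', ∑ b, σ (u' i' a') (v c b) • (u' a' m' * v b l)) := by
        refine Finset.sum_congr rfl fun a _ => ?_
        rw [Finset.sum_congr rfl fun a' _ => Finset.sum_comm, Finset.sum_comm]
        refine Finset.sum_congr rfl fun c _ => ?_
        simp only [Finset.mul_sum, Finset.smul_sum, mul_smul_comm, mul_smul, mul_assoc]
    _ = ∑ a', ∑ b, σ (u' a' m') (v b l) • ((∑ a, ∑ c, σ (u i a) (v j c) • (u a m * v c b)) *
          u' i' a') := by
        simp only [hu' _ _ _ _, Finset.mul_sum, Finset.sum_mul, Finset.smul_sum, mul_smul_comm,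
          smul_mul_assoc]
        rw [sum_comm_four]
        simp only [smul_comm (σ (u i _) _) (σ (u' _ _) _), mul_assoc]
    _ = _ := by
        simp only [hu _ _ _ _, Finset.sum_mul, Finset.smul_sum, smul_mul_assoc]
        rw [sum_comm_four]
        refine Finset.sum_congr rfl fun a _ => ?_
        rw [Finset.sum_comm]
        refine Finset.sum_congr rfl fun a' _ => Finset.sum_congr rfl fun c _ =>
          Finset.sum_congr rfl fun b _ => ?_
        rw [smul_smul, mul_comm (σ _ _), mul_assoc]

theorem Braided.tensor_right {u : I → I → A} {v : J → J → A} {v' : J' → J' → A}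
    (hv : Braided σ u v) (hv' : Braided σ u v')
    (hσ : ∀ a b i m, σ (u i m) (a * b) = ∑ c, σ (u c m) a * σ (u i c) b) :
    Braided σ u (tensorMatrix v v') := by
  rintro i m ⟨j, j'⟩ ⟨l, l'⟩
  simp only [tensorMatrix, hσ, Fintype.sum_prod_type, Finset.sum_smul]
  calc ∑ a, ∑ b, ∑ b', ∑ c, (σ (u c a) (v j b) * σ (u i c) (v' j' b')) •
        (u a m * (v b l * v' b' l'))
      = ∑ c, ∑ b', σ (u i c) (v' j' b') • ((∑ a, ∑ b, σ (u c a) (v j b) • (u a m * v b l)) *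
          v' b' l') := by
        simp only [Finset.sum_mul, Finset.smul_sum, smul_mul_assoc]
        rw [sum_comm_four, Finset.sum_comm]
        refine Finset.sum_congr rfl fun c _ => Finset.sum_congr rfl fun b' _ =>
          Finset.sum_congr rfl fun a _ => Finset.sum_congr rfl fun b _ => ?_
        rw [smul_smul, mul_comm (σ _ _), mul_assoc]
    _ = ∑ a, ∑ b, σ (u a m) (v b l) • (v j b * ∑ c, ∑ b', σ (u i c) (v' j' b') •
          (u c a * v' b' l')) := by
        simp only [hv _ _ _ _, Finset.mul_sum, Finset.sum_mul, Finset.smul_sum, mul_smul_comm,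
          smul_mul_assoc]
        rw [sum_comm_four]
        refine Finset.sum_congr rfl fun c _ => Finset.sum_congr rfl fun b' _ =>
          Finset.sum_congr rfl fun a _ => Finset.sum_congr rfl fun b _ => ?_
        rw [smul_comm, mul_assoc]
    _ = _ := by
        simp only [hv' _ _ _ _, Finset.mul_sum, Finset.smul_sum, mul_smul_comm]
        rw [sum_comm_four]
        refine Finset.sum_congr rfl fun c _ => ?_
        rw [Finset.sum_congr rfl fun b' _ => Finset.sum_comm, Finset.sum_comm]
        refine Finset.sum_congr rfl fun b _ => Finset.sum_congr rfl fun b' _ =>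
          Finset.sum_congr rfl fun a _ => ?_
        rw [smul_smul, mul_assoc]

theorem braid_of_braided [DecidableEq I] [DecidableEq J] {u : I → I → A} {v : J → J → A} (hu : D.IsCorep u) (hv : D.IsCorep v)
    (h : Braided σ u v) (i m : I) (j l : J) :
    TensorProduct.lid k A (TensorProduct.map (TensorProduct.lift σ) (LinearMap.mul' k A)
      (D.split (u i m) (v j l))) =
    TensorProduct.rid k A (TensorProduct.map
      (LinearMap.mul' k A ∘ₗ (TensorProduct.comm k A A).toLinearMap) (TensorProduct.lift σ)
      (D.split (u i m) (v j l))) := by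
  rw [split_eq (hu.comul i m) (hv.comul j l)]
  simpa [map_sum] using h i m j l

end Braid

end HopfStructure

/-! ### The form σ on SL_q(N) and its axioms. -/

namespace SLq

variable {k : Type*} [Field k] {n : ℕ} {q z : k} (hq : q ≠ 0) (hz : z ^ (n + 1) = q⁻¹)

/-- The form `σ(h, g) = r_h(g)`. -/
def sigma : SLq n q →ₗ[k] SLq n q →ₗ[k] k := (hopf hq).form ∘ₗ (rHom hq hz).toLinearMap

theorem sigma_apply (a b : SLq n q) : sigma hq hz a b = (hopf hq).form (rHom hq hz a) b := rfl

theorem sigma_x (i m j l : Fin (n + 1)) :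
    sigma hq hz (x n q i m) (x n q j l) = z * Rmat q i m j l := by
  rw [sigma_apply, rHom_x, form_rMatrix_x]

theorem sigma_mul_left (a b g : SLq n q) : sigma hq hz (a * b) g =
    LinearMap.mul' k k (TensorProduct.map (sigma hq hz a) (sigma hq hz b) ((hopf hq).Δ g)) := by
  rw [sigma_apply, map_mul, HopfStructure.form_mul]
  rfl

theorem sigma_one_left (a : SLq n q) : sigma hq hz 1 a = (hopf hq).ε a := by
  rw [sigma_apply, map_one, HopfStructure.form_one]

/-- The forms `r_h`, for the entries `h` of `u`, are the coefficients of a representation. -/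
def RepEntries (I : Type) [Fintype I] [DecidableEq I] (u : I → I → SLq n q) : Prop :=
  (hopf hq).IsRep fun i m => rHom hq hz (u i m)

theorem repEntries_one : RepEntries hq hz Unit fun _ _ => (1 : SLq n q) := by
  unfold RepEntries
  simp only [map_one]
  exact HopfStructure.IsCharacter.one'.isRep_unit

theorem repEntries_x : RepEntries hq hz (Fin (n + 1)) (x n q) := by
  unfold RepEntries
  simp only [rHom_x]
  exact isRep_rMatrix hq hz

variable {hq hz} in
theorem RepEntries.tensor {I J : Type} [Fintype I] [DecidableEq I] [Fintype J] [DecidableEq J]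
    {u : I → I → SLq n q} {v : J → J → SLq n q} (hu : RepEntries hq hz I u)
    (hv : RepEntries hq hz J v) :
    RepEntries hq hz (I × J) (HopfStructure.tensorMatrix u v) := by
  have h := HopfStructure.IsRep.tensor hu hv
  unfold RepEntries HopfStructure.tensorMatrix
  simp only [map_mul]
  exact h

theorem span_isRep :
    Submodule.span k ((hopf (n := n) hq).corepEntries (RepEntries hq hz)) = ⊤ := by
  exact HopfStructure.span_corepEntries (isCorep hq) (adjoin_x n q) _ (repEntries_one hq hz)
    (repEntries_x hq hz) fun I J _ _ _ _ u v _ _ hu hv => hu.tensor hv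

/-- Multiplicativity in the first argument is built in, since h ↦ r_h is an algebra map. In the
second argument it says that the r-forms of the entries of a corepresentation are coefficients of a
representation; this holds for the matrix of generators and passes to tensor products, whose entries
span. -/
theorem sigma_mul_right (g a b : SLq n q) : sigma hq hz g (a * b) =
    LinearMap.mul' k k (TensorProduct.map ((sigma hq hz).flip b) ((sigma hq hz).flip a)
      ((hopf hq).Δ g)) := by
  have hg : g ∈ Submodule.span k ((hopf hq).corepEntries (RepEntries hq hz)) :=
    span_isRep hq hz ▸ Submodule.mem_top
  induction hg using Submodule.span_induction with
  | mem g hg =>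
    obtain ⟨I, _, _, u, hu, hP, i, m, rfl⟩ := hg
    rw [hu.comul, sigma_apply, hP.mul]
    simp [map_sum, sigma_apply, mul_comm]
  | zero => simp
  | add g g' _ _ h h' => simp only [map_add, LinearMap.add_apply, h, h']
  | smul c g _ h => simp only [map_smul, LinearMap.smul_apply, h]

theorem sigma_one_right (a : SLq n q) : sigma hq hz a 1 = (hopf hq).ε a := by
  have ha : a ∈ Algebra.adjoin k _ := adjoin_x n q ▸ Algebra.mem_top
  induction ha using Algebra.adjoin_induction with
  | mem a ha =>
    obtain ⟨⟨i, j⟩, rfl⟩ := ha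
    rw [sigma_apply, rHom_x, (isRep_rMatrix hq hz).one, (isCorep hq).counit]
  | algebraMap r => rw [sigma_apply, AlgHom.commutes, HopfStructure.form_algebraMap]; simp
  | add a b _ _ ha hb => rw [map_add, LinearMap.add_apply, ha, hb, map_add]
  | mul a b _ _ ha hb =>
    rw [sigma_apply, map_mul, HopfStructure.form_mul_one, ← sigma_apply, ← sigma_apply, ha, hb,
      map_mul]

/-- Moreover, `u` is intertwined with the matrix of generators. -/
def BraidedEntries (I : Type) [Fintype I] [DecidableEq I] (u : I → I → SLq n q) : Prop :=
  RepEntries hq hz I u ∧ HopfStructure.Braided (sigma hq hz) u (x n q)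

/-- The braid axiom is extended from generators in two stages: here u varies while the second matrix
remains x, and in `span_braided_right` u is fixed and the second matrix varies. For u = v = x it is
the RTT relation times z. -/
theorem span_braided :
    Submodule.span k ((hopf (n := n) hq).corepEntries (BraidedEntries hq hz)) = ⊤ := by
  refine HopfStructure.span_corepEntries (isCorep hq) (adjoin_x n q) _
    ⟨repEntries_one hq hz, fun i m j l => ?_⟩ ⟨repEntries_x hq hz, fun i m j l => ?_⟩ ?_
  · simp [sigma_one_left, (isCorep hq).counit]
  · simp only [sigma_x, mul_smul, ← Finset.smul_sum]
    congr 1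
    exact ((isQuantum n q).isRTT hq) i j m l
  · intro I J _ _ _ _ u v _ _ hu hv
    refine ⟨hu.1.tensor hv.1, hu.2.tensor_left hv.2 fun a b j l => ?_⟩
    rw [sigma_apply, map_mul, (isCorep hq).form_mul]
    rfl

theorem span_braided_right {I : Type} [Fintype I] [DecidableEq I] {u : I → I → SLq n q}
    (hu : BraidedEntries hq hz I u) :
    Submodule.span k ((hopf (n := n) hq).corepEntries fun J _ _ v =>
      HopfStructure.Braided (sigma hq hz) u v) = ⊤ := by
  refine HopfStructure.span_corepEntries (isCorep hq) (adjoin_x n q) _ ?_ hu.2 ?_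
  · intro i m j l
    simp [sigma_apply, hu.1.one]
  · intro J J' _ _ _ _ v v' _ _ hv hv'
    exact hv.tensor_right hv' fun a b i m => hu.1.mul i m a b

/-- The coquasitriangular structure of `SL_q(N)`. -/
def cqt : CQT (hopf (n := n) hq) where
  σ := sigma hq hz
  mul_left := sigma_mul_left hq hz
  mul_right := sigma_mul_right hq hz
  one_left := sigma_one_left hq hz
  one_right := sigma_one_right hq hz
  exists_inv := by
    -- The inverse form is σ(S(h), g): applying the algebra map h ↦ r_h to the antipode axioms gives
    -- both identities.
    refine ⟨sigma hq hz ∘ₗ (hopf hq).S, fun a b => ?_⟩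
    obtain ⟨s, hs⟩ := (hopf hq).exists_comul a
    obtain ⟨r, hr⟩ := (hopf hq).exists_comul b
    have h₁ := LinearMap.congr_fun (hopf hq).antipode_right a
    have h₂ := LinearMap.congr_fun (hopf hq).antipode_left a
    simp only [LinearMap.comp_apply, AlgHom.toLinearMap_apply, hs, map_sum,
      LinearMap.lTensor_tmul, LinearMap.rTensor_tmul, LinearMap.mul'_apply,
      Algebra.linearMap_apply] at h₁ h₂
    have h₁' := LinearMap.congr_fun (congrArg (fun c => (hopf hq).form (rHom hq hz c)) h₁) b
    have h₂' := LinearMap.congr_fun (congrArg (fun c => (hopf hq).form (rHom hq hz c)) h₂) b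
    simp only [map_sum, map_mul, AlgHom.commutes, HopfStructure.form_algebraMap,
      LinearMap.sum_apply, (hopf hq).form_mul_of_comul hr] at h₁' h₂'
    rw [HopfStructure.split_eq hs hr]
    simp only [map_sum, TensorProduct.map_tmul, TensorProduct.lift.tmul, LinearMap.mul'_apply,
      LinearMap.comp_apply, sigma_apply]
    exact ⟨h₁', h₂'⟩
  braid := by
    intro a b
    obtain ⟨f, hf⟩ := (hopf (n := n) hq).split_mem_linear
    simp only [← hf]
    have ha : a ∈ Submodule.span k _ := span_braided hq hz ▸ Submodule.mem_top
    induction ha using Submodule.span_induction with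
    | mem a ha =>
      obtain ⟨I, _, _, u, hu, hP, i, m, rfl⟩ := ha
      have hb : b ∈ Submodule.span k _ := span_braided_right hq hz hP ▸ Submodule.mem_top
      induction hb using Submodule.span_induction with
      | mem b hb =>
        obtain ⟨J, _, _, v, hv, hP', j, l, rfl⟩ := hb
        rw [hf]
        exact HopfStructure.braid_of_braided hu hv hP' i m j l
      | zero => simp
      | add g g' _ _ h h' => simp only [map_add, h, h']
      | smul c g _ h => simp only [map_smul, h]
    | zero => simp
    | add g g' _ _ h h' => simp only [map_add, LinearMap.add_apply, h, h']
    | smul c g _ h => simp only [map_smul, LinearMap.smul_apply, h]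

end SLq

/-! ### Consequences of the relations of `U_q^ext(sl_N)` -/

section Serre

variable {k A : Type*} [Field k] [Ring A] [Algebra k A] {q : k}

/-- The quantum Serre polynomial. -/
def serrePoly (q : k) (a b : A) : A := a ^ 2 * b - (q + q⁻¹) • (a * b * a) + b * a ^ 2

theorem map_serrePoly {B : Type*} [Ring B] [Algebra k B] (φ : A →ₐ[k] B) (a b : A) :
    φ (serrePoly q a b) = serrePoly q (φ a) (φ b) := by
  simp [serrePoly]

theorem op_serrePoly (a b : A) :
    MulOpposite.op (serrePoly q a b) = serrePoly q (MulOpposite.op a) (MulOpposite.op b) := by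
  simp only [serrePoly, MulOpposite.op_add, MulOpposite.op_sub, MulOpposite.op_mul,
    MulOpposite.op_pow, MulOpposite.op_smul, mul_assoc]
  abel

theorem mul_mul_of_qcomm {a b : A} {c : k} (h : b * a = c • (a * b)) (y : A) :
    b * (a * y) = c • (a * (b * y)) := by
  rw [← mul_assoc, h, smul_mul_assoc, mul_assoc]

/-- Under these commutation rules all mixed terms cancel. It is meant for a = 1 ⊗ E_s and b = E_s ⊗
k_s with k_s the simple torus element, so that the Serre element of the coproducts has only two
terms. -/
theorem serrePoly_add (hq : q ≠ 0) {a b a' b' : A} (h₁ : b * a = q ^ 2 • (a * b))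
    (h₂ : b * a' = q⁻¹ • (a' * b)) (h₃ : b' * a = q⁻¹ • (a * b')) :
    serrePoly q (a + b) (a' + b') = serrePoly q a a' + serrePoly q b b' := by
  simp only [serrePoly, pow_two, add_mul, mul_add, mul_assoc, h₁, h₂, h₃, mul_mul_of_qcomm h₁,
    mul_mul_of_qcomm h₂, mul_mul_of_qcomm h₃, mul_smul_comm, smul_mul_assoc, smul_add, smul_smul]
  match_scalars <;> field_simp <;> ring

theorem serrePoly_mul (hq : q ≠ 0) {a u a' u' : A} (h₁ : u * a = (q ^ 2)⁻¹ • (a * u))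
    (h₂ : u * a' = q • (a' * u)) (h₃ : u' * a = q • (a * u')) (h₄ : u * u' = u' * u) :
    serrePoly q (a * u) (a' * u') = serrePoly q a a' * (u * (u * u')) := by
  have h₄' : u' * u = (1 : k) • (u * u') := by rw [h₄, one_smul]
  simp only [serrePoly, pow_two, add_mul, sub_mul, mul_assoc, h₁, h₂, h₃, mul_mul_of_qcomm h₁,
    mul_mul_of_qcomm h₂, mul_mul_of_qcomm h₃, mul_smul_comm, smul_add, smul_smul,
    mul_mul_of_qcomm h₄', h₄', smul_mul_assoc]
  match_scalars <;> field_simp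

end Serre

section Weights

variable {k A : Type*} [Field k] [Ring A] [Algebra k A] {q : k} {n : ℕ}

/-- The exponent of `q` in `K̂_i E_t K̂_i⁻¹`. -/
def rootExp (i : Fin (n + 1)) (t : Fin n) : ℤ :=
  (if i = t.castSucc then 1 else 0) - (if i = t.succ then 1 else 0)

/-- The Cartan matrix. -/
def cartan (s t : Fin n) : ℤ := rootExp s.castSucc t - rootExp s.succ t

theorem cartan_self (s : Fin n) : cartan s s = 2 := by
  simp [cartan, rootExp, Fin.ext_iff]

theorem cartan_adj {s t : Fin n} (h : |(s : ℤ) - (t : ℤ)| = 1) : cartan s t = -1 := by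
  simp only [cartan, rootExp, Fin.ext_iff, Fin.val_castSucc, Fin.val_succ]
  rcases (abs_eq (by norm_num)).1 h with h | h <;> split_ifs <;> omega

theorem cartan_far {s t : Fin n} (h : 1 < |(s : ℤ) - (t : ℤ)|) : cartan s t = 0 := by
  simp only [cartan, rootExp, Fin.ext_iff, Fin.val_castSucc, Fin.val_succ]
  rcases lt_abs.1 h with h | h <;> split_ifs <;> omega

theorem cartan_comm (s t : Fin n) : cartan s t = cartan t s := by
  simp only [cartan, rootExp, Fin.ext_iff, Fin.val_castSucc, Fin.val_succ]
  split_ifs <;> omega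

/-- `X` is a weight vector for the conjugation by the `K̂_i`. -/
def HasWeight (q : k) (K : Fin (n + 1) → A) (w : Fin (n + 1) → ℤ) (X : A) : Prop :=
  ∀ i, K i * X = q ^ w i • (X * K i)

/-- The elements `K` and `Kinv` satisfy the relations of the torus. -/
def IsTorus (K Kinv : Fin (n + 1) → A) : Prop := ∀ a b, TorusRel K Kinv a b → a = b

variable {K Kinv : Fin (n + 1) → A}

theorem HasWeight.mul (hq : q ≠ 0) {w w' : Fin (n + 1) → ℤ} {X Y : A} (hX : HasWeight q K w X)
    (hY : HasWeight q K w' Y) : HasWeight q K (w + w') (X * Y) := fun i => by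
  rw [← mul_assoc, hX i, smul_mul_assoc, mul_assoc, hY i, mul_smul_comm, smul_smul, Pi.add_apply,
    zpow_add₀ hq, mul_assoc]

theorem HasWeight.add {w : Fin (n + 1) → ℤ} {X Y : A} (hX : HasWeight q K w X)
    (hY : HasWeight q K w Y) : HasWeight q K w (X + Y) := fun i => by
  rw [mul_add, hX i, hY i, add_mul, smul_add]

theorem HasWeight.one : HasWeight q K 0 1 := fun i => by simp

section Torus

theorem IsTorus.comm (hT : IsTorus K Kinv) (i j : Fin (n + 1)) : K i * K j = K j * K i :=
  hT _ _ (.comm i j)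

theorem IsTorus.mul_inv (hT : IsTorus K Kinv) (i : Fin (n + 1)) : K i * Kinv i = 1 :=
  hT _ _ (.mul_inv i)

theorem IsTorus.inv_mul (hT : IsTorus K Kinv) (i : Fin (n + 1)) : Kinv i * K i = 1 :=
  hT _ _ (.inv_mul i)

theorem IsTorus.prod (hT : IsTorus K Kinv) : (List.ofFn K).prod = 1 := hT _ _ .prod

theorem IsTorus.inv_comm_left (hT : IsTorus K Kinv) (i j : Fin (n + 1)) :
    Kinv i * K j = K j * Kinv i := by
  calc Kinv i * K j = Kinv i * K j * (K i * Kinv i) := by rw [hT.mul_inv, mul_one]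
    _ = Kinv i * (K j * K i) * Kinv i := by simp only [mul_assoc]
    _ = Kinv i * K i * (K j * Kinv i) := by rw [hT.comm]; simp only [mul_assoc]
    _ = _ := by rw [hT.inv_mul, one_mul]

theorem IsTorus.inv_comm (hT : IsTorus K Kinv) (i j : Fin (n + 1)) :
    Kinv i * Kinv j = Kinv j * Kinv i := by
  calc Kinv i * Kinv j = Kinv j * K j * (Kinv i * Kinv j) := by rw [hT.inv_mul, one_mul]
    _ = Kinv j * (K j * Kinv i) * Kinv j := by simp only [mul_assoc]
    _ = Kinv j * Kinv i * (K j * Kinv j) := by rw [← hT.inv_comm_left]; simp only [mul_assoc]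
    _ = _ := by rw [hT.mul_inv, mul_one]

theorem HasWeight.inv_mul (hT : IsTorus K Kinv) (hq : q ≠ 0) {w : Fin (n + 1) → ℤ} {X : A}
    (hX : HasWeight q K w X) (i : Fin (n + 1)) : Kinv i * X = q ^ (-w i) • (X * Kinv i) := by
  have h : Kinv i * (K i * X) * Kinv i = q ^ w i • (Kinv i * X) := by
    rw [hX i, mul_smul_comm, smul_mul_assoc, ← mul_assoc, mul_assoc _ (K i), hT.mul_inv, mul_one]
  rw [← mul_assoc, hT.inv_mul, one_mul] at h
  rw [h, smul_smul, ← zpow_add₀ hq, neg_add_cancel, zpow_zero, one_smul]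

theorem hasWeight_iff_conj (hT : IsTorus K Kinv) {w : Fin (n + 1) → ℤ} {X : A} :
    HasWeight q K w X ↔ ∀ i, K i * X * Kinv i = q ^ w i • X := by
  refine forall_congr' fun i => ⟨fun h => ?_, fun h => ?_⟩
  · rw [h, smul_mul_assoc, mul_assoc, hT.mul_inv, mul_one]
  · rw [← smul_mul_assoc, ← h, mul_assoc _ (Kinv i), hT.inv_mul, mul_one]

/-- The element `K̂_{s+1}⁻¹ K̂_s`. -/
def simpleK (K Kinv : Fin (n + 1) → A) (s : Fin n) : A := Kinv s.succ * K s.castSucc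

/-- The element `K̂_{s+1} K̂_s⁻¹`. -/
def simpleKinv (K Kinv : Fin (n + 1) → A) (s : Fin n) : A := K s.succ * Kinv s.castSucc

theorem simpleK_mul_inv (hT : IsTorus K Kinv) (s : Fin n) :
    simpleK K Kinv s * simpleKinv K Kinv s = 1 := by
  rw [simpleK, simpleKinv, mul_assoc, ← mul_assoc (K _), hT.comm, mul_assoc (K s.succ), hT.mul_inv,
    mul_one, hT.inv_mul]

theorem simpleKinv_mul (hT : IsTorus K Kinv) (s : Fin n) :
    simpleKinv K Kinv s * simpleK K Kinv s = 1 := by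
  rw [simpleK, simpleKinv, mul_assoc, ← mul_assoc (Kinv _), hT.inv_comm, mul_assoc (Kinv s.succ),
    hT.inv_mul, mul_one, hT.mul_inv]

theorem HasWeight.simpleK_mul (hT : IsTorus K Kinv) (hq : q ≠ 0) {w : Fin (n + 1) → ℤ} {X : A}
    (hX : HasWeight q K w X) (s : Fin n) :
    simpleK K Kinv s * X = q ^ (w s.castSucc - w s.succ) • (X * simpleK K Kinv s) := by
  rw [simpleK, mul_assoc, hX, mul_smul_comm, ← mul_assoc, hX.inv_mul hT hq, smul_mul_assoc,
    smul_smul, mul_assoc, ← zpow_add₀ hq, sub_eq_add_neg]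

theorem HasWeight.simpleKinv_mul (hT : IsTorus K Kinv) (hq : q ≠ 0) {w : Fin (n + 1) → ℤ} {X : A}
    (hX : HasWeight q K w X) (s : Fin n) :
    simpleKinv K Kinv s * X = q ^ (-(w s.castSucc - w s.succ)) • (X * simpleKinv K Kinv s) := by
  rw [simpleKinv, mul_assoc, hX.inv_mul hT hq, mul_smul_comm, ← mul_assoc, hX, smul_mul_assoc,
    smul_smul, mul_assoc, ← zpow_add₀ hq]
  congr 2
  ring

theorem IsTorus.simpleK_comm (hT : IsTorus K Kinv) (s : Fin n) (i : Fin (n + 1)) :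
    K i * simpleK K Kinv s = simpleK K Kinv s * K i := by
  rw [simpleK, ← mul_assoc, ← hT.inv_comm_left, mul_assoc, hT.comm, mul_assoc]

theorem IsTorus.simpleKinv_comm (hT : IsTorus K Kinv) (s : Fin n) (i : Fin (n + 1)) :
    K i * simpleKinv K Kinv s = simpleKinv K Kinv s * K i := by
  rw [simpleKinv, ← mul_assoc, hT.comm, mul_assoc, ← hT.inv_comm_left, mul_assoc]

theorem IsTorus.hasWeight_simpleK (hT : IsTorus K Kinv) (s : Fin n) :
    HasWeight q K 0 (simpleK K Kinv s) := fun i => by simp [hT.simpleK_comm]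

theorem IsTorus.hasWeight_simpleKinv (hT : IsTorus K Kinv) (s : Fin n) :
    HasWeight q K 0 (simpleKinv K Kinv s) := fun i => by simp [hT.simpleKinv_comm]

theorem IsTorus.simpleK_simpleK (hT : IsTorus K Kinv) (s t : Fin n) :
    simpleK K Kinv s * simpleK K Kinv t = simpleK K Kinv t * simpleK K Kinv s := by
  rw [simpleK, mul_assoc, hT.simpleK_comm, ← mul_assoc, simpleK, ← mul_assoc, hT.inv_comm,
    mul_assoc (Kinv t.succ), hT.inv_comm_left]
  simp only [mul_assoc]

end Torus

section Families

variable {E F : Fin n → A}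

/-- The `E_s` have the weights of the simple roots. -/
def HasRoots (q : k) (K : Fin (n + 1) → A) (E : Fin n → A) : Prop :=
  ∀ t, HasWeight q K (fun i => rootExp i t) (E t)

/-- The `F_s` have the weights of the negative simple roots. -/
def HasNegRoots (q : k) (K : Fin (n + 1) → A) (F : Fin n → A) : Prop :=
  ∀ t, HasWeight q K (fun i => -rootExp i t) (F t)

theorem hasRoots_of_ERel (hT : IsTorus K Kinv) (hE : ∀ a b, ERel q K Kinv E a b → a = b) :
    HasRoots q K E := fun t =>
  (hasWeight_iff_conj hT).2 fun i => hE _ _ (.conj i t)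

theorem hasNegRoots_of_FRel (hT : IsTorus K Kinv) (hF : ∀ a b, FRel q K Kinv F a b → a = b) :
    HasNegRoots q K F := fun t =>
  (hasWeight_iff_conj hT).2 fun i => by
    rw [hF _ _ (.conj i t), rootExp, neg_sub]

/-- The relations for the `E_s`, in terms of weights. -/
theorem ERel_iff (hT : IsTorus K Kinv) : (∀ a b, ERel q K Kinv E a b → a = b) ↔
    HasRoots q K E ∧ (∀ s t : Fin n, 1 < |(s : ℤ) - (t : ℤ)| → E t * E s = E s * E t) ∧
      ∀ s t : Fin n, |(s : ℤ) - (t : ℤ)| = 1 → serrePoly q (E s) (E t) = 0 := by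
  refine ⟨fun h => ⟨hasRoots_of_ERel hT h, fun s t hst => h _ _ (.comm s t hst),
    fun s t hst => h _ _ (.serre s t hst)⟩, fun h a b hab => ?_⟩
  cases hab with
  | conj i t => exact (hasWeight_iff_conj hT).1 (h.1 t) i
  | comm s t hst => exact h.2.1 s t hst
  | serre s t hst => exact h.2.2 s t hst

/-- The relations for the `F_s`, in terms of weights. -/
theorem FRel_iff (hT : IsTorus K Kinv) : (∀ a b, FRel q K Kinv F a b → a = b) ↔
    HasNegRoots q K F ∧ (∀ s t : Fin n, 1 < |(s : ℤ) - (t : ℤ)| → F t * F s = F s * F t) ∧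
      ∀ s t : Fin n, |(s : ℤ) - (t : ℤ)| = 1 → serrePoly q (F s) (F t) = 0 := by
  refine ⟨fun h => ⟨hasNegRoots_of_FRel hT h, fun s t hst => h _ _ (.comm s t hst),
    fun s t hst => h _ _ (.serre s t hst)⟩, fun h a b hab => ?_⟩
  cases hab with
  | conj i t =>
    rw [(hasWeight_iff_conj hT).1 (h.1 t) i, rootExp, neg_sub]
  | comm s t hst => exact h.2.1 s t hst
  | serre s t hst => exact h.2.2 s t hst

theorem HasRoots.simpleK_mul (hE : HasRoots q K E) (hT : IsTorus K Kinv) (hq : q ≠ 0)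
    (s t : Fin n) : simpleK K Kinv s * E t = q ^ cartan s t • (E t * simpleK K Kinv s) :=
  (hE t).simpleK_mul hT hq s

theorem HasRoots.simpleKinv_mul (hE : HasRoots q K E) (hT : IsTorus K Kinv) (hq : q ≠ 0)
    (s t : Fin n) : simpleKinv K Kinv s * E t = q ^ (-cartan s t) • (E t * simpleKinv K Kinv s) :=
  (hE t).simpleKinv_mul hT hq s

theorem HasNegRoots.simpleK_mul (hF : HasNegRoots q K F) (hT : IsTorus K Kinv) (hq : q ≠ 0)
    (s t : Fin n) : simpleK K Kinv s * F t = q ^ (-cartan s t) • (F t * simpleK K Kinv s) := by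
  rw [(hF t).simpleK_mul hT hq s, cartan]
  congr 2
  ring

theorem HasNegRoots.simpleKinv_mul (hF : HasNegRoots q K F) (hT : IsTorus K Kinv) (hq : q ≠ 0)
    (s t : Fin n) : simpleKinv K Kinv s * F t = q ^ cartan s t • (F t * simpleKinv K Kinv s) := by
  rw [(hF t).simpleKinv_mul hT hq s, cartan]
  congr 2
  ring

/-! The formulas for the comultiplication are compatible with the relations. -/

/-- `Δ(E_s)` -/
def comulE (k : Type*) [Field k] [Algebra k A] (K Kinv : Fin (n + 1) → A) (E : Fin n → A)
    (s : Fin n) : A ⊗[k] A :=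
  1 ⊗ₜ E s + E s ⊗ₜ simpleK K Kinv s

/-- `Δ(F_s)` -/
def comulF (k : Type*) [Field k] [Algebra k A] (K Kinv : Fin (n + 1) → A) (F : Fin n → A)
    (s : Fin n) : A ⊗[k] A :=
  F s ⊗ₜ 1 + simpleKinv K Kinv s ⊗ₜ F s

theorem prod_ofFn_tmul_self {m : ℕ} (f : Fin m → A) :
    (List.ofFn fun i => f i ⊗ₜ[k] f i).prod = (List.ofFn f).prod ⊗ₜ (List.ofFn f).prod :=
  prod_ofFn_tmul f f

theorem IsTorus.tmul (hT : IsTorus K Kinv) :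
    IsTorus (fun i => K i ⊗ₜ[k] K i) fun i => Kinv i ⊗ₜ[k] Kinv i := by
  intro a b hab
  cases hab with
  | comm i j => simp [hT.comm i j]
  | mul_inv i => simp [hT.mul_inv, Algebra.TensorProduct.one_def]
  | inv_mul i => simp [hT.inv_mul, Algebra.TensorProduct.one_def]
  | prod => rw [prod_ofFn_tmul_self, hT.prod, Algebra.TensorProduct.one_def]

theorem HasWeight.tmul (hq : q ≠ 0) {w w' : Fin (n + 1) → ℤ} {X Y : A} (hX : HasWeight q K w X)
    (hY : HasWeight q K w' Y) : HasWeight q (fun i => K i ⊗ₜ[k] K i) (w + w') (X ⊗ₜ[k] Y) :=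
  fun i => by
    simp only [Algebra.TensorProduct.tmul_mul_tmul, hX i, hY i, TensorProduct.smul_tmul',
      TensorProduct.tmul_smul, smul_smul, Pi.add_apply, zpow_add₀ hq]
    rw [mul_comm]

theorem HasRoots.comul (hE : HasRoots q K E) (hT : IsTorus K Kinv) (hq : q ≠ 0) :
    HasRoots q (fun i => K i ⊗ₜ[k] K i) (comulE k K Kinv E) := fun t => by
  have h₁ := HasWeight.one.tmul (k := k) hq (hE t)
  have h₂ := (hE t).tmul hq (hT.hasWeight_simpleK (q := q) t)
  rw [zero_add] at h₁
  rw [add_zero] at h₂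
  exact h₁.add h₂

theorem HasNegRoots.comul (hF : HasNegRoots q K F) (hT : IsTorus K Kinv) (hq : q ≠ 0) :
    HasNegRoots q (fun i => K i ⊗ₜ[k] K i) (comulF k K Kinv F) := fun t => by
  have h₁ := (hF t).tmul (k := k) hq HasWeight.one
  have h₂ := (hT.hasWeight_simpleKinv (q := q) t).tmul hq (hF t)
  rw [add_zero] at h₁
  rw [zero_add] at h₂
  exact h₁.add h₂

/-- This identity and the similar ones below have two uses. In H^* they say that the defect of a
relation is skew-primitive, which forces it to vanish; in a presented algebra, where the defect is
zero, they say that Δ respects the relation. -/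
theorem comulE_comm (hE : HasRoots q K E) (hT : IsTorus K Kinv) (hq : q ≠ 0) {s t : Fin n}
    (h : 1 < |(s : ℤ) - (t : ℤ)|) :
    comulE k K Kinv E t * comulE k K Kinv E s - comulE k K Kinv E s * comulE k K Kinv E t =
      1 ⊗ₜ (E t * E s - E s * E t) +
        (E t * E s - E s * E t) ⊗ₜ (simpleK K Kinv t * simpleK K Kinv s) := by
  have h₁ := hE.simpleK_mul hT hq s t
  have h₂ := hE.simpleK_mul hT hq t s
  rw [cartan_comm t s] at h₂
  rw [cartan_far h, zpow_zero, one_smul] at h₁ h₂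
  simp only [comulE, add_mul, mul_add, Algebra.TensorProduct.tmul_mul_tmul, one_mul, mul_one, h₁,
    h₂, TensorProduct.tmul_sub, TensorProduct.sub_tmul, hT.simpleK_simpleK s t]
  abel

theorem comulF_comm (hF : HasNegRoots q K F) (hT : IsTorus K Kinv) (hq : q ≠ 0) {s t : Fin n}
    (h : 1 < |(s : ℤ) - (t : ℤ)|)
    (hk : simpleKinv K Kinv s * simpleKinv K Kinv t = simpleKinv K Kinv t * simpleKinv K Kinv s) :
    comulF k K Kinv F t * comulF k K Kinv F s - comulF k K Kinv F s * comulF k K Kinv F t =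
      (F t * F s - F s * F t) ⊗ₜ 1 +
        (simpleKinv K Kinv t * simpleKinv K Kinv s) ⊗ₜ (F t * F s - F s * F t) := by
  have h₁ := hF.simpleKinv_mul hT hq s t
  have h₂ := hF.simpleKinv_mul hT hq t s
  rw [cartan_comm t s] at h₂
  rw [cartan_far h, zpow_zero, one_smul] at h₁ h₂
  simp only [comulF, add_mul, mul_add, Algebra.TensorProduct.tmul_mul_tmul, one_mul, mul_one, h₁,
    h₂, TensorProduct.tmul_sub, TensorProduct.sub_tmul, hk]
  abel

theorem serrePoly_tmul_left (a b u v : A) (h : u * v = v * u) :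
    serrePoly q (a ⊗ₜ[k] u) (b ⊗ₜ[k] v) = serrePoly q a b ⊗ₜ (u ^ 2 * v) := by
  simp only [serrePoly, pow_two, Algebra.TensorProduct.tmul_mul_tmul, TensorProduct.sub_tmul,
    TensorProduct.add_tmul, TensorProduct.smul_tmul']
  rw [show u * v * u = u * u * v by rw [mul_assoc, mul_assoc, h],
    show v * (u * u) = u * u * v by rw [← mul_assoc, ← h, mul_assoc, ← h, mul_assoc]]

theorem serrePoly_tmul_right (a b u v : A) (h : u * v = v * u) :
    serrePoly q (u ⊗ₜ[k] a) (v ⊗ₜ[k] b) = (u ^ 2 * v) ⊗ₜ serrePoly q a b := by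
  simp only [serrePoly, pow_two, Algebra.TensorProduct.tmul_mul_tmul, TensorProduct.tmul_sub,
    TensorProduct.tmul_add, TensorProduct.tmul_smul]
  rw [show u * v * u = u * u * v by rw [mul_assoc, mul_assoc, h],
    show v * (u * u) = u * u * v by rw [← mul_assoc, ← h, mul_assoc, ← h, mul_assoc]]

theorem IsTorus.simpleKinv_simpleKinv (hT : IsTorus K Kinv) (s t : Fin n) :
    simpleKinv K Kinv s * simpleKinv K Kinv t = simpleKinv K Kinv t * simpleKinv K Kinv s := by
  calc _ = simpleKinv K Kinv s * (K t.succ * Kinv t.castSucc) := rfl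
    _ = K t.succ * (simpleKinv K Kinv s * Kinv t.castSucc) := by
      rw [← mul_assoc, ← hT.simpleKinv_comm, mul_assoc]
    _ = K t.succ * (Kinv t.castSucc * simpleKinv K Kinv s) := by
      congr 1
      rw [simpleKinv, mul_assoc, hT.inv_comm, ← mul_assoc, ← hT.inv_comm_left, mul_assoc]
    _ = _ := by rw [← mul_assoc]; rfl

theorem comulE_serre (hE : HasRoots q K E) (hT : IsTorus K Kinv) (hq : q ≠ 0) {s t : Fin n}
    (h : |(s : ℤ) - (t : ℤ)| = 1) :
    serrePoly q (comulE k K Kinv E s) (comulE k K Kinv E t) =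
      1 ⊗ₜ serrePoly q (E s) (E t) +
        serrePoly q (E s) (E t) ⊗ₜ (simpleK K Kinv s ^ 2 * simpleK K Kinv t) := by
  have h₁ := hE.simpleK_mul hT hq s s
  have h₂ := hE.simpleK_mul hT hq s t
  have h₃ := hE.simpleK_mul hT hq t s
  rw [cartan_comm t s] at h₃
  rw [cartan_adj h, zpow_neg_one] at h₂ h₃
  rw [cartan_self] at h₁
  rw [comulE, comulE, serrePoly_add hq, serrePoly_tmul_left _ _ _ _ (hT.simpleK_simpleK s t),
    serrePoly_tmul_right _ _ _ _ rfl, one_pow, one_mul]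
  · simp [h₁]
  · simp [h₂]
  · simp [h₃]

theorem comulF_serre (hF : HasNegRoots q K F) (hT : IsTorus K Kinv) (hq : q ≠ 0) {s t : Fin n}
    (h : |(s : ℤ) - (t : ℤ)| = 1) :
    serrePoly q (comulF k K Kinv F s) (comulF k K Kinv F t) =
      serrePoly q (F s) (F t) ⊗ₜ 1 +
        (simpleKinv K Kinv s ^ 2 * simpleKinv K Kinv t) ⊗ₜ serrePoly q (F s) (F t) := by
  have h₁ := hF.simpleKinv_mul hT hq s s
  have h₂ := hF.simpleKinv_mul hT hq s t
  have h₃ := hF.simpleKinv_mul hT hq t s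
  rw [cartan_comm t s] at h₃
  rw [cartan_adj h, zpow_neg_one] at h₂ h₃
  rw [cartan_self] at h₁
  rw [comulF, comulF, serrePoly_add hq, serrePoly_tmul_left _ _ _ _ rfl,
    serrePoly_tmul_right _ _ _ _ (hT.simpleKinv_simpleKinv s t), one_pow, one_mul]
  · simp [h₁, TensorProduct.smul_tmul']
  · simp [h₂, TensorProduct.smul_tmul']
  · simp [h₃, TensorProduct.smul_tmul']

/-- The mixed terms cancel because E_s and F_t have opposite weights, so they acquire the same power
of q. -/
theorem comulE_comulF (hE : HasRoots q K E) (hF : HasNegRoots q K F) (hT : IsTorus K Kinv)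
    (hq : q ≠ 0) (s t : Fin n) :
    comulE k K Kinv E s * comulF k K Kinv F t - comulF k K Kinv F t * comulE k K Kinv E s =
      simpleKinv K Kinv t ⊗ₜ (E s * F t - F t * E s) +
        (E s * F t - F t * E s) ⊗ₜ simpleK K Kinv s := by
  have h₁ := hE.simpleKinv_mul hT hq t s
  have h₂ := hF.simpleK_mul hT hq s t
  rw [cartan_comm t s] at h₁
  simp only [comulE, comulF, add_mul, mul_add, Algebra.TensorProduct.tmul_mul_tmul, one_mul,
    mul_one, h₁, h₂, TensorProduct.tmul_sub, TensorProduct.sub_tmul, TensorProduct.tmul_smul,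
    TensorProduct.smul_tmul']
  abel

end Families

end Weights

/-! ### Coproducts of forms -/

namespace HopfStructure

section HasComul

variable {k A : Type*} [Field k] [Ring A] [Algebra k A] {D : HopfStructure k A}

/-- The value `f(a) g(b)` of the tensor `f ⊗ g`. -/
def evalDual (D : HopfStructure k A) (a b : A) : D.Dual ⊗[k] D.Dual →ₗ[k] k :=
  LinearMap.mul' k k ∘ₗ TensorProduct.map (LinearMap.applyₗ a ∘ₗ D.form)
    (LinearMap.applyₗ b ∘ₗ D.form)

theorem evalDual_tmul (a b : A) (f g : D.Dual) :
    D.evalDual a b (f ⊗ₜ g) = D.form f a * D.form g b := rfl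

/-- `t` is a coproduct of the form `f`. -/
def HasComul (D : HopfStructure k A) (f : D.Dual) (t : D.Dual ⊗[k] D.Dual) : Prop :=
  ∀ a b, D.evalDual a b t = D.form f (a * b)

theorem isCoproduct_iff {U : Subalgebra k D.Dual} {f : D.Dual} {t : U ⊗[k] U} :
    D.IsCoproduct U f t ↔ D.HasComul f (Algebra.TensorProduct.map U.val U.val t) := by
  have h : ∀ a b, D.evalDual a b (Algebra.TensorProduct.map U.val U.val t) =
      D.evalTensor U a b t := fun a b => by
    induction t with
    | zero => simp
    | add t t' h h' => rw [map_add, map_add, map_add, h, h']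
    | tmul u v => rfl
  simp only [IsCoproduct, HasComul, h]

theorem hasComul_iff_top {f : D.Dual} {t : D.Dual ⊗[k] D.Dual} :
    D.HasComul f t ↔ D.IsCoproduct ⊤ f (Algebra.TensorProduct.map
      (Subalgebra.topEquiv (R := k) (A := D.Dual)).symm.toAlgHom
      (Subalgebra.topEquiv (R := k) (A := D.Dual)).symm.toAlgHom t) := by
  rw [isCoproduct_iff]
  have h : Algebra.TensorProduct.map (⊤ : Subalgebra k D.Dual).val (⊤ : Subalgebra k D.Dual).val
      (Algebra.TensorProduct.map (Subalgebra.topEquiv (R := k) (A := D.Dual)).symm.toAlgHom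
        (Subalgebra.topEquiv (R := k) (A := D.Dual)).symm.toAlgHom t) = t := by
    induction t with
    | zero => simp
    | add t t' h h' => rw [map_add, map_add, h, h']
    | tmul u v => rfl
  rw [h]

theorem HasComul.mul {f g : D.Dual} {t t' : D.Dual ⊗[k] D.Dual} (h : D.HasComul f t)
    (h' : D.HasComul g t') : D.HasComul (f * g) (t * t') := by
  rw [hasComul_iff_top] at *
  rw [map_mul]
  exact h.mul h'

theorem HasComul.add {f g : D.Dual} {t t' : D.Dual ⊗[k] D.Dual} (h : D.HasComul f t)
    (h' : D.HasComul g t') : D.HasComul (f + g) (t + t') := fun a b => by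
  simp [h a b, h' a b]

theorem HasComul.sub {f g : D.Dual} {t t' : D.Dual ⊗[k] D.Dual} (h : D.HasComul f t)
    (h' : D.HasComul g t') : D.HasComul (f - g) (t - t') := fun a b => by
  simp [h a b, h' a b]

theorem HasComul.smul {f : D.Dual} {t : D.Dual ⊗[k] D.Dual} (c : k) (h : D.HasComul f t) :
    D.HasComul (c • f) (c • t) := fun a b => by
  simp [h a b]

theorem HasComul.serre {q : k} {f g : D.Dual} {t t' : D.Dual ⊗[k] D.Dual} (h : D.HasComul f t)
    (h' : D.HasComul g t') : D.HasComul (serrePoly q f g) (serrePoly q t t') := by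
  simp only [serrePoly, pow_two]
  exact (((h.mul h).mul h').sub (((h.mul h').mul h).smul _)).add (h'.mul (h.mul h))

theorem IsCharacter.hasComul {f : D.Dual} (h : D.IsCharacter f) : D.HasComul f (f ⊗ₜ f) :=
  fun a b => by rw [evalDual_tmul, h.mul]

/-- A skew-primitive form that vanishes on generators is zero. -/
theorem eq_zero_of_skew {f g g' : D.Dual} (h : D.HasComul f (g ⊗ₜ f + f ⊗ₜ g'))
    (hg : D.form g 1 = 1) (hg' : D.form g' 1 = 1) {G : Set A} (hG : Algebra.adjoin k G = ⊤)
    (hf : ∀ a ∈ G, D.form f a = 0) : f = 0 := by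
  have h₁ : D.form f 1 = 0 := by
    have := h 1 1
    rw [map_add, evalDual_tmul, evalDual_tmul, hg, hg', mul_one, one_mul, mul_one] at this
    simpa using this
  apply D.form_injective
  ext a
  rw [map_zero, LinearMap.zero_apply]
  have ha : a ∈ Algebra.adjoin k G := hG ▸ Algebra.mem_top
  induction ha using Algebra.adjoin_induction with
  | mem a ha => exact hf a ha
  | algebraMap r => rw [Algebra.algebraMap_eq_smul_one, map_smul, h₁, smul_zero]
  | add a b _ _ ha hb => rw [map_add, ha, hb, add_zero]
  | mul a b _ _ ha hb =>
    rw [← h, map_add, evalDual_tmul, evalDual_tmul, ha, hb, mul_zero, zero_mul, add_zero]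

theorem sum_S_mul {ι : Type*} {s : Finset ι} {u v : ι → A} {a : A}
    (h : D.Δ a = ∑ i ∈ s, u i ⊗ₜ v i) : ∑ i ∈ s, D.S (u i) * v i = algebraMap k A (D.ε a) := by
  have := LinearMap.congr_fun D.antipode_left a
  simpa [h] using this

theorem sum_mul_S {ι : Type*} {s : Finset ι} {u v : ι → A} {a : A}
    (h : D.Δ a = ∑ i ∈ s, u i ⊗ₜ v i) : ∑ i ∈ s, u i * D.S (v i) = algebraMap k A (D.ε a) := by
  have := LinearMap.congr_fun D.antipode_right a
  simpa [h] using this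

theorem IsCharacter.dualS_mul_self {f : D.Dual} (hf : D.IsCharacter f) : D.dualS f * f = 1 := by
  apply D.form_injective
  ext a
  obtain ⟨s, hs⟩ := D.exists_comul a
  have := congrArg (D.form f) (sum_S_mul hs)
  rw [D.form_mul_of_comul hs, D.form_one]
  simpa [hf.mul, hf.one, Algebra.algebraMap_eq_smul_one] using this

theorem IsCharacter.mul_dualS_self {f : D.Dual} (hf : D.IsCharacter f) : f * D.dualS f = 1 := by
  apply D.form_injective
  ext a
  obtain ⟨s, hs⟩ := D.exists_comul a
  have := congrArg (D.form f) (sum_mul_S hs)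
  rw [D.form_mul_of_comul hs, D.form_one]
  simpa [hf.mul, hf.one, Algebra.algebraMap_eq_smul_one] using this

theorem IsCharacter.dualS {f : D.Dual} (hf : D.IsCharacter f) : D.IsCharacter (D.dualS f) where
  mul a b := by rw [form_dualS, D.S_mul, hf.mul, mul_comm]; rfl
  one := by rw [form_dualS, D.S_one, hf.one]

/-- Evaluate f at S(a₁)a₂ = ε(a)1 and expand with the coproduct of f; since f(1) = 0 this is the
antipode axiom for f, from which f ∘ S can be solved when g' is invertible. -/
theorem dualS_of_skew {f g g' : D.Dual} (h : D.HasComul f (g ⊗ₜ f + f ⊗ₜ g'))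
    (hf : D.form f 1 = 0) : D.dualS g * f + D.dualS f * g' = 0 := by
  apply D.form_injective
  ext a
  obtain ⟨s, hs⟩ := D.exists_comul a
  have h₁ := congrArg (D.form f) (sum_S_mul hs)
  simp only [map_sum, ← h _ _, Algebra.algebraMap_eq_smul_one, map_smul, hf, smul_zero, map_add,
    evalDual_tmul, Finset.sum_add_distrib] at h₁
  rw [map_add, LinearMap.add_apply, D.form_mul_of_comul hs, D.form_mul_of_comul hs]
  simpa using h₁

end HasComul

section Coefficient

universe u v
variable {k : Type u} {A : Type v} [Field k] [Ring A] [Algebra k A] {D : HopfStructure k A}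

theorem IsRep.isCoefficient {I : Type} [Fintype I] [DecidableEq I] {f : I → I → D.Dual}
    (hf : D.IsRep f) (i m : I) : D.IsCoefficient (f i m) := by
  let φ : A →ₐ[k] Matrix I I k := AlgHom.ofLinearMap
    { toFun a := Matrix.of fun m i => D.form (f i m) a
      map_add' a b := by ext; simp
      map_smul' c a := by ext; simp }
    (by ext i m; simp [hf.one, Matrix.one_apply, eq_comm])
    (fun a b => by ext i m; simp [hf.mul, Matrix.mul_apply])
  exact ⟨_, inferInstance, inferInstance, inferInstance, φ, Matrix.entryLinearMap k k m i, rfl⟩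

theorem IsCharacter.isCoefficient {f : D.Dual} (hf : D.IsCharacter f) : D.IsCoefficient f :=
  hf.isRep_unit.isCoefficient () ()

theorem IsCoefficient.smul {f : D.Dual} (hf : D.IsCoefficient f) (c : k) :
    D.IsCoefficient (c • f) := by
  rw [Algebra.smul_def]
  exact (isCoefficient_algebraMap c).mul hf

end Coefficient

end HopfStructure

/-! ### The generators of `H_σ` -/

namespace SLq

variable {k : Type*} [Field k] {n : ℕ} {q z : k} (hq : q ≠ 0) (hz : z ^ (n + 1) = q⁻¹)

/-- The forms `l_{ij}`. -/
def lMatrix (i j : Fin (n + 1)) : (hopf (n := n) hq).Dual := (cqt hq hz).l (x n q i j)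

theorem form_l (a b : SLq n q) : (hopf hq).form ((cqt hq hz).l a) b = sigma hq hz b a := rfl

theorem r_x (i j : Fin (n + 1)) : (cqt hq hz).r (x n q i j) = rMatrix hq hz i j :=
  rHom_x hq hz i j

theorem form_lMatrix_x (i j a b : Fin (n + 1)) :
    (hopf hq).form (lMatrix hq hz i j) (x n q a b) = z * Rmat q a b i j :=
  sigma_x hq hz a b i j

/-- The indices are exchanged because `IsRep` describes the transpose of a representation, while the
l_{ij} are the matrix of one. -/
theorem isRep_lMatrix : (hopf (n := n) hq).IsRep fun i m => lMatrix hq hz m i where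
  mul i m a b := by
    simp only [lMatrix, form_l]
    rw [sigma_mul_left, (isCorep hq).comul]
    simp
  one i m := by
    simp only [lMatrix, form_l]
    rw [sigma_one_left, (isCorep hq).counit]
    simp only [eq_comm]

theorem lMatrix_eq_zero {i m : Fin (n + 1)} (h : i < m) : lMatrix hq hz i m = 0 := by
  refine (isRep_lMatrix hq hz).eq_zero_of_gt (adjoin_x n q) ?_ h
  rintro _ ⟨⟨a, b⟩, rfl⟩ j l h
  simp only [form_lMatrix_x, Rmat_eq, kron, offCoef, h.ne', if_false, mul_zero, zero_add]
  by_cases h' : j = a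
  · rw [if_neg (h' ▸ h.not_gt)]
    ring
  · rw [if_neg h']
    ring

theorem K_eq (i : Fin (n + 1)) : (cqt hq hz).K i = lMatrix hq hz i i := rfl

theorem isCharacter_K (i : Fin (n + 1)) : (hopf hq).IsCharacter ((cqt hq hz).K i) :=
  (isRep_lMatrix hq hz).isCharacter_diag (fun _ _ h => lMatrix_eq_zero hq hz h) i

theorem Kinv_eq (i : Fin (n + 1)) : (cqt hq hz).Kinv i = (hopf hq).dualS ((cqt hq hz).K i) := rfl

theorem isCharacter_Kinv (i : Fin (n + 1)) : (hopf hq).IsCharacter ((cqt hq hz).Kinv i) :=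
  (isCharacter_K hq hz i).dualS

theorem form_K_x (i a b : Fin (n + 1)) : (hopf hq).form ((cqt hq hz).K i) (x n q a b) =
    if a = b then z * (if a = i then q else 1) else 0 := by
  rw [K_eq, form_lMatrix_x, Rmat_eq]
  by_cases h : a = b
  · subst h
    simp +contextual [kron, diagCoef, offCoef, eq_comm]
  · simp +contextual [kron, diagCoef, offCoef, h, Ne.symm h]

/-- Two characters with the same values on generators. Thus H_l and H_r share the torus, although
one is defined through the second argument of σ and the other through the first. -/
theorem rMatrix_diag (i : Fin (n + 1)) : rMatrix hq hz i i = (cqt hq hz).K i := by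
  refine (isCharacter_rMatrix hq hz i).ext (isCharacter_K hq hz i) (adjoin_x n q) ?_
  rintro _ ⟨⟨a, b⟩, rfl⟩
  simp only [form_K_x, form_rMatrix_x, Rmat_eq]
  by_cases h : a = b
  · subst h
    simp +contextual [kron, diagCoef, offCoef, eq_comm]
  · simp +contextual [kron, diagCoef, offCoef, h, Ne.symm h]

/-- The evaluation of forms at the generators. -/
def ev : (hopf (n := n) hq).Dual →ₐ[k] Matrix (Fin (n + 1)) (Fin (n + 1)) k := (isCorep hq).evalHom

theorem ev_K (i : Fin (n + 1)) : ev hq ((cqt hq hz).K i) =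
    Matrix.diagonal fun a => z * if a = i then q else 1 := by
  ext a b
  rw [Matrix.diagonal_apply]
  exact form_K_x hq hz i a b

theorem z_ne_zero (hq : q ≠ 0) (hz : z ^ (n + 1) = q⁻¹) : z ≠ 0 := by
  rintro rfl
  rw [zero_pow (Nat.succ_ne_zero n)] at hz
  exact inv_ne_zero hq hz.symm

theorem ev_Kinv (i : Fin (n + 1)) : ev hq ((cqt hq hz).Kinv i) =
    Matrix.diagonal fun a => z⁻¹ * if a = i then q⁻¹ else 1 := by
  have h : ev hq ((cqt hq hz).Kinv i) * ev hq ((cqt hq hz).K i) = 1 := by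
    rw [← map_mul, Kinv_eq, (isCharacter_K hq hz i).dualS_mul_self, map_one]
  refine left_inv_eq_right_inv h ?_
  rw [ev_K, Matrix.diagonal_mul_diagonal, ← Matrix.diagonal_one]
  congr 1
  funext a
  have hz0 := z_ne_zero hq hz
  by_cases ha : a = i
  · simp only [ha, if_true]
    field_simp
  · simp only [ha, if_false]
    field_simp

theorem ev_eq_of_form {f g : (hopf (n := n) hq).Dual} (h : ev hq f = ev hq g) :
    ∀ a ∈ Set.range (fun p : Fin (n + 1) × Fin (n + 1) => x n q p.1 p.2),
      (hopf hq).form f a = (hopf hq).form g a := by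
  rintro _ ⟨⟨a, b⟩, rfl⟩
  exact congrFun (congrFun h a) b

theorem ext_of_ev {f g : (hopf (n := n) hq).Dual} (hf : (hopf hq).IsCharacter f)
    (hg : (hopf hq).IsCharacter g) (h : ev hq f = ev hq g) : f = g :=
  hf.ext hg (adjoin_x n q) (ev_eq_of_form hq h)

/-- The working form of the principle for skew-primitive forms: relations in H^* that are
skew-primitive become identities of matrices. -/
theorem eq_zero_of_ev {f g g' : (hopf (n := n) hq).Dual}
    (h : (hopf hq).HasComul f (g ⊗ₜ f + f ⊗ₜ g')) (hg : (hopf hq).IsCharacter g)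
    (hg' : (hopf hq).IsCharacter g') (hf : ev hq f = 0) : f = 0 :=
  HopfStructure.eq_zero_of_skew h hg.one hg'.one (adjoin_x n q) fun a ha => by
    rw [ev_eq_of_form hq (hf.trans (map_zero (ev hq)).symm) a ha, map_zero, LinearMap.zero_apply]

theorem isTorus_K : IsTorus (cqt (n := n) hq hz).K (cqt hq hz).Kinv := by
  intro a b hab
  cases hab with
  | comm i j =>
    refine ext_of_ev hq ((isCharacter_K hq hz i).mul' (isCharacter_K hq hz j))
      ((isCharacter_K hq hz j).mul' (isCharacter_K hq hz i)) ?_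
    simp only [map_mul, ev_K, Matrix.diagonal_mul_diagonal, mul_comm]
  | mul_inv i => exact (isCharacter_K hq hz i).mul_dualS_self
  | inv_mul i => exact (isCharacter_K hq hz i).dualS_mul_self
  | prod =>
    rw [← prod_rMatrix hq hz]
    simp only [rMatrix_diag]

/-- By triangularity only intermediate indices between s and s + 1 contribute, and for adjacent
indices these are the two ends. -/
theorem hasComul_l (s : Fin n) : (hopf hq).HasComul (lMatrix hq hz s.succ s.castSucc)
    ((cqt hq hz).K s.succ ⊗ₜ lMatrix hq hz s.succ s.castSucc +
      lMatrix hq hz s.succ s.castSucc ⊗ₜ (cqt hq hz).K s.castSucc) := by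
  intro a b
  have hne : s.succ ≠ s.castSucc := (Fin.castSucc_lt_succ (i := s)).ne'
  rw [(isRep_lMatrix hq hz).mul, map_add, HopfStructure.evalDual_tmul,
    HopfStructure.evalDual_tmul, Finset.sum_eq_add s.succ s.castSucc hne, K_eq, K_eq]
  · rintro c - ⟨h₁, h₂⟩
    rcases lt_or_gt_of_ne h₁ with h | h
    · rw [lMatrix_eq_zero hq hz (i := c) (m := s.castSucc), map_zero, LinearMap.zero_apply,
        mul_zero]
      exact lt_of_le_of_ne (Fin.le_castSucc_iff.2 h) h₂
    · rw [lMatrix_eq_zero hq hz (i := s.succ) (m := c) h, map_zero, LinearMap.zero_apply, zero_mul]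
  · simp
  · simp

theorem hasComul_r (s : Fin n) : (hopf hq).HasComul (rMatrix hq hz s.castSucc s.succ)
    (rMatrix hq hz s.castSucc s.succ ⊗ₜ (cqt hq hz).K s.castSucc +
      (cqt hq hz).K s.succ ⊗ₜ rMatrix hq hz s.castSucc s.succ) := by
  intro a b
  have hne : s.castSucc ≠ s.succ := (Fin.castSucc_lt_succ (i := s)).ne
  rw [(isRep_rMatrix hq hz).mul, map_add, HopfStructure.evalDual_tmul,
    HopfStructure.evalDual_tmul, Finset.sum_eq_add s.castSucc s.succ hne, rMatrix_diag,
    rMatrix_diag]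
  · rintro c - ⟨h₁, h₂⟩
    rcases lt_or_gt_of_ne h₁ with h | h
    · rw [rMatrix_eq_zero hq hz (i := s.castSucc) (m := c) h, map_zero, LinearMap.zero_apply,
        mul_zero]
    · rw [rMatrix_eq_zero hq hz (i := c) (m := s.succ), map_zero, LinearMap.zero_apply, zero_mul]
      exact lt_of_le_of_ne (Fin.castSucc_lt_iff_succ_le.1 h) h₂.symm
  · simp
  · simp

theorem F_eq (s : Fin n) : (cqt hq hz).F s = ((q - q⁻¹) ^ 2)⁻¹ •
    ((cqt hq hz).Kinv s.castSucc * rMatrix hq hz s.castSucc s.succ) := by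
  rw [CQT.F, r_x, r_x, rMatrix_diag]
  rfl

theorem E_eq (s : Fin n) : (cqt hq hz).E s =
    (cqt hq hz).Kinv s.succ * lMatrix hq hz s.succ s.castSucc := rfl

theorem hasComul_E (s : Fin n) : (hopf hq).HasComul ((cqt hq hz).E s)
    (comulE k (cqt hq hz).K (cqt hq hz).Kinv (cqt hq hz).E s) := by
  have h := (isCharacter_Kinv hq hz s.succ).hasComul.mul (hasComul_l hq hz s)
  rw [mul_add, Algebra.TensorProduct.tmul_mul_tmul, Algebra.TensorProduct.tmul_mul_tmul,
    (isTorus_K hq hz).inv_mul] at h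
  exact h

theorem hasComul_F (s : Fin n) : (hopf hq).HasComul ((cqt hq hz).F s)
    (comulF k (cqt hq hz).K (cqt hq hz).Kinv (cqt hq hz).F s) := by
  have h := ((isCharacter_Kinv hq hz s.castSucc).hasComul.mul (hasComul_r hq hz s)).smul
    ((q - q⁻¹) ^ 2)⁻¹
  rw [mul_add, Algebra.TensorProduct.tmul_mul_tmul, Algebra.TensorProduct.tmul_mul_tmul,
    (isTorus_K hq hz).inv_mul, smul_add, TensorProduct.smul_tmul', ← TensorProduct.tmul_smul,
    ← F_eq, (isTorus_K hq hz).inv_comm_left] at h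
  exact h

theorem ev_E (s : Fin n) : ev hq ((cqt hq hz).E s) =
    Matrix.single s.castSucc s.succ (q - q⁻¹) := by
  have hz0 := z_ne_zero hq hz
  ext a b
  rw [E_eq, map_mul, ev_Kinv, Matrix.diagonal_mul, Matrix.single_apply]
  change _ * (hopf hq).form (lMatrix hq hz s.succ s.castSucc) (x n q a b) = _
  rw [form_lMatrix_x, Rmat_eq]
  have hlt := Fin.castSucc_lt_succ (i := s)
  by_cases ha : s.castSucc = a
  · subst ha
    by_cases hb : s.succ = b
    · subst hb
      simp [kron, diagCoef, offCoef, hlt.ne, hlt.ne', hlt]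
      field_simp
    · simp [kron, diagCoef, offCoef, hlt.ne, hlt.ne', hb, Ne.symm hb]
  · simp [kron, hlt.ne, ha]

/-- The factor (q - q⁻¹)⁻² in F_s makes the coefficients of the two matrix units for E_s and F_s
inverse to each other, so their commutator is a difference of diagonal units. -/
theorem ev_F (hq2 : q ^ 2 ≠ 1) (s : Fin n) : ev hq ((cqt hq hz).F s) =
    Matrix.single s.succ s.castSucc (q - q⁻¹)⁻¹ := by
  have hz0 := z_ne_zero hq hz
  have hl : q - q⁻¹ ≠ 0 := fun h => hq2 (by
    rw [sub_eq_zero] at h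
    rw [pow_two]
    nth_rewrite 2 [h]
    exact mul_inv_cancel₀ hq)
  ext a b
  rw [F_eq, map_smul, map_mul, ev_Kinv, Matrix.smul_apply, Matrix.diagonal_mul,
    Matrix.single_apply]
  change _ • (_ * (hopf hq).form (rMatrix hq hz s.castSucc s.succ) (x n q a b)) = _
  rw [form_rMatrix_x, Rmat_eq]
  have hlt := Fin.castSucc_lt_succ (i := s)
  by_cases ha : s.succ = a
  · subst ha
    by_cases hb : s.castSucc = b
    · subst hb
      simp [kron, diagCoef, offCoef, hlt.ne, hlt.ne', hlt]
      generalize q - q⁻¹ = c at hl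
      field_simp
    · simp [kron, diagCoef, offCoef, hlt.ne, hlt.ne', hb, Ne.symm hb]
  · simp [kron, hlt.ne', ha]

end SLq

namespace SLq

variable {k : Type*} [Field k] {n : ℕ} {q z : k} (hq : q ≠ 0) (hz : z ^ (n + 1) = q⁻¹)

theorem isCharacter_simpleK (s : Fin n) :
    (hopf hq).IsCharacter (simpleK (cqt hq hz).K (cqt hq hz).Kinv s) :=
  (isCharacter_Kinv hq hz _).mul' (isCharacter_K hq hz _)

theorem isCharacter_simpleKinv (s : Fin n) :
    (hopf hq).IsCharacter (simpleKinv (cqt hq hz).K (cqt hq hz).Kinv s) :=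
  (isCharacter_K hq hz _).mul' (isCharacter_Kinv hq hz _)

/-! Relations between the generators. -/

theorem hasRoots_E : HasRoots q (cqt (n := n) hq hz).K (cqt hq hz).E := by
  intro t i
  rw [← sub_eq_zero]
  have hK := (isCharacter_K hq hz i).hasComul
  have hE := hasComul_E hq hz t
  -- K̂_i E_t - q^w E_t K̂_i is skew-primitive between K̂_i and K̂_i times the simple torus element.
  refine eq_zero_of_ev hq (g := (cqt hq hz).K i)
    (g' := (cqt hq hz).K i * simpleK (cqt hq hz).K (cqt hq hz).Kinv t) ?_ (isCharacter_K hq hz i)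
    ((isCharacter_K hq hz i).mul' (isCharacter_simpleK hq hz t)) ?_
  · convert (hK.mul hE).sub ((hE.mul hK).smul (q ^ rootExp i t)) using 1
    simp only [comulE, mul_add, add_mul, Algebra.TensorProduct.tmul_mul_tmul, mul_one, one_mul,
      ← (isTorus_K hq hz).simpleK_comm, smul_add, TensorProduct.tmul_sub, TensorProduct.sub_tmul,
      TensorProduct.tmul_smul, TensorProduct.smul_tmul']
    abel
  · have hz0 := z_ne_zero hq hz
    rw [map_sub, map_smul, map_mul, map_mul, ev_K, ev_E, sub_eq_zero]
    ext a b
    rw [Matrix.diagonal_mul, Matrix.smul_apply, Matrix.mul_diagonal, Matrix.single_apply]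
    by_cases hab : t.castSucc = a ∧ t.succ = b
    · obtain ⟨rfl, rfl⟩ := hab
      have hne := (Fin.castSucc_lt_succ (i := t)).ne
      simp only [rootExp, and_self, if_true, smul_eq_mul]
      by_cases h₁ : t.castSucc = i
      · subst h₁
        simp [hne, hne.symm]
        ring
      · by_cases h₂ : t.succ = i
        · subst h₂
          simp [hne, hne.symm]
          field_simp
        · simp [h₁, h₂, Ne.symm h₁, Ne.symm h₂]
          ring
    · rw [if_neg hab]
      simp

theorem hasNegRoots_F (hq2 : q ^ 2 ≠ 1) :
    HasNegRoots q (cqt (n := n) hq hz).K (cqt hq hz).F := by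
  intro t i
  rw [← sub_eq_zero]
  have hK := (isCharacter_K hq hz i).hasComul
  have hF := hasComul_F hq hz t
  refine eq_zero_of_ev hq (g := (cqt hq hz).K i * simpleKinv (cqt hq hz).K (cqt hq hz).Kinv t)
    (g' := (cqt hq hz).K i) ?_
    ((isCharacter_K hq hz i).mul' (isCharacter_simpleKinv hq hz t)) (isCharacter_K hq hz i) ?_
  · convert (hK.mul hF).sub ((hF.mul hK).smul (q ^ (-rootExp i t))) using 1
    simp only [comulF, mul_add, add_mul, Algebra.TensorProduct.tmul_mul_tmul, mul_one, one_mul,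
      ← (isTorus_K hq hz).simpleKinv_comm, smul_add, TensorProduct.tmul_sub,
      TensorProduct.sub_tmul, TensorProduct.tmul_smul, TensorProduct.smul_tmul']
    abel
  · have hz0 := z_ne_zero hq hz
    rw [map_sub, map_smul, map_mul, map_mul, ev_K, ev_F hq hz hq2, sub_eq_zero]
    ext a b
    rw [Matrix.diagonal_mul, Matrix.smul_apply, Matrix.mul_diagonal, Matrix.single_apply]
    by_cases hab : t.succ = a ∧ t.castSucc = b
    · obtain ⟨rfl, rfl⟩ := hab
      have hne := (Fin.castSucc_lt_succ (i := t)).ne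
      simp only [rootExp, and_self, if_true, smul_eq_mul]
      generalize (q - q⁻¹)⁻¹ = c
      by_cases h₁ : t.castSucc = i
      · subst h₁
        simp [hne, hne.symm]
        field_simp
      · by_cases h₂ : t.succ = i
        · subst h₂
          simp [hne, hne.symm]
          ring
        · simp [h₁, h₂, Ne.symm h₁, Ne.symm h₂]
          ring
    · rw [if_neg hab]
      simp

theorem single_mul_single {N : ℕ} (a b c d : Fin N) (u v : k) :
    Matrix.single a b u * Matrix.single c d v = if b = c then Matrix.single a d (u * v) else 0 := by
  split_ifs with h
  · subst h
    exact Matrix.single_mul_single_same ..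
  · exact Matrix.single_mul_single_of_ne (h := h) ..

theorem E_rel (a b : (hopf (n := n) hq).Dual)
    (h : ERel q (cqt hq hz).K (cqt hq hz).Kinv (cqt hq hz).E a b) : a = b := by
  have hT := isTorus_K (n := n) hq hz
  have hR := hasRoots_E (n := n) hq hz
  refine (ERel_iff hT).2 ⟨hR, fun s t hst => ?_, fun s t hst => ?_⟩ a b h
  · rw [← sub_eq_zero]
    refine eq_zero_of_ev hq (g := 1) (g' := _) ?_ .one' ((isCharacter_simpleK hq hz t).mul'
      (isCharacter_simpleK hq hz s)) ?_
    · rw [← comulE_comm hR hT hq hst]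
      exact ((hasComul_E hq hz t).mul (hasComul_E hq hz s)).sub
        ((hasComul_E hq hz s).mul (hasComul_E hq hz t))
    · simp only [map_sub, map_mul, ev_E, single_mul_single, Fin.ext_iff, Fin.val_castSucc,
        Fin.val_succ]
      rcases lt_abs.1 hst with h | h <;> rw [if_neg (by omega), if_neg (by omega), sub_zero]
  · refine eq_zero_of_ev hq (g := 1) (g' := _) ?_ .one'
      (((isCharacter_simpleK hq hz s).mul' (isCharacter_simpleK hq hz s)).mul'
        (isCharacter_simpleK hq hz t)) ?_
    · rw [← pow_two, ← comulE_serre hR hT hq hst]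
      exact (hasComul_E hq hz s).serre (hasComul_E hq hz t)
    · rw [map_serrePoly]
      simp only [serrePoly, pow_two, ev_E, mul_assoc]
      -- Each of the three words vanishes as a product of matrix units e_{s,s+1}, e_{s,s+1},
      -- e_{t,t+1}: two equal neighbours multiply to zero, and the middle word would need t = s + 1
      -- and s = t + 1.
      simp only [single_mul_single, Fin.ext_iff,
        Fin.val_castSucc, Fin.val_succ, mul_ite, mul_zero]
      split_ifs <;> first | omega | simp

theorem F_rel (hq2 : q ^ 2 ≠ 1) (a b : (hopf (n := n) hq).Dual)
    (h : FRel q (cqt hq hz).K (cqt hq hz).Kinv (cqt hq hz).F a b) : a = b := by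
  have hT := isTorus_K (n := n) hq hz
  have hR := hasNegRoots_F (n := n) hq hz hq2
  refine (FRel_iff hT).2 ⟨hR, fun s t hst => ?_, fun s t hst => ?_⟩ a b h
  · rw [← sub_eq_zero]
    refine eq_zero_of_ev hq (g := _) (g' := 1) ?_ ((isCharacter_simpleKinv hq hz t).mul'
      (isCharacter_simpleKinv hq hz s)) .one' ?_
    · rw [add_comm, ← comulF_comm hR hT hq hst (hT.simpleKinv_simpleKinv s t)]
      exact ((hasComul_F hq hz t).mul (hasComul_F hq hz s)).sub
        ((hasComul_F hq hz s).mul (hasComul_F hq hz t))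
    · simp only [map_sub, map_mul, ev_F hq hz hq2, single_mul_single, Fin.ext_iff,
        Fin.val_castSucc, Fin.val_succ]
      rcases lt_abs.1 hst with h | h <;> rw [if_neg (by omega), if_neg (by omega), sub_zero]
  · refine eq_zero_of_ev hq (g := _) (g' := 1) ?_
      (((isCharacter_simpleKinv hq hz s).mul' (isCharacter_simpleKinv hq hz s)).mul'
        (isCharacter_simpleKinv hq hz t)) .one' ?_
    · rw [← pow_two, add_comm, ← comulF_serre hR hT hq hst]
      exact (hasComul_F hq hz s).serre (hasComul_F hq hz t)
    · rw [map_serrePoly]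
      simp only [serrePoly, pow_two, ev_F hq hz hq2, mul_assoc]
      simp only [single_mul_single, Fin.ext_iff,
        Fin.val_castSucc, Fin.val_succ, mul_ite, mul_zero]
      split_ifs <;> first | omega | simp

theorem sub_inv_ne_zero (hq : q ≠ 0) (hq2 : q ^ 2 ≠ 1) : q - q⁻¹ ≠ 0 := fun h => hq2 (by
  rw [sub_eq_zero] at h
  rw [pow_two]
  nth_rewrite 2 [h]
  exact mul_inv_cancel₀ hq)

/-- The commutator of E_s and F_t is skew-primitive between k_t⁻¹ and k_s, for the simple torus
elements k. For s = t the difference k_s - k_s⁻¹ is skew-primitive between the same two characters,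
so the two sides can be compared on generators. -/
theorem EF_rel (hq2 : q ^ 2 ≠ 1) (a b : (hopf (n := n) hq).Dual)
    (h : EFRel q (cqt hq hz).K (cqt hq hz).Kinv (cqt hq hz).E (cqt hq hz).F a b) : a = b := by
  have hT := isTorus_K (n := n) hq hz
  have hc := comulE_comulF (hasRoots_E (n := n) hq hz) (hasNegRoots_F hq hz hq2) hT hq
  have hl := sub_inv_ne_zero hq hq2
  obtain ⟨s, t⟩ := h
  have h₁ := ((hasComul_E hq hz s).mul (hasComul_F hq hz t)).sub
    ((hasComul_F hq hz t).mul (hasComul_E hq hz s))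
  rw [hc s t] at h₁
  rw [← sub_eq_zero]
  split_ifs with hst
  · subst hst
    have h₂ := (((isCharacter_simpleK hq hz s).hasComul.sub
      (isCharacter_simpleKinv hq hz s).hasComul)).smul (q - q⁻¹)⁻¹
    have hk : (cqt hq hz).K s.castSucc * (cqt hq hz).Kinv s.succ =
        simpleK (cqt hq hz).K (cqt hq hz).Kinv s := (hT.inv_comm_left _ _).symm
    have hk' : (cqt hq hz).Kinv s.castSucc * (cqt hq hz).K s.succ =
        simpleKinv (cqt hq hz).K (cqt hq hz).Kinv s := hT.inv_comm_left _ _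
    rw [hk, hk']
    refine eq_zero_of_ev hq (g := _) (g' := _) ?_ (isCharacter_simpleKinv hq hz s)
      (isCharacter_simpleK hq hz s) ?_
    · convert h₁.sub h₂ using 1
      simp only [TensorProduct.tmul_sub, TensorProduct.sub_tmul, TensorProduct.tmul_smul,
        TensorProduct.smul_tmul', smul_sub]
      abel
    · simp only [map_sub, map_smul, map_mul, simpleK, simpleKinv, ev_E, ev_F hq hz hq2, ev_K,
        ev_Kinv, Matrix.diagonal_mul_diagonal, single_mul_single, if_true]
      have hne := (Fin.castSucc_lt_succ (i := s)).ne
      have hz0 := z_ne_zero hq hz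
      ext a b
      simp only [Matrix.sub_apply, Matrix.smul_apply, Matrix.diagonal_apply, Matrix.single_apply,
        Matrix.zero_apply, smul_eq_mul]
      by_cases hab : a = b
      · subst hab
        by_cases h₁ : s.castSucc = a
        · subst h₁
          simp [hne, hne.symm, hl]
          field_simp
          simp
        · by_cases h₂ : s.succ = a
          · subst h₂
            simp [hne, hne.symm, hl]
            field_simp
            simp
          · simp [h₁, h₂, Ne.symm h₁, Ne.symm h₂, hz0]
      · have h₁ : ∀ c, ¬ (c = a ∧ c = b) := fun c h => hab (h.1.symm.trans h.2)
        simp [hab, h₁]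
  · rw [sub_zero]
    refine eq_zero_of_ev hq h₁ (isCharacter_simpleKinv hq hz t) (isCharacter_simpleK hq hz s) ?_
    have hst' : t ≠ s := fun h => hst h.symm
    simp [ev_E, ev_F hq hz hq2, single_mul_single, hst, hst']

end SLq

/-! ### Products of subalgebras -/

section GenSet

variable {R : Type*} {n : ℕ} {K Kinv : Fin (n + 1) → R}

/-- The set of the `K̂_i^{±1}` and the `X_s`. -/
def genSet (K Kinv : Fin (n + 1) → R) (X : Fin n → R) : Set R :=
  Set.range K ∪ Set.range Kinv ∪ Set.range X

theorem K_mem_genSet (X : Fin n → R) (i : Fin (n + 1)) : K i ∈ genSet K Kinv X :=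
  .inl (.inl ⟨i, rfl⟩)

theorem Kinv_mem_genSet (X : Fin n → R) (i : Fin (n + 1)) : Kinv i ∈ genSet K Kinv X :=
  .inl (.inr ⟨i, rfl⟩)

theorem mem_genSet (X : Fin n → R) (s : Fin n) : X s ∈ genSet K Kinv X := .inr ⟨s, rfl⟩

end GenSet

section Exchange

variable {k R : Type*} [Field k] [Ring R] [Algebra k R]

/-- The exchange rule g a = c g + d extends from generators a to all of A, so AB is stable under
left multiplication by A and by the generators of B. Since it contains 1, it contains the algebra
generated by both. -/
theorem toSubmodule_sup_eq_mul {A B : Subalgebra k R} {GA GB : Set R}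
    (hA : A = Algebra.adjoin k GA) (hB : B = Algebra.adjoin k GB)
    (h : ∀ g ∈ GB, ∀ a ∈ GA, ∃ c ∈ A, ∃ d ∈ A, g * a = c * g + d) :
    Subalgebra.toSubmodule (A ⊔ B) = Subalgebra.toSubmodule A * Subalgebra.toSubmodule B := by
  have h₁ : ∀ g ∈ GB, ∀ a ∈ A, ∃ c ∈ A, ∃ d ∈ A, g * a = c * g + d := by
    intro g hg a ha
    rw [hA] at ha
    induction ha using Algebra.adjoin_induction with
    | mem a ha => exact h g hg a ha
    | algebraMap r =>
      exact ⟨algebraMap k R r, A.algebraMap_mem r, 0, A.zero_mem, by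
        rw [add_zero, Algebra.commutes]⟩
    | add a b _ _ ha hb =>
      obtain ⟨c, hc, d, hd, e⟩ := ha
      obtain ⟨c', hc', d', hd', e'⟩ := hb
      exact ⟨c + c', A.add_mem hc hc', d + d', A.add_mem hd hd', by
        rw [mul_add, e, e', add_mul]; abel⟩
    | mul a b _ hbA ha hb =>
      obtain ⟨c, hc, d, hd, e⟩ := ha
      obtain ⟨c', hc', d', hd', e'⟩ := hb
      exact ⟨c * c', A.mul_mem hc hc', c * d' + d * b,
        A.add_mem (A.mul_mem hc hd') (A.mul_mem hd (hA ▸ hbA)), by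
        rw [← mul_assoc, e, add_mul, mul_assoc, e', mul_add, mul_assoc, add_assoc]⟩
  set M := Subalgebra.toSubmodule A * Subalgebra.toSubmodule B with hM
  have hAM : ∀ a ∈ A, ∀ m ∈ M, a * m ∈ M := by
    intro a ha m hm
    induction hm using Submodule.mul_induction_on' with
    | mem_mul_mem a' ha' b hb =>
      rw [← mul_assoc]
      exact Submodule.mul_mem_mul (A.mul_mem ha ha') hb
    | add m _ m' _ h h' => rw [mul_add]; exact M.add_mem h h'
  have hGM : ∀ g ∈ GB, ∀ m ∈ M, g * m ∈ M := by
    intro g hg m hm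
    have hgB : g ∈ B := hB ▸ Algebra.subset_adjoin hg
    induction hm using Submodule.mul_induction_on' with
    | mem_mul_mem a ha b hb =>
      obtain ⟨c, hc, d, hd, e⟩ := h₁ g hg a ha
      rw [← mul_assoc, e, add_mul, mul_assoc]
      exact M.add_mem (Submodule.mul_mem_mul hc (B.mul_mem hgB hb)) (Submodule.mul_mem_mul hd hb)
    | add m _ m' _ h h' => rw [mul_add]; exact M.add_mem h h'
  have h1M : (1 : R) ∈ M := by
    rw [← one_mul (1 : R)]
    exact Submodule.mul_mem_mul A.one_mem B.one_mem
  have hall : ∀ u ∈ A ⊔ B, ∀ m ∈ M, u * m ∈ M := by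
    intro u hu
    rw [hA, hB, ← Algebra.adjoin_union] at hu
    induction hu using Algebra.adjoin_induction with
    | mem a ha =>
      rcases ha with ha | ha
      · exact hAM a (hA ▸ Algebra.subset_adjoin ha)
      · exact hGM a ha
    | algebraMap r => intro m hm; rw [← Algebra.smul_def]; exact M.smul_mem r hm
    | add a b _ _ ha hb => intro m hm; rw [add_mul]; exact M.add_mem (ha m hm) (hb m hm)
    | mul a b _ _ ha hb => intro m hm; rw [mul_assoc]; exact ha _ (hb m hm)
  refine le_antisymm (fun u hu => ?_) (Submodule.mul_le.2 fun a ha b hb => ?_)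
  · rw [← mul_one u]
    exact hall u hu 1 h1M
  · exact (A ⊔ B).mul_mem (le_sup_left (a := A) ha) (le_sup_right (a := A) hb)

variable {n : ℕ} {q : k} {K Kinv : Fin (n + 1) → R} {E F : Fin n → R}

theorem IsTorus.hasWeight_K (hT : IsTorus K Kinv) (i : Fin (n + 1)) : HasWeight q K 0 (K i) :=
  fun j => by simp [hT.comm i j]

theorem IsTorus.hasWeight_Kinv (hT : IsTorus K Kinv) (i : Fin (n + 1)) :
    HasWeight q K 0 (Kinv i) :=
  fun j => by simp [hT.inv_comm_left i j]

theorem exists_hasWeight_of_genSet (hT : IsTorus K Kinv) {X : Fin n → R}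
    (hX : ∀ t, ∃ w, HasWeight q K w (X t)) {g : R} (hg : g ∈ genSet K Kinv X) :
    ∃ w, HasWeight q K w g := by
  rcases hg with (⟨i, rfl⟩ | ⟨i, rfl⟩) | ⟨t, rfl⟩
  · exact ⟨0, hT.hasWeight_K i⟩
  · exact ⟨0, hT.hasWeight_Kinv i⟩
  · exact hX t

theorem exchange_genSet (hq : q ≠ 0) (hT : IsTorus K Kinv) {X Y : Fin n → R}
    (hX : ∀ t, ∃ w, HasWeight q K w (X t)) (hY : ∀ t, ∃ w, HasWeight q K w (Y t))
    (hXY : ∀ s t, Y s * X t - X t * Y s ∈ Algebra.adjoin k (genSet K Kinv X))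
    {g a : R} (hg : g ∈ genSet K Kinv Y) (ha : a ∈ genSet K Kinv X) :
    ∃ c ∈ Algebra.adjoin k (genSet K Kinv X), ∃ d ∈ Algebra.adjoin k (genSet K Kinv X),
      g * a = c * g + d := by
  set A := Algebra.adjoin k (genSet K Kinv X)
  have haA : a ∈ A := Algebra.subset_adjoin ha
  rcases hg with (⟨i, rfl⟩ | ⟨i, rfl⟩) | ⟨s, rfl⟩
  · obtain ⟨w, hw⟩ := exists_hasWeight_of_genSet hT hX ha
    exact ⟨q ^ w i • a, A.smul_mem haA _, 0, A.zero_mem, by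
      rw [hw i, add_zero, smul_mul_assoc]⟩
  · obtain ⟨w, hw⟩ := exists_hasWeight_of_genSet hT hX ha
    exact ⟨q ^ (-w i) • a, A.smul_mem haA _, 0, A.zero_mem, by
      rw [hw.inv_mul hT hq i, add_zero, smul_mul_assoc]⟩
  · obtain ⟨w, hw⟩ := hY s
    rcases ha with (⟨i, rfl⟩ | ⟨i, rfl⟩) | ⟨t, rfl⟩
    · exact ⟨q ^ (-w i) • K i, A.smul_mem haA _, 0, A.zero_mem, by
        rw [add_zero, smul_mul_assoc, hw i, smul_smul, ← zpow_add₀ hq, neg_add_cancel, zpow_zero,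
          one_smul]⟩
    · exact ⟨q ^ w i • Kinv i, A.smul_mem haA _, 0, A.zero_mem, by
        rw [add_zero, smul_mul_assoc, hw.inv_mul hT hq i, smul_smul, ← zpow_add₀ hq,
          add_neg_cancel, zpow_zero, one_smul]⟩
    · exact ⟨X t, haA, Y s * X t - X t * Y s, hXY s t, by abel⟩

theorem commutator_mem (hEF : ∀ a b, EFRel q K Kinv E F a b → a = b) (s t : Fin n)
    {U : Subalgebra k R} (hK : ∀ i, K i ∈ U) (hKinv : ∀ i, Kinv i ∈ U) :
    E s * F t - F t * E s ∈ U := by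
  rw [hEF _ _ (.mk s t)]
  split_ifs
  · exact U.smul_mem (U.sub_mem (U.mul_mem (hK _) (hKinv _)) (U.mul_mem (hKinv _) (hK _))) _
  · exact U.zero_mem

/-- The product decomposition, with the `F_s` on the left. -/
theorem adjoin_sup_eq_mul (hq : q ≠ 0) (hT : IsTorus K Kinv) (hE : HasRoots q K E)
    (hF : HasNegRoots q K F) (hEF : ∀ a b, EFRel q K Kinv E F a b → a = b) :
    Subalgebra.toSubmodule (Algebra.adjoin k (genSet K Kinv F) ⊔
        Algebra.adjoin k (genSet K Kinv E)) =
      Subalgebra.toSubmodule (Algebra.adjoin k (genSet K Kinv F)) *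
        Subalgebra.toSubmodule (Algebra.adjoin k (genSet K Kinv E)) :=
  toSubmodule_sup_eq_mul rfl rfl fun g hg a ha => exchange_genSet hq hT
    (fun t => ⟨_, hF t⟩) (fun t => ⟨_, hE t⟩) (fun s t => commutator_mem hEF s t
      (fun i => Algebra.subset_adjoin (K_mem_genSet F i))
      fun i => Algebra.subset_adjoin (Kinv_mem_genSet F i)) hg ha

/-- The product decomposition, with the `E_s` on the left. -/
theorem adjoin_sup_eq_mul' (hq : q ≠ 0) (hT : IsTorus K Kinv) (hE : HasRoots q K E)
    (hF : HasNegRoots q K F) (hEF : ∀ a b, EFRel q K Kinv E F a b → a = b) :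
    Subalgebra.toSubmodule (Algebra.adjoin k (genSet K Kinv E) ⊔
        Algebra.adjoin k (genSet K Kinv F)) =
      Subalgebra.toSubmodule (Algebra.adjoin k (genSet K Kinv E)) *
        Subalgebra.toSubmodule (Algebra.adjoin k (genSet K Kinv F)) :=
  toSubmodule_sup_eq_mul rfl rfl fun g hg a ha => exchange_genSet hq hT
    (fun t => ⟨_, hE t⟩) (fun t => ⟨_, hF t⟩) (fun s t => by
      rw [← neg_sub]
      exact neg_mem (commutator_mem hEF t s
        (fun i => Algebra.subset_adjoin (K_mem_genSet E i))
        fun i => Algebra.subset_adjoin (Kinv_mem_genSet E i))) hg ha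

theorem exists_prod_eq_mul {U : Subalgebra k R} {a : R} (L : List R) (hL : ∀ b ∈ L, b ∈ U)
    (hc : ∀ b ∈ L, b * a = a * b) (ha : a ∈ L) : ∃ b ∈ U, L.prod = a * b := by
  induction L with
  | nil => simp at ha
  | cons c L ih =>
    rw [List.prod_cons]
    by_cases hca : c = a
    · exact ⟨L.prod, list_prod_mem fun b hb => hL b (by simp [hb]), by rw [hca]⟩
    · obtain ⟨b, hb, e⟩ := ih (fun b hb => hL b (by simp [hb])) (fun b hb => hc b (by simp [hb]))
        ((List.mem_cons.1 ha).resolve_left (Ne.symm hca))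
      exact ⟨c * b, U.mul_mem (hL c (by simp)) hb, by
        rw [e, ← mul_assoc, hc c (by simp), mul_assoc]⟩

/-- As K̂_1 ⋯ K̂_N = 1 and the factors commute, K̂_i⁻¹ is the product of the others. This puts the
inverses into H_l and H_r, which are given only as sets of forms l_h and r_h. -/
theorem IsTorus.Kinv_mem (hT : IsTorus K Kinv) {U : Subalgebra k R} (hK : ∀ i, K i ∈ U)
    (i : Fin (n + 1)) : Kinv i ∈ U := by
  obtain ⟨b, hb, e⟩ := exists_prod_eq_mul (U := U) (a := K i) (List.ofFn K)
    (fun b hb => by obtain ⟨j, rfl⟩ := (List.mem_ofFn' _ _).1 hb; exact hK j)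
    (fun b hb => by obtain ⟨j, rfl⟩ := (List.mem_ofFn' _ _).1 hb; exact hT.comm j i)
    ((List.mem_ofFn' _ _).2 ⟨i, rfl⟩)
  rw [hT.prod] at e
  rwa [left_inv_eq_right_inv (hT.inv_mul i) e.symm]

end Exchange

/-! ### Generators of H_l, H_r and H_σ, and the product decomposition. -/

namespace SLq

variable {k : Type*} [Field k] {n : ℕ} {q z : k} (hq : q ≠ 0) (hz : z ^ (n + 1) = q⁻¹)

/-- With m = j + 1 strictly between j and i, the cross relation gives (q - q⁻¹) l_{ij} K̂_m as the
commutator of l_{mj} and l_{im}, both closer to the diagonal. As q² ≠ 1, l_{ij} is recovered; the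
entries next to the diagonal are K̂_{s+1} E_s, and those above it vanish. -/
theorem Hl_eq (hq2 : q ^ 2 ≠ 1) : (cqt (n := n) hq hz).Hl =
    Algebra.adjoin k (genSet (cqt hq hz).K (cqt hq hz).Kinv (cqt hq hz).E) := by
  have hT := isTorus_K (n := n) hq hz
  have hl := sub_inv_ne_zero hq hq2
  refine le_antisymm ?_ (Algebra.adjoin_le ?_)
  · set U := Algebra.adjoin k (genSet (cqt hq hz).K (cqt hq hz).Kinv (cqt hq hz).E)
    have hK : ∀ i, (cqt hq hz).K i ∈ U := fun i => Algebra.subset_adjoin (K_mem_genSet _ i)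
    have hKinv : ∀ i, (cqt hq hz).Kinv i ∈ U := fun i =>
      Algebra.subset_adjoin (Kinv_mem_genSet _ i)
    have hE : ∀ s, (cqt hq hz).E s ∈ U := fun s => Algebra.subset_adjoin (mem_genSet _ s)
    have key : ∀ (d : ℕ) (i j : Fin (n + 1)), (i : ℕ) ≤ j + d → lMatrix hq hz i j ∈ U := by
      intro d
      induction d with
      | zero =>
        intro i j hij
        rcases (show i ≤ j from hij).eq_or_lt with rfl | h
        · exact hK i
        · rw [lMatrix_eq_zero hq hz h]
          exact U.zero_mem
      | succ d ih =>
        intro i j hij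
        rcases hij.lt_or_eq with h | h
        · exact ih i j (by omega)
        rcases Nat.eq_zero_or_pos d with rfl | hd
        · have hj : (j : ℕ) < n := by have := i.2; omega
          have h₁ : i = (⟨j, hj⟩ : Fin n).succ := Fin.ext (by simpa using h)
          rw [h₁]
          change lMatrix hq hz _ (⟨j, hj⟩ : Fin n).castSucc ∈ U
          have := U.mul_mem (hK (⟨j, hj⟩ : Fin n).succ) (hE ⟨j, hj⟩)
          rwa [E_eq, ← mul_assoc, hT.mul_inv, one_mul] at this
        · have hm : (j : ℕ) + 1 < n + 1 := by have := i.2; omega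
          set m : Fin (n + 1) := ⟨j + 1, hm⟩
          have hjm : j < m := by rw [Fin.lt_def]; simp [m]
          have hmi : m < i := by rw [Fin.lt_def]; simp [m]; omega
          -- The map l reverses products, so the relation is read backwards from here on.
          have hx := congrArg (cqt hq hz).l ((isQuantum n q).cross m i j m hmi hjm)
          rw [map_sub, map_smul, CQT.l_mul, CQT.l_mul, CQT.l_mul] at hx
          have hmem : lMatrix hq hz m j * lMatrix hq hz i m - lMatrix hq hz i m * lMatrix hq hz m j
              ∈ U := U.sub_mem (U.mul_mem (ih m j (by simp [m]; omega)) (ih i m (by simp [m]; omega)))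
                (U.mul_mem (ih i m (by simp [m]; omega)) (ih m j (by simp [m]; omega)))
          have e : lMatrix hq hz i j = (q - q⁻¹)⁻¹ • ((lMatrix hq hz m j * lMatrix hq hz i m -
              lMatrix hq hz i m * lMatrix hq hz m j) * (cqt hq hz).Kinv m) := by
            simp only [lMatrix, hx]
            rw [smul_mul_assoc, smul_smul, inv_mul_cancel₀ hl, one_smul, mul_assoc]
            change _ = _ * ((cqt hq hz).K m * _)
            rw [hT.mul_inv, mul_one]
          rw [e]
          exact U.smul_mem (U.mul_mem hmem (hKinv m)) _
    rintro _ ⟨a, rfl⟩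
    have ha : a ∈ Algebra.adjoin k _ := adjoin_x n q ▸ Algebra.mem_top
    change (cqt hq hz).l a ∈ U
    induction ha using Algebra.adjoin_induction with
    | mem a ha =>
      obtain ⟨⟨i, j⟩, rfl⟩ := ha
      exact key n i j (by have := i.2; omega)
    | algebraMap r =>
      rw [Algebra.algebraMap_eq_smul_one, ← CQT.algebraMap_eq_l]
      exact U.algebraMap_mem r
    | add a b _ _ ha hb => rw [map_add]; exact U.add_mem ha hb
    | mul a b _ _ ha hb => rw [CQT.l_mul]; exact U.mul_mem hb ha
  · have hK : ∀ i, (cqt hq hz).K i ∈ (cqt hq hz).Hl := fun i => ⟨_, rfl⟩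
    rintro _ ((⟨i, rfl⟩ | ⟨i, rfl⟩) | ⟨s, rfl⟩)
    · exact hK i
    · exact hT.Kinv_mem hK i
    · exact mul_mem (hT.Kinv_mem hK _) ⟨_, rfl⟩

theorem Hr_eq (hq2 : q ^ 2 ≠ 1) : (cqt (n := n) hq hz).Hr =
    Algebra.adjoin k (genSet (cqt hq hz).K (cqt hq hz).Kinv (cqt hq hz).F) := by
  have hT := isTorus_K (n := n) hq hz
  have hl := sub_inv_ne_zero hq hq2
  refine le_antisymm ?_ (Algebra.adjoin_le ?_)
  · set U := Algebra.adjoin k (genSet (cqt hq hz).K (cqt hq hz).Kinv (cqt hq hz).F)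
    have hK : ∀ i, (cqt hq hz).K i ∈ U := fun i => Algebra.subset_adjoin (K_mem_genSet _ i)
    have hKinv : ∀ i, (cqt hq hz).Kinv i ∈ U := fun i =>
      Algebra.subset_adjoin (Kinv_mem_genSet _ i)
    have hF : ∀ s, (cqt hq hz).F s ∈ U := fun s => Algebra.subset_adjoin (mem_genSet _ s)
    have key : ∀ (d : ℕ) (i j : Fin (n + 1)), (j : ℕ) ≤ i + d → rMatrix hq hz i j ∈ U := by
      intro d
      induction d with
      | zero =>
        intro i j hij
        rcases (show j ≤ i from hij).eq_or_lt with rfl | h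
        · rw [rMatrix_diag]
          exact hK j
        · rw [rMatrix_eq_zero hq hz h]
          exact U.zero_mem
      | succ d ih =>
        intro i j hij
        rcases hij.lt_or_eq with h | h
        · exact ih i j (by omega)
        rcases Nat.eq_zero_or_pos d with rfl | hd
        · have hi : (i : ℕ) < n := by have := j.2; omega
          have h₁ : j = (⟨i, hi⟩ : Fin n).succ := Fin.ext (by simpa using h)
          rw [h₁]
          change rMatrix hq hz (⟨i, hi⟩ : Fin n).castSucc _ ∈ U
          have := U.smul_mem (U.mul_mem (hK (⟨i, hi⟩ : Fin n).castSucc) (hF ⟨i, hi⟩))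
            ((q - q⁻¹) ^ 2)
          rwa [F_eq, mul_smul_comm, smul_smul, mul_inv_cancel₀ (pow_ne_zero 2 hl), one_smul,
            ← mul_assoc, hT.mul_inv, one_mul] at this
        · have hm : (i : ℕ) + 1 < n + 1 := by have := j.2; omega
          set m : Fin (n + 1) := ⟨i + 1, hm⟩
          have him : i < m := by rw [Fin.lt_def]; simp [m]
          have hmj : m < j := by rw [Fin.lt_def]; simp [m]; omega
          have hx := (isRTT_rMatrix hq hz).isQuantum.cross i m m j him hmj
          have hmem : rMatrix hq hz m j * rMatrix hq hz i m - rMatrix hq hz i m * rMatrix hq hz m j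
              ∈ U := U.sub_mem (U.mul_mem (ih m j (by simp [m]; omega)) (ih i m (by simp [m]; omega)))
                (U.mul_mem (ih i m (by simp [m]; omega)) (ih m j (by simp [m]; omega)))
          have e : rMatrix hq hz i j = (q - q⁻¹)⁻¹ • ((rMatrix hq hz m j * rMatrix hq hz i m -
              rMatrix hq hz i m * rMatrix hq hz m j) * (cqt hq hz).Kinv m) := by
            rw [hx, smul_mul_assoc, smul_smul, inv_mul_cancel₀ hl, one_smul, mul_assoc,
              rMatrix_diag, hT.mul_inv, mul_one]
          rw [e]
          exact U.smul_mem (U.mul_mem hmem (hKinv m)) _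
    rintro _ ⟨a, rfl⟩
    have ha : a ∈ Algebra.adjoin k _ := adjoin_x n q ▸ Algebra.mem_top
    change (cqt hq hz).r a ∈ U
    induction ha using Algebra.adjoin_induction with
    | mem a ha =>
      obtain ⟨⟨i, j⟩, rfl⟩ := ha
      simp only [r_x]
      exact key n i j (by have := j.2; omega)
    | algebraMap r =>
      rw [Algebra.algebraMap_eq_smul_one, ← CQT.algebraMap_eq_r]
      exact U.algebraMap_mem r
    | add a b _ _ ha hb => rw [map_add]; exact U.add_mem ha hb
    | mul a b _ _ ha hb => rw [CQT.r_mul]; exact U.mul_mem ha hb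
  · have hK : ∀ i, (cqt hq hz).K i ∈ (cqt hq hz).Hr := fun i =>
      ⟨x n q i i, by rw [r_x, rMatrix_diag]⟩
    rintro _ ((⟨i, rfl⟩ | ⟨i, rfl⟩) | ⟨s, rfl⟩)
    · exact hK i
    · exact hT.Kinv_mem hK i
    · rw [F_eq]
      exact Subalgebra.smul_mem _ (mul_mem (hT.Kinv_mem hK _) ⟨_, r_x hq hz _ _⟩) _

theorem Hsigma_eq (hq2 : q ^ 2 ≠ 1) : (cqt (n := n) hq hz).Hsigma =
    Algebra.adjoin k (genSet (cqt hq hz).K (cqt hq hz).Kinv (cqt hq hz).E ∪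
      Set.range (cqt hq hz).F) := by
  rw [CQT.Hsigma, Hl_eq hq hz hq2, Hr_eq hq hz hq2, ← Algebra.adjoin_union]
  congr 1
  simp only [genSet]
  ext f
  simp only [Set.mem_union]
  tauto

theorem Hsigma_eq_mul (hq2 : q ^ 2 ≠ 1) : Subalgebra.toSubmodule (cqt (n := n) hq hz).Hsigma =
    Subalgebra.toSubmodule (cqt hq hz).Hl * Subalgebra.toSubmodule (cqt hq hz).Hr := by
  rw [CQT.Hsigma, Hl_eq hq hz hq2, Hr_eq hq hz hq2]
  exact adjoin_sup_eq_mul' hq (isTorus_K hq hz) (hasRoots_E hq hz) (hasNegRoots_F hq hz hq2)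
    (EF_rel hq hz hq2)

theorem Hsigma_eq_mul' (hq2 : q ^ 2 ≠ 1) : Subalgebra.toSubmodule (cqt (n := n) hq hz).Hsigma =
    Subalgebra.toSubmodule (cqt hq hz).Hr * Subalgebra.toSubmodule (cqt hq hz).Hl := by
  rw [CQT.Hsigma, sup_comm, Hl_eq hq hz hq2, Hr_eq hq hz hq2]
  exact adjoin_sup_eq_mul hq (isTorus_K hq hz) (hasRoots_E hq hz) (hasNegRoots_F hq hz hq2)
    (EF_rel hq hz hq2)

end SLq

namespace HopfStructure

variable {k A B : Type*} [Field k] [Ring A] [Algebra k A] [Ring B] [Algebra k B]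

theorem IsHom.of_adjoin {DA : HopfStructure k A} {DB : HopfStructure k B} {f : A →ₐ[k] B}
    {G : Set A} (hG : Algebra.adjoin k G = ⊤)
    (h₁ : ∀ g ∈ G, DB.Δ (f g) = Algebra.TensorProduct.map f f (DA.Δ g))
    (h₂ : ∀ g ∈ G, DB.ε (f g) = DA.ε g) (h₃ : ∀ g ∈ G, DB.S (f g) = f (DA.S g)) :
    DA.IsHom DB f where
  map_comul a := AlgHom.congr_fun (AlgHom.ext_of_adjoin_eq_top
    (φ₁ := DB.Δ.comp f) (φ₂ := (Algebra.TensorProduct.map f f).comp DA.Δ) hG h₁) a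
  map_counit a := AlgHom.congr_fun (AlgHom.ext_of_adjoin_eq_top
    (φ₁ := DB.ε.comp f) (φ₂ := DA.ε) hG h₂) a
  map_antipode a := by
    have ha : a ∈ Algebra.adjoin k G := hG ▸ Algebra.mem_top
    induction ha using Algebra.adjoin_induction with
    | mem a ha => exact h₃ a ha
    | algebraMap r =>
      simp only [Algebra.algebraMap_eq_smul_one, map_smul, map_one, S_one]
    | add a b _ _ ha hb => simp only [map_add, ha, hb]
    | mul a b _ _ ha hb => simp only [map_mul, S_mul, ha, hb]

end HopfStructure

/-! ### Counit, antipode and coproduct on generators; sub-Hopf algebras of the finite dual. -/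

namespace SLq

variable {k : Type*} [Field k] {n : ℕ} {q z : k} (hq : q ≠ 0) (hz : z ^ (n + 1) = q⁻¹)

theorem form_E_one (s : Fin n) : (hopf hq).form ((cqt hq hz).E s) 1 = 0 := by
  rw [E_eq, HopfStructure.form_mul_one, (isRep_lMatrix hq hz).one,
    if_neg (Fin.castSucc_lt_succ (i := s)).ne, mul_zero]

theorem form_F_one (s : Fin n) : (hopf hq).form ((cqt hq hz).F s) 1 = 0 := by
  rw [F_eq, map_smul, LinearMap.smul_apply, HopfStructure.form_mul_one, (isRep_rMatrix hq hz).one,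
    if_neg (Fin.castSucc_lt_succ (i := s)).ne, mul_zero, smul_zero]

theorem dualS_Kinv (i : Fin (n + 1)) : (hopf hq).dualS ((cqt hq hz).Kinv i) = (cqt hq hz).K i :=
  left_inv_eq_right_inv (isCharacter_Kinv hq hz i).dualS_mul_self ((isTorus_K hq hz).inv_mul i)

theorem dualS_E (s : Fin n) : (hopf hq).dualS ((cqt hq hz).E s) =
    -((cqt hq hz).E s * simpleKinv (cqt hq hz).K (cqt hq hz).Kinv s) := by
  have h := HopfStructure.dualS_of_skew (hasComul_E hq hz s) (form_E_one hq hz s)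
  have h1 : (hopf (n := n) hq).dualS 1 = 1 := by
    simpa using HopfStructure.dualS_algebraMap (D := hopf (n := n) hq) 1
  rw [h1, one_mul] at h
  have h' := congrArg (· * simpleKinv (cqt hq hz).K (cqt hq hz).Kinv s) h
  simp only [add_mul, mul_assoc, simpleK_mul_inv (isTorus_K hq hz), mul_one, zero_mul] at h'
  exact eq_neg_of_add_eq_zero_right h'

theorem dualS_F (s : Fin n) : (hopf hq).dualS ((cqt hq hz).F s) =
    -(simpleK (cqt hq hz).K (cqt hq hz).Kinv s * (cqt hq hz).F s) := by
  have hc := hasComul_F hq hz s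
  rw [comulF, add_comm] at hc
  have h := HopfStructure.dualS_of_skew hc (form_F_one hq hz s)
  rw [mul_one, left_inv_eq_right_inv (isCharacter_simpleKinv hq hz s).dualS_mul_self
    (simpleKinv_mul (isTorus_K hq hz) s)] at h
  exact eq_neg_of_add_eq_zero_right h

theorem isCoefficient_E (s : Fin n) : (hopf hq).IsCoefficient ((cqt hq hz).E s) :=
  (isCharacter_Kinv hq hz _).isCoefficient.mul ((isRep_lMatrix hq hz).isCoefficient _ _)

theorem isCoefficient_F (s : Fin n) : (hopf hq).IsCoefficient ((cqt hq hz).F s) := by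
  rw [F_eq]
  exact ((isCharacter_Kinv hq hz _).isCoefficient.mul
    ((isRep_rMatrix hq hz).isCoefficient _ _)).smul _

section Sub

variable {U : Subalgebra k (hopf (n := n) hq).Dual} (hK : ∀ i, (cqt hq hz).K i ∈ U)
  (hKinv : ∀ i, (cqt hq hz).Kinv i ∈ U)

theorem isCoproduct_K (i : Fin (n + 1)) : (hopf hq).IsCoproduct U ((cqt hq hz).K i)
    ((⟨_, hK i⟩ : U) ⊗ₜ (⟨_, hK i⟩ : U)) :=
  HopfStructure.isCoproduct_iff.2 (isCharacter_K hq hz i).hasComul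

theorem isCoproduct_Kinv (i : Fin (n + 1)) : (hopf hq).IsCoproduct U ((cqt hq hz).Kinv i)
    ((⟨_, hKinv i⟩ : U) ⊗ₜ (⟨_, hKinv i⟩ : U)) :=
  HopfStructure.isCoproduct_iff.2 (isCharacter_Kinv hq hz i).hasComul

theorem isCoproduct_E {s : Fin n} (hE : (cqt hq hz).E s ∈ U) :
    (hopf hq).IsCoproduct U ((cqt hq hz).E s)
      ((1 : U) ⊗ₜ (⟨_, hE⟩ : U) + (⟨_, hE⟩ : U) ⊗ₜ
        ((⟨_, hKinv s.succ⟩ : U) * (⟨_, hK s.castSucc⟩ : U))) :=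
  HopfStructure.isCoproduct_iff.2 (by
    rw [map_add]
    exact hasComul_E hq hz s)

theorem isCoproduct_F {s : Fin n} (hF : (cqt hq hz).F s ∈ U) :
    (hopf hq).IsCoproduct U ((cqt hq hz).F s)
      ((⟨_, hF⟩ : U) ⊗ₜ (1 : U) + ((⟨_, hK s.succ⟩ : U) * (⟨_, hKinv s.castSucc⟩ : U)) ⊗ₜ
        (⟨_, hF⟩ : U)) :=
  HopfStructure.isCoproduct_iff.2 (by
    rw [map_add]
    exact hasComul_F hq hz s)

theorem exists_isSubHopf (hK : ∀ i, (cqt hq hz).K i ∈ U) (hKinv : ∀ i, (cqt hq hz).Kinv i ∈ U)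
    {G : Set (hopf (n := n) hq).Dual} (hU : U = Algebra.adjoin k G)
    (hG : G ⊆ genSet (cqt hq hz).K (cqt hq hz).Kinv (cqt hq hz).E ∪ Set.range (cqt hq hz).F) :
    ∃ DU : HopfStructure k U, (hopf hq).IsSubHopf U DU := by
  have hGU : ∀ g ∈ G, g ∈ U := fun g hg => hU ▸ Algebra.subset_adjoin hg
  have hΔ := (hopf hq).exists_isCoproduct_of_adjoin hU fun g hg => by
    have hgU := hGU g hg
    rcases hG hg with ((⟨i, rfl⟩ | ⟨i, rfl⟩) | ⟨s, rfl⟩) | ⟨s, rfl⟩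
    · exact ⟨_, isCoproduct_K hq hz hK i⟩
    · exact ⟨_, isCoproduct_Kinv hq hz hKinv i⟩
    · exact ⟨_, isCoproduct_E hq hz hK hKinv hgU⟩
    · exact ⟨_, isCoproduct_F hq hz hK hKinv hgU⟩
  have hS := HopfStructure.dualS_mem_of_adjoin (isCorep hq) (adjoin_x n q) hU fun g hg => by
    have hgU := hGU g hg
    rcases hG hg with ((⟨i, rfl⟩ | ⟨i, rfl⟩) | ⟨s, rfl⟩) | ⟨s, rfl⟩
    · exact hKinv i
    · rw [dualS_Kinv]
      exact hK i
    · rw [dualS_E]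
      exact neg_mem (mul_mem hgU (mul_mem (hK _) (hKinv _)))
    · rw [dualS_F]
      exact neg_mem (mul_mem (mul_mem (hKinv _) (hK _)) hgU)
  refine ⟨_, (hopf hq).isSubHopf_subHopf hΔ hS ?_⟩
  rw [hU]
  refine HopfStructure.adjoin_subset_finiteDual fun g hg => ?_
  rcases hG hg with ((⟨i, rfl⟩ | ⟨i, rfl⟩) | ⟨s, rfl⟩) | ⟨s, rfl⟩
  · exact (isCharacter_K hq hz i).isCoefficient
  · exact (isCharacter_Kinv hq hz i).isCoefficient
  · exact isCoefficient_E hq hz s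
  · exact isCoefficient_F hq hz s

variable {DU : HopfStructure k U}

/-- The formulas hold for any Hopf structure on U compatible with H^0: a coproduct is determined by
its values, and counit and antipode are prescribed by theirs. -/
theorem torusHopf_sub (h : (hopf hq).IsSubHopf U DU) :
    TorusHopf DU (fun i => (⟨_, hK i⟩ : U)) fun i => (⟨_, hKinv i⟩ : U) where
  comul_K i := (isCoproduct_K hq hz hK i).unique (h.comul ⟨_, hK i⟩) |>.symm
  comul_Kinv i := (isCoproduct_Kinv hq hz hKinv i).unique (h.comul ⟨_, hKinv i⟩) |>.symm
  counit_K i := (h.counit _).trans (isCharacter_K hq hz i).one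
  counit_Kinv i := (h.counit _).trans (isCharacter_Kinv hq hz i).one
  antipode_K i := Subtype.ext ((hopf hq).form_injective (LinearMap.ext fun a => h.antipode _ a))
  antipode_Kinv i := Subtype.ext ((hopf hq).form_injective (LinearMap.ext fun a => by
    rw [h.antipode, ← HopfStructure.form_dualS, dualS_Kinv]))

theorem eHopf_sub (h : (hopf hq).IsSubHopf U DU) (hE : ∀ s, (cqt hq hz).E s ∈ U) :
    EHopf DU (fun i => (⟨_, hK i⟩ : U)) (fun i => (⟨_, hKinv i⟩ : U))
      fun s => (⟨_, hE s⟩ : U) where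
  comul s := (isCoproduct_E hq hz hK hKinv (hE s)).unique (h.comul ⟨_, hE s⟩) |>.symm
  counit s := (h.counit _).trans (form_E_one hq hz s)
  antipode s := Subtype.ext ((hopf hq).form_injective (LinearMap.ext fun a => by
    rw [h.antipode, ← HopfStructure.form_dualS, dualS_E, simpleKinv,
      ← (isTorus_K hq hz).inv_comm_left, ← mul_assoc]
    rfl))

theorem fHopf_sub (h : (hopf hq).IsSubHopf U DU) (hF : ∀ s, (cqt hq hz).F s ∈ U) :
    FHopf DU (fun i => (⟨_, hK i⟩ : U)) (fun i => (⟨_, hKinv i⟩ : U))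
      fun s => (⟨_, hF s⟩ : U) where
  comul s := (isCoproduct_F hq hz hK hKinv (hF s)).unique (h.comul ⟨_, hF s⟩) |>.symm
  counit s := (h.counit _).trans (form_F_one hq hz s)
  antipode s := Subtype.ext ((hopf hq).form_injective (LinearMap.ext fun a => by
    rw [h.antipode, ← HopfStructure.form_dualS, dualS_F, simpleK,
      (isTorus_K hq hz).inv_comm_left]
    rfl))

end Sub

end SLq

/-! ### The Hopf structures of the presented algebras -/

section OppositeRelations

variable {k A : Type*} [Field k] [Ring A] [Algebra k A] {n : ℕ} {q : k}
  {K Kinv : Fin (n + 1) → A} {E F : Fin n → A}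

theorem prod_mul_reverse_prod {ι : Type*} {f g : ι → A} (h : ∀ i, f i * g i = 1) (L : List ι) :
    (L.map f).prod * (L.map g).reverse.prod = 1 := by
  induction L with
  | nil => simp
  | cons a L ih =>
    simp only [List.map_cons, List.prod_cons, List.reverse_cons, List.prod_append, List.prod_nil,
      mul_one]
    rw [mul_assoc, ← mul_assoc _ _ (g a), ih, one_mul, h]

theorem IsTorus.op (hT : IsTorus K Kinv) :
    IsTorus (fun i => MulOpposite.op (Kinv i)) fun i => MulOpposite.op (K i) := by
  intro a b hab
  cases hab with
  | comm i j => rw [← MulOpposite.op_mul, ← MulOpposite.op_mul, hT.inv_comm]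
  | mul_inv i => rw [← MulOpposite.op_mul, hT.mul_inv, MulOpposite.op_one]
  | inv_mul i => rw [← MulOpposite.op_mul, hT.inv_mul, MulOpposite.op_one]
  | prod =>
    apply MulOpposite.unop_injective
    rw [MulOpposite.unop_list_prod, List.map_ofFn, MulOpposite.unop_one]
    -- Over the opposite algebra the inverses are multiplied in reverse order, which is the inverse
    -- of K̂_1 ⋯ K̂_N.
    have h := prod_mul_reverse_prod hT.mul_inv (List.finRange (n + 1))
    rw [← List.ofFn_eq_map, ← List.ofFn_eq_map, hT.prod, one_mul] at h
    exact h

theorem HasWeight.op (hT : IsTorus K Kinv) (hq : q ≠ 0) {w : Fin (n + 1) → ℤ} {X : A}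
    (hX : HasWeight q K w X) :
    HasWeight q (fun i => MulOpposite.op (Kinv i)) w (MulOpposite.op X) := fun i => by
  rw [← MulOpposite.op_mul, ← MulOpposite.op_mul, hX.inv_mul hT hq, MulOpposite.op_smul, smul_smul,
    ← zpow_add₀ hq, add_neg_cancel, zpow_zero, one_smul]

theorem HasWeight.neg {w : Fin (n + 1) → ℤ} {X : A} (hX : HasWeight q K w X) :
    HasWeight q K w (-X) := fun i => by
  rw [mul_neg, hX i, neg_mul, smul_neg]

/-- `S(E_s)` -/
def antipodeE (K Kinv : Fin (n + 1) → A) (E : Fin n → A) (s : Fin n) : A :=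
  -(E s * simpleKinv K Kinv s)

/-- `S(F_s)` -/
def antipodeF (K Kinv : Fin (n + 1) → A) (F : Fin n → A) (s : Fin n) : A :=
  -(simpleK K Kinv s * F s)

theorem serrePoly_neg (a b : A) : serrePoly q (-a) (-b) = -serrePoly q a b := by
  simp only [serrePoly, neg_sq, mul_neg, neg_mul, neg_neg, smul_neg]
  abel

theorem serrePoly_smul (c d : k) (a b : A) :
    serrePoly q (c • a) (d • b) = (c ^ 2 * d) • serrePoly q a b := by
  simp only [serrePoly, pow_two, smul_mul_assoc, mul_smul_comm, smul_smul, smul_add, smul_sub]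
  match_scalars <;> ring

theorem qcomm_mul_mul {a u a' u' : A} {c : k} (hc : c ≠ 0) (h₁ : u * a' = c • (a' * u))
    (h₂ : u' * a = c • (a * u')) (h₃ : a * a' = a' * a) (h₄ : u * u' = u' * u) :
    a * u * (a' * u') = a' * u' * (a * u) := by
  rw [mul_assoc, ← mul_assoc u, h₁, mul_assoc a', ← mul_assoc u', h₂]
  simp only [smul_mul_assoc, mul_smul_comm, mul_assoc, h₄]
  rw [← mul_assoc, h₃, mul_assoc]

theorem ERel.op (hT : IsTorus K Kinv) (hq : q ≠ 0) (hE : ∀ a b, ERel q K Kinv E a b → a = b) :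
    ∀ a b, ERel q (fun i => MulOpposite.op (Kinv i)) (fun i => MulOpposite.op (K i))
      (fun s => MulOpposite.op (antipodeE K Kinv E s)) a b → a = b := by
  obtain ⟨hR, hc, hs⟩ := (ERel_iff hT).1 hE
  refine (ERel_iff hT.op).2 ⟨fun t => ?_, fun s t hst => ?_, fun s t hst => ?_⟩
  · have h := (hR t).mul hq (hT.hasWeight_simpleKinv (q := q) t)
    rw [add_zero] at h
    exact h.neg.op hT hq
  · have h₁ := hR.simpleKinv_mul hT hq s t
    have h₂ := hR.simpleKinv_mul hT hq t s
    rw [cartan_comm t s] at h₂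
    rw [← MulOpposite.op_mul, ← MulOpposite.op_mul, antipodeE, antipodeE, neg_mul_neg, neg_mul_neg,
      qcomm_mul_mul (zpow_ne_zero _ hq) h₁ h₂ (hc s t hst).symm (hT.simpleKinv_simpleKinv s t)]
  · have h₁ := hR.simpleKinv_mul hT hq s s
    have h₂ := hR.simpleKinv_mul hT hq s t
    have h₃ := hR.simpleKinv_mul hT hq t s
    rw [cartan_comm t s] at h₃
    rw [cartan_adj hst, neg_neg, zpow_one] at h₂ h₃
    rw [cartan_self, zpow_neg, zpow_ofNat] at h₁
    rw [← op_serrePoly, antipodeE, antipodeE, serrePoly_neg,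
      serrePoly_mul hq h₁ h₂ h₃ (hT.simpleKinv_simpleKinv s t), hs s t hst, zero_mul, neg_zero,
      MulOpposite.op_zero]

theorem FRel.op (hT : IsTorus K Kinv) (hq : q ≠ 0) (hF : ∀ a b, FRel q K Kinv F a b → a = b) :
    ∀ a b, FRel q (fun i => MulOpposite.op (Kinv i)) (fun i => MulOpposite.op (K i))
      (fun s => MulOpposite.op (antipodeF K Kinv F s)) a b → a = b := by
  obtain ⟨hR, hc, hs⟩ := (FRel_iff hT).1 hF
  refine (FRel_iff hT.op).2 ⟨fun t => ?_, fun s t hst => ?_, fun s t hst => ?_⟩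
  · have h := (hT.hasWeight_simpleK (q := q) t).mul hq (hR t)
    rw [zero_add] at h
    exact h.neg.op hT hq
  · have h₁ := hR.simpleK_mul hT hq s t
    have h₂ := hR.simpleK_mul hT hq t s
    rw [cartan_comm t s] at h₂
    rw [← MulOpposite.op_mul, ← MulOpposite.op_mul, antipodeF, antipodeF, neg_mul_neg, neg_mul_neg,
      hR.simpleK_mul hT hq s s, hR.simpleK_mul hT hq t t, smul_mul_smul_comm, smul_mul_smul_comm,
      qcomm_mul_mul (zpow_ne_zero _ hq) h₁ h₂ (hc s t hst).symm (hT.simpleK_simpleK s t), mul_comm]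
  · have h₁ := hR.simpleK_mul hT hq s s
    have h₂ := hR.simpleK_mul hT hq s t
    have h₃ := hR.simpleK_mul hT hq t s
    have h₄ := hR.simpleK_mul hT hq t t
    rw [cartan_comm t s] at h₃
    rw [cartan_adj hst, neg_neg, zpow_one] at h₂ h₃
    -- `serrePoly_mul` expects the torus factor on the right, so k_s F_s is first rewritten as a
    -- scalar multiple of F_s k_s, and the scalars are taken out.
    rw [← op_serrePoly, antipodeF, antipodeF, serrePoly_neg, h₁, h₄, serrePoly_smul]
    rw [cartan_self, zpow_neg, zpow_ofNat] at h₁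
    rw [serrePoly_mul hq h₁ h₂ h₃ (hT.simpleK_simpleK s t), hs s t hst, zero_mul, smul_zero,
      neg_zero, MulOpposite.op_zero]

/-- Over the opposite algebra the commutator of the antipodes is, up to sign, the commutator of E_s
and F_t enclosed between k_t and k_s⁻¹. For s = t these cancel against k_s - k_s⁻¹, leaving the same
relation with K̂ replaced by its inverse. -/
theorem EFRel.op (hT : IsTorus K Kinv) (hq : q ≠ 0) (hE : HasRoots q K E)
    (hF : HasNegRoots q K F) (hEF : ∀ a b, EFRel q K Kinv E F a b → a = b) :
    ∀ a b, EFRel q (fun i => MulOpposite.op (Kinv i)) (fun i => MulOpposite.op (K i))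
      (fun s => MulOpposite.op (antipodeE K Kinv E s))
      (fun s => MulOpposite.op (antipodeF K Kinv F s)) a b → a = b := by
  rintro _ _ ⟨s, t⟩
  have h₁ := hE.simpleK_mul hT hq t s
  have h₂ := hF.simpleKinv_mul hT hq s t
  rw [cartan_comm t s] at h₁
  have hk : simpleKinv K Kinv s * simpleK K Kinv t = simpleK K Kinv t * simpleKinv K Kinv s := by
    simpa using ((hT.hasWeight_simpleKinv (q := q) s).simpleK_mul hT hq t).symm
  have h₃ : antipodeF K Kinv F t * antipodeE K Kinv E s -
      antipodeE K Kinv E s * antipodeF K Kinv F t =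
      -(simpleK K Kinv t * (E s * F t - F t * E s) * simpleKinv K Kinv s) := by
    have h₄ : E s * simpleKinv K Kinv s * (simpleK K Kinv t * F t) =
        simpleK K Kinv t * (E s * F t) * simpleKinv K Kinv s := by
      rw [mul_assoc, ← mul_assoc (simpleKinv K Kinv s), hk, mul_assoc (simpleK K Kinv t), h₂,
        ← mul_assoc (simpleK K Kinv t), h₁]
      simp only [mul_smul_comm, smul_mul_assoc, mul_assoc]
    rw [antipodeE, antipodeF, neg_mul_neg, neg_mul_neg, h₄]
    simp only [mul_sub, sub_mul, mul_assoc]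
    abel
  rw [← MulOpposite.op_mul, ← MulOpposite.op_mul, ← MulOpposite.op_sub, h₃, hEF _ _ (.mk s t)]
  split_ifs with hst
  · subst hst
    have h₄ : K s.castSucc * Kinv s.succ = simpleK K Kinv s := (hT.inv_comm_left _ _).symm
    have h₅ : Kinv s.castSucc * K s.succ = simpleKinv K Kinv s := hT.inv_comm_left _ _
    rw [h₄, h₅, ← MulOpposite.op_mul, ← MulOpposite.op_mul, ← simpleK, ← simpleKinv,
      ← MulOpposite.op_sub, ← MulOpposite.op_smul]
    congr 1
    simp only [mul_smul_comm, smul_mul_assoc, mul_sub, sub_mul, mul_assoc,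
      simpleK_mul_inv hT, mul_one]
    rw [one_mul, ← smul_neg, neg_sub]
    rfl
  · simp

theorem isTorus_one : IsTorus (fun _ : Fin (n + 1) => (1 : k)) fun _ => 1 := by
  intro a b hab
  cases hab <;> simp

theorem ERel.zero (hT : IsTorus K Kinv) :
    ∀ a b, ERel q K Kinv (fun _ => (0 : A)) a b → a = b :=
  (ERel_iff hT).2 ⟨fun t i => by simp, fun s t _ => rfl, fun s t _ => by simp [serrePoly]⟩

theorem FRel.zero (hT : IsTorus K Kinv) :
    ∀ a b, FRel q K Kinv (fun _ => (0 : A)) a b → a = b :=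
  (FRel_iff hT).2 ⟨fun t i => by simp, fun s t _ => rfl, fun s t _ => by simp [serrePoly]⟩

theorem EFRel.zero : ∀ a b, EFRel q (fun _ : Fin (n + 1) => (1 : k)) (fun _ => 1)
    (fun _ => (0 : k)) (fun _ => 0) a b → a = b := by
  rintro _ _ ⟨s, t⟩
  simp

theorem ERel.comul (hT : IsTorus K Kinv) (hq : q ≠ 0) (hE : ∀ a b, ERel q K Kinv E a b → a = b) :
    ∀ a b, ERel q (fun i => K i ⊗ₜ[k] K i) (fun i => Kinv i ⊗ₜ[k] Kinv i) (comulE k K Kinv E)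
      a b → a = b := by
  obtain ⟨hR, hc, hs⟩ := (ERel_iff hT).1 hE
  refine (ERel_iff hT.tmul).2 ⟨hR.comul hT hq, fun s t hst => ?_, fun s t hst => ?_⟩
  · rw [← sub_eq_zero, comulE_comm hR hT hq hst, hc s t hst]
    simp
  · rw [comulE_serre hR hT hq hst, hs s t hst]
    simp

theorem FRel.comul (hT : IsTorus K Kinv) (hq : q ≠ 0) (hF : ∀ a b, FRel q K Kinv F a b → a = b) :
    ∀ a b, FRel q (fun i => K i ⊗ₜ[k] K i) (fun i => Kinv i ⊗ₜ[k] Kinv i) (comulF k K Kinv F)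
      a b → a = b := by
  obtain ⟨hR, hc, hs⟩ := (FRel_iff hT).1 hF
  refine (FRel_iff hT.tmul).2 ⟨hR.comul hT hq, fun s t hst => ?_, fun s t hst => ?_⟩
  · rw [← sub_eq_zero, comulF_comm hR hT hq hst (hT.simpleKinv_simpleKinv s t), hc s t hst]
    simp
  · rw [comulF_serre hR hT hq hst, hs s t hst]
    simp

theorem EFRel.comul (hT : IsTorus K Kinv) (hq : q ≠ 0) (hE : HasRoots q K E)
    (hF : HasNegRoots q K F) (hEF : ∀ a b, EFRel q K Kinv E F a b → a = b) :
    ∀ a b, EFRel q (fun i => K i ⊗ₜ[k] K i) (fun i => Kinv i ⊗ₜ[k] Kinv i) (comulE k K Kinv E)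
      (comulF k K Kinv F) a b → a = b := by
  rintro _ _ ⟨s, t⟩
  rw [comulE_comulF hE hF hT hq, hEF _ _ (.mk s t)]
  split_ifs with hst
  · subst hst
    have h₄ : K s.castSucc * Kinv s.succ = simpleK K Kinv s := (hT.inv_comm_left _ _).symm
    have h₅ : Kinv s.castSucc * K s.succ = simpleKinv K Kinv s := hT.inv_comm_left _ _
    simp only [Algebra.TensorProduct.tmul_mul_tmul, h₄, h₅, TensorProduct.tmul_smul,
      TensorProduct.smul_tmul', TensorProduct.tmul_sub, TensorProduct.sub_tmul, smul_sub]
    abel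
  · simp

/-! The Hopf axioms on generators. -/

/-- The Hopf axioms hold at the element `g`. -/
structure HopfAt (Δ : A →ₐ[k] A ⊗[k] A) (ε : A →ₐ[k] k) (S : A →ₐ[k] Aᵐᵒᵖ) (g : A) : Prop where
  coassoc : Algebra.TensorProduct.assoc k k k A A A
    (Algebra.TensorProduct.map Δ (.id k A) (Δ g)) = Algebra.TensorProduct.map (.id k A) Δ (Δ g)
  counit_left : Algebra.TensorProduct.map ε (.id k A) (Δ g) = 1 ⊗ₜ g
  counit_right : Algebra.TensorProduct.map (.id k A) ε (Δ g) = g ⊗ₜ 1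
  antipode_left : LinearMap.mul' k A ((HopfStructure.antiLinear S).rTensor A (Δ g)) =
    algebraMap k A (ε g)
  antipode_right : LinearMap.mul' k A ((HopfStructure.antiLinear S).lTensor A (Δ g)) =
    algebraMap k A (ε g)

variable {Δ : A →ₐ[k] A ⊗[k] A} {ε : A →ₐ[k] k} {S : A →ₐ[k] Aᵐᵒᵖ}

theorem HopfAt.groupLike {g g' : A} (hΔ : Δ g = g ⊗ₜ g) (hε : ε g = 1)
    (hS : S g = MulOpposite.op g') (h₁ : g * g' = 1) (h₂ : g' * g = 1) : HopfAt Δ ε S g where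
  coassoc := by simp [hΔ]
  counit_left := by simp [hΔ, hε]
  counit_right := by simp [hΔ, hε]
  antipode_left := by simp [hΔ, hε, HopfStructure.antiLinear_apply, hS, h₂]
  antipode_right := by simp [hΔ, hε, HopfStructure.antiLinear_apply, hS, h₁]

theorem HopfAt.skewRight {e g g' : A} (hΔ : Δ e = 1 ⊗ₜ e + e ⊗ₜ g) (hε : ε e = 0)
    (hS : S e = MulOpposite.op (-(e * g'))) (hΔg : Δ g = g ⊗ₜ g) (hεg : ε g = 1)
    (hSg : S g = MulOpposite.op g') (h₂ : g' * g = 1) : HopfAt Δ ε S e where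
  coassoc := by
    simp [hΔ, hΔg, TensorProduct.add_tmul, TensorProduct.tmul_add, Algebra.TensorProduct.one_def,
      add_assoc]
  counit_left := by simp [hΔ, hε]
  counit_right := by simp [hΔ, hε, hεg]
  antipode_left := by simp [hΔ, hε, HopfStructure.antiLinear_apply, hS, mul_assoc, h₂]
  antipode_right := by simp [hΔ, hε, HopfStructure.antiLinear_apply, hS, hSg]

theorem HopfAt.skewLeft {f g g' : A} (hΔ : Δ f = f ⊗ₜ 1 + g' ⊗ₜ f) (hε : ε f = 0)
    (hS : S f = MulOpposite.op (-(g * f))) (hΔg : Δ g' = g' ⊗ₜ g') (hεg : ε g' = 1)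
    (hSg : S g' = MulOpposite.op g) (h₂ : g' * g = 1) : HopfAt Δ ε S f where
  coassoc := by
    simp [hΔ, hΔg, TensorProduct.add_tmul, TensorProduct.tmul_add, Algebra.TensorProduct.one_def,
      add_assoc]
  counit_left := by simp [hΔ, hε, hεg]
  counit_right := by simp [hΔ, hε]
  antipode_left := by simp [hΔ, hε, HopfStructure.antiLinear_apply, hS, hSg]
  antipode_right := by
    simp [hΔ, hε, HopfStructure.antiLinear_apply, hS, ← mul_assoc, h₂]

/-- The Hopf structure given by its values on generators. -/
def HopfStructure.ofHopfAt (G : Set A) (hG : Algebra.adjoin k G = ⊤)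
    (h : ∀ g ∈ G, HopfAt Δ ε S g) : HopfStructure k A :=
  HopfStructure.ofGenerators G hG Δ ε S (fun g hg => (h g hg).coassoc)
    (fun g hg => (h g hg).counit_left) (fun g hg => (h g hg).counit_right)
    (fun g hg => (h g hg).antipode_left) (fun g hg => (h g hg).antipode_right)

theorem simpleK_values (hT : IsTorus K Kinv) (hΔK : ∀ i, Δ (K i) = K i ⊗ₜ K i)
    (hΔKinv : ∀ i, Δ (Kinv i) = Kinv i ⊗ₜ Kinv i) (hεK : ∀ i, ε (K i) = 1)
    (hεKinv : ∀ i, ε (Kinv i) = 1) (hSK : ∀ i, S (K i) = MulOpposite.op (Kinv i))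
    (hSKinv : ∀ i, S (Kinv i) = MulOpposite.op (K i)) (s : Fin n) :
    Δ (simpleK K Kinv s) = simpleK K Kinv s ⊗ₜ simpleK K Kinv s ∧ ε (simpleK K Kinv s) = 1 ∧
      S (simpleK K Kinv s) = MulOpposite.op (simpleKinv K Kinv s) := by
  refine ⟨by simp [simpleK, hΔK, hΔKinv], by simp [simpleK, hεK, hεKinv], ?_⟩
  rw [simpleK, map_mul, hSK, hSKinv, ← MulOpposite.op_mul, hT.inv_comm_left]
  rfl

theorem simpleKinv_values (hT : IsTorus K Kinv) (hΔK : ∀ i, Δ (K i) = K i ⊗ₜ K i)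
    (hΔKinv : ∀ i, Δ (Kinv i) = Kinv i ⊗ₜ Kinv i) (hεK : ∀ i, ε (K i) = 1)
    (hεKinv : ∀ i, ε (Kinv i) = 1) (hSK : ∀ i, S (K i) = MulOpposite.op (Kinv i))
    (hSKinv : ∀ i, S (Kinv i) = MulOpposite.op (K i)) (s : Fin n) :
    Δ (simpleKinv K Kinv s) = simpleKinv K Kinv s ⊗ₜ simpleKinv K Kinv s ∧
      ε (simpleKinv K Kinv s) = 1 ∧
      S (simpleKinv K Kinv s) = MulOpposite.op (simpleK K Kinv s) := by
  refine ⟨by simp [simpleKinv, hΔK, hΔKinv], by simp [simpleKinv, hεK, hεKinv], ?_⟩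
  rw [simpleKinv, map_mul, hSK, hSKinv, ← MulOpposite.op_mul, ← hT.inv_comm_left]
  rfl

end OppositeRelations

/-! ### Transport of the relations along algebra maps. -/

section MapRelations

variable {k A B : Type*} [Field k] [Ring A] [Algebra k A] [Ring B] [Algebra k B] {n : ℕ} {q : k}
  {K Kinv : Fin (n + 1) → A} {E F : Fin n → A} (φ : A →ₐ[k] B) {a b : A}

theorem TorusRel.map (h : TorusRel K Kinv a b) :
    TorusRel (fun i => φ (K i)) (fun i => φ (Kinv i)) (φ a) (φ b) := by
  cases h with
  | comm i j => rw [map_mul, map_mul]; exact .comm i j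
  | mul_inv i => rw [map_mul, map_one]; exact .mul_inv i
  | inv_mul i => rw [map_mul, map_one]; exact .inv_mul i
  | prod => rw [map_list_prod, map_one, List.map_ofFn]; exact .prod

theorem ERel.map (h : ERel q K Kinv E a b) :
    ERel q (fun i => φ (K i)) (fun i => φ (Kinv i)) (fun s => φ (E s)) (φ a) (φ b) := by
  cases h with
  | conj i t => rw [map_mul, map_mul, map_smul]; exact .conj i t
  | comm s t hst => rw [map_mul, map_mul]; exact .comm s t hst
  | serre s t hst =>
    simp only [map_add, map_sub, map_smul, map_mul, map_pow, map_zero]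
    exact .serre s t hst

theorem FRel.map (h : FRel q K Kinv F a b) :
    FRel q (fun i => φ (K i)) (fun i => φ (Kinv i)) (fun s => φ (F s)) (φ a) (φ b) := by
  cases h with
  | conj i t => rw [map_mul, map_mul, map_smul]; exact .conj i t
  | comm s t hst => rw [map_mul, map_mul]; exact .comm s t hst
  | serre s t hst =>
    simp only [map_add, map_sub, map_smul, map_mul, map_pow, map_zero]
    exact .serre s t hst

theorem EFRel.map (h : EFRel q K Kinv E F a b) : EFRel q (fun i => φ (K i)) (fun i => φ (Kinv i))
    (fun s => φ (E s)) (fun s => φ (F s)) (φ a) (φ b) := by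
  obtain ⟨s, t⟩ := h
  simp only [map_sub, map_mul, apply_ite φ, map_smul, map_zero]
  exact .mk s t

end MapRelations

section PresentedQuotient

variable {k X : Type*} [Field k] {r : FreeAlgebra k X → FreeAlgebra k X → Prop}

theorem adjoin_ringQuot_gens : Algebra.adjoin k
    (Set.range fun g => RingQuot.mkAlgHom k r (FreeAlgebra.ι k g)) = ⊤ := by
  have h : Set.range (fun g => RingQuot.mkAlgHom k r (FreeAlgebra.ι k g)) =
      RingQuot.mkAlgHom k r '' Set.range (FreeAlgebra.ι k) := by
    rw [← Set.range_comp]; rfl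
  rw [h, ← AlgHom.map_adjoin, FreeAlgebra.adjoin_range_ι, Algebra.map_top]
  exact (AlgHom.range_eq_top _).2 (RingQuot.mkAlgHom_surjective k r)

end PresentedQuotient

/-- A family indexed by the generators of a Borel part. -/
def BGen.elim {B : Type*} {n : ℕ} (K Kinv : Fin (n + 1) → B) (X : Fin n → B) : BGen n → B
  | .K i => K i
  | .Kinv i => Kinv i
  | .X s => X s

/-- A family indexed by the generators of `U_q^ext(sl_N)`. -/
def UGen.elim {B : Type*} {n : ℕ} (K Kinv : Fin (n + 1) → B) (E F : Fin n → B) : UGen n → B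
  | .K i => K i
  | .Kinv i => Kinv i
  | .E s => E s
  | .F s => F s

/-! ### The Hopf algebra on the K̂_i and E_s. -/

namespace BorelE

variable {k : Type*} [Field k] {n : ℕ} {q : k}

/-- The canonical map from the free algebra. -/
def mk (n : ℕ) (q : k) : FreeAlgebra k (BGen n) →ₐ[k] BorelE n q :=
  RingQuot.mkAlgHom k (BorelERel n q)

theorem mk_rel {a b : FreeAlgebra k (BGen n)} (h : BorelERel n q a b) : mk n q a = mk n q b :=
  RingQuot.mkAlgHom_rel k h

theorem adjoin_gen : Algebra.adjoin k (Set.range (gen n q)) = ⊤ := adjoin_ringQuot_gens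

theorem isTorus : IsTorus (fun i => gen n q (.K i)) fun i => gen n q (.Kinv i) := by
  intro a b hab
  cases hab with
  | comm i j =>
    have := mk_rel (n := n) (q := q) (.inl (.comm i j))
    rw [map_mul, map_mul] at this
    exact this
  | mul_inv i =>
    have := mk_rel (n := n) (q := q) (.inl (.mul_inv i))
    rw [map_mul, map_one] at this
    exact this
  | inv_mul i =>
    have := mk_rel (n := n) (q := q) (.inl (.inv_mul i))
    rw [map_mul, map_one] at this
    exact this
  | prod =>
    have := mk_rel (n := n) (q := q) (.inl .prod)
    rw [map_list_prod, List.map_ofFn, map_one] at this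
    exact this

theorem rel : ∀ a b, ERel q (fun i => gen n q (.K i)) (fun i => gen n q (.Kinv i))
    (fun s => gen n q (.X s)) a b → a = b := by
  intro a b hab
  cases hab with
  | conj i t =>
    have := mk_rel (n := n) (q := q) (.inr (.conj i t))
    rw [map_mul, map_mul, map_smul] at this
    exact this
  | comm s t hst =>
    have := mk_rel (n := n) (q := q) (.inr (.comm s t hst))
    rw [map_mul, map_mul] at this
    exact this
  | serre s t hst =>
    have := mk_rel (n := n) (q := q) (.inr (.serre s t hst))
    simp only [map_add, map_sub, map_smul, map_mul, map_pow, map_zero] at this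
    exact this

variable {B : Type*} [Ring B] [Algebra k B] {K Kinv : Fin (n + 1) → B} {X : Fin n → B}

/-- The universal property. -/
def lift (hT : IsTorus K Kinv) (hX : ∀ a b, ERel q K Kinv X a b → a = b) :
    BorelE n q →ₐ[k] B :=
  RingQuot.liftAlgHom k ⟨FreeAlgebra.lift k (BGen.elim K Kinv X), by
    intro a b hab
    rcases hab with hab | hab
    · have h := hab.map (FreeAlgebra.lift k (BGen.elim K Kinv X))
      simp only [FreeAlgebra.lift_ι_apply] at h
      exact hT _ _ h
    · have h := hab.map (FreeAlgebra.lift k (BGen.elim K Kinv X))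
      simp only [FreeAlgebra.lift_ι_apply] at h
      exact hX _ _ h⟩

theorem lift_gen (hT : IsTorus K Kinv) (hX : ∀ a b, ERel q K Kinv X a b → a = b) (g : BGen n) :
    lift hT hX (gen n q g) = BGen.elim K Kinv X g :=
  (RingQuot.liftAlgHom_mkAlgHom_apply ..).trans (FreeAlgebra.lift_ι_apply ..)

/-- The comultiplication. -/
def comulHom (hq : q ≠ 0) : BorelE n q →ₐ[k] BorelE n q ⊗[k] BorelE n q :=
  lift isTorus.tmul (ERel.comul isTorus hq rel)

/-- The counit. -/
def counitHom : BorelE n q →ₐ[k] k := lift isTorus_one (ERel.zero isTorus_one)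

/-- The antipode. -/
def antipodeHom (hq : q ≠ 0) : BorelE n q →ₐ[k] (BorelE n q)ᵐᵒᵖ :=
  lift isTorus.op (ERel.op isTorus hq rel)

theorem comulHom_gen (hq : q ≠ 0) (g : BGen n) : comulHom hq (gen n q g) =
    BGen.elim (fun i => gen n q (.K i) ⊗ₜ[k] gen n q (.K i))
      (fun i => gen n q (.Kinv i) ⊗ₜ[k] gen n q (.Kinv i))
      (comulE k (fun i => gen n q (.K i)) (fun i => gen n q (.Kinv i))
        fun s => gen n q (.X s)) g :=
  lift_gen _ _ g

theorem counitHom_gen (g : BGen n) : counitHom (gen n q g) =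
    BGen.elim (fun _ => (1 : k)) (fun _ => 1) (fun _ => 0) g :=
  lift_gen _ _ g

theorem antipodeHom_gen (hq : q ≠ 0) (g : BGen n) : antipodeHom hq (gen n q g) =
    .op (BGen.elim (fun i => gen n q (.Kinv i)) (fun i => gen n q (.K i))
      (antipodeE (fun i => gen n q (.K i)) (fun i => gen n q (.Kinv i))
        fun s => gen n q (.X s)) g) := by
  cases g <;> exact lift_gen _ _ _

theorem hopfAt (hq : q ≠ 0) (g : BGen n) :
    HopfAt (comulHom hq) counitHom (antipodeHom hq) (gen n q g) := by
  have h := simpleK_values (Δ := comulHom (n := n) hq) (ε := counitHom) (S := antipodeHom hq)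
    isTorus (fun i => comulHom_gen hq (.K i)) (fun i => comulHom_gen hq (.Kinv i))
    (fun i => counitHom_gen (.K i)) (fun i => counitHom_gen (.Kinv i))
    (fun i => antipodeHom_gen hq (.K i)) (fun i => antipodeHom_gen hq (.Kinv i))
  cases g with
  | K i =>
    exact .groupLike (comulHom_gen hq (.K i)) (counitHom_gen (.K i))
      (antipodeHom_gen hq (.K i))
      (isTorus.mul_inv i) (isTorus.inv_mul i)
  | Kinv i =>
    exact .groupLike (comulHom_gen hq (.Kinv i)) (counitHom_gen (.Kinv i))
      (antipodeHom_gen hq (.Kinv i)) (isTorus.inv_mul i) (isTorus.mul_inv i)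
  | X s =>
    exact .skewRight (comulHom_gen hq (.X s)) (counitHom_gen (.X s))
      (antipodeHom_gen hq (.X s))
      (h s).1 (h s).2.1 (h s).2.2 (simpleKinv_mul isTorus s)

/-- The Hopf structure. -/
def hopf (hq : q ≠ 0) : HopfStructure k (BorelE n q) :=
  .ofHopfAt _ adjoin_gen (by rintro _ ⟨g, rfl⟩; exact hopfAt hq g)

theorem torusHopf (hq : q ≠ 0) : TorusHopf (hopf (n := n) hq) (fun i => gen n q (.K i))
    fun i => gen n q (.Kinv i) where
  comul_K i := comulHom_gen hq (.K i)
  comul_Kinv i := comulHom_gen hq (.Kinv i)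
  counit_K i := counitHom_gen (.K i)
  counit_Kinv i := counitHom_gen (.Kinv i)
  antipode_K i := congrArg MulOpposite.unop (antipodeHom_gen hq (.K i))
  antipode_Kinv i := congrArg MulOpposite.unop (antipodeHom_gen hq (.Kinv i))

theorem eHopf (hq : q ≠ 0) : EHopf (hopf (n := n) hq) (fun i => gen n q (.K i))
    (fun i => gen n q (.Kinv i)) fun s => gen n q (.X s) where
  comul s := comulHom_gen hq (.X s)
  counit s := counitHom_gen (.X s)
  antipode s := by
    refine (congrArg MulOpposite.unop (antipodeHom_gen hq (.X s))).trans ?_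
    change -(_ * (_ * _)) = _
    rw [← isTorus.inv_comm_left, ← mul_assoc]

end BorelE

/-! ### The Hopf algebra on the K̂_i and F_s. -/

namespace BorelF

variable {k : Type*} [Field k] {n : ℕ} {q : k}

/-- The canonical map from the free algebra. -/
def mk (n : ℕ) (q : k) : FreeAlgebra k (BGen n) →ₐ[k] BorelF n q :=
  RingQuot.mkAlgHom k (BorelFRel n q)

theorem mk_rel {a b : FreeAlgebra k (BGen n)} (h : BorelFRel n q a b) : mk n q a = mk n q b :=
  RingQuot.mkAlgHom_rel k h

theorem adjoin_gen : Algebra.adjoin k (Set.range (gen n q)) = ⊤ := adjoin_ringQuot_gens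

theorem isTorus : IsTorus (fun i => gen n q (.K i)) fun i => gen n q (.Kinv i) := by
  intro a b hab
  cases hab with
  | comm i j =>
    have := mk_rel (n := n) (q := q) (.inl (.comm i j))
    rw [map_mul, map_mul] at this
    exact this
  | mul_inv i =>
    have := mk_rel (n := n) (q := q) (.inl (.mul_inv i))
    rw [map_mul, map_one] at this
    exact this
  | inv_mul i =>
    have := mk_rel (n := n) (q := q) (.inl (.inv_mul i))
    rw [map_mul, map_one] at this
    exact this
  | prod =>
    have := mk_rel (n := n) (q := q) (.inl .prod)
    rw [map_list_prod, List.map_ofFn, map_one] at this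
    exact this

theorem rel : ∀ a b, FRel q (fun i => gen n q (.K i)) (fun i => gen n q (.Kinv i))
    (fun s => gen n q (.X s)) a b → a = b := by
  intro a b hab
  cases hab with
  | conj i t =>
    have := mk_rel (n := n) (q := q) (.inr (.conj i t))
    rw [map_mul, map_mul, map_smul] at this
    exact this
  | comm s t hst =>
    have := mk_rel (n := n) (q := q) (.inr (.comm s t hst))
    rw [map_mul, map_mul] at this
    exact this
  | serre s t hst =>
    have := mk_rel (n := n) (q := q) (.inr (.serre s t hst))
    simp only [map_add, map_sub, map_smul, map_mul, map_pow, map_zero] at this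
    exact this

variable {B : Type*} [Ring B] [Algebra k B] {K Kinv : Fin (n + 1) → B} {X : Fin n → B}

/-- The universal property. -/
def lift (hT : IsTorus K Kinv) (hX : ∀ a b, FRel q K Kinv X a b → a = b) :
    BorelF n q →ₐ[k] B :=
  RingQuot.liftAlgHom k ⟨FreeAlgebra.lift k (BGen.elim K Kinv X), by
    intro a b hab
    rcases hab with hab | hab
    · have h := hab.map (FreeAlgebra.lift k (BGen.elim K Kinv X))
      simp only [FreeAlgebra.lift_ι_apply] at h
      exact hT _ _ h
    · have h := hab.map (FreeAlgebra.lift k (BGen.elim K Kinv X))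
      simp only [FreeAlgebra.lift_ι_apply] at h
      exact hX _ _ h⟩

theorem lift_gen (hT : IsTorus K Kinv) (hX : ∀ a b, FRel q K Kinv X a b → a = b) (g : BGen n) :
    lift hT hX (gen n q g) = BGen.elim K Kinv X g :=
  (RingQuot.liftAlgHom_mkAlgHom_apply ..).trans (FreeAlgebra.lift_ι_apply ..)

/-- The comultiplication. -/
def comulHom (hq : q ≠ 0) : BorelF n q →ₐ[k] BorelF n q ⊗[k] BorelF n q :=
  lift isTorus.tmul (FRel.comul isTorus hq rel)

/-- The counit. -/
def counitHom : BorelF n q →ₐ[k] k := lift isTorus_one (FRel.zero isTorus_one)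

/-- The antipode. -/
def antipodeHom (hq : q ≠ 0) : BorelF n q →ₐ[k] (BorelF n q)ᵐᵒᵖ :=
  lift isTorus.op (FRel.op isTorus hq rel)

theorem comulHom_gen (hq : q ≠ 0) (g : BGen n) : comulHom hq (gen n q g) =
    BGen.elim (fun i => gen n q (.K i) ⊗ₜ[k] gen n q (.K i))
      (fun i => gen n q (.Kinv i) ⊗ₜ[k] gen n q (.Kinv i))
      (comulF k (fun i => gen n q (.K i)) (fun i => gen n q (.Kinv i))
        fun s => gen n q (.X s)) g :=
  lift_gen _ _ g

theorem counitHom_gen (g : BGen n) : counitHom (gen n q g) =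
    BGen.elim (fun _ => (1 : k)) (fun _ => 1) (fun _ => 0) g :=
  lift_gen _ _ g

theorem antipodeHom_gen (hq : q ≠ 0) (g : BGen n) : antipodeHom hq (gen n q g) =
    .op (BGen.elim (fun i => gen n q (.Kinv i)) (fun i => gen n q (.K i))
      (antipodeF (fun i => gen n q (.K i)) (fun i => gen n q (.Kinv i))
        fun s => gen n q (.X s)) g) := by
  cases g <;> exact lift_gen _ _ _

theorem hopfAt (hq : q ≠ 0) (g : BGen n) :
    HopfAt (comulHom hq) counitHom (antipodeHom hq) (gen n q g) := by
  have h := simpleKinv_values (Δ := comulHom (n := n) hq) (ε := counitHom) (S := antipodeHom hq)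
    isTorus (fun i => comulHom_gen hq (.K i)) (fun i => comulHom_gen hq (.Kinv i))
    (fun i => counitHom_gen (.K i)) (fun i => counitHom_gen (.Kinv i))
    (fun i => antipodeHom_gen hq (.K i)) (fun i => antipodeHom_gen hq (.Kinv i))
  cases g with
  | K i =>
    exact .groupLike (comulHom_gen hq (.K i)) (counitHom_gen (.K i))
      (antipodeHom_gen hq (.K i))
      (isTorus.mul_inv i) (isTorus.inv_mul i)
  | Kinv i =>
    exact .groupLike (comulHom_gen hq (.Kinv i)) (counitHom_gen (.Kinv i))
      (antipodeHom_gen hq (.Kinv i)) (isTorus.inv_mul i) (isTorus.mul_inv i)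
  | X s =>
    exact .skewLeft (comulHom_gen hq (.X s)) (counitHom_gen (.X s))
      (antipodeHom_gen hq (.X s))
      (h s).1 (h s).2.1 (h s).2.2 (simpleKinv_mul isTorus s)

/-- The Hopf structure. -/
def hopf (hq : q ≠ 0) : HopfStructure k (BorelF n q) :=
  .ofHopfAt _ adjoin_gen (by rintro _ ⟨g, rfl⟩; exact hopfAt hq g)

theorem torusHopf (hq : q ≠ 0) : TorusHopf (hopf (n := n) hq) (fun i => gen n q (.K i))
    fun i => gen n q (.Kinv i) where
  comul_K i := comulHom_gen hq (.K i)
  comul_Kinv i := comulHom_gen hq (.Kinv i)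
  counit_K i := counitHom_gen (.K i)
  counit_Kinv i := counitHom_gen (.Kinv i)
  antipode_K i := congrArg MulOpposite.unop (antipodeHom_gen hq (.K i))
  antipode_Kinv i := congrArg MulOpposite.unop (antipodeHom_gen hq (.Kinv i))

theorem fHopf (hq : q ≠ 0) : FHopf (hopf (n := n) hq) (fun i => gen n q (.K i))
    (fun i => gen n q (.Kinv i)) fun s => gen n q (.X s) where
  comul s := comulHom_gen hq (.X s)
  counit s := counitHom_gen (.X s)
  antipode s := by
    refine (congrArg MulOpposite.unop (antipodeHom_gen hq (.X s))).trans ?_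
    change -(_ * _ * _) = _
    rw [isTorus.inv_comm_left]

end BorelF

/-! ### The Hopf algebra U_q^ext(sl_N). -/

namespace Uext

variable {k : Type*} [Field k] {n : ℕ} {q : k}

/-- The canonical map from the free algebra. -/
def mk (n : ℕ) (q : k) : FreeAlgebra k (UGen n) →ₐ[k] Uext n q :=
  RingQuot.mkAlgHom k (UextRel n q)

theorem mk_rel {a b : FreeAlgebra k (UGen n)} (h : UextRel n q a b) : mk n q a = mk n q b :=
  RingQuot.mkAlgHom_rel k h

theorem adjoin_gen : Algebra.adjoin k (Set.range (gen n q)) = ⊤ := adjoin_ringQuot_gens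

theorem isTorus : IsTorus (fun i => gen n q (.K i)) fun i => gen n q (.Kinv i) := by
  intro a b hab
  cases hab with
  | comm i j =>
    have := mk_rel (n := n) (q := q) (.inl (.comm i j))
    rw [map_mul, map_mul] at this
    exact this
  | mul_inv i =>
    have := mk_rel (n := n) (q := q) (.inl (.mul_inv i))
    rw [map_mul, map_one] at this
    exact this
  | inv_mul i =>
    have := mk_rel (n := n) (q := q) (.inl (.inv_mul i))
    rw [map_mul, map_one] at this
    exact this
  | prod =>
    have := mk_rel (n := n) (q := q) (.inl .prod)
    rw [map_list_prod, List.map_ofFn, map_one] at this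
    exact this

theorem relE : ∀ a b, ERel q (fun i => gen n q (.K i)) (fun i => gen n q (.Kinv i))
    (fun s => gen n q (.E s)) a b → a = b := by
  intro a b hab
  cases hab with
  | conj i t =>
    have := mk_rel (n := n) (q := q) (.inr (.inl (.conj i t)))
    rw [map_mul, map_mul, map_smul] at this
    exact this
  | comm s t hst =>
    have := mk_rel (n := n) (q := q) (.inr (.inl (.comm s t hst)))
    rw [map_mul, map_mul] at this
    exact this
  | serre s t hst =>
    have := mk_rel (n := n) (q := q) (.inr (.inl (.serre s t hst)))
    simp only [map_add, map_sub, map_smul, map_mul, map_pow, map_zero] at this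
    exact this

theorem relF : ∀ a b, FRel q (fun i => gen n q (.K i)) (fun i => gen n q (.Kinv i))
    (fun s => gen n q (.F s)) a b → a = b := by
  intro a b hab
  cases hab with
  | conj i t =>
    have := mk_rel (n := n) (q := q) (.inr (.inr (.inl (.conj i t))))
    rw [map_mul, map_mul, map_smul] at this
    exact this
  | comm s t hst =>
    have := mk_rel (n := n) (q := q) (.inr (.inr (.inl (.comm s t hst))))
    rw [map_mul, map_mul] at this
    exact this
  | serre s t hst =>
    have := mk_rel (n := n) (q := q) (.inr (.inr (.inl (.serre s t hst))))
    simp only [map_add, map_sub, map_smul, map_mul, map_pow, map_zero] at this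
    exact this

theorem relEF : ∀ a b, EFRel q (fun i => gen n q (.K i)) (fun i => gen n q (.Kinv i))
    (fun s => gen n q (.E s)) (fun s => gen n q (.F s)) a b → a = b := by
  rintro _ _ ⟨s, t⟩
  have := mk_rel (n := n) (q := q) (.inr (.inr (.inr (.mk s t))))
  simp only [apply_ite (mk n q), map_sub, map_smul, map_mul, map_zero] at this
  exact this

theorem hasRoots : HasRoots q (fun i => gen n q (.K i)) fun s => gen n q (.E s) :=
  hasRoots_of_ERel isTorus relE

theorem hasNegRoots : HasNegRoots q (fun i => gen n q (.K i)) fun s => gen n q (.F s) :=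
  hasNegRoots_of_FRel isTorus relF

variable {B : Type*} [Ring B] [Algebra k B] {K Kinv : Fin (n + 1) → B} {E F : Fin n → B}

/-- The universal property. -/
def lift (hT : IsTorus K Kinv) (hE : ∀ a b, ERel q K Kinv E a b → a = b)
    (hF : ∀ a b, FRel q K Kinv F a b → a = b) (hEF : ∀ a b, EFRel q K Kinv E F a b → a = b) :
    Uext n q →ₐ[k] B :=
  RingQuot.liftAlgHom k ⟨FreeAlgebra.lift k (UGen.elim K Kinv E F), by
    intro a b hab
    rcases hab with hab | hab | hab | hab
    all_goals
      have h := hab.map (FreeAlgebra.lift k (UGen.elim K Kinv E F))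
      simp only [FreeAlgebra.lift_ι_apply] at h
    · exact hT _ _ h
    · exact hE _ _ h
    · exact hF _ _ h
    · exact hEF _ _ h⟩

theorem lift_gen (hT : IsTorus K Kinv) (hE : ∀ a b, ERel q K Kinv E a b → a = b)
    (hF : ∀ a b, FRel q K Kinv F a b → a = b) (hEF : ∀ a b, EFRel q K Kinv E F a b → a = b)
    (g : UGen n) : lift hT hE hF hEF (gen n q g) = UGen.elim K Kinv E F g :=
  (RingQuot.liftAlgHom_mkAlgHom_apply ..).trans (FreeAlgebra.lift_ι_apply ..)

/-- The comultiplication. -/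
def comulHom (hq : q ≠ 0) : Uext n q →ₐ[k] Uext n q ⊗[k] Uext n q :=
  lift isTorus.tmul (ERel.comul isTorus hq relE) (FRel.comul isTorus hq relF)
    (EFRel.comul isTorus hq hasRoots hasNegRoots relEF)

/-- The counit. -/
def counitHom : Uext n q →ₐ[k] k :=
  lift isTorus_one (ERel.zero isTorus_one) (FRel.zero isTorus_one) EFRel.zero

/-- The antipode. -/
def antipodeHom (hq : q ≠ 0) : Uext n q →ₐ[k] (Uext n q)ᵐᵒᵖ :=
  lift isTorus.op (ERel.op isTorus hq relE) (FRel.op isTorus hq relF)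
    (EFRel.op isTorus hq hasRoots hasNegRoots relEF)

theorem comulHom_gen (hq : q ≠ 0) (g : UGen n) : comulHom hq (gen n q g) =
    UGen.elim (fun i => gen n q (.K i) ⊗ₜ[k] gen n q (.K i))
      (fun i => gen n q (.Kinv i) ⊗ₜ[k] gen n q (.Kinv i))
      (comulE k (fun i => gen n q (.K i)) (fun i => gen n q (.Kinv i)) fun s => gen n q (.E s))
      (comulF k (fun i => gen n q (.K i)) (fun i => gen n q (.Kinv i)) fun s => gen n q (.F s)) g :=
  lift_gen _ _ _ _ g

theorem counitHom_gen (g : UGen n) : counitHom (gen n q g) =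
    UGen.elim (fun _ => (1 : k)) (fun _ => 1) (fun _ => 0) (fun _ => 0) g :=
  lift_gen _ _ _ _ g

theorem antipodeHom_gen (hq : q ≠ 0) (g : UGen n) : antipodeHom hq (gen n q g) =
    .op (UGen.elim (fun i => gen n q (.Kinv i)) (fun i => gen n q (.K i))
      (antipodeE (fun i => gen n q (.K i)) (fun i => gen n q (.Kinv i)) fun s => gen n q (.E s))
      (antipodeF (fun i => gen n q (.K i)) (fun i => gen n q (.Kinv i))
        fun s => gen n q (.F s)) g) := by
  cases g <;> exact lift_gen _ _ _ _ _

theorem hopfAt (hq : q ≠ 0) (g : UGen n) :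
    HopfAt (comulHom hq) counitHom (antipodeHom hq) (gen n q g) := by
  have h := simpleK_values (Δ := comulHom (n := n) hq) (ε := counitHom) (S := antipodeHom hq)
    isTorus (fun i => comulHom_gen hq (.K i)) (fun i => comulHom_gen hq (.Kinv i))
    (fun i => counitHom_gen (.K i)) (fun i => counitHom_gen (.Kinv i))
    (fun i => antipodeHom_gen hq (.K i)) (fun i => antipodeHom_gen hq (.Kinv i))
  have h' := simpleKinv_values (Δ := comulHom (n := n) hq) (ε := counitHom) (S := antipodeHom hq)
    isTorus (fun i => comulHom_gen hq (.K i)) (fun i => comulHom_gen hq (.Kinv i))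
    (fun i => counitHom_gen (.K i)) (fun i => counitHom_gen (.Kinv i))
    (fun i => antipodeHom_gen hq (.K i)) (fun i => antipodeHom_gen hq (.Kinv i))
  cases g with
  | K i =>
    exact .groupLike (comulHom_gen hq (.K i)) (counitHom_gen (.K i))
      (antipodeHom_gen hq (.K i)) (isTorus.mul_inv i) (isTorus.inv_mul i)
  | Kinv i =>
    exact .groupLike (comulHom_gen hq (.Kinv i)) (counitHom_gen (.Kinv i))
      (antipodeHom_gen hq (.Kinv i)) (isTorus.inv_mul i) (isTorus.mul_inv i)
  | E s =>
    exact .skewRight (comulHom_gen hq (.E s)) (counitHom_gen (.E s))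
      (antipodeHom_gen hq (.E s)) (h s).1 (h s).2.1 (h s).2.2 (simpleKinv_mul isTorus s)
  | F s =>
    exact .skewLeft (comulHom_gen hq (.F s)) (counitHom_gen (.F s))
      (antipodeHom_gen hq (.F s)) (h' s).1 (h' s).2.1 (h' s).2.2 (simpleKinv_mul isTorus s)

/-- The Hopf structure. -/
def hopf (hq : q ≠ 0) : HopfStructure k (Uext n q) :=
  .ofHopfAt _ adjoin_gen (by rintro _ ⟨g, rfl⟩; exact hopfAt hq g)

theorem torusHopf (hq : q ≠ 0) : TorusHopf (hopf (n := n) hq) (fun i => gen n q (.K i))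
    fun i => gen n q (.Kinv i) where
  comul_K i := comulHom_gen hq (.K i)
  comul_Kinv i := comulHom_gen hq (.Kinv i)
  counit_K i := counitHom_gen (.K i)
  counit_Kinv i := counitHom_gen (.Kinv i)
  antipode_K i := congrArg MulOpposite.unop (antipodeHom_gen hq (.K i))
  antipode_Kinv i := congrArg MulOpposite.unop (antipodeHom_gen hq (.Kinv i))

theorem eHopf (hq : q ≠ 0) : EHopf (hopf (n := n) hq) (fun i => gen n q (.K i))
    (fun i => gen n q (.Kinv i)) fun s => gen n q (.E s) where
  comul s := comulHom_gen hq (.E s)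
  counit s := counitHom_gen (.E s)
  antipode s := by
    refine (congrArg MulOpposite.unop (antipodeHom_gen hq (.E s))).trans ?_
    change -(_ * (_ * _)) = _
    rw [← isTorus.inv_comm_left, ← mul_assoc]

theorem fHopf (hq : q ≠ 0) : FHopf (hopf (n := n) hq) (fun i => gen n q (.K i))
    (fun i => gen n q (.Kinv i)) fun s => gen n q (.F s) where
  comul s := comulHom_gen hq (.F s)
  counit s := counitHom_gen (.F s)
  antipode s := by
    refine (congrArg MulOpposite.unop (antipodeHom_gen hq (.F s))).trans ?_
    change -(_ * _ * _) = _
    rw [isTorus.inv_comm_left]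

end Uext

/-! ### Morphisms of Hopf algebras, checked on generators. -/

section HomAt

variable {k A B : Type*} [Field k] [Ring A] [Algebra k A] [Ring B] [Algebra k B] {n : ℕ}

/-- The map `f` is compatible with the Hopf structures at the element `g`. -/
def HopfStructure.HomAt (DA : HopfStructure k A) (DB : HopfStructure k B) (f : A →ₐ[k] B) (g : A) :
    Prop :=
  DB.Δ (f g) = Algebra.TensorProduct.map f f (DA.Δ g) ∧ DB.ε (f g) = DA.ε g ∧
    DB.S (f g) = f (DA.S g)

variable {DA : HopfStructure k A} {DB : HopfStructure k B} {f : A →ₐ[k] B}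
  {K Kinv : Fin (n + 1) → A} {X : Fin n → A} {K' Kinv' : Fin (n + 1) → B} {X' : Fin n → B}

theorem HopfStructure.IsHom.of_homAt {G : Set A} (hG : Algebra.adjoin k G = ⊤)
    (h : ∀ g ∈ G, DA.HomAt DB f g) : DA.IsHom DB f :=
  .of_adjoin hG (fun g hg => (h g hg).1) (fun g hg => (h g hg).2.1) fun g hg => (h g hg).2.2

theorem TorusHopf.homAt_K (hA : TorusHopf DA K Kinv) (hB : TorusHopf DB K' Kinv')
    (hK : ∀ i, f (K i) = K' i) (hKinv : ∀ i, f (Kinv i) = Kinv' i) (i : Fin (n + 1)) :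
    DA.HomAt DB f (K i) := by
  refine ⟨?_, ?_, ?_⟩
  · rw [hK, hB.comul_K, hA.comul_K, Algebra.TensorProduct.map_tmul, hK]
  · rw [hK, hB.counit_K, hA.counit_K]
  · rw [hK, hB.antipode_K, hA.antipode_K, hKinv]

theorem TorusHopf.homAt_Kinv (hA : TorusHopf DA K Kinv) (hB : TorusHopf DB K' Kinv')
    (hK : ∀ i, f (K i) = K' i) (hKinv : ∀ i, f (Kinv i) = Kinv' i) (i : Fin (n + 1)) :
    DA.HomAt DB f (Kinv i) := by
  refine ⟨?_, ?_, ?_⟩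
  · rw [hKinv, hB.comul_Kinv, hA.comul_Kinv, Algebra.TensorProduct.map_tmul, hKinv]
  · rw [hKinv, hB.counit_Kinv, hA.counit_Kinv]
  · rw [hKinv, hB.antipode_Kinv, hA.antipode_Kinv, hK]

theorem EHopf.homAt (hA : EHopf DA K Kinv X) (hB : EHopf DB K' Kinv' X')
    (hK : ∀ i, f (K i) = K' i) (hKinv : ∀ i, f (Kinv i) = Kinv' i) (hX : ∀ s, f (X s) = X' s)
    (s : Fin n) : DA.HomAt DB f (X s) := by
  refine ⟨?_, ?_, ?_⟩
  · rw [hX, hB.comul, hA.comul]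
    simp only [map_add, map_mul, Algebra.TensorProduct.map_tmul, hX, hK, hKinv, map_one]
  · rw [hX, hB.counit, hA.counit]
  · rw [hX, hB.antipode, hA.antipode, map_neg, map_mul, map_mul, hX, hK, hKinv]

theorem FHopf.homAt (hA : FHopf DA K Kinv X) (hB : FHopf DB K' Kinv' X')
    (hK : ∀ i, f (K i) = K' i) (hKinv : ∀ i, f (Kinv i) = Kinv' i) (hX : ∀ s, f (X s) = X' s)
    (s : Fin n) : DA.HomAt DB f (X s) := by
  refine ⟨?_, ?_, ?_⟩
  · rw [hX, hB.comul, hA.comul]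
    simp only [map_add, map_mul, Algebra.TensorProduct.map_tmul, hX, hK, hKinv, map_one]
  · rw [hX, hB.counit, hA.counit]
  · rw [hX, hB.antipode, hA.antipode, map_neg, map_mul, map_mul, hX, hK, hKinv]

end HomAt

theorem BGen.range_elim {B : Type*} {n : ℕ} (K Kinv : Fin (n + 1) → B) (X : Fin n → B) :
    Set.range (BGen.elim K Kinv X) = genSet K Kinv X := by
  ext b
  constructor
  · rintro ⟨_ | _ | _, rfl⟩
    · exact K_mem_genSet X _
    · exact Kinv_mem_genSet X _
    · exact mem_genSet X _
  · rintro ((⟨i, rfl⟩ | ⟨i, rfl⟩) | ⟨s, rfl⟩)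
    · exact ⟨.K i, rfl⟩
    · exact ⟨.Kinv i, rfl⟩
    · exact ⟨.X s, rfl⟩

theorem UGen.range_elim {B : Type*} {n : ℕ} (K Kinv : Fin (n + 1) → B) (E F : Fin n → B) :
    Set.range (UGen.elim K Kinv E F) = genSet K Kinv E ∪ Set.range F := by
  ext b
  constructor
  · rintro ⟨_ | _ | _ | _, rfl⟩
    · exact .inl (K_mem_genSet E _)
    · exact .inl (Kinv_mem_genSet E _)
    · exact .inl (mem_genSet E _)
    · exact .inr ⟨_, rfl⟩
  · rintro (((⟨i, rfl⟩ | ⟨i, rfl⟩) | ⟨s, rfl⟩) | ⟨s, rfl⟩)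
    · exact ⟨.K i, rfl⟩
    · exact ⟨.Kinv i, rfl⟩
    · exact ⟨.E s, rfl⟩
    · exact ⟨.F s, rfl⟩

theorem AlgHom.range_eq_adjoin_of_gens {k A B ι : Type*} [Field k] [Ring A] [Algebra k A] [Ring B]
    [Algebra k B] {g : ι → A} (hg : Algebra.adjoin k (Set.range g) = ⊤) (f : A →ₐ[k] B) {b : ι → B}
    (h : ∀ i, f (g i) = b i) : f.range = Algebra.adjoin k (Set.range b) := by
  rw [← Algebra.map_top, ← hg, AlgHom.map_adjoin, ← Set.range_comp]
  congr 2
  exact funext h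

theorem BorelE.isHom_of_gens {k B : Type*} [Field k] [Ring B] [Algebra k B] {n : ℕ} {q : k}
    (hq : q ≠ 0) {DB : HopfStructure k B} {f : BorelE n q →ₐ[k] B} {K' Kinv' : Fin (n + 1) → B}
    {X' : Fin n → B} (hT : TorusHopf DB K' Kinv')
    (hX : EHopf DB K' Kinv' X')
    (h : ∀ g, f (.gen n q g) = BGen.elim K' Kinv' X' g) : (BorelE.hopf hq).IsHom DB f := by
  refine .of_homAt BorelE.adjoin_gen ?_
  rintro _ ⟨i | i | s, rfl⟩
  · exact (BorelE.torusHopf hq).homAt_K hT (fun i => h (.K i)) (fun i => h (.Kinv i)) i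
  · exact (BorelE.torusHopf hq).homAt_Kinv hT (fun i => h (.K i)) (fun i => h (.Kinv i)) i
  · exact (BorelE.eHopf hq).homAt hX (fun i => h (.K i)) (fun i => h (.Kinv i))
      (fun s => h (.X s)) s

theorem BorelF.isHom_of_gens {k B : Type*} [Field k] [Ring B] [Algebra k B] {n : ℕ} {q : k}
    (hq : q ≠ 0) {DB : HopfStructure k B} {f : BorelF n q →ₐ[k] B} {K' Kinv' : Fin (n + 1) → B}
    {X' : Fin n → B} (hT : TorusHopf DB K' Kinv')
    (hX : FHopf DB K' Kinv' X')
    (h : ∀ g, f (.gen n q g) = BGen.elim K' Kinv' X' g) : (BorelF.hopf hq).IsHom DB f := by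
  refine .of_homAt BorelF.adjoin_gen ?_
  rintro _ ⟨i | i | s, rfl⟩
  · exact (BorelF.torusHopf hq).homAt_K hT (fun i => h (.K i)) (fun i => h (.Kinv i)) i
  · exact (BorelF.torusHopf hq).homAt_Kinv hT (fun i => h (.K i)) (fun i => h (.Kinv i)) i
  · exact (BorelF.fHopf hq).homAt hX (fun i => h (.K i)) (fun i => h (.Kinv i))
      (fun s => h (.X s)) s

theorem Uext.isHom_of_gens {k B : Type*} [Field k] [Ring B] [Algebra k B] {n : ℕ} {q : k}
    (hq : q ≠ 0) {DB : HopfStructure k B} {f : Uext n q →ₐ[k] B} {K' Kinv' : Fin (n + 1) → B}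
    {E' : Fin n → B} {F' : Fin n → B} (hT : TorusHopf DB K' Kinv')
    (hE : EHopf DB K' Kinv' E')
    (hF : FHopf DB K' Kinv' F')
    (h : ∀ g, f (.gen n q g) = UGen.elim K' Kinv' E' F' g) : (Uext.hopf hq).IsHom DB f := by
  refine .of_homAt Uext.adjoin_gen ?_
  rintro _ ⟨i | i | s | s, rfl⟩
  · exact (Uext.torusHopf hq).homAt_K hT (fun i => h (.K i)) (fun i => h (.Kinv i)) i
  · exact (Uext.torusHopf hq).homAt_Kinv hT (fun i => h (.K i)) (fun i => h (.Kinv i)) i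
  · exact (Uext.eHopf hq).homAt hE (fun i => h (.K i)) (fun i => h (.Kinv i))
      (fun s => h (.E s)) s
  · exact (Uext.fHopf hq).homAt hF (fun i => h (.K i)) (fun i => h (.Kinv i))
      (fun s => h (.F s)) s

/-! ### The canonical surjections onto H_l, H_r and H_σ. -/

namespace SLq

variable {k : Type*} [Field k] {n : ℕ} {q z : k} (hq : q ≠ 0) (hz : z ^ (n + 1) = q⁻¹)

/-- The map from the Borel algebra to the convolution algebra. -/
def ofBorelE : BorelE n q →ₐ[k] (hopf (n := n) hq).Dual :=
  BorelE.lift (isTorus_K hq hz) (E_rel hq hz)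

/-- The map from the Borel algebra to the convolution algebra. -/
def ofBorelF (hq2 : q ^ 2 ≠ 1) : BorelF n q →ₐ[k] (hopf (n := n) hq).Dual :=
  BorelF.lift (isTorus_K hq hz) (F_rel hq hz hq2)

/-- The map from `U_q^ext(sl_N)` to the convolution algebra. -/
def ofUext (hq2 : q ^ 2 ≠ 1) : Uext n q →ₐ[k] (hopf (n := n) hq).Dual :=
  Uext.lift (isTorus_K hq hz) (E_rel hq hz) (F_rel hq hz hq2) (EF_rel hq hz hq2)

theorem ofBorelE_gen (g : BGen n) : ofBorelE hq hz (.gen n q g) =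
    g.elim (cqt hq hz).K (cqt hq hz).Kinv (cqt hq hz).E := BorelE.lift_gen _ _ g

theorem ofBorelF_gen (hq2 : q ^ 2 ≠ 1) (g : BGen n) : ofBorelF hq hz hq2 (.gen n q g) =
    g.elim (cqt hq hz).K (cqt hq hz).Kinv (cqt hq hz).F := BorelF.lift_gen _ _ g

theorem ofUext_gen (hq2 : q ^ 2 ≠ 1) (g : UGen n) : ofUext hq hz hq2 (.gen n q g) =
    g.elim (cqt hq hz).K (cqt hq hz).Kinv (cqt hq hz).E (cqt hq hz).F := Uext.lift_gen _ _ _ _ g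

theorem range_ofBorelE (hq2 : q ^ 2 ≠ 1) : (ofBorelE (n := n) hq hz).range = (cqt hq hz).Hl := by
  rw [Hl_eq hq hz hq2, AlgHom.range_eq_adjoin_of_gens BorelE.adjoin_gen _ (ofBorelE_gen hq hz),
    BGen.range_elim]

theorem range_ofBorelF (hq2 : q ^ 2 ≠ 1) : (ofBorelF (n := n) hq hz hq2).range = (cqt hq hz).Hr := by
  rw [Hr_eq hq hz hq2, AlgHom.range_eq_adjoin_of_gens BorelF.adjoin_gen _ (ofBorelF_gen hq hz hq2),
    BGen.range_elim]

theorem range_ofUext (hq2 : q ^ 2 ≠ 1) :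
    (ofUext (n := n) hq hz hq2).range = (cqt hq hz).Hsigma := by
  rw [Hsigma_eq hq hz hq2, AlgHom.range_eq_adjoin_of_gens Uext.adjoin_gen _ (ofUext_gen hq hz hq2),
    UGen.range_elim]

/-- The canonical map onto `H_l`. -/
def toHl (hq2 : q ^ 2 ≠ 1) : BorelE n q →ₐ[k] (cqt (n := n) hq hz).Hl :=
  (ofBorelE hq hz).codRestrict _ fun a => range_ofBorelE hq hz hq2 ▸ ⟨a, rfl⟩

/-- The canonical map onto `H_r`. -/
def toHr (hq2 : q ^ 2 ≠ 1) : BorelF n q →ₐ[k] (cqt (n := n) hq hz).Hr :=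
  (ofBorelF hq hz hq2).codRestrict _ fun a => range_ofBorelF hq hz hq2 ▸ ⟨a, rfl⟩

/-- The canonical map onto `H_σ`. -/
def toHsigma (hq2 : q ^ 2 ≠ 1) : Uext n q →ₐ[k] (cqt (n := n) hq hz).Hsigma :=
  (ofUext hq hz hq2).codRestrict _ fun a => range_ofUext hq hz hq2 ▸ ⟨a, rfl⟩

theorem toHl_surjective (hq2 : q ^ 2 ≠ 1) : Function.Surjective (toHl (n := n) hq hz hq2) := by
  rintro ⟨b, hb⟩
  obtain ⟨a, rfl⟩ := (range_ofBorelE hq hz hq2 ▸ hb : b ∈ (ofBorelE (n := n) hq hz).range)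
  exact ⟨a, rfl⟩

theorem toHr_surjective (hq2 : q ^ 2 ≠ 1) : Function.Surjective (toHr (n := n) hq hz hq2) := by
  rintro ⟨b, hb⟩
  obtain ⟨a, rfl⟩ := (range_ofBorelF hq hz hq2 ▸ hb : b ∈ (ofBorelF (n := n) hq hz hq2).range)
  exact ⟨a, rfl⟩

theorem toHsigma_surjective (hq2 : q ^ 2 ≠ 1) :
    Function.Surjective (toHsigma (n := n) hq hz hq2) := by
  rintro ⟨b, hb⟩
  obtain ⟨a, rfl⟩ := (range_ofUext hq hz hq2 ▸ hb : b ∈ (ofUext (n := n) hq hz hq2).range)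
  exact ⟨a, rfl⟩

theorem toHl_isHom (hq2 : q ^ 2 ≠ 1) {DU : HopfStructure k (cqt (n := n) hq hz).Hl}
    (h : (hopf hq).IsSubHopf _ DU) : (BorelE.hopf hq).IsHom DU (toHl hq hz hq2) := by
  have hG : ∀ {g}, g ∈ genSet (cqt (n := n) hq hz).K (cqt hq hz).Kinv (cqt hq hz).E →
      g ∈ (cqt (n := n) hq hz).Hl := fun hg => Hl_eq hq hz hq2 ▸ Algebra.subset_adjoin hg
  refine BorelE.isHom_of_gens hq (torusHopf_sub hq hz (fun i => hG (K_mem_genSet _ i))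
    (fun i => hG (Kinv_mem_genSet _ i)) h) (eHopf_sub hq hz (fun i => hG (K_mem_genSet _ i))
    (fun i => hG (Kinv_mem_genSet _ i)) h fun s => hG (mem_genSet _ s)) fun g => Subtype.ext ?_
  refine (ofBorelE_gen hq hz g).trans ?_
  cases g <;> rfl

theorem toHr_isHom (hq2 : q ^ 2 ≠ 1) {DU : HopfStructure k (cqt (n := n) hq hz).Hr}
    (h : (hopf hq).IsSubHopf _ DU) : (BorelF.hopf hq).IsHom DU (toHr hq hz hq2) := by
  have hG : ∀ {g}, g ∈ genSet (cqt (n := n) hq hz).K (cqt hq hz).Kinv (cqt hq hz).F →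
      g ∈ (cqt (n := n) hq hz).Hr := fun hg => Hr_eq hq hz hq2 ▸ Algebra.subset_adjoin hg
  refine BorelF.isHom_of_gens hq (torusHopf_sub hq hz (fun i => hG (K_mem_genSet _ i))
    (fun i => hG (Kinv_mem_genSet _ i)) h) (fHopf_sub hq hz (fun i => hG (K_mem_genSet _ i))
    (fun i => hG (Kinv_mem_genSet _ i)) h fun s => hG (mem_genSet _ s)) fun g => Subtype.ext ?_
  refine (ofBorelF_gen hq hz hq2 g).trans ?_
  cases g <;> rfl

theorem K_mem_Hsigma (hq2 : q ^ 2 ≠ 1) (i : Fin (n + 1)) : (cqt hq hz).K i ∈ (cqt hq hz).Hsigma :=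
  Hsigma_eq hq hz hq2 ▸ Algebra.subset_adjoin (.inl (K_mem_genSet _ i))

theorem Kinv_mem_Hsigma (hq2 : q ^ 2 ≠ 1) (i : Fin (n + 1)) :
    (cqt hq hz).Kinv i ∈ (cqt hq hz).Hsigma :=
  Hsigma_eq hq hz hq2 ▸ Algebra.subset_adjoin (.inl (Kinv_mem_genSet _ i))

theorem E_mem_Hsigma (hq2 : q ^ 2 ≠ 1) (s : Fin n) : (cqt hq hz).E s ∈ (cqt hq hz).Hsigma :=
  Hsigma_eq hq hz hq2 ▸ Algebra.subset_adjoin (.inl (mem_genSet _ s))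

theorem F_mem_Hsigma (hq2 : q ^ 2 ≠ 1) (s : Fin n) : (cqt hq hz).F s ∈ (cqt hq hz).Hsigma :=
  Hsigma_eq hq hz hq2 ▸ Algebra.subset_adjoin (.inr ⟨s, rfl⟩)

theorem coe_toHsigma (hq2 : q ^ 2 ≠ 1) (a : Uext n q) :
    (toHsigma hq hz hq2 a : (hopf (n := n) hq).Dual) = ofUext hq hz hq2 a := rfl

theorem toHsigma_isHom (hq2 : q ^ 2 ≠ 1) {DU : HopfStructure k (cqt (n := n) hq hz).Hsigma}
    (h : (hopf hq).IsSubHopf _ DU) : (Uext.hopf hq).IsHom DU (toHsigma hq hz hq2) := by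
  refine Uext.isHom_of_gens hq
    (torusHopf_sub hq hz (K_mem_Hsigma hq hz hq2) (Kinv_mem_Hsigma hq hz hq2) h)
    (eHopf_sub hq hz (K_mem_Hsigma hq hz hq2) (Kinv_mem_Hsigma hq hz hq2) h
      (E_mem_Hsigma hq hz hq2))
    (fHopf_sub hq hz (K_mem_Hsigma hq hz hq2) (Kinv_mem_Hsigma hq hz hq2) h
      (F_mem_Hsigma hq hz hq2)) ?_
  intro g
  apply Subtype.ext
  rw [coe_toHsigma, ofUext_gen]
  cases g with
  | K i => exact rfl
  | Kinv i => exact rfl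
  | E s => exact rfl
  | F s => exact rfl

end SLq

/-! ### Root vectors -/

section RootVectors

variable {k B : Type*} [Field k] [Ring B] [Algebra k B] {q : k}

/-- The root vectors `[E_j, [E_{j+1}, …, E_{j+m}]_q …]_q`. -/
def rootVec (q : k) (E : ℕ → B) : ℕ → ℕ → B
  | j, 0 => E j
  | j, m + 1 => E j * rootVec q E (j + 1) m - q • (rootVec q E (j + 1) m * E j)

/-- The Serre relations between the members of a sequence. -/
structure IsSerre (q : k) (E : ℕ → B) : Prop where
  comm : ∀ s t, s + 1 < t → E s * E t = E t * E s
  serre : ∀ s, serrePoly q (E s) (E (s + 1)) = 0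
  serre' : ∀ s, serrePoly q (E (s + 1)) (E s) = 0

variable {E : ℕ → B}

theorem IsSerre.comm_rootVec_of_lt (hE : IsSerre q E) (m : ℕ) : ∀ {s j : ℕ}, s + 1 < j →
    E s * rootVec q E j m = rootVec q E j m * E s := by
  induction m with
  | zero => exact fun h => hE.comm _ _ h
  | succ m ih =>
    intro s j h
    have h₁ : Commute (E s) (E j) := hE.comm _ _ h
    have h₂ : Commute (E s) (rootVec q E (j + 1) m) := ih (by omega)
    exact (h₁.mul_right h₂).sub_right ((h₂.mul_right h₁).smul_right q)

/-- Since a commutes with y, the Serre polynomial in a can be applied to b inside the bracket. So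
E_j satisfies a Serre relation with every root vector starting at j + 1. -/
theorem serrePoly_qbracket {a b y : B} (h : serrePoly q a b = 0) (hy : a * y = y * a) :
    serrePoly q a (b * y - q • (y * b)) = 0 := by
  have hy' : ∀ t, y * (a * t) = a * (y * t) := fun t => by rw [← mul_assoc, ← hy, mul_assoc]
  have h₁ : serrePoly q a (b * y - q • (y * b)) = serrePoly q a b * y -
      q • (y * serrePoly q a b) := by
    simp only [serrePoly, pow_two, mul_sub, sub_mul, mul_add, add_mul, mul_smul_comm,
      smul_mul_assoc, mul_assoc, smul_sub, smul_add, smul_smul, ← hy, hy']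
    module
  rw [h₁, h, zero_mul, mul_zero, smul_zero, sub_zero]

theorem IsSerre.serre_rootVec (hE : IsSerre q E) (j m : ℕ) :
    serrePoly q (E j) (rootVec q E (j + 1) m) = 0 := by
  cases m with
  | zero => exact hE.serre j
  | succ m => exact serrePoly_qbracket (hE.serre j) (hE.comm_rootVec_of_lt m (by omega))

/-- The Serre polynomial is itself the iterated bracket: with b = ax - q xa it equals ab - q⁻¹ ba.
In `qbracket_mul_of_serre` the other Serre relation is used in the same way. -/
theorem mul_qbracket_of_serre (hq : q ≠ 0) {a x : B} (h : serrePoly q a x = 0) :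
    a * (a * x - q • (x * a)) = q⁻¹ • ((a * x - q • (x * a)) * a) := by
  rw [← sub_eq_zero, ← h]
  simp only [serrePoly, pow_two, mul_sub, sub_mul, mul_smul_comm, smul_mul_assoc, mul_assoc,
    smul_sub, smul_smul]
  match_scalars <;> field_simp
  ring

theorem qbracket_mul_of_serre (hq : q ≠ 0) {a x : B} (h : serrePoly q x a = 0) :
    (a * x - q • (x * a)) * x = q⁻¹ • (x * (a * x - q • (x * a))) := by
  rw [← sub_eq_zero, ← h]
  simp only [serrePoly, pow_two, mul_sub, sub_mul, mul_smul_comm, smul_mul_assoc, mul_assoc,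
    smul_sub, smul_smul]
  match_scalars <;> field_simp
  ring

theorem IsSerre.mul_rootVec_self (hE : IsSerre q E) (hq : q ≠ 0) (j m : ℕ) :
    E j * rootVec q E j (m + 1) = q⁻¹ • (rootVec q E j (m + 1) * E j) :=
  mul_qbracket_of_serre hq (hE.serre_rootVec j m)

/-- Write X for the double bracket, w for the bracket of b with y and c for the bracket of a with b.
As a and y commute, X is also the bracket of c with y. The two descriptions give bX = q(cw - wc) +
q² Xb and Xb = q(cw - wc) + q² bX, so (1 + q²)(bX - Xb) = 0. -/
theorem qbracket_comm (hq : q ≠ 0) (hq4 : 1 + q ^ 2 ≠ 0) {a b y : B} (hab : serrePoly q b a = 0)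
    (hay : a * y = y * a)
    (hbw : b * (b * y - q • (y * b)) = q⁻¹ • ((b * y - q • (y * b)) * b)) :
    b * (a * (b * y - q • (y * b)) - q • ((b * y - q • (y * b)) * a)) =
      (a * (b * y - q • (y * b)) - q • ((b * y - q • (y * b)) * a)) * b := by
  set w := b * y - q • (y * b) with hw
  set c := a * b - q • (b * a) with hc
  have hcb : c * b = q⁻¹ • (b * c) := qbracket_mul_of_serre hq hab
  have hbc : b * c = q • (c * b) := by rw [hcb, smul_smul, mul_inv_cancel₀ hq, one_smul]
  have hwb : w * b = q • (b * w) := by rw [hbw, smul_smul, mul_inv_cancel₀ hq, one_smul]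
  have hX : a * w - q • (w * a) = c * y - q • (y * c) := by
    have hay' : ∀ t, y * (a * t) = a * (y * t) := fun t => by rw [← mul_assoc, ← hay, mul_assoc]
    rw [hw, hc]
    simp only [mul_sub, sub_mul, mul_smul_comm, smul_mul_assoc, mul_assoc, smul_sub, hay, hay']
    abel
  have h₁ : b * (a * w - q • (w * a)) = q • (c * w - w * c) + q ^ 2 • ((a * w - q • (w * a)) * b) := by
    rw [hX]
    have e₁ : b * (c * y) = q • (c * (b * y)) := by rw [← mul_assoc, hbc, smul_mul_assoc, mul_assoc]
    have e₂ : b * (y * c) = w * c + q • (y * (b * c)) := by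
      rw [hw]; simp only [sub_mul, smul_mul_assoc, mul_assoc]; abel
    have e₃ : c * (b * y) = c * w + q • (c * (y * b)) := by
      rw [hw]; simp only [mul_sub, mul_smul_comm]; abel
    rw [mul_sub, mul_smul_comm, e₁, e₂, e₃, hbc]
    simp only [sub_mul, smul_mul_assoc, mul_assoc, smul_sub, smul_add, smul_smul, mul_smul_comm]
    module
  have h₂ : (a * w - q • (w * a)) * b = q • (c * w - w * c) + q ^ 2 • (b * (a * w - q • (w * a))) := by
    have e₁ : a * w * b = q • (a * b * w) := by rw [mul_assoc, hwb, mul_smul_comm, mul_assoc]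
    have e₂ : a * b = c + q • (b * a) := by rw [hc]; abel
    have e₃ : w * a * b = w * c + q • (w * (b * a)) := by
      rw [mul_assoc, e₂, mul_add, mul_smul_comm]
    have e₄ : w * (b * a) = q • (b * (w * a)) := by
      rw [← mul_assoc, hwb, smul_mul_assoc, mul_assoc]
    rw [sub_mul, smul_mul_assoc, e₁, e₂, e₃, e₄]
    simp only [add_mul, mul_sub, smul_mul_assoc, mul_assoc, smul_sub, smul_add, smul_smul,
      mul_smul_comm]
    module
  have h₃ : (1 + q ^ 2) • (b * (a * w - q • (w * a)) - (a * w - q • (w * a)) * b) = 0 := by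
    rw [add_smul, one_smul, smul_sub]
    nth_rewrite 1 [h₁]
    nth_rewrite 2 [h₂]
    abel
  exact sub_eq_zero.1 ((smul_eq_zero.1 h₃).resolve_left hq4)

/-- For s beyond j + 1, E_s commutes with E_j and, by induction, with the shorter root vector. The
case s = j + 1 is `qbracket_comm`. -/
theorem IsSerre.comm_rootVec_of_mem (hE : IsSerre q E) (hq : q ≠ 0) (hq4 : 1 + q ^ 2 ≠ 0) (m : ℕ) :
    ∀ {s j : ℕ}, j < s → s < j + m → E s * rootVec q E j m = rootVec q E j m * E s := by
  induction m with
  | zero => intro s j h h'; omega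
  | succ m ih =>
    intro s j h h'
    rcases (Nat.succ_le_of_lt h).lt_or_eq with h | rfl
    · have h₁ : Commute (E s) (E j) := (hE.comm _ _ h).symm
      have h₂ : Commute (E s) (rootVec q E (j + 1) m) := ih h (by omega)
      exact (h₁.mul_right h₂).sub_right ((h₂.mul_right h₁).smul_right q)
    · obtain ⟨m, rfl⟩ : ∃ l, m = l + 1 := ⟨m - 1, by omega⟩
      exact qbracket_comm hq hq4 (hE.serre' j) (hE.comm_rootVec_of_lt m (by omega))
        (hE.mul_rootVec_self hq (j + 1) m)

theorem qbracket_mul_qbracket {a b y w X : B} (hq : q ≠ 0) (hw : w = b * y - q • (y * b))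
    (hX : X = a * w - q • (w * a)) (hay : a * y = y * a) (hwy : w * y = q⁻¹ • (y * w))
    (hbX : b * X = X * b) : X * w = q⁻¹ • (w * X) := by
  have hyw : y * w = q • (w * y) := by rw [hwy, smul_smul, mul_inv_cancel₀ hq, one_smul]
  have hyX : y * X = q • (X * y) := by
    have e : y * (a * w) = q • (a * (w * y)) := by
      rw [← mul_assoc, ← hay, mul_assoc, hyw, mul_smul_comm]
    have e' : y * (w * a) = q • (w * (a * y)) := by
      rw [← mul_assoc, hyw, smul_mul_assoc, mul_assoc, hay]
    rw [hX, mul_sub, mul_smul_comm, e, e']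
    simp only [sub_mul, smul_mul_assoc, mul_assoc, smul_sub]
  have hXy : X * y = q⁻¹ • (y * X) := by rw [hyX, smul_smul, inv_mul_cancel₀ hq, one_smul]
  have e₁ : X * (b * y) = q⁻¹ • (b * (y * X)) := by
    rw [← mul_assoc, ← hbX, mul_assoc, hXy, mul_smul_comm]
  have e₂ : X * (y * b) = q⁻¹ • (y * (b * X)) := by
    rw [← mul_assoc, hXy, smul_mul_assoc, mul_assoc, hbX]
  rw [hw, mul_sub, mul_smul_comm, e₁, e₂]
  simp only [sub_mul, smul_mul_assoc, mul_assoc, smul_sub, smul_smul]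
  module

/-- Root vectors with the same end and adjacent starts commute up to q⁻¹. The step expands the
shorter one as a bracket of E_{j+1} with a still shorter root vector; the first of these commutes
with the long root vector. -/
theorem IsSerre.rootVec_mul_rootVec (hE : IsSerre q E) (hq : q ≠ 0) (hq4 : 1 + q ^ 2 ≠ 0) (m : ℕ) :
    ∀ j, rootVec q E j (m + 1) * rootVec q E (j + 1) m =
      q⁻¹ • (rootVec q E (j + 1) m * rootVec q E j (m + 1)) := by
  induction m with
  | zero => exact fun j => qbracket_mul_of_serre hq (hE.serre' j)
  | succ m ih =>
    exact fun j => qbracket_mul_qbracket hq rfl rfl (hE.comm_rootVec_of_lt m (by omega)) (ih (j + 1))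
      (hE.comm_rootVec_of_mem hq hq4 (m + 2) (by omega) (by omega))

end RootVectors

/-! ### Faithfulness of modules with letter-stripping operators -/

section QComm

variable {k B : Type*} [Field k] [Ring B] [Algebra k B] {q : k}

/-- `a` and `y` commute up to the factor `q ^ m`. -/
def QComm (q : k) (m : ℤ) (a y : B) : Prop := a * y = q ^ m • (y * a)

theorem QComm.mul_right (hq : q ≠ 0) {a y y' : B} {m m' : ℤ} (h : QComm q m a y)
    (h' : QComm q m' a y') : QComm q (m + m') a (y * y') := by
  rw [QComm, ← mul_assoc, h, smul_mul_assoc, mul_assoc, h', mul_smul_comm, smul_smul,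
    zpow_add₀ hq, mul_assoc]

theorem QComm.mul_left (hq : q ≠ 0) {a a' y : B} {m m' : ℤ} (h : QComm q m a y)
    (h' : QComm q m' a' y) : QComm q (m + m') (a * a') y := by
  rw [QComm, mul_assoc, h', mul_smul_comm, ← mul_assoc, h, smul_mul_assoc, smul_smul, mul_assoc,
    zpow_add₀ hq, mul_comm (q ^ m)]

theorem QComm.qbracket (hq : q ≠ 0) {a y y' : B} {m m' l : ℤ} (h : QComm q m a y)
    (h' : QComm q m' a y') (hl : m + m' = l) : QComm q l a (y * y' - q • (y' * y)) := by
  have h₁ := h.mul_right hq h'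
  have h₂ := h'.mul_right hq h
  rw [hl] at h₁
  rw [add_comm, hl] at h₂
  rw [QComm] at *
  rw [mul_sub, h₁, mul_smul_comm, h₂, sub_mul, smul_mul_assoc, smul_sub, smul_comm q]

theorem QComm.pow_right (hq : q ≠ 0) {a y : B} {m : ℤ} (h : QComm q m a y) (r : ℕ) :
    QComm q (r * m) a (y ^ r) := by
  induction r with
  | zero => simp [QComm]
  | succ r ih =>
    rw [pow_succ, Nat.cast_succ, add_mul, one_mul]
    exact ih.mul_right hq h

end QComm

section StripModule

variable {k B T : Type*} [Field k] [Ring B] [Algebra k B] [AddCommGroup T] [Module k T]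
  [Module B T] {q lam : k} {n : ℕ}

/-- A module over an algebra with elements `E_s` subject to the Serre relations, with operators `L_i`
adding the letter `i` and `D_i` stripping it. -/
structure IsStripModule (q lam : k) (n : ℕ) (E kE : ℕ → B) (D L : ℕ → T →ₗ[k] T) : Prop where
  isSerre : IsSerre q E
  isUnit : ∀ s < n, IsUnit (kE s)
  wt_self : ∀ s < n, QComm q 2 (kE s) (E s)
  wt_succ : ∀ s < n, QComm q (-1) (kE s) (E (s + 1))
  wt_pred : ∀ s, s + 1 < n → QComm q (-1) (kE (s + 1)) (E s)
  wt_far : ∀ s < n, ∀ t, s + 1 < t ∨ t + 1 < s → QComm q 0 (kE s) (E t)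
  D_E : ∀ i s, i ≠ s → ∀ v, D i (E s • v) = E s • D i v
  D_E_self : ∀ s v, D s (E s • v) = E s • D s v + lam • kE s • D (s + 1) v
  E_L : ∀ s c, s + 1 < c → ∀ v, E s • L c v = L c (E s • v)
  D_L : ∀ c ≤ n, ∀ v, D c (L c v) = v
  D_L_ne : ∀ i c, i ≠ c → ∀ v, D i (L c v) = 0

namespace IsStripModule

variable {E kE : ℕ → B} {D L : ℕ → T →ₗ[k] T}

theorem wt_rootVec_far (h : IsStripModule q lam n E kE D L) (hq : q ≠ 0) {s : ℕ} (hs : s < n)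
    (m : ℕ) : ∀ {j}, s + 1 < j → QComm q 0 (kE s) (rootVec q E j m) := by
  induction m with
  | zero => exact fun hj => h.wt_far s hs _ (.inl hj)
  | succ m ih =>
    exact fun hj => (h.wt_far s hs _ (.inl hj)).qbracket hq (ih (by omega)) (by simp)

theorem wt_rootVec_succ (h : IsStripModule q lam n E kE D L) (hq : q ≠ 0) {s : ℕ} (hs : s < n)
    (m : ℕ) : QComm q (-1) (kE s) (rootVec q E (s + 1) m) := by
  cases m with
  | zero => exact h.wt_succ s hs
  | succ m => exact (h.wt_succ s hs).qbracket hq (h.wt_rootVec_far hq hs m (by omega)) (by simp)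

/-- The product `k_j k_{j+1} ⋯ k_{j+m}`. -/
def rootK (kE : ℕ → B) : ℕ → ℕ → B
  | j, 0 => kE j
  | j, m + 1 => kE j * rootK kE (j + 1) m

theorem isUnit_rootK (h : IsStripModule q lam n E kE D L) (m : ℕ) : ∀ {j}, j + m < n →
    IsUnit (rootK kE j m) := by
  induction m with
  | zero => exact fun hj => h.isUnit _ hj
  | succ m ih => exact fun hj => (h.isUnit _ (by omega)).mul (ih (by omega))

theorem wt_rootK_far (h : IsStripModule q lam n E kE D L) (hq : q ≠ 0) (m : ℕ) : ∀ {j s},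
    j + m < n → s + 1 < j → QComm q 0 (rootK kE j m) (E s) := by
  induction m with
  | zero => exact fun hj hs => h.wt_far _ hj _ (.inr hs)
  | succ m ih =>
    exact fun hj hs => (h.wt_far _ (by omega) _ (.inr hs)).mul_left hq (ih (by omega) (by omega))

theorem wt_rootK_pred (h : IsStripModule q lam n E kE D L) (hq : q ≠ 0) (m : ℕ) {j : ℕ}
    (hj : j + 1 + m < n) : QComm q (-1) (rootK kE (j + 1) m) (E j) := by
  cases m with
  | zero => exact h.wt_pred _ hj
  | succ m =>
    exact (h.wt_pred _ (by omega)).mul_left hq (h.wt_rootK_far hq m (by omega) (by omega))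

theorem wt_rootK_rootVec (h : IsStripModule q lam n E kE D L) (hq : q ≠ 0) (m : ℕ) : ∀ {j},
    j + m < n → QComm q 2 (rootK kE j m) (rootVec q E j m) := by
  induction m with
  | zero => exact fun hj => h.wt_self _ hj
  | succ m ih =>
    intro j hj
    refine QComm.qbracket (m := 1) (m' := 1) hq ?_ ?_ rfl
    · exact (h.wt_self j (by omega)).mul_left hq (h.wt_rootK_pred hq m (by omega))
    · exact (h.wt_rootVec_succ hq (by omega) m).mul_left hq (ih (by omega))

/-- The commutator of the stripping operator `D_j` and the root vector. -/
def stripComm (q lam : k) (E kE : ℕ → B) (D : ℕ → T →ₗ[k] T) : ℕ → ℕ → T → T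
  | j, 0, v => lam • kE j • D (j + 1) v
  | j, m + 1, v => lam • ((q⁻¹ - q) • rootVec q E (j + 1) m • kE j • D (j + 1) v +
      kE j • stripComm q lam E kE D (j + 1) m v)

/-- Only the stripping operator at the start of the root vector fails to commute with it. The
induction needs all four claims: when D_{j+1} passes the bracket of E_j with the root vector at j +
1, the two correction terms cancel precisely because the correction commutes with E_j up to q⁻¹. -/
theorem D_rootVec [IsScalarTower k B T] (h : IsStripModule q lam n E kE D L) (hq : q ≠ 0) (m : ℕ) : ∀ {j}, j + m < n →
    (∀ i, i ≠ j → ∀ v, D i (rootVec q E j m • v) = rootVec q E j m • D i v) ∧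
    (∀ v, D j (rootVec q E j m • v) = rootVec q E j m • D j v + stripComm q lam E kE D j m v) ∧
    (∀ s, s + 1 < j → ∀ v, stripComm q lam E kE D j m (E s • v) =
      E s • stripComm q lam E kE D j m v) ∧
    (∀ s, s + 1 = j → ∀ v, stripComm q lam E kE D j m (E s • v) =
      q⁻¹ • E s • stripComm q lam E kE D j m v) := by
  have hcomm : ∀ {a b : B} {l : ℤ}, QComm q l a b → ∀ v : T, a • b • v = q ^ l • b • a • v :=
    fun hab v => by rw [← mul_smul, hab, smul_assoc, mul_smul]
  induction m with
  | zero =>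
    intro j hj
    refine ⟨fun i hi v => h.D_E i j hi v, h.D_E_self j, fun s hs v => ?_, ?_⟩
    · rw [stripComm, stripComm, h.D_E _ _ (by omega), hcomm (h.wt_far j hj s (.inr hs)), zpow_zero,
        one_smul, smul_comm lam]
    · rintro s rfl v
      rw [stripComm, stripComm, h.D_E _ _ (by omega), hcomm (h.wt_pred _ hj), smul_comm (E s) lam,
        smul_comm lam, zpow_neg_one]
  | succ m ih =>
    intro j hj
    obtain ⟨h₁, h₂, h₃, h₄⟩ := ih (j := j + 1) (by omega)
    refine ⟨fun i hi v => ?_, fun v => ?_, fun s hs v => ?_, ?_⟩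
    · simp only [rootVec, sub_smul, mul_smul, smul_assoc, map_sub, map_smul]
      by_cases hij : i = j + 1
      · subst hij
        simp only [h.D_E _ _ hi, h₂, h₄ j rfl, smul_add]
        -- The factor q of the bracket meets the q⁻¹ of the fourth claim, and the corrections
        -- cancel.
        rw [smul_smul q q⁻¹, mul_inv_cancel₀ hq, one_smul]
        abel
      · simp only [h.D_E _ _ hi, h₁ i hij]
    · simp only [rootVec, sub_smul, mul_smul, smul_assoc, map_sub, map_smul, h.D_E_self,
        h₁ j (by omega), h₂, stripComm, smul_add]
      rw [smul_comm (rootVec q E (j + 1) m) lam, hcomm (h.wt_rootVec_succ hq (by omega) m),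
        zpow_neg_one]
      generalize E j • rootVec q E (j + 1) m • D j v = a₁
      generalize rootVec q E (j + 1) m • E j • D j v = a₂
      generalize rootVec q E (j + 1) m • kE j • D (j + 1) v = a₃
      generalize kE j • stripComm q lam E kE D (j + 1) m v = a₄
      module
    · rw [stripComm, stripComm, h.D_E _ _ (by omega), h₃ s (by omega),
        hcomm (h.wt_far j (by omega) s (.inr hs)), hcomm (h.wt_far j (by omega) s (.inr hs)),
        zpow_zero, one_smul, one_smul, ← mul_smul (rootVec q E (j + 1) m),
        ← h.isSerre.comm_rootVec_of_lt m (by omega), mul_smul, smul_comm (E s) lam, smul_add (E s),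
        smul_comm (E s) (q⁻¹ - q)]
    · rintro s rfl v
      rw [stripComm, stripComm, h.D_E _ _ (by omega), h₃ s (by omega),
        hcomm (h.wt_pred s (by omega)), hcomm (h.wt_pred s (by omega)),
        smul_comm (rootVec q E _ m) (q ^ _), ← mul_smul (rootVec q E _ m),
        ← h.isSerre.comm_rootVec_of_lt m (by omega), mul_smul, zpow_neg_one,
        smul_comm (E s) lam, smul_add (E s), smul_comm (E s) (q⁻¹ - q)]
      generalize E s • rootVec q E (s + 1 + 1) m • kE (s + 1) • D (s + 1 + 1) v = a₁
      generalize E s • kE (s + 1) • stripComm q lam E kE D (s + 1 + 1) m v = a₂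
      module

/-- On a vector killed by the intermediate stripping operators only the innermost term of the
recursion remains: it strips the letter j + m + 1 and contributes one factor `lam` for each simple
root. -/
theorem stripComm_eq [IsScalarTower k B T] (m : ℕ) : ∀ {j} {v : T}, (∀ d, j < d → d ≤ j + m → D d v = 0) →
    stripComm q lam E kE D j m v = lam ^ (m + 1) • rootK kE j m • D (j + m + 1) v := by
  induction m with
  | zero => intro j v _; simp [stripComm, rootK]
  | succ m ih =>
    intro j v hv
    rw [stripComm, ih fun d hd hd' => hv d (by omega) (by omega), hv (j + 1) (by omega) (by omega),
      smul_zero, smul_zero, smul_zero, zero_add, rootK, mul_smul, smul_comm (kE j) (lam ^ (m + 1)),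
      smul_smul, ← pow_succ']
    congr 4
    rw [show j + 1 + m + 1 = j + (m + 1) + 1 by ring]

end IsStripModule

end StripModule

/-! ### Ordered products of root vectors span the algebra of the E_s. -/

section RaisingFiltration

variable {k B : Type*} [Field k] [Ring B] [Algebra k B] {q : k}

/-- The subalgebra generated by `E_0, …, E_{c-1}`. -/
def raisingAlg (k : Type*) {B : Type*} [Field k] [Ring B] [Algebra k B] (E : ℕ → B) (c : ℕ) :
    Subalgebra k B := Algebra.adjoin k (E '' Set.Iio c)

/-- The span of the products `X_{j-1}^{r_{j-1}} ⋯ X_0^{r_0} a`, where `X_i` are the root vectors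
that contain `E_c` and `a` is a product of `E_0, …, E_{c-1}`. -/
def pbwSpan (q : k) (E : ℕ → B) (c : ℕ) : ℕ → Submodule k B
  | 0 => Subalgebra.toSubmodule (raisingAlg k E c)
  | j + 1 => ⨆ r : ℕ, (pbwSpan q E c j).map (LinearMap.mulLeft k (rootVec q E j (c - j) ^ r))

variable {E : ℕ → B} {c : ℕ}

theorem pow_mul_mem_pbwSpan {j : ℕ} {y : B} (hy : y ∈ pbwSpan q E c j) (r : ℕ) :
    rootVec q E j (c - j) ^ r * y ∈ pbwSpan q E c (j + 1) :=
  Submodule.mem_iSup_of_mem r ⟨y, hy, rfl⟩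

theorem mem_pbwSpan_succ {j : ℕ} {y : B} (hy : y ∈ pbwSpan q E c j) : y ∈ pbwSpan q E c (j + 1) := by
  simpa using pow_mul_mem_pbwSpan hy 0

theorem pbwSpan_succ_induction {j : ℕ} {p : B → Prop} (hadd : ∀ a b, p a → p b → p (a + b))
    (h0 : p 0) (h : ∀ r, ∀ y ∈ pbwSpan q E c j, p (rootVec q E j (c - j) ^ r * y)) {u : B}
    (hu : u ∈ pbwSpan q E c (j + 1)) : p u := by
  refine Submodule.iSup_induction _ (motive := p) hu ?_ h0 hadd
  rintro r _ ⟨y, hy, rfl⟩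
  exact h r y hy

theorem rootVec_mul_mem_pbwSpan {j : ℕ} {u : B} (hu : u ∈ pbwSpan q E c (j + 1)) :
    rootVec q E j (c - j) * u ∈ pbwSpan q E c (j + 1) := by
  refine pbwSpan_succ_induction (p := fun u => rootVec q E j (c - j) * u ∈ pbwSpan q E c (j + 1))
    (fun a b ha hb => ?_) ?_ (fun r y hy => ?_) hu
  · rw [mul_add]; exact add_mem ha hb
  · rw [mul_zero]; exact zero_mem _
  · rw [← mul_assoc, ← pow_succ']
    exact pow_mul_mem_pbwSpan hy _

/-- The letter a moves through the power of x, leaving at most one bracket b, which can be collected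
on the right. The exact coefficient d is irrelevant for spanning. -/
theorem exists_mul_pow {a x b : B} (h : a * x = b + q • (x * a)) (hbx : b * x = q⁻¹ • (x * b))
    (r : ℕ) : ∃ d : k, a * x ^ r = q ^ r • (x ^ r * a) + d • (x ^ (r - 1) * b) := by
  rcases r with - | r
  · exact ⟨0, by simp⟩
  induction r with
  | zero => exact ⟨1, by simp [h, add_comm]⟩
  | succ r ih =>
    obtain ⟨d, hd⟩ := ih
    refine ⟨q ^ (r + 1) + d * q⁻¹, ?_⟩
    rw [pow_succ, ← mul_assoc, hd, add_mul, smul_mul_assoc, smul_mul_assoc, mul_assoc, h,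
      mul_assoc _ b, hbx]
    simp only [Nat.add_sub_cancel, pow_succ, mul_add, mul_smul_comm, smul_add, smul_smul, mul_assoc]
    module

/-- E_s commutes up to a scalar with the root vector that starts at j and ends at c, by the three
commutation lemmas for root vectors, with one exception. This is s = j - 1, where the bracket is the
next longer root vector, starting at s, which stands further to the right in the ordered product and
is absorbed there. -/
theorem IsSerre.mul_mem_pbwSpan (hE : IsSerre q E) (hq : q ≠ 0) (hq4 : 1 + q ^ 2 ≠ 0) {s : ℕ}
    (hs : s < c) {j : ℕ} (hj : j ≤ c + 1) : ∀ u ∈ pbwSpan q E c j, E s * u ∈ pbwSpan q E c j := by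
  induction j with
  | zero =>
    exact fun u hu => (raisingAlg k E c).mul_mem (Algebra.subset_adjoin ⟨s, hs, rfl⟩) hu
  | succ j ih =>
    intro u hu
    specialize ih (by omega)
    refine pbwSpan_succ_induction (p := fun u => E s * u ∈ pbwSpan q E c (j + 1))
      (fun a b ha hb => ?_) ?_ (fun r y hy => ?_) hu
    · rw [mul_add]; exact add_mem ha hb
    · rw [mul_zero]; exact zero_mem _
    · have key : ∀ d : k, E s * rootVec q E j (c - j) = d • (rootVec q E j (c - j) * E s) →
          E s * (rootVec q E j (c - j) ^ r * y) ∈ pbwSpan q E c (j + 1) := by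
        intro d hd
        have h : E s * rootVec q E j (c - j) ^ r = d ^ r • (rootVec q E j (c - j) ^ r * E s) := by
          clear hy
          induction r with
          | zero => simp
          | succ r ihr =>
            rw [pow_succ, ← mul_assoc, ihr, smul_mul_assoc, mul_assoc, hd, mul_smul_comm, smul_smul,
              ← pow_succ, ← mul_assoc]
        rw [← mul_assoc, h, smul_mul_assoc, mul_assoc]
        exact Submodule.smul_mem _ _ (pow_mul_mem_pbwSpan (ih y hy) r)
      rcases lt_trichotomy s j with h | rfl | h
      · rcases (Nat.succ_le_of_lt h).lt_or_eq with h | rfl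
        · exact key 1 (by rw [one_smul, hE.comm_rootVec_of_lt _ h])
        -- The exceptional case: the bracket of E_s with the root vector starting at s + 1 is the
        -- root vector starting at s.
        · obtain ⟨m, hm⟩ : ∃ m, c - s = m + 1 := ⟨c - s - 1, by omega⟩
          have hm' : c - s.succ = m := by omega
          have hb : rootVec q E s (c - s) = E s * rootVec q E s.succ (c - s.succ) -
              q • (rootVec q E s.succ (c - s.succ) * E s) := by rw [hm, hm']; rfl
          have hbx := hE.rootVec_mul_rootVec hq hq4 m s
          rw [← hm] at hbx
          rw [← hm'] at hbx
          obtain ⟨d, hd⟩ := exists_mul_pow (a := E s) (b := rootVec q E s (c - s))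
            (x := rootVec q E s.succ (c - s.succ)) (q := q) (by rw [hb]; abel) hbx r
          rw [← mul_assoc, hd, add_mul, smul_mul_assoc, smul_mul_assoc, mul_assoc, mul_assoc]
          refine add_mem (Submodule.smul_mem _ _ (pow_mul_mem_pbwSpan (ih y hy) r))
            (Submodule.smul_mem _ _ (pow_mul_mem_pbwSpan (rootVec_mul_mem_pbwSpan hy) _))
      · obtain ⟨m, hm⟩ : ∃ m, c - s = m + 1 := ⟨c - s - 1, by omega⟩
        exact key q⁻¹ (by rw [hm]; exact hE.mul_rootVec_self hq s m)
      · exact key 1 (by rw [one_smul, hE.comm_rootVec_of_mem hq hq4 _ h (by omega)])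

theorem IsSerre.raisingAlg_le_pbwSpan (hE : IsSerre q E) (hq : q ≠ 0) (hq4 : 1 + q ^ 2 ≠ 0) {u : B}
    (hu : u ∈ raisingAlg k E (c + 1)) : u ∈ pbwSpan q E c (c + 1) := by
  have h : ∀ v ∈ pbwSpan q E c (c + 1), u * v ∈ pbwSpan q E c (c + 1) := by
    induction hu using Algebra.adjoin_induction with
    | mem x hx =>
      obtain ⟨s, hs, rfl⟩ := hx
      rcases (Nat.lt_succ_iff.1 hs).lt_or_eq with hs | rfl
      · exact hE.mul_mem_pbwSpan hq hq4 hs le_rfl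
      -- The top generator E_c is itself the last root vector, the one of length c - c = 0, and it
      -- stands leftmost.
      · intro v hv
        have := rootVec_mul_mem_pbwSpan hv
        rwa [Nat.sub_self] at this
    | algebraMap r =>
      intro v hv
      rw [← Algebra.smul_def]
      exact Submodule.smul_mem _ _ hv
    | add x y _ _ hx hy => intro v hv; rw [add_mul]; exact add_mem (hx v hv) (hy v hv)
    | mul x y _ _ hx hy => intro v hv; rw [mul_assoc]; exact hx _ (hy v hv)
  have h1 : ∀ j, (1 : B) ∈ pbwSpan q E c j := by
    intro j
    induction j with
    | zero => exact one_mem (raisingAlg k E c)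
    | succ j ih => exact mem_pbwSpan_succ ih
  simpa using h 1 (h1 _)

theorem exists_sum_of_mem_pbwSpan {j : ℕ} {u : B} (hu : u ∈ pbwSpan q E c (j + 1)) :
    ∃ (R : ℕ) (y : ℕ → B), (∀ r, y r ∈ pbwSpan q E c j) ∧
      u = ∑ r ∈ Finset.range R, rootVec q E j (c - j) ^ r * y r := by
  obtain ⟨f, hf, rfl⟩ := (Submodule.mem_iSup_iff_exists_finsupp _ _).1 hu
  choose y hy hyf using hf
  refine ⟨f.support.sup id + 1, y, hy, ?_⟩
  rw [Finsupp.sum_of_support_subset f (s := Finset.range (f.support.sup id + 1)) _ _ (by simp)]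
  · exact Finset.sum_congr rfl fun r _ => (hyf r).symm
  · intro r hr
    exact Finset.mem_range.2 (Nat.lt_succ_of_le (Finset.le_sup (f := id) hr))

end RaisingFiltration

namespace IsStripModule

variable {k B T : Type*} [Field k] [Ring B] [Algebra k B] [AddCommGroup T] [Module k T]
  [Module B T] [IsScalarTower k B T] {q lam : k} {n : ℕ} {E kE : ℕ → B} {D L : ℕ → T →ₗ[k] T}

theorem smul_L (h : IsStripModule q lam n E kE D L) {c : ℕ} {a : B} (ha : a ∈ raisingAlg k E c)
    (v : T) : a • L (c + 1) v = L (c + 1) (a • v) := by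
  induction ha using Algebra.adjoin_induction generalizing v with
  | mem x hx =>
    obtain ⟨s, hs, rfl⟩ := hx
    exact h.E_L s _ (Nat.succ_lt_succ hs) v
  | algebraMap r => rw [algebraMap_smul, algebraMap_smul, map_smul]
  | add x y _ _ hx hy => rw [add_smul, add_smul, hx, hy, map_add]
  | mul x y _ _ hx hy => rw [mul_smul, mul_smul, hy, hx]

/-- A product of root vectors with starts below j commutes with D_d for d ≥ j, and the generators
below c commute with the operator adding the letter c + 1. So y followed by that letter is invisible
to D_j, …, D_c, while D_{c+1} just removes the letter. -/
theorem D_smul_L (h : IsStripModule q lam n E kE D L) (hq : q ≠ 0) {c : ℕ} (hc : c < n) {j : ℕ}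
    (hj : j ≤ c + 1) : ∀ y ∈ pbwSpan q E c j, ∀ v,
      (∀ d, j ≤ d → d ≤ c → D d (y • L (c + 1) v) = 0) ∧ D (c + 1) (y • L (c + 1) v) = y • v := by
  induction j with
  | zero =>
    intro y hy v
    rw [h.smul_L hy]
    exact ⟨fun d _ hd => h.D_L_ne _ _ (by omega) _, h.D_L _ (by omega) _⟩
  | succ j ih =>
    specialize ih (by omega)
    intro y hy
    refine pbwSpan_succ_induction (p := fun y => ∀ v,
      (∀ d, j + 1 ≤ d → d ≤ c → D d (y • L (c + 1) v) = 0) ∧ D (c + 1) (y • L (c + 1) v) = y • v)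
      (fun a b ha hb => ?_) (by simp) (fun r y hy => ?_) hy
    · intro v
      refine ⟨fun d hd hd' => ?_, ?_⟩
      · rw [add_smul, map_add, (ha v).1 d hd hd', (hb v).1 d hd hd', add_zero]
      · rw [add_smul, map_add, (ha v).2, (hb v).2, add_smul]
    · intro v
      have hr := (h.D_rootVec hq (c - j) (j := j) (by omega)).1
      have hr' : ∀ i, i ≠ j → ∀ v, D i (rootVec q E j (c - j) ^ r • v) =
          rootVec q E j (c - j) ^ r • D i v := by
        intro i hi
        clear hy
        induction r with
        | zero => simp
        | succ r ihr => intro v; rw [pow_succ', mul_smul, hr i hi, ihr, mul_smul]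
      refine ⟨fun d hd hd' => ?_, ?_⟩
      · rw [mul_smul, hr' d (by omega), (ih y hy v).1 d (by omega) hd', smul_zero]
      · rw [mul_smul, hr' _ (by omega), (ih y hy v).2, mul_smul]

/-- D_j differentiates the power: the geometric sum in q² is the q²-integer r + 1. It arises because
the torus element left by each differentiation passes the remaining root vectors with a factor q².
-/
theorem D_pow_smul (h : IsStripModule q lam n E kE D L) (hq : q ≠ 0) {j m : ℕ} (hj : j + m < n)
    {v : T} (hv : ∀ d, j ≤ d → d ≤ j + m → D d v = 0) (r : ℕ) :
    D j (rootVec q E j m ^ (r + 1) • v) = (lam ^ (m + 1) * ∑ i ∈ Finset.range (r + 1), (q ^ 2) ^ i) •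
      rootVec q E j m ^ r • rootK kE j m • D (j + m + 1) v := by
  obtain ⟨h₁, h₂, -, -⟩ := h.D_rootVec hq m hj
  have hp : ∀ i, i ≠ j → ∀ (r : ℕ) v, D i (rootVec q E j m ^ r • v) =
      rootVec q E j m ^ r • D i v := by
    intro i hi r
    induction r with
    | zero => simp
    | succ r ihr => intro v; rw [pow_succ', mul_smul, h₁ i hi, ihr, mul_smul]
  have hs : ∀ r : ℕ, stripComm q lam E kE D j m (rootVec q E j m ^ r • v) =
      (lam ^ (m + 1) * (q ^ 2) ^ r) • rootVec q E j m ^ r • rootK kE j m • D (j + m + 1) v := by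
    intro r
    rw [stripComm_eq m fun d hd hd' => by rw [hp d (by omega), hv d (by omega) hd', smul_zero],
      hp _ (by omega), ← mul_smul (rootK kE j m), (h.wt_rootK_rootVec hq m hj).pow_right hq r,
      smul_assoc, mul_smul, smul_smul]
    congr 2
    rw [mul_comm (r : ℤ), zpow_mul, zpow_natCast]
    norm_cast
  induction r with
  | zero =>
    rw [pow_one, h₂, hv j le_rfl (by omega), smul_zero, zero_add]
    have := hs 0
    simpa using this
  | succ r ih =>
    rw [pow_succ', mul_smul, h₂, ih, hs, Finset.sum_range_succ _ (r + 1), mul_add, add_smul,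
      smul_comm (rootVec q E j m), ← mul_smul (rootVec q E j m), ← pow_succ']

/-- Write u as Σ X^r y_r, with X the root vector from j to c. Applying D_j after adding a letter c +
1 turns this, up to a unit, into Σ [r+1] q^{-2r} X^r y_{r+1}, a shorter sum that again acts by zero
on the same vectors. So the y_{r+1} vanish by induction on the length, and y_0 vanishes by induction
on j. For j = 0 the letter c + 1 is simply pulled out, and faithfulness of the smaller algebra is
used. -/
theorem eq_zero_of_mem_pbwSpan (h : IsStripModule q lam n E kE D L) (hq : q ≠ 0) (hlam : lam ≠ 0)
    (hroot : ∀ m : ℕ, 0 < m → q ^ m ≠ 1) {c : ℕ} (hc : c < n)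
    (hA : ∀ a ∈ raisingAlg k E c, (∀ v : T, a • v = 0) → a = 0) {j : ℕ} (hj : j ≤ c + 1) :
    ∀ u ∈ pbwSpan q E c j, ∀ P : ℕ, (∀ v, u • (L (c + 1) ^ P) v = 0) → u = 0 := by
  induction j with
  | zero =>
    intro u hu P hP
    refine hA u hu fun v => ?_
    have hL : ∀ (P : ℕ) v, u • (L (c + 1) ^ P) v = (L (c + 1) ^ P) (u • v) := by
      intro P
      induction P with
      | zero => intro v; rfl
      | succ P ih => intro v; rw [pow_succ', Module.End.mul_apply, h.smul_L hu, ih]; rfl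
    have hinj : Function.Injective (L (c + 1)) :=
      Function.LeftInverse.injective (h.D_L (c + 1) (by omega))
    have := (hL P v).symm.trans (hP v)
    rw [Module.End.coe_pow] at this
    exact (hinj.iterate P) (this.trans (by rw [← Module.End.coe_pow, map_zero]))
  | succ j ih =>
    specialize ih (by omega)
    set X := rootVec q E j (c - j) with hX
    have hcj : j + (c - j) = c := by omega
    have hK := h.wt_rootK_rootVec hq (c - j) (j := j) (by omega)
    obtain ⟨κ, hκ⟩ := h.isUnit_rootK (c - j) (j := j) (by omega)
    -- If a q²-integer vanished, then q would be a root of unity, since (q² - 1) times it is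
    -- q^{2(r+1)} - 1.
    have hcoef : ∀ r : ℕ, ∑ i ∈ Finset.range (r + 1), (q ^ 2) ^ i ≠ 0 := by
      intro r hr
      have := Commute.geom_sum₂_mul (Commute.one_right (q ^ 2)) (r + 1)
      simp only [one_pow, mul_one] at this
      rw [hr, zero_mul, ← pow_mul] at this
      exact hroot _ (by omega) (sub_eq_zero.1 this.symm)
    have key : ∀ (R : ℕ) (y : ℕ → B), (∀ r, y r ∈ pbwSpan q E c j) → ∀ P : ℕ,
        (∀ v, (∑ r ∈ Finset.range R, X ^ r * y r) • (L (c + 1) ^ P) v = 0) →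
        ∀ r < R, y r = 0 := by
      intro R
      induction R with
      | zero => intro y hy P hP r hr; omega
      | succ R ihR =>
        intro y hy P hP
        -- The first factor comes from differentiating X^{r+1}; the second from moving the torus
        -- unit κ to the left of X^r, where it can be cancelled from the whole sum.
        have hz := ihR (fun r => ((∑ i ∈ Finset.range (r + 1), (q ^ 2) ^ i) *
            (q ^ (r * 2 : ℤ))⁻¹) • y (r + 1))
          (fun r => Submodule.smul_mem _ _ (hy _)) P fun v => by
            have hv := congrArg (D j) (hP (L (c + 1) v))
            rw [← Module.End.mul_apply, ← pow_succ, pow_succ', Module.End.mul_apply,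
              Finset.sum_range_succ', add_smul, map_add, pow_zero, one_mul,
              (h.D_smul_L hq hc (by omega) _ (hy 0) _).1 j le_rfl (by omega), add_zero, map_zero,
              Finset.sum_smul, map_sum] at hv
            have hterm : ∀ r : ℕ, D j ((X ^ (r + 1) * y (r + 1)) • L (c + 1) ((L (c + 1) ^ P) v)) =
                lam ^ (c - j + 1) • (κ : B) • (X ^ r * (((∑ i ∈ Finset.range (r + 1), (q ^ 2) ^ i) *
                  (q ^ (r * 2 : ℤ))⁻¹) • y (r + 1))) • (L (c + 1) ^ P) v := by
              intro r
              have hd := h.D_smul_L hq hc (by omega) _ (hy (r + 1)) ((L (c + 1) ^ P) v)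
              have hκX : (X ^ r * κ : B) = (q ^ (r * 2 : ℤ))⁻¹ • (κ * X ^ r) := by
                rw [hκ, hK.pow_right hq r, smul_smul, inv_mul_cancel₀ (zpow_ne_zero _ hq), one_smul]
              rw [mul_smul, h.D_pow_smul hq (by omega) (fun d hd₁ hd₂ => hd.1 d hd₁ (by omega)) r,
                hcj, hd.2, ← hκ, ← hX, ← mul_smul (X ^ r), hκX]
              simp only [mul_smul_comm, smul_assoc, mul_smul, smul_comm (κ : B)]
            rw [Finset.sum_congr rfl fun r _ => hterm r, ← Finset.smul_sum, ← Finset.smul_sum,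
              ← Finset.sum_smul] at hv
            have hv' := (smul_eq_zero.1 hv).resolve_left (pow_ne_zero _ hlam)
            have := congrArg (fun t => (↑κ⁻¹ : B) • t) hv'
            simpa only [← mul_smul, Units.inv_mul, one_smul, smul_zero, one_mul, ← mul_assoc] using this
        have hy' : ∀ r < R, y (r + 1) = 0 := fun r hr =>
          (smul_eq_zero.1 (hz r hr)).resolve_left
            (mul_ne_zero (hcoef r) (inv_ne_zero (zpow_ne_zero _ hq)))
        rintro (- | r) hr
        · refine ih _ (hy 0) P fun v => ?_
          have := hP v
          rwa [Finset.sum_range_succ', Finset.sum_eq_zero fun r hr => by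
            rw [hy' r (Finset.mem_range.1 hr), mul_zero], zero_add, pow_zero, one_mul] at this
        · exact hy' r (by omega)
    intro u hu P hP
    obtain ⟨R, y, hy, rfl⟩ := exists_sum_of_mem_pbwSpan hu
    exact Finset.sum_eq_zero fun r hr => by
      rw [key R y hy P hP r (Finset.mem_range.1 hr), mul_zero]

theorem eq_zero_of_mem_raisingAlg [Nontrivial T] (h : IsStripModule q lam n E kE D L) (hq : q ≠ 0)
    (hlam : lam ≠ 0) (hroot : ∀ m : ℕ, 0 < m → q ^ m ≠ 1) {c : ℕ} (hc : c ≤ n) :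
    ∀ a ∈ raisingAlg k E c, (∀ v : T, a • v = 0) → a = 0 := by
  -- 1 + q² divides q⁴ - 1.
  have hq4 : 1 + q ^ 2 ≠ 0 := fun h => hroot 4 (by norm_num) (by linear_combination (q ^ 2 - 1) * h)
  induction c with
  | zero =>
    intro a ha hv
    have hs : E '' Set.Iio 0 = ∅ := by simp
    rw [raisingAlg, hs, Algebra.adjoin_empty] at ha
    obtain ⟨r, rfl⟩ := Algebra.mem_bot.1 ha
    obtain ⟨v, hv0⟩ := exists_ne (0 : T)
    have := hv v
    rw [algebraMap_smul] at this
    rw [(smul_eq_zero.1 this).resolve_right hv0, map_zero]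
  | succ c ih =>
    intro a ha hv
    exact h.eq_zero_of_mem_pbwSpan hq hlam hroot hc (ih (by omega)) le_rfl a
      (h.isSerre.raisingAlg_le_pbwSpan hq hq4 ha) 0 fun v => hv _

end IsStripModule

/-! ### Faithfulness on the Borel algebra -/

section TorusHom

variable {k B : Type*} [Field k] [Ring B] [Algebra k B] {q : k} {n : ℕ} {K Kinv : Fin (n + 1) → B}

/-- The unit `K̂_i`. -/
def IsTorus.unit (hT : IsTorus K Kinv) (i : Fin (n + 1)) : Bˣ :=
  ⟨K i, Kinv i, hT.mul_inv i, hT.inv_mul i⟩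

theorem IsTorus.pairwise_commute (hT : IsTorus K Kinv) : Pairwise fun i j : Fin n => ∀ x y,
    Commute (zpowersHom Bˣ (hT.unit i.castSucc) x) (zpowersHom Bˣ (hT.unit j.castSucc) y) := by
  intro i j _ x y
  have h : Commute (hT.unit i.castSucc) (hT.unit j.castSucc) :=
    Units.ext (hT.comm i.castSucc j.castSucc)
  rw [zpowersHom_apply, zpowersHom_apply]
  exact h.zpow_zpow _ _

/-- The monomials in `K̂_1^{±1}, …, K̂_{N-1}^{±1}`. -/
def IsTorus.hom (hT : IsTorus K Kinv) : (Fin n → Multiplicative ℤ) →* Bˣ :=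
  MonoidHom.noncommPiCoprod (fun i => zpowersHom Bˣ (hT.unit i.castSucc)) hT.pairwise_commute

theorem IsTorus.hom_mulSingle (hT : IsTorus K Kinv) (i : Fin n) :
    hT.hom (Pi.mulSingle i (Multiplicative.ofAdd 1)) = hT.unit i.castSucc :=
  (MonoidHom.noncommPiCoprod_mulSingle (hcomm := hT.pairwise_commute) _ i _).trans (by simp)

theorem pi_int_induction {p : (Fin n → Multiplicative ℤ) → Prop} (h1 : p 1)
    (hmul : ∀ a b, p a → p b → p (a * b)) (hinv : ∀ a, p a → p a⁻¹)
    (hsingle : ∀ i, p (Pi.mulSingle i (Multiplicative.ofAdd 1))) (w : Fin n → Multiplicative ℤ) :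
    p w := by
  let S : Subgroup (Fin n → Multiplicative ℤ) :=
    { carrier := {w | p w}, one_mem' := h1, mul_mem' := hmul _ _, inv_mem' := hinv _ }
  have h : w ∈ S := by
    rw [← Finset.univ_prod_mulSingle w]
    refine prod_mem fun i _ => ?_
    have hw : w i = Multiplicative.ofAdd 1 ^ Multiplicative.toAdd (w i) := by
      rw [← ofAdd_zsmul, smul_eq_mul, mul_one, ofAdd_toAdd]
    rw [hw, Pi.mulSingle_zpow]
    exact zpow_mem (hsingle i : Pi.mulSingle i (Multiplicative.ofAdd 1) ∈ S) _
  exact h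

/-- The last K̂ is the inverse of the product of the others, so monomials in the first N - 1 of them
exhaust the torus and their exponents are free parameters. -/
theorem IsTorus.exists_hom_eq (hT : IsTorus K Kinv) (i : Fin (n + 1)) :
    ∃ w, hT.hom w = hT.unit i := by
  induction i using Fin.lastCases with
  | cast i => exact ⟨_, hT.hom_mulSingle i⟩
  | last =>
    have hp : (List.ofFn fun i : Fin n => hT.unit i.castSucc).prod * hT.unit (Fin.last n) = 1 := by
      apply Units.ext
      have := hT.prod
      rw [List.ofFn_succ', List.concat_eq_append, List.prod_append, List.prod_singleton] at this
      rw [Units.val_mul, Units.val_one, ← this, ← Units.coeHom_apply, map_list_prod, List.map_ofFn]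
      rfl
    have hm : (List.ofFn fun i : Fin n => hT.unit i.castSucc).prod ∈ hT.hom.range :=
      list_prod_mem fun x hx => by
        obtain ⟨i, rfl⟩ := (List.mem_ofFn' _ _).1 hx
        exact ⟨_, hT.hom_mulSingle i⟩
    obtain ⟨w, hw⟩ := inv_mem hm
    exact ⟨w, hw.trans (inv_eq_of_mul_eq_one_right hp)⟩

end TorusHom

/-! ### Separation of the torus monomials. -/

section TorusSeparation

variable {k B T : Type*} [Field k] [Ring B] [Algebra k B] [AddCommGroup T] [Module k T]
  [Module B T] [IsScalarTower k B T] {q lam : k} {n : ℕ} {E kE : ℕ → B} {D L : ℕ → T →ₗ[k] T}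

theorem IsStripModule.D_smul_of_forall (h : IsStripModule q lam n E kE D L) {y : B}
    (hy : y ∈ raisingAlg k E n) (j : ℕ) : ∀ v : T, (∀ d, j < d → D d v = 0) →
      (∀ d, j < d → D d (y • v) = 0) ∧ D j (y • v) = y • D j v := by
  induction hy using Algebra.adjoin_induction with
  | mem x hx =>
    obtain ⟨s, -, rfl⟩ := hx
    intro v hv
    have key : ∀ d, j ≤ d → D d (E s • v) = E s • D d v := by
      intro d hd
      by_cases hds : d = s
      · subst hds
        rw [h.D_E_self, hv (d + 1) (by omega), smul_zero, smul_zero, add_zero]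
      · exact h.D_E d s hds v
    exact ⟨fun d hd => by rw [key d hd.le, hv d hd, smul_zero], key j le_rfl⟩
  | algebraMap r =>
    intro v hv
    exact ⟨fun d hd => by rw [algebraMap_smul, map_smul, hv d hd, smul_zero], by
      rw [algebraMap_smul, map_smul, algebraMap_smul]⟩
  | add x y _ _ hx hy =>
    intro v hv
    exact ⟨fun d hd => by rw [add_smul, map_add, (hx v hv).1 d hd, (hy v hv).1 d hd, add_zero], by
      rw [add_smul, map_add, (hx v hv).2, (hy v hv).2, add_smul]⟩
  | mul x y _ _ hx hy =>
    intro v hv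
    have h' := hx _ (hy v hv).1
    exact ⟨fun d hd => by rw [mul_smul, h'.1 d hd], by
      rw [mul_smul, h'.2, (hy v hv).2, mul_smul]⟩

/-- Dedekind's independence of characters, with vector coefficients: apply an arbitrary linear form
to them. -/
theorem eq_zero_of_sum_monoidHom {G M ι : Type*} [Monoid G] [AddCommGroup M] [Module k M]
    {f : ι → G →* k} (hf : Function.Injective f) {s : Finset ι} {m : ι → M}
    (h : ∀ g, ∑ i ∈ s, f i g • m i = 0) : ∀ i ∈ s, m i = 0 := by
  intro i hi
  rw [← Module.forall_dual_apply_eq_zero_iff k]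
  intro φ
  have hl := (linearIndependent_monoidHom G k).comp f hf
  refine linearIndependent_iff'.1 hl s (fun i => φ (m i)) (funext fun g => ?_) i hi
  have := congrArg φ (h g)
  simpa [mul_comm] using this

/-- Let u = Σ κ_i y_i. Adding the letter j and stripping it again passes through y_i unchanged and
multiplies the i-th term by χ_i(j). Doing this along words produces the characters of the free
monoid defined by the χ_i, which are distinct, so each κ_i y_i acts by zero separately. -/
theorem IsStripModule.eq_zero_of_smul_eq_zero [Nontrivial T] (h : IsStripModule q lam n E kE D L)
    (hq : q ≠ 0) (hlam : lam ≠ 0) (hroot : ∀ m : ℕ, 0 < m → q ^ m ≠ 1) {ι : Type*} {κ : ι → Bˣ}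
    {χ : ι → Fin (n + 1) → k} (hχ : Function.Injective χ)
    (hD : ∀ i (j : Fin (n + 1)) v, D j ((κ i : B) • v) = χ i j • (κ i : B) • D j v) {u : B}
    (hu : u ∈ ⨆ i, (Subalgebra.toSubmodule (raisingAlg k E n)).map
      (LinearMap.mulLeft k (κ i : B))) (huv : ∀ v : T, u • v = 0) : u = 0 := by
  obtain ⟨f, hf, rfl⟩ := (Submodule.mem_iSup_iff_exists_finsupp _ _).1 hu
  choose y hy hyf using hf
  have key : ∀ (g : FreeMonoid (Fin (n + 1))) (v : T),
      ∑ i ∈ f.support, FreeMonoid.lift (χ i) g • (f i • v) = 0 := by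
    intro g
    induction g using FreeMonoid.inductionOn' with
    | one =>
      intro v
      have := huv v
      rw [Finsupp.sum, Finset.sum_smul] at this
      simpa using this
    | of_mul j g ih =>
      intro v
      have := congrArg (D j) (ih (L j v))
      rw [map_sum, map_zero] at this
      rw [← this]
      refine Finset.sum_congr rfl fun i _ => ?_
      have hv : ∀ d, (j : ℕ) < d → D d (L j v) = 0 := fun d hd => h.D_L_ne d j (by omega) v
      have hy' := h.D_smul_of_forall (hy i) j (L j v) hv
      rw [← hyf i, LinearMap.mulLeft_apply, mul_smul, mul_smul, map_smul, hD, hy'.2,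
        h.D_L j (by omega), map_mul, FreeMonoid.lift_eval_of, mul_comm,
        mul_smul (FreeMonoid.lift (χ i) g)]
  refine Finset.sum_eq_zero fun i hi => ?_
  have hz : y i = 0 := h.eq_zero_of_mem_raisingAlg hq hlam hroot le_rfl _ (hy i) fun v => by
    have := eq_zero_of_sum_monoidHom (fun a b hab => hχ (FreeMonoid.lift.injective hab))
      (fun g => key g v) i hi
    rw [← hyf i, LinearMap.mulLeft_apply, mul_smul] at this
    simpa [← mul_smul] using congrArg (fun t => (↑(κ i)⁻¹ : B) • t) this
  rw [← hyf i, hz, map_zero]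

end TorusSeparation

/-! ### Modules of words, and faithfulness for the whole Borel algebra. -/

section WordModule

variable {k B T : Type*} [Field k] [Ring B] [Algebra k B] [AddCommGroup T] [Module k T]
  [Module B T] {q lam z : k} {n : ℕ}

/-- A module with the properties of the space of noncommutative polynomials in the letters
`0, …, n`. -/
structure IsWordModule (q lam z : k) (K Kinv : Fin (n + 1) → B) (E : Fin n → B)
    (D L : Fin (n + 1) → T →ₗ[k] T) (vac : T) : Prop where
  isTorus : IsTorus K Kinv
  rel : ∀ a b, ERel q K Kinv E a b → a = b
  K_L : ∀ i j v, K i • L j v = (z * if j = i then q else 1) • L j (K i • v)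
  E_L : ∀ s j v, E s • L j v = L j (E s • v) +
    if j = s.succ then lam • L s.castSucc (simpleK K Kinv s • v) else 0
  D_L : ∀ i j v, D i (L j v) = if i = j then v else 0
  K_vac : ∀ i, K i • vac = vac
  E_vac : ∀ s, E s • vac = 0
  D_vac : ∀ i, D i vac = 0
  vac_ne : vac ≠ 0
  span : Submodule.span k ({vac} ∪ ⋃ j, Set.range (L j)) = ⊤

/-- The extension of a finite sequence by a constant. -/
def natExt {M : Type*} {m : ℕ} (f : Fin m → M) (d : M) (i : ℕ) : M :=
  if h : i < m then f ⟨i, h⟩ else d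

theorem natExt_of_lt {M : Type*} {m : ℕ} (f : Fin m → M) (d : M) {i : ℕ} (h : i < m) :
    natExt f d i = f ⟨i, h⟩ := dif_pos h

theorem natExt_of_le {M : Type*} {m : ℕ} (f : Fin m → M) (d : M) {i : ℕ} (h : m ≤ i) :
    natExt f d i = d := dif_neg h.not_gt

theorem natExt_val {M : Type*} {m : ℕ} (f : Fin m → M) (d : M) (i : Fin m) :
    natExt f d i = f i := dif_pos i.2

namespace IsWordModule

variable {K Kinv : Fin (n + 1) → B} {E : Fin n → B} {D L : Fin (n + 1) → T →ₗ[k] T} {vac : T}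

theorem induction (h : IsWordModule q lam z K Kinv E D L vac) {f g : T →ₗ[k] T}
    (h₀ : f vac = g vac) (h₁ : ∀ j v, f (L j v) = g (L j v)) (v : T) : f v = g v := by
  refine LinearMap.congr_fun (LinearMap.ext_on h.span ?_) v
  rintro _ (rfl | hw)
  · exact h₀
  · obtain ⟨j, v, rfl⟩ := Set.mem_iUnion.1 hw
    exact h₁ j v

theorem D_K [IsScalarTower k B T] (h : IsWordModule q lam z K Kinv E D L vac) (i j : Fin (n + 1)) (v : T) :
    D j (K i • v) = (z * if j = i then q else 1) • K i • D j v := by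
  refine h.induction (f := D j ∘ₗ Algebra.lsmul k k T (K i))
    (g := (z * if j = i then q else 1) • Algebra.lsmul k k T (K i) ∘ₗ D j) ?_ (fun l v => ?_) v
  · simp only [LinearMap.comp_apply, LinearMap.smul_apply, Algebra.lsmul_coe, h.K_vac, h.D_vac,
      smul_zero]
  · simp only [LinearMap.comp_apply, Algebra.lsmul_coe, LinearMap.smul_apply, h.K_L, map_smul,
      h.D_L]
    split_ifs with h₁ h₂ h₃ <;> simp_all

/-- Both sides are linear in v, so it suffices to compare them on the vacuum and after adding a
letter j. Since E_s changes an outer letter s + 1 into s, stripping s produces an extra term. -/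
theorem D_E [IsScalarTower k B T] (h : IsWordModule q lam z K Kinv E D L vac) (i : Fin (n + 1)) (s : Fin n) (v : T) :
    D i (E s • v) = E s • D i v +
      if i = s.castSucc then lam • simpleK K Kinv s • D s.succ v else 0 := by
  have key : ∀ f g : T →ₗ[k] T, f vac = g vac → (∀ j v, f (L j v) = g (L j v)) → f v = g v :=
    fun f g h₀ h₁ => h.induction h₀ h₁ v
  have := key (D i ∘ₗ Algebra.lsmul k k T (E s)) (Algebra.lsmul k k T (E s) ∘ₗ D i +
      if i = s.castSucc then lam • Algebra.lsmul k k T (simpleK K Kinv s) ∘ₗ D s.succ else 0)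
    ?_ fun j v => ?_
  · simp only [LinearMap.comp_apply, Algebra.lsmul_coe, LinearMap.add_apply] at this
    rw [this]
    split_ifs <;> rfl
  · split_ifs <;> simp [h.E_vac, h.D_vac]
  · simp only [LinearMap.comp_apply, Algebra.lsmul_coe, LinearMap.add_apply, h.E_L, map_add, h.D_L,
      apply_ite (D i), map_smul, map_zero]
    have hne : s.succ ≠ s.castSucc := (Fin.castSucc_lt_succ (i := s)).ne'
    by_cases h₁ : i = s.castSucc <;> by_cases h₂ : j = s.succ <;> by_cases h₃ : i = j <;>
      simp_all [h.D_L, eq_comm]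

/-- The sequences are padded by 0 beyond their range (by 1 for the torus elements), so the relations
that involve a missing index hold trivially and no bounds are needed in the root vector calculus. -/
theorem isStripModule [IsScalarTower k B T] (h : IsWordModule q lam z K Kinv E D L vac) (hq : q ≠ 0) :
    IsStripModule q lam n (natExt E 0) (natExt (simpleK K Kinv) 1) (natExt D 0) (natExt L 0) := by
  obtain ⟨hR, hc, hs⟩ := (ERel_iff h.isTorus).1 h.rel
  have habs : ∀ s : ℕ, |(s : ℤ) - ((s + 1 : ℕ) : ℤ)| = 1 := fun s => by simp
  have habs' : ∀ s : ℕ, |((s + 1 : ℕ) : ℤ) - (s : ℤ)| = 1 := fun s => by simp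
  have hfar : ∀ s t : ℕ, s + 1 < t ∨ t + 1 < s → 1 < |(s : ℤ) - (t : ℤ)| := fun s t hst =>
    lt_abs.2 (by omega)
  have hwt : ∀ s < n, ∀ (t : ℕ) (m : ℤ), (∀ (hs : s < n) (ht : t < n),
      cartan (⟨s, hs⟩ : Fin n) ⟨t, ht⟩ = m) →
      QComm q m (natExt (simpleK K Kinv) 1 s) (natExt E 0 t) := by
    intro s hs t m hm
    by_cases ht : t < n
    · rw [natExt_of_lt _ _ hs, natExt_of_lt _ _ ht, ← hm hs ht]
      exact hR.simpleK_mul h.isTorus hq _ _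
    · rw [natExt_of_le _ _ (not_lt.1 ht)]
      simp [QComm]
  have hDE : ∀ (i s : ℕ) (v : T), natExt D 0 i (natExt E 0 s • v) =
      natExt E 0 s • natExt D 0 i v +
        if i = s then lam • natExt (simpleK K Kinv) 1 s • natExt D 0 (s + 1) v else 0 := by
    intro i s v
    by_cases hsn : s < n
    · by_cases hi : i < n + 1
      · rw [natExt_of_lt D 0 hi, natExt_of_lt E 0 hsn, natExt_of_lt (simpleK K Kinv) 1 hsn,
          natExt_of_lt D 0 (Nat.succ_lt_succ hsn), h.D_E]
        simp only [Fin.ext_iff, Fin.val_castSucc]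
        rfl
      · rw [natExt_of_le D 0 (not_lt.1 hi), if_neg (by omega)]
        simp
    · rw [natExt_of_le E 0 (not_lt.1 hsn), natExt_of_le D 0 (by omega : n + 1 ≤ s + 1)]
      simp
  refine ⟨⟨fun s t hst => ?_, fun s => ?_, fun s => ?_⟩, fun s hs => ?_, fun s hs => ?_,
    fun s hs => ?_, fun s hs => ?_, fun s hs t hst => ?_, fun i s his v => ?_, fun s v => ?_,
    fun s c hsc v => ?_, fun c hcn v => ?_, fun i c hic v => ?_⟩
  · by_cases ht : t < n
    · rw [natExt_of_lt _ _ ht, natExt_of_lt _ _ (by omega : s < n)]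
      exact hc _ _ (hfar _ _ (.inr hst))
    · rw [natExt_of_le _ _ (not_lt.1 ht), zero_mul, mul_zero]
  · by_cases ht : s + 1 < n
    · rw [natExt_of_lt _ _ ht, natExt_of_lt _ _ (by omega : s < n)]
      exact hs _ _ (habs s)
    · rw [natExt_of_le _ _ (not_lt.1 ht)]
      simp [serrePoly]
  · by_cases ht : s + 1 < n
    · rw [natExt_of_lt _ _ ht, natExt_of_lt _ _ (by omega : s < n)]
      exact hs _ _ (habs' s)
    · rw [natExt_of_le _ _ (not_lt.1 ht)]
      simp [serrePoly]
  · rw [natExt_of_lt _ _ hs]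
    exact ⟨⟨_, _, simpleK_mul_inv h.isTorus _, simpleKinv_mul h.isTorus _⟩, rfl⟩
  · exact hwt s hs s 2 fun _ _ => cartan_self _
  · exact hwt s hs (s + 1) (-1) fun _ _ => cartan_adj (habs s)
  · exact hwt (s + 1) hs s (-1) fun _ _ => cartan_adj (habs' s)
  · exact hwt s hs t 0 fun _ _ => cartan_far (hfar s t hst)
  · rw [hDE, if_neg his, add_zero]
  · rw [hDE, if_pos rfl]
  · by_cases hcn : c < n + 1
    · rw [natExt_of_lt L 0 hcn, natExt_of_lt E 0 (by omega : s < n), h.E_L, if_neg, add_zero]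
      rw [Fin.ext_iff, Fin.val_succ]
      exact hsc.ne'
    · rw [natExt_of_le L 0 (not_lt.1 hcn)]
      simp
  · rw [natExt_of_lt D 0 (Nat.lt_succ_of_le hcn), natExt_of_lt L 0 (Nat.lt_succ_of_le hcn), h.D_L,
      if_pos rfl]
  · by_cases hi : i < n + 1
    · by_cases hcn : c < n + 1
      · rw [natExt_of_lt D 0 hi, natExt_of_lt L 0 hcn, h.D_L, if_neg (by simpa [Fin.ext_iff])]
      · rw [natExt_of_le L 0 (not_lt.1 hcn)]
        simp
    · rw [natExt_of_le D 0 (not_lt.1 hi)]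
      simp

theorem nontrivial (h : IsWordModule q lam z K Kinv E D L vac) : Nontrivial T := ⟨_, _, h.vac_ne⟩

/-- The character of a torus monomial. -/
def torusChar (q z : k) (w : Fin n → Multiplicative ℤ) (j : Fin (n + 1)) : k :=
  ∏ i : Fin n, (z * if j = i.castSucc then q else 1) ^ Multiplicative.toAdd (w i)

/-- The last letter is never one of the first N - 1, so there the character sees only powers of z.
Dividing the value at letter l by it leaves q to the l-th exponent, which determines the exponent as
q is not a root of unity. -/
theorem torusChar_injective (hq : q ≠ 0) (hz : z ≠ 0) (hroot : ∀ m : ℕ, 0 < m → q ^ m ≠ 1) :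
    Function.Injective (torusChar (n := n) q z) := by
  have hval : ∀ (w : Fin n → Multiplicative ℤ) (j : Fin (n + 1)), torusChar q z w j =
      torusChar q z w (Fin.last n) *
        ∏ i : Fin n, (if j = i.castSucc then q else 1) ^ Multiplicative.toAdd (w i) := by
    intro w j
    rw [torusChar, torusChar, ← Finset.prod_mul_distrib]
    refine Finset.prod_congr rfl fun i _ => ?_
    rw [if_neg (Fin.castSucc_lt_last i).ne', mul_one, ← mul_zpow]
  intro w w' h
  funext l
  have h₁ := congrFun h (Fin.last n)
  have h₂ := congrFun h l.castSucc
  rw [hval w, hval w', h₁] at h₂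
  have h₃ := mul_left_cancel₀ (Finset.prod_ne_zero_iff.2 fun i _ => zpow_ne_zero _ (by
    rw [if_neg (Fin.castSucc_lt_last i).ne', mul_one]; exact hz)) h₂
  have hprod : ∀ w : Fin n → Multiplicative ℤ, ∏ i : Fin n,
      (if l.castSucc = i.castSucc then q else 1) ^ Multiplicative.toAdd (w i) =
      q ^ Multiplicative.toAdd (w l) := by
    intro w
    rw [Finset.prod_eq_single l (fun i _ hi => by
      rw [if_neg (by simpa [eq_comm] using hi), one_zpow]) (by simp), if_pos rfl]
  rw [hprod, hprod] at h₃
  have hne : ∀ a b : ℤ, a < b → q ^ a ≠ q ^ b := fun a b hab e => by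
    obtain ⟨m, hm⟩ := Int.eq_ofNat_of_zero_le (sub_nonneg.2 hab.le)
    refine hroot m (by omega) ?_
    rw [← zpow_natCast, ← hm, zpow_sub₀ hq, e, div_self (zpow_ne_zero _ hq)]
  apply Multiplicative.toAdd.injective
  rcases lt_trichotomy (Multiplicative.toAdd (w l)) (Multiplicative.toAdd (w' l)) with h | h | h
  · exact absurd h₃ (hne _ _ h)
  · exact h
  · exact absurd h₃.symm (hne _ _ h)

theorem D_hom [IsScalarTower k B T] (h : IsWordModule q lam z K Kinv E D L vac) (hq : q ≠ 0)
    (hz : z ≠ 0) (j : Fin (n + 1)) (w : Fin n → Multiplicative ℤ) : ∀ v : T,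
    D j ((h.isTorus.hom w : B) • v) = torusChar q z w j • (h.isTorus.hom w : B) • D j v := by
  have hc : ∀ i : Fin n, (z * if j = i.castSucc then q else 1) ≠ 0 := fun i =>
    mul_ne_zero hz (by split_ifs <;> simp [hq])
  induction w using pi_int_induction with
  | h1 => simp [torusChar]
  | hmul a b ha hb =>
    intro v
    have : torusChar q z (a * b) j = torusChar q z a j * torusChar q z b j := by
      rw [torusChar, torusChar, torusChar, ← Finset.prod_mul_distrib]
      exact Finset.prod_congr rfl fun i _ => by rw [Pi.mul_apply, toAdd_mul, zpow_add₀ (hc i)]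
    rw [map_mul, Units.val_mul, mul_smul, ha, hb, this, mul_smul, mul_smul,
      smul_comm (h.isTorus.hom a : B)]
  | hinv a ha =>
    intro v
    have hne : torusChar q z a j ≠ 0 := Finset.prod_ne_zero_iff.2 fun i _ => zpow_ne_zero _ (hc i)
    have hi : torusChar q z a⁻¹ j = (torusChar q z a j)⁻¹ := by
      rw [torusChar, torusChar, ← Finset.prod_inv_distrib]
      exact Finset.prod_congr rfl fun i _ => by rw [Pi.inv_apply, toAdd_inv, zpow_neg]
    have := ha ((↑(h.isTorus.hom a)⁻¹ : B) • v)
    rw [← mul_smul, Units.mul_inv, one_smul] at this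
    rw [map_inv, hi, this, smul_comm (↑(h.isTorus.hom a)⁻¹ : B), smul_smul,
      inv_mul_cancel₀ hne, one_smul, ← mul_smul, Units.inv_mul, one_smul]
  | hsingle i =>
    intro v
    rw [h.isTorus.hom_mulSingle]
    refine (h.D_K i.castSucc j v).trans ?_
    congr 1
    rw [torusChar, Finset.prod_eq_single i (fun l _ hl => by
      rw [Pi.mulSingle_eq_of_ne hl, toAdd_one, zpow_zero]) (by simp), Pi.mulSingle_eq_same,
      toAdd_ofAdd, zpow_one]

theorem exists_qcomm_hom (hT : IsTorus K Kinv) (hq : q ≠ 0) {w : Fin (n + 1) → ℤ} {X : B}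
    (hX : HasWeight q K w X) (l : Fin n → Multiplicative ℤ) :
    ∃ m : ℤ, QComm q m (hT.hom l : B) X := by
  induction l using pi_int_induction with
  | h1 => exact ⟨0, by simp [QComm]⟩
  | hmul a b ha hb =>
    obtain ⟨m, hm⟩ := ha
    obtain ⟨m', hm'⟩ := hb
    exact ⟨m + m', by rw [map_mul, Units.val_mul]; exact hm.mul_left hq hm'⟩
  | hinv a ha =>
    obtain ⟨m, hm⟩ := ha
    refine ⟨-m, ?_⟩
    have h : (↑(hT.hom a)⁻¹ * (hT.hom a * X) * ↑(hT.hom a)⁻¹ : B) = q ^ m • (↑(hT.hom a)⁻¹ * X) := by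
      rw [hm, mul_smul_comm, smul_mul_assoc, ← mul_assoc, Units.mul_inv_cancel_right]
    rw [Units.inv_mul_cancel_left] at h
    rw [map_inv, QComm, h, smul_smul, ← zpow_add₀ hq, neg_add_cancel, zpow_zero, one_smul]
  | hsingle i => exact ⟨w i.castSucc, by rw [hT.hom_mulSingle]; exact hX i.castSucc⟩

/-- E_s commutes with torus monomials up to a power of q, so all torus elements can be collected on
the left. -/
theorem mem_iSup_torus (hT : IsTorus K Kinv) (hq : q ≠ 0) (hE : HasRoots q K E) {u : B}
    (hu : u ∈ Algebra.adjoin k (genSet K Kinv E)) :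
    u ∈ ⨆ w, (Subalgebra.toSubmodule (raisingAlg k (natExt E 0) n)).map
      (LinearMap.mulLeft k (hT.hom w : B)) := by
  set S := ⨆ w, (Subalgebra.toSubmodule (raisingAlg k (natExt E 0) n)).map
    (LinearMap.mulLeft k (hT.hom w : B)) with hS
  have hmem : ∀ w, ∀ y ∈ raisingAlg k (natExt E 0) n, (hT.hom w : B) * y ∈ S := fun w y hy =>
    Submodule.mem_iSup_of_mem w ⟨y, hy, rfl⟩
  have hind : ∀ a : B, (∀ w, ∀ y ∈ raisingAlg k (natExt E 0) n, a * ((hT.hom w : B) * y) ∈ S) →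
      ∀ v ∈ S, a * v ∈ S := by
    intro a ha v hv
    refine Submodule.iSup_induction _ (motive := fun v => a * v ∈ S) hv ?_ ?_ ?_
    · rintro w _ ⟨y, hy, rfl⟩
      exact ha w y hy
    · rw [mul_zero]; exact zero_mem _
    · intro x y hx hy
      rw [mul_add]; exact add_mem hx hy
  have h : ∀ v ∈ S, u * v ∈ S := by
    induction hu using Algebra.adjoin_induction with
    | mem x hx =>
      rcases hx with (⟨i, rfl⟩ | ⟨i, rfl⟩) | ⟨s, rfl⟩
      · refine hind _ fun w y hy => ?_
        obtain ⟨w', hw'⟩ := hT.exists_hom_eq i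
        have := hmem (w' * w) y hy
        rwa [map_mul, hw', Units.val_mul, mul_assoc] at this
      · refine hind _ fun w y hy => ?_
        obtain ⟨w', hw'⟩ := hT.exists_hom_eq i
        have := hmem (w'⁻¹ * w) y hy
        rwa [map_mul, map_inv, hw', Units.val_mul, mul_assoc] at this
      · refine hind _ fun w y hy => ?_
        obtain ⟨m, hm⟩ := exists_qcomm_hom hT hq (hE s) w
        have h : E s * (hT.hom w : B) = q ^ (-m) • ((hT.hom w : B) * E s) := by
          rw [hm, smul_smul, ← zpow_add₀ hq, neg_add_cancel, zpow_zero, one_smul]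
        rw [← mul_assoc, h, smul_mul_assoc, mul_assoc]
        refine Submodule.smul_mem _ _ (hmem w _ (mul_mem (Algebra.subset_adjoin ⟨s, s.2, ?_⟩) hy))
        exact natExt_val E 0 s
    | algebraMap r =>
      intro v hv
      rw [← Algebra.smul_def]
      exact Submodule.smul_mem _ _ hv
    | add x y _ _ hx hy => intro v hv; rw [add_mul]; exact add_mem (hx v hv) (hy v hv)
    | mul x y _ _ hx hy => intro v hv; rw [mul_assoc]; exact hx _ (hy v hv)
  have h1 := hmem 1 1 (one_mem _)
  rw [map_one, Units.val_one, one_mul] at h1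
  simpa using h 1 h1

theorem eq_zero_of_smul_eq_zero [IsScalarTower k B T] (h : IsWordModule q lam z K Kinv E D L vac)
    (hq : q ≠ 0) (hz : z ≠ 0) (hlam : lam ≠ 0) (hroot : ∀ m : ℕ, 0 < m → q ^ m ≠ 1)
    (hG : Algebra.adjoin k (genSet K Kinv E) = ⊤) {u : B} (huv : ∀ v : T, u • v = 0) : u = 0 := by
  have := h.nontrivial
  refine (h.isStripModule hq).eq_zero_of_smul_eq_zero hq hlam hroot (torusChar_injective hq hz hroot)
    (fun w j v => ?_)
    (mem_iSup_torus h.isTorus hq (hasRoots_of_ERel h.isTorus h.rel) (hG ▸ Algebra.mem_top)) huv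
  rw [natExt_val]
  exact h.D_hom hq hz j w v

end IsWordModule

end WordModule

/-! ### The action on noncommutative polynomials -/

section Strip

variable {k I : Type*} [Field k]

/-- The auxiliary homomorphism for the definition of the stripping operators. -/
def stripAux [DecidableEq I] (k : Type*) [Field k] (i : I) :
    FreeAlgebra k I →ₐ[k] Matrix (Fin 2) (Fin 2) (FreeAlgebra k I) :=
  FreeAlgebra.lift k fun j => !![0, if i = j then 1 else 0; 0, FreeAlgebra.ι k j]

theorem stripAux_apply [DecidableEq I] (i : I) (w : FreeAlgebra k I) :
    stripAux k i w 1 0 = 0 ∧ stripAux k i w 1 1 = w := by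
  induction w using FreeAlgebra.induction with
  | grade0 r =>
    rw [AlgHom.commutes]
    simp [Matrix.algebraMap_matrix_apply]
  | grade1 j => simp [stripAux]
  | mul a b ha hb => simp [map_mul, Matrix.mul_apply, Fin.sum_univ_two, ha, hb]
  | add a b ha hb => simp [map_add, ha, hb]

/-- The operator that strips the letter `i` on the left. -/
def stripLeft [DecidableEq I] (k : Type*) [Field k] (i : I) : FreeAlgebra k I →ₗ[k] FreeAlgebra k I where
  toFun w := stripAux k i w 0 1
  map_add' a b := by rw [map_add, Matrix.add_apply]
  map_smul' c a := by rw [map_smul, Matrix.smul_apply, RingHom.id_apply]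

/-- In the upper triangular matrices of `stripAux` the lower right entry is the word itself and the
upper left entry of a letter is 0. So in the corner of the product only the corner of the first
letter times the rest of the word survives. -/
theorem stripLeft_ι_mul [DecidableEq I] (i j : I) (w : FreeAlgebra k I) :
    stripLeft k i (FreeAlgebra.ι k j * w) = if i = j then w else 0 := by
  change stripAux k i _ 0 1 = _
  rw [map_mul, Matrix.mul_apply, Fin.sum_univ_two, (stripAux_apply i w).2]
  simp [stripAux]

theorem stripLeft_one [DecidableEq I] (i : I) : stripLeft k i 1 = 0 := by
  change stripAux k i _ 0 1 = _
  simp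

/-- The reversal of words. -/
def wordRev (k I : Type*) [Field k] : FreeAlgebra k I →ₗ[k] FreeAlgebra k I :=
  (MulOpposite.opLinearEquiv k).symm.toLinearMap ∘ₗ
    (FreeAlgebra.lift k fun i => MulOpposite.op (FreeAlgebra.ι k i) :
      FreeAlgebra k I →ₐ[k] (FreeAlgebra k I)ᵐᵒᵖ).toLinearMap

theorem wordRev_mul (a b : FreeAlgebra k I) : wordRev k I (a * b) = wordRev k I b * wordRev k I a := by
  simp [wordRev]

theorem wordRev_ι (i : I) : wordRev k I (FreeAlgebra.ι k i) = FreeAlgebra.ι k i := by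
  simp [wordRev]

theorem wordRev_one : wordRev k I 1 = 1 := by
  simp [wordRev]

theorem wordRev_wordRev (w : FreeAlgebra k I) : wordRev k I (wordRev k I w) = w := by
  induction w using FreeAlgebra.induction with
  | grade0 r => rw [Algebra.algebraMap_eq_smul_one, map_smul, map_smul, wordRev_one, wordRev_one]
  | grade1 j => rw [wordRev_ι, wordRev_ι]
  | mul a b ha hb => rw [wordRev_mul, wordRev_mul, ha, hb]
  | add a b ha hb => rw [map_add, map_add, ha, hb]

/-- The operator that strips the letter `i` on the right. -/
def stripRight [DecidableEq I] (k : Type*) [Field k] (i : I) : FreeAlgebra k I →ₗ[k] FreeAlgebra k I :=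
  wordRev k I ∘ₗ stripLeft k i ∘ₗ wordRev k I

theorem stripRight_mul_ι [DecidableEq I] (i j : I) (w : FreeAlgebra k I) :
    stripRight k i (w * FreeAlgebra.ι k j) = if i = j then w else 0 := by
  simp only [stripRight, LinearMap.comp_apply, wordRev_mul, wordRev_ι, stripLeft_ι_mul]
  split_ifs
  · exact wordRev_wordRev w
  · exact map_zero _

theorem stripRight_one [DecidableEq I] (i : I) : stripRight k i 1 = 0 := by
  simp [stripRight, wordRev_one, stripLeft_one]

theorem span_ι_mul : Submodule.span k ({1} ∪ ⋃ j : I, Set.range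
    (LinearMap.mulLeft k (FreeAlgebra.ι k j))) = ⊤ := by
  set S := Submodule.span k ({1} ∪ ⋃ j : I, Set.range (LinearMap.mulLeft k (FreeAlgebra.ι k j)))
  have h1 : (1 : FreeAlgebra k I) ∈ S := Submodule.subset_span (.inl rfl)
  have hm : ∀ j w, FreeAlgebra.ι k j * w ∈ S := fun j w =>
    Submodule.subset_span (.inr (Set.mem_iUnion.2 ⟨j, w, rfl⟩))
  refine eq_top_iff.2 fun w _ => ?_
  induction w using FreeAlgebra.induction with
  | grade0 r => rw [Algebra.algebraMap_eq_smul_one]; exact S.smul_mem r h1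
  | grade1 j => simpa using hm j 1
  | add a b ha hb => exact add_mem (ha trivial) (hb trivial)
  | mul a b ha hb =>
    refine Submodule.span_induction (p := fun a _ => a * b ∈ S) ?_ ?_ ?_ ?_ (ha trivial)
    · rintro _ (rfl | hw)
      · rw [one_mul]; exact hb trivial
      · obtain ⟨j, v, rfl⟩ := Set.mem_iUnion.1 hw
        rw [LinearMap.mulLeft_apply, mul_assoc]
        exact hm j _
    · rw [zero_mul]; exact zero_mem _
    · intro x y _ _ hx hy
      rw [add_mul]; exact add_mem hx hy
    · intro c x _ hx
      rw [smul_mul_assoc]; exact S.smul_mem c hx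

theorem span_mul_ι : Submodule.span k ({1} ∪ ⋃ j : I, Set.range
    (LinearMap.mulRight k (FreeAlgebra.ι k j))) = ⊤ := by
  refine eq_top_iff.2 fun w _ => ?_
  have h : ∀ v ∈ Submodule.span k ({1} ∪ ⋃ j : I, Set.range
      (LinearMap.mulLeft k (FreeAlgebra.ι k j))), wordRev k I v ∈ Submodule.span k
      ({1} ∪ ⋃ j : I, Set.range (LinearMap.mulRight k (FreeAlgebra.ι k j))) := by
    intro v hv
    have := Submodule.mem_map_of_mem (f := wordRev k I) hv
    rw [Submodule.map_span] at this
    refine Submodule.span_mono ?_ this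
    rintro _ ⟨_, rfl | hw, rfl⟩
    · exact .inl wordRev_one
    · obtain ⟨j, v, rfl⟩ := Set.mem_iUnion.1 hw
      refine .inr (Set.mem_iUnion.2 ⟨j, wordRev k I v, ?_⟩)
      rw [LinearMap.mulLeft_apply, wordRev_mul, wordRev_ι]
      rfl
  have := h (wordRev k I w) (by rw [span_ι_mul]; trivial)
  rwa [wordRev_wordRev] at this

end Strip

/-! ### The action of H^* on the tensor algebra of a comodule. -/

namespace HopfStructure

variable {k H I : Type*} [Field k] [Ring H] [Algebra k H] [Fintype I]
  {D : HopfStructure k H}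

/-- The coaction on noncommutative polynomials. -/
def coact (k : Type*) [Field k] [Algebra k H] (u : I → I → H) :
    FreeAlgebra k I →ₐ[k] FreeAlgebra k I ⊗[k] H :=
  FreeAlgebra.lift k fun j => ∑ i, FreeAlgebra.ι k i ⊗ₜ u i j

/-- The evaluation of the second tensor factor. -/
def evalRight (T : Type*) [AddCommGroup T] [Module k T] (D : HopfStructure k H) (f : D.Dual) :
    T ⊗[k] H →ₗ[k] T :=
  (TensorProduct.rid k T).toLinearMap ∘ₗ (D.form f).lTensor T

theorem evalRight_tmul {T : Type*} [AddCommGroup T] [Module k T] (f : D.Dual) (t : T) (h : H) :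
    D.evalRight T f (t ⊗ₜ h) = D.form f h • t := by
  simp [evalRight]

/-- The coaction is an algebra map, so a form acts on products through its coproduct. Two terms
suffice: group-like and skew-primitive forms are the only ones needed. -/
theorem evalRight_mul {T : Type*} [Ring T] [Algebra k T] {f g₁ h₁ g₂ h₂ : D.Dual}
    (h : D.HasComul f (g₁ ⊗ₜ h₁ + g₂ ⊗ₜ h₂)) (X Y : T ⊗[k] H) :
    D.evalRight T f (X * Y) = D.evalRight T g₁ X * D.evalRight T h₁ Y +
      D.evalRight T g₂ X * D.evalRight T h₂ Y := by
  induction X with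
  | zero => simp
  | add X X' hX hX' => simp only [add_mul, map_add, hX, hX']; abel
  | tmul t a =>
    induction Y with
    | zero => simp
    | add Y Y' hY hY' => simp only [mul_add, map_add, hY, hY']; abel
    | tmul t' b =>
      have := h a b
      rw [map_add, evalDual_tmul, evalDual_tmul] at this
      simp only [Algebra.TensorProduct.tmul_mul_tmul, evalRight_tmul, ← this, smul_mul_smul_comm,
        add_smul]

variable {u : I → I → H}

/-- The action of a form on noncommutative polynomials. -/
def act (D : HopfStructure k H) (u : I → I → H) (f : D.Dual) :
    FreeAlgebra k I →ₗ[k] FreeAlgebra k I :=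
  D.evalRight _ f ∘ₗ (coact k u).toLinearMap

theorem act_mul_of_hasComul {f g₁ h₁ g₂ h₂ : D.Dual} (h : D.HasComul f (g₁ ⊗ₜ h₁ + g₂ ⊗ₜ h₂))
    (a b : FreeAlgebra k I) : D.act u f (a * b) = D.act u g₁ a * D.act u h₁ b +
      D.act u g₂ a * D.act u h₂ b := by
  simp only [act, LinearMap.comp_apply, AlgHom.toLinearMap_apply, map_mul]
  exact evalRight_mul h _ _

theorem act_ι (f : D.Dual) (j : I) :
    D.act u f (FreeAlgebra.ι k j) = ∑ i, D.form f (u i j) • FreeAlgebra.ι k i := by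
  simp [act, coact, evalRight_tmul]

theorem act_one_right (f : D.Dual) : D.act u f 1 = D.form f 1 • 1 := by
  simp only [act, LinearMap.comp_apply, AlgHom.toLinearMap_apply, map_one]
  rw [Algebra.TensorProduct.one_def, evalRight_tmul]

theorem act_one [DecidableEq I] (hu : D.IsCorep u) (w : FreeAlgebra k I) : D.act u 1 w = w := by
  have h : ((Algebra.TensorProduct.rid k k (FreeAlgebra k I)).toAlgHom.comp
      ((Algebra.TensorProduct.map (.id k _) D.ε).comp (coact k u))) = .id k _ := by
    ext j
    simp [coact, hu.counit]
  refine Eq.trans ?_ (AlgHom.congr_fun h w)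
  change D.evalRight _ 1 (coact k u w) = Algebra.TensorProduct.rid k k (FreeAlgebra k I)
    (Algebra.TensorProduct.map (.id k _) D.ε (coact k u w))
  induction coact k u w with
  | zero => simp
  | add X Y hX hY => simp only [map_add, hX, hY]
  | tmul t a => simp [evalRight_tmul, form_one]

/-- This is coassociativity of the coaction, checked on letters, with f and g evaluated on the last
two tensor factors. -/
theorem act_mul [DecidableEq I] (hu : D.IsCorep u) (f g : D.Dual) (w : FreeAlgebra k I) :
    D.act u (f * g) w = D.act u f (D.act u g w) := by
  have h : ((Algebra.TensorProduct.assoc k k k (FreeAlgebra k I) H H).toAlgHom.comp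
      ((Algebra.TensorProduct.map (coact k u) (.id k H)).comp (coact k u))) =
      (Algebra.TensorProduct.map (.id k _) D.Δ).comp (coact k u) := by
    ext j
    simp only [AlgHom.comp_apply, Function.comp_apply, coact, FreeAlgebra.lift_ι_apply, map_sum,
      Algebra.TensorProduct.map_tmul, hu.comul, TensorProduct.sum_tmul, TensorProduct.tmul_sum]
    rw [Finset.sum_comm]
    rfl
  have h₁ : ∀ X : FreeAlgebra k I ⊗[k] H, D.evalRight _ (f * g) X =
      TensorProduct.rid k _ ((LinearMap.mul' k k ∘ₗ TensorProduct.map (D.form f) (D.form g)).lTensor _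
        (Algebra.TensorProduct.map (.id k _) D.Δ X)) := by
    intro X
    induction X with
    | zero => simp
    | add X Y hX hY => simp only [map_add, hX, hY]
    | tmul t a => simp [evalRight_tmul, form_mul]
  have h₂ : ∀ X : FreeAlgebra k I ⊗[k] H, D.act u f (D.evalRight _ g X) =
      TensorProduct.rid k _ ((LinearMap.mul' k k ∘ₗ TensorProduct.map (D.form f) (D.form g)).lTensor _
        (Algebra.TensorProduct.assoc k k k (FreeAlgebra k I) H H
          (Algebra.TensorProduct.map (coact k u) (.id k H) X))) := by
    intro X
    induction X with
    | zero => simp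
    | add X Y hX hY => simp only [map_add, hX, hY]
    | tmul t a =>
      rw [evalRight_tmul, map_smul, Algebra.TensorProduct.map_tmul]
      change D.form g a • D.evalRight _ f (coact k u t) = _
      induction coact k u t with
      | zero => simp
      | add X Y hX hY => simp only [map_add, smul_add, hX, hY, TensorProduct.add_tmul]
      | tmul t b => simp [evalRight_tmul, smul_smul, mul_comm]
  change D.evalRight _ (f * g) (coact k u w) = D.act u f (D.evalRight _ g (coact k u w))
  rw [h₁, h₂]
  exact congrArg _ (congrArg _ (AlgHom.congr_fun h w).symm)

/-- The representation of the convolution algebra on noncommutative polynomials. -/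
def actHom [DecidableEq I] (hu : D.IsCorep u) : D.Dual →ₐ[k] Module.End k (FreeAlgebra k I) :=
  AlgHom.ofLinearMap
    { toFun := D.act u
      map_add' f g := by
        refine LinearMap.ext fun w => ?_
        change D.evalRight _ (f + g) (coact k u w) = D.evalRight _ f (coact k u w) +
          D.evalRight _ g (coact k u w)
        induction coact k u w with
        | zero => simp
        | add X Y hX hY => simp only [map_add, hX, hY]; abel
        | tmul t a => simp [evalRight_tmul, add_smul]
      map_smul' c f := by
        refine LinearMap.ext fun w => ?_
        change D.evalRight _ (c • f) (coact k u w) = c • D.evalRight _ f (coact k u w)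
        induction coact k u w with
        | zero => simp
        | add X Y hX hY => simp only [map_add, hX, hY, smul_add]
        | tmul t a => simp [evalRight_tmul, smul_smul] }
    (LinearMap.ext (act_one hu)) fun f g => LinearMap.ext (act_mul hu f g)

end HopfStructure

/-! ### Injectivity on the Borel algebras -/

section Reverse

variable {k B : Type*} [Field k] [Ring B] [Algebra k B] {q : k} {n : ℕ} {K Kinv : Fin (n + 1) → B}
  {F : Fin n → B}

theorem IsTorus.rev (hT : IsTorus K Kinv) : IsTorus (fun i => K i.rev) fun i => Kinv i.rev := by
  intro a b hab
  cases hab with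
  | comm i j => exact hT.comm _ _
  | mul_inv i => exact hT.mul_inv _
  | inv_mul i => exact hT.inv_mul _
  | prod =>
    rw [← hT.prod]
    refine List.Perm.prod_eq' ?_ ?_
    · rw [List.ofFn_eq_map, List.ofFn_eq_map, ← Function.comp_def, ← List.map_map]
      refine List.Perm.map _ ?_
      refine (List.perm_ext_iff_of_nodup ((List.nodup_finRange _).map Fin.rev_injective)
        (List.nodup_finRange _)).2 fun a => ?_
      simpa using ⟨a.rev, a.rev_rev⟩
    · refine List.pairwise_of_forall_mem_list fun a ha b hb => ?_
      obtain ⟨i, rfl⟩ := (List.mem_ofFn' _ _).1 ha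
      obtain ⟨j, rfl⟩ := (List.mem_ofFn' _ _).1 hb
      exact hT.comm _ _

theorem neg_rootExp_rev (i : Fin (n + 1)) (t : Fin n) : -rootExp i.rev t.rev = rootExp i t := by
  simp only [rootExp, ← Fin.rev_succ, ← Fin.rev_castSucc, Fin.rev_inj, neg_sub]

theorem abs_rev_sub_rev (s t : Fin n) :
    |((s.rev : Fin n) : ℤ) - ((t.rev : Fin n) : ℤ)| = |(s : ℤ) - (t : ℤ)| := by
  rw [← abs_neg]
  congr 1
  rw [Fin.val_rev, Fin.val_rev]
  omega

/-- Reversing the order of the indices negates the roots, hence turns the relations of the F_s into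
those of the E_s. The faithfulness theorem for word modules then covers both Borel algebras. -/
theorem FRel.rev (hT : IsTorus K Kinv) (hF : ∀ a b, FRel q K Kinv F a b → a = b) :
    ∀ a b, ERel q (fun i => K i.rev) (fun i => Kinv i.rev) (fun s => F s.rev) a b → a = b := by
  obtain ⟨hR, hc, hs⟩ := (FRel_iff hT).1 hF
  refine (ERel_iff hT.rev).2 ⟨fun t i => ?_, fun s t hst => ?_, fun s t hst => ?_⟩
  · have := hR t.rev i.rev
    beta_reduce at this
    rwa [neg_rootExp_rev] at this
  · exact hc _ _ (by rwa [abs_rev_sub_rev])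
  · exact hs _ _ (by rwa [abs_rev_sub_rev])

theorem genSet_rev (K Kinv : Fin (n + 1) → B) (F : Fin n → B) :
    genSet (fun i => K i.rev) (fun i => Kinv i.rev) (fun s => F s.rev) = genSet K Kinv F := by
  have h : ∀ {M : Type _} {m : ℕ} (f : Fin m → M), Set.range (fun i : Fin m => f i.rev) = Set.range f :=
    fun f => Fin.rev_surjective.range_comp f
  rw [genSet, genSet, h K, h Kinv, h F]

theorem IsTorus.simpleK_rev (hT : IsTorus K Kinv) (s : Fin n) :
    simpleK (fun i => K i.rev) (fun i => Kinv i.rev) s = simpleKinv K Kinv s.rev := by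
  rw [simpleK, simpleKinv, Fin.rev_succ, Fin.rev_castSucc, hT.inv_comm_left]

end Reverse

theorem BorelE.adjoin_genSet {k : Type*} [Field k] {n : ℕ} {q : k} : Algebra.adjoin k
    (genSet (fun i => BorelE.gen n q (.K i)) (fun i => BorelE.gen n q (.Kinv i))
      fun s => BorelE.gen n q (.X s)) = ⊤ := by
  rw [← BGen.range_elim, ← BorelE.adjoin_gen]
  congr 2
  funext g
  cases g <;> rfl

theorem BorelF.adjoin_genSet {k : Type*} [Field k] {n : ℕ} {q : k} : Algebra.adjoin k
    (genSet (fun i => BorelF.gen n q (.K i)) (fun i => BorelF.gen n q (.Kinv i))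
      fun s => BorelF.gen n q (.X s)) = ⊤ := by
  rw [← BGen.range_elim, ← BorelF.adjoin_gen]
  congr 2
  funext g
  cases g <;> rfl

/-! ### The noncommutative polynomials as a faithful module of each Borel algebra. -/

namespace SLq

open HopfStructure FreeAlgebra

variable {k : Type*} [Field k] {n : ℕ} {q z : k} (hq : q ≠ 0) (hz : z ^ (n + 1) = q⁻¹)

/-- The representation of the convolution algebra on noncommutative polynomials. -/
def wordRep : (hopf (n := n) hq).Dual →ₐ[k] Module.End k (FreeAlgebra k (Fin (n + 1))) :=
  actHom (isCorep hq)

theorem wordRep_ι (f : (hopf (n := n) hq).Dual) (j : Fin (n + 1)) :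
    wordRep hq f (ι k j) = ∑ i, ev hq f i j • ι k i :=
  act_ι f j

theorem wordRep_one (f : (hopf (n := n) hq).Dual) :
    wordRep hq f 1 = (hopf hq).form f 1 • 1 :=
  act_one_right f

theorem wordRep_mul {f g₁ h₁ g₂ h₂ : (hopf (n := n) hq).Dual}
    (h : (hopf hq).HasComul f (g₁ ⊗ₜ h₁ + g₂ ⊗ₜ h₂)) (a b : FreeAlgebra k (Fin (n + 1))) :
    wordRep hq f (a * b) = wordRep hq g₁ a * wordRep hq h₁ b +
      wordRep hq g₂ a * wordRep hq h₂ b :=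
  act_mul_of_hasComul h a b

theorem wordRep_K_mul (i : Fin (n + 1)) (a b : FreeAlgebra k (Fin (n + 1))) :
    wordRep hq ((cqt hq hz).K i) (a * b) =
      wordRep hq ((cqt hq hz).K i) a * wordRep hq ((cqt hq hz).K i) b := by
  have h : (hopf hq).HasComul ((cqt hq hz).K i)
      ((cqt hq hz).K i ⊗ₜ (cqt hq hz).K i + 0 ⊗ₜ 0) := by
    rw [TensorProduct.tmul_zero, add_zero]
    exact (isCharacter_K hq hz i).hasComul
  rw [wordRep_mul hq h, map_zero, LinearMap.zero_apply, zero_mul, add_zero]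

theorem wordRep_K_ι (i j : Fin (n + 1)) : wordRep hq ((cqt hq hz).K i) (ι k j) =
    (z * if j = i then q else 1) • ι k j := by
  rw [wordRep_ι, ev_K, Finset.sum_eq_single j]
  · rw [Matrix.diagonal_apply_eq]
  · intro a _ ha
    rw [Matrix.diagonal_apply_ne _ ha, zero_smul]
  · simp

theorem wordRep_E_ι (s : Fin n) (j : Fin (n + 1)) : wordRep hq ((cqt hq hz).E s) (ι k j) =
    if j = s.succ then (q - q⁻¹) • ι k s.castSucc else 0 := by
  rw [wordRep_ι, ev_E, Finset.sum_eq_single s.castSucc]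
  · simp [Matrix.single_apply, eq_comm]
  · intro a _ ha
    simp [Matrix.single_apply, ha.symm]
  · simp

theorem wordRep_F_ι (hq2 : q ^ 2 ≠ 1) (s : Fin n) (j : Fin (n + 1)) :
    wordRep hq ((cqt hq hz).F s) (ι k j) =
      if j = s.castSucc then (q - q⁻¹)⁻¹ • ι k s.succ else 0 := by
  rw [wordRep_ι, ev_F hq hz hq2, Finset.sum_eq_single s.succ]
  · simp [Matrix.single_apply, eq_comm]
  · intro a _ ha
    simp [Matrix.single_apply, ha.symm]
  · simp

theorem wordRep_E_mul (s : Fin n) (a b : FreeAlgebra k (Fin (n + 1))) :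
    wordRep hq ((cqt hq hz).E s) (a * b) = a * wordRep hq ((cqt hq hz).E s) b +
      wordRep hq ((cqt hq hz).E s) a * wordRep hq (simpleK (cqt hq hz).K (cqt hq hz).Kinv s) b := by
  rw [wordRep_mul hq (hasComul_E hq hz s), map_one, Module.End.one_apply]

theorem wordRep_F_mul (s : Fin n) (a b : FreeAlgebra k (Fin (n + 1))) :
    wordRep hq ((cqt hq hz).F s) (a * b) = wordRep hq ((cqt hq hz).F s) a * b +
      wordRep hq (simpleKinv (cqt hq hz).K (cqt hq hz).Kinv s) a *
        wordRep hq ((cqt hq hz).F s) b := by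
  rw [wordRep_mul hq (hasComul_F hq hz s), map_one, Module.End.one_apply]

/-- By Δ(E_s) = 1 ⊗ E_s + E_s ⊗ k_s, the letters added and stripped on the left make the polynomials
a word module with parameter q - q⁻¹. An element with zero image in H^* acts by zero, hence is zero.
-/
theorem ofBorelE_injective (hq2 : q ^ 2 ≠ 1) (h : ∀ m : ℕ, 0 < m → q ^ m ≠ 1) :
    Function.Injective (ofBorelE (n := n) hq hz) := by
  refine (injective_iff_map_eq_zero _).2 fun u hu => ?_
  let φ : BorelE n q →ₐ[k] Module.End k (FreeAlgebra k (Fin (n + 1))) :=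
    (wordRep hq).comp (ofBorelE hq hz)
  let _ : Module (BorelE n q) (FreeAlgebra k (Fin (n + 1))) := Module.compHom _ φ.toRingHom
  have hφ : ∀ (b : BorelE n q) (v : FreeAlgebra k (Fin (n + 1))),
      b • v = wordRep hq (ofBorelE hq hz b) v := fun _ _ => rfl
  have : IsScalarTower k (BorelE n q) (FreeAlgebra k (Fin (n + 1))) := ⟨fun c b v => by
    rw [hφ, hφ, map_smul, map_smul, LinearMap.smul_apply]⟩
  have hmod : IsWordModule q (q - q⁻¹) z (fun i => BorelE.gen n q (.K i))
      (fun i => BorelE.gen n q (.Kinv i)) (fun s => BorelE.gen n q (.X s))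
      (fun i => stripLeft k i) (fun j => LinearMap.mulLeft k (ι k j)) 1 := by
    refine ⟨BorelE.isTorus, BorelE.rel, fun i j v => ?_, fun s j v => ?_, fun i j v => ?_,
      fun i => ?_, fun s => ?_, fun i => stripLeft_one i, one_ne_zero, span_ι_mul⟩
    · rw [hφ, hφ, ofBorelE_gen, LinearMap.mulLeft_apply, LinearMap.mulLeft_apply]
      exact (wordRep_K_mul hq hz i _ _).trans (by rw [wordRep_K_ι, smul_mul_assoc]; rfl)
    · rw [hφ, hφ, hφ, ofBorelE_gen, LinearMap.mulLeft_apply, LinearMap.mulLeft_apply,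
        LinearMap.mulLeft_apply]
      refine (wordRep_E_mul hq hz s _ _).trans ?_
      rw [wordRep_E_ι, simpleK, simpleK, map_mul (ofBorelE hq hz), ofBorelE_gen, ofBorelE_gen,
        ite_mul, zero_mul, smul_mul_assoc]
      rfl
    · exact stripLeft_ι_mul i j v
    · rw [hφ, ofBorelE_gen, wordRep_one]
      exact (congrArg (· • (1 : FreeAlgebra k (Fin (n + 1))))
        (isCharacter_K hq hz i).one).trans (one_smul _ _)
    · rw [hφ, ofBorelE_gen, wordRep_one]
      exact (congrArg (· • (1 : FreeAlgebra k (Fin (n + 1))))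
        (form_E_one hq hz s)).trans (zero_smul _ _)
  refine hmod.eq_zero_of_smul_eq_zero hq (z_ne_zero hq hz) (sub_inv_ne_zero hq hq2) h
    BorelE.adjoin_genSet fun v => ?_
  rw [hφ, hu, map_zero, LinearMap.zero_apply]

theorem ofBorelF_injective (hq2 : q ^ 2 ≠ 1) (h : ∀ m : ℕ, 0 < m → q ^ m ≠ 1) :
    Function.Injective (ofBorelF (n := n) hq hz hq2) := by
  refine (injective_iff_map_eq_zero _).2 fun u hu => ?_
  let φ : BorelF n q →ₐ[k] Module.End k (FreeAlgebra k (Fin (n + 1))) :=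
    (wordRep hq).comp (ofBorelF hq hz hq2)
  let _ : Module (BorelF n q) (FreeAlgebra k (Fin (n + 1))) := Module.compHom _ φ.toRingHom
  have hφ : ∀ (b : BorelF n q) (v : FreeAlgebra k (Fin (n + 1))),
      b • v = wordRep hq (ofBorelF hq hz hq2 b) v := fun _ _ => rfl
  have : IsScalarTower k (BorelF n q) (FreeAlgebra k (Fin (n + 1))) := ⟨fun c b v => by
    rw [hφ, hφ, map_smul, map_smul, LinearMap.smul_apply]⟩
  -- Δ(F_s) = F_s ⊗ 1 + k_s⁻¹ ⊗ F_s has the torus factor on the left, so letters are now added on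
  -- the right, and the alphabet is reversed because F_s raises the letter.
  have hmod : IsWordModule q (q - q⁻¹)⁻¹ z (fun i => BorelF.gen n q (.K i.rev))
      (fun i => BorelF.gen n q (.Kinv i.rev)) (fun s => BorelF.gen n q (.X s.rev))
      (fun i => stripRight k i.rev) (fun j => LinearMap.mulRight k (ι k j.rev)) 1 := by
    refine ⟨BorelF.isTorus.rev, FRel.rev BorelF.isTorus BorelF.rel, fun i j v => ?_,
      fun s j v => ?_, fun i j v => ?_, fun i => ?_, fun s => ?_, fun i => stripRight_one _,
      one_ne_zero, ?_⟩
    · rw [hφ, hφ, ofBorelF_gen, LinearMap.mulRight_apply, LinearMap.mulRight_apply]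
      refine (wordRep_K_mul hq hz i.rev _ _).trans ?_
      simp only [wordRep_K_ι, mul_smul_comm, Fin.rev_inj]
      rfl
    · rw [hφ, hφ, hφ, ofBorelF_gen, LinearMap.mulRight_apply, LinearMap.mulRight_apply,
        LinearMap.mulRight_apply]
      refine (wordRep_F_mul hq hz s.rev _ _).trans ?_
      have hK := (BorelF.isTorus (n := n) (q := q)).simpleK_rev s
      beta_reduce at hK
      rw [hK, wordRep_F_ι hq hz hq2, simpleKinv, simpleKinv, map_mul (ofBorelF hq hz hq2),
        ofBorelF_gen, ofBorelF_gen, mul_ite, mul_zero, mul_smul_comm, Fin.rev_castSucc]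
      simp only [← Fin.rev_succ, Fin.rev_inj]
      rfl
    · exact (stripRight_mul_ι i.rev j.rev v).trans (by simp only [Fin.rev_inj])
    · rw [hφ, ofBorelF_gen, wordRep_one]
      exact (congrArg (· • (1 : FreeAlgebra k (Fin (n + 1))))
        (isCharacter_K hq hz i.rev).one).trans (one_smul _ _)
    · rw [hφ, ofBorelF_gen, wordRep_one]
      exact (congrArg (· • (1 : FreeAlgebra k (Fin (n + 1))))
        (form_F_one hq hz s.rev)).trans (zero_smul _ _)
    · rw [← span_mul_ι, Fin.rev_surjective.iUnion_comp
        fun j => Set.range (LinearMap.mulRight k (ι k j))]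
  refine hmod.eq_zero_of_smul_eq_zero hq (z_ne_zero hq hz) (inv_ne_zero (sub_inv_ne_zero hq hq2)) h
    ((congrArg _ (genSet_rev _ _ _)).trans BorelF.adjoin_genSet) fun v => ?_
  rw [hφ, hu, map_zero, LinearMap.zero_apply]

end SLq

/-! ### Leading terms with respect to an inner grading -/

section InnerGrading

variable {k X Y : Type*} [Field k] [Ring X] [Algebra k X] [Ring Y] [Algebra k Y] {q : k}

/-- The elements `t` with `R t = q ^ d t R`. -/
def innerWt (q : k) (R : X) (d : ℤ) : Submodule k X where
  carrier := {t | QComm q d R t}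
  add_mem' {a b} ha hb := by
    change R * (a + b) = _ at *
    rw [mul_add, add_mul, smul_add, ← ha, ← hb]
  zero_mem' := by simp [QComm]
  smul_mem' c a ha := by
    change R * (c • a) = _
    rw [mul_smul_comm, smul_mul_assoc, smul_comm, ← ha]

theorem mem_innerWt {R t : X} {d : ℤ} : t ∈ innerWt q R d ↔ QComm q d R t := Iff.rfl

/-- The span of the elements of weight greater than `d`. -/
def innerWtGT (q : k) (R : X) (d : ℤ) : Submodule k X := ⨆ e : {e : ℤ // d < e}, innerWt q R e

theorem innerWt_le_innerWtGT {R : X} {d e : ℤ} (h : d < e) : innerWt q R e ≤ innerWtGT q R d :=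
  le_iSup (fun e : {e : ℤ // d < e} => innerWt q R e) ⟨e, h⟩

theorem innerWtGT_mono {R : X} {d e : ℤ} (h : d ≤ e) : innerWtGT q R e ≤ innerWtGT q R d :=
  iSup_le fun e' => innerWt_le_innerWtGT (h.trans_lt e'.2)

theorem innerWt_mul_le (hq : q ≠ 0) {R : X} (d e : ℤ) :
    innerWt q R d * innerWt q R e ≤ innerWt q R (d + e) :=
  Submodule.mul_le.2 fun _ ha _ hb => QComm.mul_right hq ha hb

theorem innerWt_mul_innerWtGT_le (hq : q ≠ 0) {R : X} (d e : ℤ) :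
    innerWt q R d * innerWtGT q R e ≤ innerWtGT q R (d + e) := by
  rw [innerWtGT, Submodule.mul_iSup]
  exact iSup_le fun e' => (innerWt_mul_le hq _ _).trans
    (innerWt_le_innerWtGT (by have := e'.2; omega))

theorem innerWtGT_mul_innerWt_le (hq : q ≠ 0) {R : X} (d e : ℤ) :
    innerWtGT q R d * innerWt q R e ≤ innerWtGT q R (d + e) := by
  rw [innerWtGT, Submodule.iSup_mul]
  exact iSup_le fun e' => (innerWt_mul_le hq _ _).trans
    (innerWt_le_innerWtGT (by have := e'.2; omega))

theorem innerWtGT_mul_innerWtGT_le (hq : q ≠ 0) {R : X} (d e : ℤ) :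
    innerWtGT q R d * innerWtGT q R e ≤ innerWtGT q R (d + e) := by
  rw [innerWtGT, Submodule.iSup_mul]
  exact iSup_le fun e' => (innerWt_mul_innerWtGT_le hq _ _).trans
    (innerWtGT_mono (by have := e'.2; omega))

theorem map_mem_innerWt (f : X →ₐ[k] Y) {R t : X} {d : ℤ} (h : t ∈ innerWt q R d) :
    f t ∈ innerWt q (f R) d := by
  change f R * f t = _
  rw [← map_mul, h, map_smul, map_mul]

theorem map_mem_innerWtGT (f : X →ₐ[k] Y) {R t : X} {d : ℤ} (h : t ∈ innerWtGT q R d) :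
    f t ∈ innerWtGT q (f R) d := by
  have : innerWtGT q R d ≤ (innerWtGT q (f R) d).comap f.toLinearMap :=
    iSup_le fun e _ ht => innerWt_le_innerWtGT e.2 (map_mem_innerWt f ht)
  exact this h

theorem zpow_ne_zpow_of_lt (hq : q ≠ 0) (hroot : ∀ m : ℕ, 0 < m → q ^ m ≠ 1) {a b : ℤ}
    (hab : a < b) : q ^ a ≠ q ^ b := fun e => by
  obtain ⟨m, hm⟩ := Int.eq_ofNat_of_zero_le (sub_nonneg.2 hab.le)
  refine hroot m (by omega) ?_
  rw [← zpow_natCast, ← hm, zpow_sub₀ hq, e, div_self (zpow_ne_zero _ hq)]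

/-- The weight spaces lie in eigenspaces of conjugation by R, and the eigenvalues q^d are distinct
since q is not a root of unity. -/
theorem disjoint_innerWt (hq : q ≠ 0) (hroot : ∀ m : ℕ, 0 < m → q ^ m ≠ 1) (R : Xˣ) (d : ℤ) :
    Disjoint (innerWt q (R : X) d) (innerWtGT q (R : X) d) := by
  set f : Module.End k X := LinearMap.mulLeft k (R : X) ∘ₗ LinearMap.mulRight k (↑R⁻¹ : X)
  have hf : ∀ e, innerWt q (R : X) e ≤ f.eigenspace (q ^ e) := fun e t ht => by
    rw [Module.End.mem_eigenspace_iff]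
    change (R : X) * (t * ↑R⁻¹) = _
    rw [← mul_assoc, mem_innerWt.1 ht, smul_mul_assoc, Units.mul_inv_cancel_right]
  refine (f.eigenspaces_iSupIndep (q ^ d)).mono (hf d) (iSup_le fun e => (hf e).trans ?_)
  exact le_iSup₂ (f := fun (c : k) (_ : c ≠ q ^ d) => f.eigenspace c) (q ^ (e : ℤ))
    (zpow_ne_zpow_of_lt hq hroot e.2).symm

/-- The element `t` of weight `d` is the leading term of `Δ a`, up to terms of greater weight. -/
def HasLead {A : Type*} [Ring A] [Algebra k A] (q : k) (Δ : A →ₐ[k] X) (R : X) (d : ℤ) (a : A)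
    (t : X) : Prop :=
  t ∈ innerWt q R d ∧ Δ a - t ∈ innerWtGT q R d

namespace HasLead

variable {A : Type*} [Ring A] [Algebra k A] {Δ : A →ₐ[k] X} {R : X} {d e : ℤ} {a b : A} {s t : X}

theorem mul (hq : q ≠ 0) (ha : HasLead q Δ R d a s) (hb : HasLead q Δ R e b t) :
    HasLead q Δ R (d + e) (a * b) (s * t) := by
  refine ⟨innerWt_mul_le hq d e (Submodule.mul_mem_mul ha.1 hb.1), ?_⟩
  have : Δ (a * b) - s * t = (Δ a - s) * t + (Δ a - s) * (Δ b - t) + s * (Δ b - t) := by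
    rw [map_mul]
    noncomm_ring
  rw [this]
  exact add_mem (add_mem (innerWtGT_mul_innerWt_le hq d e (Submodule.mul_mem_mul ha.2 hb.1))
    (innerWtGT_mul_innerWtGT_le hq d e (Submodule.mul_mem_mul ha.2 hb.2)))
    (innerWt_mul_innerWtGT_le hq d e (Submodule.mul_mem_mul ha.1 hb.2))

theorem add (ha : HasLead q Δ R d a s) (hb : HasLead q Δ R d b t) :
    HasLead q Δ R d (a + b) (s + t) := by
  refine ⟨add_mem ha.1 hb.1, ?_⟩
  rw [map_add, add_sub_add_comm]
  exact add_mem ha.2 hb.2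

theorem smul (c : k) (ha : HasLead q Δ R d a s) : HasLead q Δ R d (c • a) (c • s) := by
  refine ⟨Submodule.smul_mem _ c ha.1, ?_⟩
  rw [map_smul, ← smul_sub]
  exact Submodule.smul_mem _ c ha.2

theorem zero : HasLead q Δ R d 0 0 := ⟨zero_mem _, by simp⟩

theorem of_eq (h : Δ a = t) (ht : t ∈ innerWt q R d) : HasLead q Δ R d a t :=
  ⟨ht, by rw [h, sub_self]; exact zero_mem _⟩

theorem of_eq_add (h : Δ a = t + s) (ht : t ∈ innerWt q R d) (hs : s ∈ innerWt q R e)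
    (hde : d < e) : HasLead q Δ R d a t :=
  ⟨ht, by rw [h, add_sub_cancel_left]; exact innerWt_le_innerWtGT hde hs⟩

end HasLead

end InnerGrading

/-! ### A torus element that measures height. -/

section HeightElement

variable {k B : Type*} [Field k] [Ring B] [Algebra k B] {q : k} {n : ℕ} {K Kinv : Fin (n + 1) → B}

theorem IsTorus.qcomm_hom (hT : IsTorus K Kinv) (hq : q ≠ 0) {w : Fin (n + 1) → ℤ} {X : B}
    (hX : HasWeight q K w X) (l : Fin n → Multiplicative ℤ) :
    QComm q (∑ i, Multiplicative.toAdd (l i) * w i.castSucc) (hT.hom l : B) X := by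
  induction l using pi_int_induction with
  | h1 => simp [QComm]
  | hmul a b ha hb =>
    rw [map_mul, Units.val_mul]
    simpa [add_mul, Finset.sum_add_distrib] using ha.mul_left hq hb
  | hinv a ha =>
    have h : (↑(hT.hom a)⁻¹ * (hT.hom a * X) * ↑(hT.hom a)⁻¹ : B) =
        q ^ (∑ i, Multiplicative.toAdd (a i) * w i.castSucc) • (↑(hT.hom a)⁻¹ * X) := by
      rw [ha, mul_smul_comm, smul_mul_assoc, ← mul_assoc, Units.mul_inv_cancel_right]
    rw [Units.inv_mul_cancel_left] at h
    simp only [Pi.inv_apply, toAdd_inv, neg_mul, Finset.sum_neg_distrib]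
    rw [map_inv, QComm, h, smul_smul, ← zpow_add₀ hq, neg_add_cancel, zpow_zero, one_smul]
  | hsingle i =>
    rw [hT.hom_mulSingle, Finset.sum_eq_single i (fun j _ hj => by
      rw [Pi.mulSingle_eq_of_ne hj, toAdd_one, zero_mul]) (by simp), Pi.mulSingle_eq_same,
      toAdd_ofAdd, one_mul]
    exact hX i.castSucc

/-- The torus element whose conjugation measures the height of a root. -/
def IsTorus.heightUnit (hT : IsTorus K Kinv) : Bˣ :=
  hT.hom fun i => Multiplicative.ofAdd ((n : ℤ) - i)

/-- The exponents n - i fall by one from each index to the next, so they pair to 1 with every simple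
root. The last index does not occur in the sum, but its exponent would be n - n = 0. -/
theorem sum_mul_rootExp (t : Fin n) : ∑ i : Fin n, ((n : ℤ) - i) * rootExp i.castSucc t = 1 := by
  simp only [rootExp, mul_sub, Finset.sum_sub_distrib, mul_ite, mul_one, mul_zero,
    Fin.castSucc_inj, Finset.sum_ite_eq', Finset.mem_univ, if_true]
  by_cases h : (t : ℕ) + 1 < n
  · rw [Finset.sum_eq_single ⟨t + 1, h⟩]
    · rw [if_pos (show Fin.castSucc ⟨t + 1, h⟩ = t.succ from rfl)]
      push_cast
      ring
    · intro j _ hj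
      rw [if_neg]
      intro e
      exact hj (Fin.ext (by simpa using congrArg Fin.val e))
    · simp
  · rw [Finset.sum_eq_zero]
    · have := t.2
      omega
    · intro j _
      rw [if_neg]
      intro e
      have := congrArg Fin.val e
      simp only [Fin.val_castSucc, Fin.val_succ] at this
      omega

theorem HasRoots.qcomm_heightUnit {E : Fin n → B} (hE : HasRoots q K E) (hT : IsTorus K Kinv)
    (hq : q ≠ 0) (s : Fin n) : QComm q 1 (hT.heightUnit : B) (E s) := by
  have := hT.qcomm_hom hq (hE s) fun i => Multiplicative.ofAdd ((n : ℤ) - i)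
  simp only [toAdd_ofAdd, sum_mul_rootExp] at this
  exact this

theorem HasNegRoots.qcomm_heightUnit {F : Fin n → B} (hF : HasNegRoots q K F)
    (hT : IsTorus K Kinv) (hq : q ≠ 0) (s : Fin n) :
    QComm q (-1) (hT.heightUnit : B) (F s) := by
  have := hT.qcomm_hom hq (hF s) fun i => Multiplicative.ofAdd ((n : ℤ) - i)
  simp only [toAdd_ofAdd, mul_neg, Finset.sum_neg_distrib, sum_mul_rootExp] at this
  exact this

theorem HasWeight.qcomm_heightUnit {X : B} (hX : HasWeight q K 0 X) (hT : IsTorus K Kinv)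
    (hq : q ≠ 0) : QComm q 0 (hT.heightUnit : B) X := by
  have := hT.qcomm_hom hq hX fun i => Multiplicative.ofAdd ((n : ℤ) - i)
  simp only [Pi.zero_apply, mul_zero, Finset.sum_const_zero] at this
  exact this

end HeightElement

/-! ### Left multiplication by the F_s combined with conjugation by the torus. -/

section ConjRep

variable {k A : Type*} [Field k] [Ring A] [Algebra k A] {q : k} {n : ℕ}
  {K Kinv : Fin (n + 1) → A} {F : Fin n → A}

/-- Conjugation by a unit, as a linear endomorphism. -/
def conjEnd (k A : Type*) [Field k] [Ring A] [Algebra k A] : Aˣ →* Module.End k A where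
  toFun u := LinearMap.mulLeft k (u : A) ∘ₗ LinearMap.mulRight k (↑u⁻¹ : A)
  map_one' := LinearMap.ext fun a => by simp
  map_mul' u v := LinearMap.ext fun a => by simp [mul_assoc]

theorem conjEnd_apply (u : Aˣ) (a : A) : conjEnd k A u a = u * a * ↑u⁻¹ := (mul_assoc _ _ _).symm

theorem IsTorus.prod_unit (hT : IsTorus K Kinv) : (List.ofFn hT.unit).prod = 1 := by
  apply Units.ext
  rw [← Units.coeHom_apply, map_list_prod, List.map_ofFn]
  exact hT.prod

theorem IsTorus.conjEnd (hT : IsTorus K Kinv) : IsTorus (fun i => conjEnd k A (hT.unit i))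
    fun i => _root_.conjEnd k A (hT.unit i)⁻¹ := by
  intro a b hab
  cases hab with
  | comm i j =>
    rw [← map_mul, ← map_mul]
    exact congrArg _ (Units.ext (hT.comm i j))
  | mul_inv i => rw [← map_mul, mul_inv_cancel, map_one]
  | inv_mul i => rw [← map_mul, inv_mul_cancel, map_one]
  | prod =>
    rw [← map_one (_root_.conjEnd k A), ← hT.prod_unit, map_list_prod, List.map_ofFn]
    rfl

/-- In this representation torus elements fix 1, so applying fκ to 1 gives f. That makes fκ ⊗ κe ↦
fκe a well-defined linear map, although κ occurs in both factors. -/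
theorem FRel.conjEnd (hT : IsTorus K Kinv) (hF : ∀ a b, FRel q K Kinv F a b → a = b) :
    ∀ a b, FRel q (fun i => conjEnd k A (hT.unit i)) (fun i => _root_.conjEnd k A (hT.unit i)⁻¹)
      (fun s => Algebra.lmul k A (F s)) a b → a = b := by
  obtain ⟨hR, hc, hs⟩ := (FRel_iff hT).1 hF
  refine (FRel_iff hT.conjEnd).2 ⟨fun t i => ?_, fun s t hst => ?_, fun s t hst => ?_⟩
  · refine LinearMap.ext fun a => ?_
    have h : (hT.unit i : A) * F t = q ^ (-rootExp i t) • (F t * hT.unit i) := hR t i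
    change _root_.conjEnd k A (hT.unit i) (F t * a) =
      q ^ (-rootExp i t) • (F t * _root_.conjEnd k A (hT.unit i) a)
    rw [conjEnd_apply, conjEnd_apply, ← mul_assoc (F t), ← mul_assoc (F t), ← smul_mul_assoc,
      ← smul_mul_assoc, ← h, ← mul_assoc]
  · rw [← map_mul, hc s t hst, map_mul]
  · have := congrArg (Algebra.lmul k A) (hs s t hst)
    rw [map_zero] at this
    rw [← this]
    simp only [serrePoly, map_add, map_sub, map_mul, map_smul, map_pow]

end ConjRep

/-! ### Injectivity on the extended quantized enveloping algebra -/

namespace Uext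

variable {k : Type*} [Field k] {n : ℕ} {q : k}

/-- The map from the Borel algebra of the `E_s`. -/
def ofE : BorelE n q →ₐ[k] Uext n q := BorelE.lift isTorus relE

/-- The map from the Borel algebra of the `F_s`. -/
def ofF : BorelF n q →ₐ[k] Uext n q := BorelF.lift isTorus relF

/-- The representation in which the `F_s` act by left multiplication and the `K̂_i` by
conjugation. -/
def conjRep : BorelF n q →ₐ[k] Module.End k (Uext n q) :=
  BorelF.lift isTorus.conjEnd (FRel.conjEnd isTorus relF)

theorem conjRep_F (s : Fin n) (a : Uext n q) :
    conjRep (.gen n q (.X s)) a = gen n q (.F s) * a :=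
  LinearMap.congr_fun (BorelF.lift_gen _ _ (.X s)) a

theorem conjRep_K (i : Fin (n + 1)) (a : Uext n q) :
    conjRep (.gen n q (.K i)) a = gen n q (.K i) * a * gen n q (.Kinv i) :=
  (LinearMap.congr_fun (BorelF.lift_gen _ _ (.K i)) a).trans (conjEnd_apply _ a)

theorem conjRep_Kinv (i : Fin (n + 1)) (a : Uext n q) :
    conjRep (.gen n q (.Kinv i)) a = gen n q (.Kinv i) * a * gen n q (.K i) :=
  (LinearMap.congr_fun (BorelF.lift_gen _ _ (.Kinv i)) a).trans (conjEnd_apply _ a)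

/-- The map with `f κ ⊗ κ e ↦ f κ e` for products `f` of the `F_s`, `e` of the `E_s` and `κ` of the
`K̂_i^{±1}`. -/
def mixMul : BorelF n q ⊗[k] BorelE n q →ₗ[k] Uext n q :=
  LinearMap.mul' k (Uext n q) ∘ₗ
    TensorProduct.map (LinearMap.applyₗ 1 ∘ₗ conjRep.toLinearMap) ofE.toLinearMap

theorem mixMul_tmul (y : BorelF n q) (x : BorelE n q) :
    mixMul (y ⊗ₜ[k] x) = conjRep y 1 * ofE x := rfl

theorem conjRep_one (a : Uext n q) : conjRep 1 a = a :=
  LinearMap.congr_fun (map_one conjRep) a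

theorem mixMul_one : mixMul (1 : BorelF n q ⊗[k] BorelE n q) = 1 := by
  rw [Algebra.TensorProduct.one_def, mixMul_tmul, conjRep_one, map_one, mul_one]

theorem mixMul_F_mul (s : Fin n) (τ : BorelF n q ⊗[k] BorelE n q) :
    mixMul ((.gen n q (.X s) ⊗ₜ 1) * τ) = gen n q (.F s) * mixMul τ := by
  induction τ with
  | zero => simp
  | add a b ha hb => rw [mul_add, map_add, map_add, ha, hb, mul_add]
  | tmul y x =>
    rw [Algebra.TensorProduct.tmul_mul_tmul, mixMul_tmul, mixMul_tmul, map_mul, one_mul,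
      Module.End.mul_apply, conjRep_F, mul_assoc]

/-- Conjugation on the left factor gives K̂ f K̂⁻¹, whose last factor cancels the K̂ in the right
factor. -/
theorem mixMul_K_mul (i : Fin (n + 1)) (τ : BorelF n q ⊗[k] BorelE n q) :
    mixMul ((.gen n q (.K i) ⊗ₜ .gen n q (.K i)) * τ) = gen n q (.K i) * mixMul τ := by
  induction τ with
  | zero => simp
  | add a b ha hb => rw [mul_add, map_add, map_add, ha, hb, mul_add]
  | tmul y x =>
    rw [Algebra.TensorProduct.tmul_mul_tmul, mixMul_tmul, mixMul_tmul, map_mul, map_mul,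
      Module.End.mul_apply, conjRep_K, ofE, BorelE.lift_gen, mul_assoc, ← mul_assoc (gen n q (.Kinv i))]
    change _ * (gen n q (.Kinv i) * gen n q (.K i) * _) = _
    rw [isTorus.inv_mul i, one_mul, mul_assoc]

theorem mixMul_Kinv_mul (i : Fin (n + 1)) (τ : BorelF n q ⊗[k] BorelE n q) :
    mixMul ((.gen n q (.Kinv i) ⊗ₜ .gen n q (.Kinv i)) * τ) = gen n q (.Kinv i) * mixMul τ := by
  induction τ with
  | zero => simp
  | add a b ha hb => rw [mul_add, map_add, map_add, ha, hb, mul_add]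
  | tmul y x =>
    rw [Algebra.TensorProduct.tmul_mul_tmul, mixMul_tmul, mixMul_tmul, map_mul, map_mul,
      Module.End.mul_apply, conjRep_Kinv, ofE, BorelE.lift_gen, mul_assoc, ← mul_assoc (gen n q (.K i))]
    change _ * (gen n q (.K i) * gen n q (.Kinv i) * _) = _
    rw [isTorus.mul_inv i, one_mul, mul_assoc]

theorem mixMul_mul_of_conjRep {y : BorelF n q} (hy : conjRep y 1 = 1) (x : BorelE n q)
    (τ : BorelF n q ⊗[k] BorelE n q) : mixMul (τ * (y ⊗ₜ x)) = mixMul τ * ofE x := by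
  induction τ with
  | zero => simp
  | add a b ha hb => rw [add_mul, map_add, map_add, ha, hb, add_mul]
  | tmul y' x' =>
    rw [Algebra.TensorProduct.tmul_mul_tmul, mixMul_tmul, mixMul_tmul, map_mul, map_mul,
      Module.End.mul_apply, hy, mul_assoc]

theorem conjRep_K_one (i : Fin (n + 1)) : conjRep (.gen n q (.K i)) (1 : Uext n q) = 1 := by
  rw [conjRep_K, mul_one]
  exact isTorus.mul_inv i

theorem conjRep_Kinv_one (i : Fin (n + 1)) : conjRep (.gen n q (.Kinv i)) (1 : Uext n q) = 1 := by
  rw [conjRep_Kinv, mul_one]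
  exact isTorus.inv_mul i

variable (hq : q ≠ 0)

/-- The grading element of the tensor square. -/
def gradeUnit : (Uext n q ⊗[k] Uext n q)ˣ :=
  Units.map ((Algebra.TensorProduct.includeLeft : Uext n q →ₐ[k] Uext n q ⊗[k] Uext n q) :
    Uext n q →* Uext n q ⊗[k] Uext n q) (isTorus (n := n) (q := q)).heightUnit

theorem tmul_mem_innerWt {a : Uext n q} {d : ℤ}
    (h : QComm q d ((isTorus (n := n) (q := q)).heightUnit : Uext n q) a) (b : Uext n q) :
    a ⊗ₜ b ∈ innerWt q (gradeUnit : (Uext n q ⊗[k] Uext n q)ˣ).1 d := by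
  change (_ ⊗ₜ 1) * _ = q ^ d • (_ * (_ ⊗ₜ 1))
  rw [Algebra.TensorProduct.tmul_mul_tmul, Algebra.TensorProduct.tmul_mul_tmul, one_mul, mul_one, h,
    TensorProduct.smul_tmul']

/-- The inclusion of the tensor product of the Borel algebras. -/
def ofFE : BorelF n q ⊗[k] BorelE n q →ₐ[k] Uext n q ⊗[k] Uext n q :=
  Algebra.TensorProduct.map ofF ofE

/-- `τ` describes the leading term of the coproduct of `u`. -/
def LeadAt (h : ℤ) (u : Uext n q) (τ : BorelF n q ⊗[k] BorelE n q) : Prop :=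
  HasLead q (hopf hq).Δ (gradeUnit : (Uext n q ⊗[k] Uext n q)ˣ).1 h u (ofFE τ)

theorem hasWeight_zero_K (i : Fin (n + 1)) :
    HasWeight q (fun i => gen n q (.K i)) 0 (gen n q (.K i)) := fun j => by
  simpa using isTorus.comm j i

theorem hasWeight_zero_Kinv (i : Fin (n + 1)) :
    HasWeight q (fun i => gen n q (.K i)) 0 (gen n q (.Kinv i)) := fun j => by
  simpa using (isTorus.inv_comm_left i j).symm

theorem leadAt_K (i : Fin (n + 1)) :
    LeadAt hq 0 (gen n q (.K i)) (.gen n q (.K i) ⊗ₜ .gen n q (.K i)) := by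
  rw [LeadAt, ofFE, Algebra.TensorProduct.map_tmul, ofF, ofE, BorelF.lift_gen, BorelE.lift_gen]
  exact .of_eq ((torusHopf hq).comul_K i)
    (tmul_mem_innerWt ((hasWeight_zero_K i).qcomm_heightUnit isTorus hq) _)

theorem leadAt_Kinv (i : Fin (n + 1)) :
    LeadAt hq 0 (gen n q (.Kinv i)) (.gen n q (.Kinv i) ⊗ₜ .gen n q (.Kinv i)) := by
  rw [LeadAt, ofFE, Algebra.TensorProduct.map_tmul, ofF, ofE, BorelF.lift_gen, BorelE.lift_gen]
  exact .of_eq ((torusHopf hq).comul_Kinv i)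
    (tmul_mem_innerWt ((hasWeight_zero_Kinv i).qcomm_heightUnit isTorus hq) _)

/-- Height is read off in the first tensor factor: in Δ(E_s) the term E_s ⊗ k_s has height 1 and is
discarded. In Δ(F_s) the term F_s ⊗ 1 has height -1 and is the one kept. Leading terms thus lie in
the tensor product of the two Borel algebras. -/
theorem leadAt_E (s : Fin n) : LeadAt hq 0 (gen n q (.E s)) (1 ⊗ₜ .gen n q (.X s)) := by
  rw [LeadAt, ofFE, Algebra.TensorProduct.map_tmul, ofE, BorelE.lift_gen, map_one]
  exact .of_eq_add ((eHopf hq).comul s)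
    (tmul_mem_innerWt (HasWeight.one.qcomm_heightUnit isTorus hq) _)
    (tmul_mem_innerWt (hasRoots.qcomm_heightUnit isTorus hq s) _) one_pos

theorem leadAt_F (s : Fin n) : LeadAt hq (-1) (gen n q (.F s)) (.gen n q (.X s) ⊗ₜ 1) := by
  rw [LeadAt, ofFE, Algebra.TensorProduct.map_tmul, ofF, BorelF.lift_gen, map_one]
  exact .of_eq_add ((fHopf hq).comul s)
    (tmul_mem_innerWt (hasNegRoots.qcomm_heightUnit isTorus hq s) _)
    (tmul_mem_innerWt ((isTorus.hasWeight_simpleKinv s).qcomm_heightUnit isTorus hq) _)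
    (by norm_num)

theorem leadAt_one : LeadAt hq 0 (1 : Uext n q) 1 := by
  rw [LeadAt, map_one]
  refine .of_eq (map_one _) ?_
  rw [Algebra.TensorProduct.one_def]
  exact tmul_mem_innerWt (HasWeight.one.qcomm_heightUnit isTorus hq) _

theorem LeadAt.mul {hq : q ≠ 0} {d e : ℤ} {u v : Uext n q} {σ τ : BorelF n q ⊗[k] BorelE n q}
    (h : LeadAt hq d u σ) (h' : LeadAt hq e v τ) : LeadAt hq (d + e) (u * v) (σ * τ) := by
  rw [LeadAt, map_mul]
  exact HasLead.mul hq h h'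

/-- The elements `u` whose coproduct has a leading term of weight `-h` that determines `u`. -/
def leadSpace (h : ℕ) : Submodule k (Uext n q) where
  carrier := {u | ∃ τ, LeadAt hq (-h) u τ ∧ mixMul τ = u}
  add_mem' := by
    rintro _ _ ⟨σ, h₁, rfl⟩ ⟨τ, h₂, rfl⟩
    refine ⟨σ + τ, ?_, map_add _ _ _⟩
    rw [LeadAt, map_add]
    exact HasLead.add h₁ h₂
  zero_mem' := ⟨0, by rw [LeadAt, map_zero]; exact .zero, map_zero _⟩
  smul_mem' := by
    rintro c _ ⟨σ, h₁, rfl⟩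
    refine ⟨c • σ, ?_, map_smul _ _ _⟩
    rw [LeadAt, map_smul]
    exact HasLead.smul c h₁

variable {hq} {h : ℕ} {u : Uext n q}

theorem F_mul_mem_leadSpace (s : Fin n) (hu : u ∈ leadSpace hq h) :
    gen n q (.F s) * u ∈ leadSpace hq (h + 1) := by
  obtain ⟨τ, h₁, rfl⟩ := hu
  refine ⟨_, ?_, mixMul_F_mul s τ⟩
  have := (leadAt_F hq s).mul h₁
  rwa [← neg_add, add_comm, ← Nat.cast_succ] at this

theorem K_mul_mem_leadSpace (i : Fin (n + 1)) (hu : u ∈ leadSpace hq h) :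
    gen n q (.K i) * u ∈ leadSpace hq h := by
  obtain ⟨τ, h₁, rfl⟩ := hu
  refine ⟨_, ?_, mixMul_K_mul i τ⟩
  have := (leadAt_K hq i).mul h₁
  rwa [zero_add] at this

theorem Kinv_mul_mem_leadSpace (i : Fin (n + 1)) (hu : u ∈ leadSpace hq h) :
    gen n q (.Kinv i) * u ∈ leadSpace hq h := by
  obtain ⟨τ, h₁, rfl⟩ := hu
  refine ⟨_, ?_, mixMul_Kinv_mul i τ⟩
  have := (leadAt_Kinv hq i).mul h₁
  rwa [zero_add] at this

theorem mul_K_mem_leadSpace (i : Fin (n + 1)) (hu : u ∈ leadSpace hq h) :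
    u * gen n q (.K i) ∈ leadSpace hq h := by
  obtain ⟨τ, h₁, rfl⟩ := hu
  refine ⟨_, ?_, (mixMul_mul_of_conjRep (conjRep_K_one i) (.gen n q (.K i)) τ).trans ?_⟩
  · have := h₁.mul (leadAt_K hq i)
    rwa [add_zero] at this
  · rw [ofE, BorelE.lift_gen]
    rfl

theorem mul_Kinv_mem_leadSpace (i : Fin (n + 1)) (hu : u ∈ leadSpace hq h) :
    u * gen n q (.Kinv i) ∈ leadSpace hq h := by
  obtain ⟨τ, h₁, rfl⟩ := hu
  refine ⟨_, ?_, (mixMul_mul_of_conjRep (conjRep_Kinv_one i) (.gen n q (.Kinv i)) τ).trans ?_⟩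
  · have := h₁.mul (leadAt_Kinv hq i)
    rwa [add_zero] at this
  · rw [ofE, BorelE.lift_gen]
    rfl

theorem mul_E_mem_leadSpace (s : Fin n) (hu : u ∈ leadSpace hq h) :
    u * gen n q (.E s) ∈ leadSpace hq h := by
  obtain ⟨τ, h₁, rfl⟩ := hu
  refine ⟨_, ?_, (mixMul_mul_of_conjRep (y := 1) (conjRep_one 1) (.gen n q (.X s)) τ).trans
    ?_⟩
  · have := h₁.mul (leadAt_E hq s)
    rwa [add_zero] at this
  · rw [ofE, BorelE.lift_gen]
    rfl

theorem one_mem_leadSpace : (1 : Uext n q) ∈ leadSpace hq 0 :=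
  ⟨1, by simpa using leadAt_one hq, mixMul_one⟩

variable (hq)

theorem mem_leadSpace_zero {g : Uext n q} (hg : g ∈ Algebra.adjoin k
    (genSet (fun i => gen n q (.K i)) (fun i => gen n q (.Kinv i)) fun s => gen n q (.E s))) :
    g ∈ leadSpace hq 0 := by
  have key : ∀ v ∈ leadSpace hq 0, v * g ∈ leadSpace hq 0 := by
    induction hg using Algebra.adjoin_induction with
    | mem x hx =>
      intro v hv
      rcases hx with (⟨i, rfl⟩ | ⟨i, rfl⟩) | ⟨s, rfl⟩
      · exact mul_K_mem_leadSpace i hv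
      · exact mul_Kinv_mem_leadSpace i hv
      · exact mul_E_mem_leadSpace s hv
    | algebraMap r =>
      intro v hv
      rw [← Algebra.commutes, ← Algebra.smul_def]
      exact Submodule.smul_mem _ _ hv
    | add x y _ _ hx hy => intro v hv; rw [mul_add]; exact add_mem (hx v hv) (hy v hv)
    | mul x y _ _ hx hy => intro v hv; rw [← mul_assoc]; exact hy _ (hx v hv)
  simpa using key 1 one_mem_leadSpace

theorem mul_mem_iSup_leadSpace {g : Uext n q} (hg : g ∈ Algebra.adjoin k
    (genSet (fun i => gen n q (.K i)) (fun i => gen n q (.Kinv i)) fun s => gen n q (.F s))) :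
    ∀ v ∈ ⨆ h, leadSpace hq h, g * v ∈ ⨆ h, leadSpace hq h := by
  have hind : ∀ g : Uext n q, (∀ h, ∀ v ∈ leadSpace hq h, g * v ∈ ⨆ h, leadSpace hq h) →
      ∀ v ∈ ⨆ h, leadSpace hq h, g * v ∈ ⨆ h, leadSpace hq h := by
    intro g hg v hv
    refine Submodule.iSup_induction _ (motive := fun v => g * v ∈ ⨆ h, leadSpace hq h) hv hg ?_ ?_
    · rw [mul_zero]; exact zero_mem _
    · intro x y hx hy
      rw [mul_add]; exact add_mem hx hy
  induction hg using Algebra.adjoin_induction with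
  | mem x hx =>
    refine hind _ fun h v hv => ?_
    rcases hx with (⟨i, rfl⟩ | ⟨i, rfl⟩) | ⟨s, rfl⟩
    · exact Submodule.mem_iSup_of_mem h (K_mul_mem_leadSpace i hv)
    · exact Submodule.mem_iSup_of_mem h (Kinv_mul_mem_leadSpace i hv)
    · exact Submodule.mem_iSup_of_mem (h + 1) (F_mul_mem_leadSpace s hv)
  | algebraMap r =>
    intro v hv
    rw [← Algebra.smul_def]
    exact Submodule.smul_mem _ _ hv
  | add x y _ _ hx hy => intro v hv; rw [add_mul]; exact add_mem (hx v hv) (hy v hv)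
  | mul x y _ _ hx hy => intro v hv; rw [mul_assoc]; exact hx _ (hy v hv)

/-- By the product decomposition with the F_s on the left, every element is a sum of products of an
F-part and an E-part. The E-part stays in degree 0 under right multiplication, and each F_s on the
left raises the degree by one. -/
theorem iSup_leadSpace : ⨆ h, leadSpace (n := n) hq h = ⊤ := by
  have htop : Algebra.adjoin k (genSet (fun i => gen n q (.K i)) (fun i => gen n q (.Kinv i))
      fun s => gen n q (.F s)) ⊔ Algebra.adjoin k (genSet (fun i => gen n q (.K i))
      (fun i => gen n q (.Kinv i)) fun s => gen n q (.E s)) = ⊤ := by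
    rw [eq_top_iff, ← adjoin_gen, ← Algebra.adjoin_union]
    refine Algebra.adjoin_mono ?_
    rintro _ ⟨i | i | s | s, rfl⟩
    · exact .inl (.inl (.inl ⟨i, rfl⟩))
    · exact .inl (.inl (.inr ⟨i, rfl⟩))
    · exact .inr (.inr ⟨s, rfl⟩)
    · exact .inl (.inr ⟨s, rfl⟩)
  have := adjoin_sup_eq_mul hq (isTorus (n := n)) hasRoots hasNegRoots relEF
  rw [htop, Algebra.top_toSubmodule] at this
  rw [eq_top_iff, this]
  exact Submodule.mul_le.2 fun a ha b hb => mul_mem_iSup_leadSpace hq ha _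
    (Submodule.mem_iSup_of_mem 0 (mem_leadSpace_zero hq hb))

theorem comul_mem_of_mem_leadSpace (hu : u ∈ leadSpace hq h) {d : ℤ} (hd : d < -h) :
    (hopf hq).Δ u ∈ innerWtGT q (gradeUnit : (Uext n q ⊗[k] Uext n q)ˣ).1 d := by
  obtain ⟨τ, ⟨h₁, h₂⟩, -⟩ := hu
  have := add_mem (innerWtGT_mono hd.le h₂) (innerWt_le_innerWtGT hd h₁)
  rwa [sub_add_cancel] at this

/-- A map that is injective on the Borel algebras is injective. -/
theorem eq_zero_of_map_comul (hroot : ∀ m : ℕ, 0 < m → q ^ m ≠ 1) {C : Type*} [Ring C] [Algebra k C]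
    {φ : Uext n q →ₐ[k] C} (hF : Function.Injective (φ.comp ofF))
    (hE : Function.Injective (φ.comp ofE)) {u : Uext n q}
    (hu : Algebra.TensorProduct.map φ φ ((hopf hq).Δ u) = 0) : u = 0 := by
  set Φ := Algebra.TensorProduct.map φ φ
  have hinj : Function.Injective (Φ.comp (ofFE (n := n) (q := q))) := by
    have h : Φ.comp (ofFE (n := n) (q := q)) =
        Algebra.TensorProduct.map (φ.comp ofF) (φ.comp ofE) := by
      rw [ofFE]
      exact (Algebra.TensorProduct.map_comp _ _ _ _).symm
    rw [h]
    -- Over a field the tensor product of injective maps is injective.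
    exact TensorProduct.map_injective_of_flat_flat (φ.comp ofF).toLinearMap
      (φ.comp ofE).toLinearMap hF hE
  -- Induction on a bound for the number of F_s. If u = a + b with a of degree H and b of lower
  -- degree, then the image of Δ(u) has in weight -H only the image of the leading term of a; this
  -- term is therefore zero, and it determines a.
  have key : ∀ H : ℕ, ∀ u ∈ (Finset.range H).sup (leadSpace (n := n) hq),
      Φ ((hopf hq).Δ u) = 0 → u = 0 := by
    intro H
    induction H with
    | zero => intro u hu _; simpa using hu
    | succ H ih =>
      intro u hu h0
      rw [Finset.range_add_one, Finset.sup_insert] at hu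
      obtain ⟨a, ⟨τ, ⟨h₁, h₂⟩, rfl⟩, b, hb, rfl⟩ := Submodule.mem_sup.1 hu
      have hbΔ : (hopf hq).Δ b ∈
          innerWtGT q (gradeUnit : (Uext n q ⊗[k] Uext n q)ˣ).1 (-(H : ℤ)) := by
        have : (Finset.range H).sup (leadSpace (n := n) hq) ≤
            (innerWtGT q (gradeUnit : (Uext n q ⊗[k] Uext n q)ˣ).1 (-(H : ℤ))).comap
              (hopf hq).Δ.toLinearMap :=
          Finset.sup_le fun h hh v hv => comul_mem_of_mem_leadSpace hq hv (by
            have := Finset.mem_range.1 hh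
            omega)
        exact this hb
      have hsum : Φ (ofFE τ) = -Φ ((hopf hq).Δ (mixMul τ) - ofFE τ + (hopf hq).Δ b) := by
        rw [map_add, map_add] at h0
        rw [map_add, map_sub, eq_neg_iff_add_eq_zero, ← h0]
        abel
      have hzero : Φ (ofFE τ) = 0 := by
        refine Submodule.disjoint_def.1 (disjoint_innerWt hq hroot (Units.map
          (Φ : Uext n q ⊗[k] Uext n q →* C ⊗[k] C) gradeUnit)
          (-(H : ℤ))) _ (map_mem_innerWt Φ h₁) ?_
        rw [hsum]
        exact neg_mem (map_mem_innerWtGT Φ (add_mem h₂ hbΔ))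
      have hτ : τ = 0 := (injective_iff_map_eq_zero _).1 hinj τ hzero
      rw [hτ, map_zero, zero_add] at h0 ⊢
      exact ih b hb h0
  have hmem : u ∈ ⨆ h, leadSpace (n := n) hq h := iSup_leadSpace (n := n) hq ▸ Submodule.mem_top
  obtain ⟨s, hs⟩ := Submodule.mem_iSup_iff_exists_finset.1 hmem
  obtain ⟨H, hH⟩ := s.exists_nat_subset_range
  refine key H u ?_ hu
  rw [← Finset.sup_eq_iSup] at hs
  exact (Finset.sup_mono hH : s.sup (leadSpace hq) ≤ _) hs

end Uext

/-! ### Injectivity of the map from U_q^ext(sl_N). -/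

namespace SLq

variable {k : Type*} [Field k] {n : ℕ} {q z : k} (hq : q ≠ 0) (hz : z ^ (n + 1) = q⁻¹)

theorem ofUext_comp_ofE (hq2 : q ^ 2 ≠ 1) :
    (ofUext hq hz hq2).comp Uext.ofE = ofBorelE (n := n) hq hz := by
  refine AlgHom.ext_of_adjoin_eq_top BorelE.adjoin_gen ?_
  rintro _ ⟨g, rfl⟩
  rw [AlgHom.comp_apply, Uext.ofE, BorelE.lift_gen, ofBorelE_gen]
  cases g <;> exact ofUext_gen hq hz hq2 _

theorem ofUext_comp_ofF (hq2 : q ^ 2 ≠ 1) :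
    (ofUext hq hz hq2).comp Uext.ofF = ofBorelF (n := n) hq hz hq2 := by
  refine AlgHom.ext_of_adjoin_eq_top BorelF.adjoin_gen ?_
  rintro _ ⟨g, rfl⟩
  rw [AlgHom.comp_apply, Uext.ofF, BorelF.lift_gen, ofBorelF_gen]
  cases g <;> exact ofUext_gen hq hz hq2 _

/-- The map onto H_σ commutes with Δ, so an element of its kernel has a coproduct killed by the
tensor square of the map. Injectivity on the two Borel algebras is already known, and the leading
term argument concludes. -/
theorem ofUext_injective (hq2 : q ^ 2 ≠ 1) (h : ∀ m : ℕ, 0 < m → q ^ m ≠ 1) :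
    Function.Injective (ofUext (n := n) hq hz hq2) := by
  refine (injective_iff_map_eq_zero _).2 fun u hu => ?_
  obtain ⟨DU, hDU⟩ := exists_isSubHopf hq hz (K_mem_Hsigma hq hz hq2)
    (Kinv_mem_Hsigma hq hz hq2) (Hsigma_eq (n := n) hq hz hq2) subset_rfl
  have hu' : toHsigma hq hz hq2 u = 0 := Subtype.ext hu
  refine Uext.eq_zero_of_map_comul hq h (φ := toHsigma hq hz hq2) (fun a b hab => ?_)
    (fun a b hab => ?_) ?_
  · refine ofBorelF_injective hq hz hq2 h ?_
    rw [← ofUext_comp_ofF]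
    exact congrArg Subtype.val hab
  · refine ofBorelE_injective hq hz hq2 h ?_
    rw [← ofUext_comp_ofE hq hz hq2]
    exact congrArg Subtype.val hab
  · rw [← (toHsigma_isHom hq hz hq2 hDU).map_comul, hu', map_zero]

end SLq

theorem mainTheorem9 {k : Type*} [Field k] (n : ℕ) (q z : k) (hq : q ≠ 0) (hq2 : q ^ 2 ≠ 1)
    (hz : z ^ (n + 1) = q⁻¹) :
    -- the Hopf algebra `H = SL_q(n + 1)`, with its comatrix coalgebra structure
    ∃ D : HopfStructure k (SLq n q),
      (∀ i j, D.Δ (SLq.x n q i j) = ∑ m, SLq.x n q i m ⊗ₜ[k] SLq.x n q m j) ∧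
      (∀ i j, D.ε (SLq.x n q i j) = if i = j then 1 else 0) ∧
    -- its coquasitriangular structure
    ∃ C : CQT D,
      (∀ i m j l, C.σ (SLq.x n q i m) (SLq.x n q j l) =
        z * ((if i = j then q else 1) * (if m = i then 1 else 0) * (if l = j then 1 else 0) +
          (if i < j then q - q⁻¹ else 0) * (if m = j then 1 else 0) *
            (if l = i then 1 else 0))) ∧
    -- `H_σ` is the product `H_l H_r = H_r H_l`
      Subalgebra.toSubmodule C.Hsigma
        = Subalgebra.toSubmodule C.Hl * Subalgebra.toSubmodule C.Hr ∧
      Subalgebra.toSubmodule C.Hsigma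
        = Subalgebra.toSubmodule C.Hr * Subalgebra.toSubmodule C.Hl ∧
    -- generators of `H_σ`, `H_l`, `H_r`
      C.Hsigma = Algebra.adjoin k
        (Set.range C.K ∪ Set.range C.Kinv ∪ Set.range C.E ∪ Set.range C.F) ∧
      C.Hl = Algebra.adjoin k (Set.range C.K ∪ Set.range C.Kinv ∪ Set.range C.E) ∧
      C.Hr = Algebra.adjoin k (Set.range C.K ∪ Set.range C.Kinv ∪ Set.range C.F) ∧
    -- relations between the generators
      (∀ a b, TorusRel C.K C.Kinv a b → a = b) ∧
      (∀ a b, ERel q C.K C.Kinv C.E a b → a = b) ∧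
      (∀ a b, FRel q C.K C.Kinv C.F a b → a = b) ∧
      (∀ a b, EFRel q C.K C.Kinv C.E C.F a b → a = b) ∧
    -- `H_σ`, `H_l`, `H_r` are sub-Hopf algebras of the finite dual `H^0`
    ∃ (Dσ : HopfStructure k C.Hsigma) (Dl : HopfStructure k C.Hl) (Dr : HopfStructure k C.Hr),
      D.IsSubHopf C.Hsigma Dσ ∧ D.IsSubHopf C.Hl Dl ∧ D.IsSubHopf C.Hr Dr ∧
    -- the Hopf algebra `U_q^ext(sl_{n+1})` and its Borel parts
    ∃ (DU : HopfStructure k (Uext n q)) (DE : HopfStructure k (BorelE n q))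
      (DF : HopfStructure k (BorelF n q)),
      (TorusHopf DU (fun i => Uext.gen n q (.K i)) (fun i => Uext.gen n q (.Kinv i)) ∧
        EHopf DU (fun i => Uext.gen n q (.K i)) (fun i => Uext.gen n q (.Kinv i))
          (fun s => Uext.gen n q (.E s)) ∧
        FHopf DU (fun i => Uext.gen n q (.K i)) (fun i => Uext.gen n q (.Kinv i))
          (fun s => Uext.gen n q (.F s))) ∧
      (TorusHopf DE (fun i => BorelE.gen n q (.K i)) (fun i => BorelE.gen n q (.Kinv i)) ∧
        EHopf DE (fun i => BorelE.gen n q (.K i)) (fun i => BorelE.gen n q (.Kinv i))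
          (fun s => BorelE.gen n q (.X s))) ∧
      (TorusHopf DF (fun i => BorelF.gen n q (.K i)) (fun i => BorelF.gen n q (.Kinv i)) ∧
        FHopf DF (fun i => BorelF.gen n q (.K i)) (fun i => BorelF.gen n q (.Kinv i))
          (fun s => BorelF.gen n q (.X s))) ∧
    -- the canonical surjections of Hopf algebras, which are isomorphisms if `q` is not a root of 1
    ∃ (Φ : Uext n q →ₐ[k] C.Hsigma) (Φl : BorelE n q →ₐ[k] C.Hl) (Φr : BorelF n q →ₐ[k] C.Hr),
      ((∀ i, (Φ (Uext.gen n q (.K i)) : D.Dual) = C.K i) ∧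
        (∀ i, (Φ (Uext.gen n q (.Kinv i)) : D.Dual) = C.Kinv i) ∧
        (∀ s, (Φ (Uext.gen n q (.E s)) : D.Dual) = C.E s) ∧
        (∀ s, (Φ (Uext.gen n q (.F s)) : D.Dual) = C.F s)) ∧
      ((∀ i, (Φl (BorelE.gen n q (.K i)) : D.Dual) = C.K i) ∧
        (∀ i, (Φl (BorelE.gen n q (.Kinv i)) : D.Dual) = C.Kinv i) ∧
        (∀ s, (Φl (BorelE.gen n q (.X s)) : D.Dual) = C.E s)) ∧
      ((∀ i, (Φr (BorelF.gen n q (.K i)) : D.Dual) = C.K i) ∧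
        (∀ i, (Φr (BorelF.gen n q (.Kinv i)) : D.Dual) = C.Kinv i) ∧
        (∀ s, (Φr (BorelF.gen n q (.X s)) : D.Dual) = C.F s)) ∧
      (DU.IsHom Dσ Φ ∧ DE.IsHom Dl Φl ∧ DF.IsHom Dr Φr) ∧
      (Function.Surjective Φ ∧ Function.Surjective Φl ∧ Function.Surjective Φr) ∧
      ((∀ m : ℕ, 0 < m → q ^ m ≠ 1) →
        Function.Bijective Φ ∧ Function.Bijective Φl ∧ Function.Bijective Φr) := by
  obtain ⟨Dσ, hσ⟩ := SLq.exists_isSubHopf hq hz (SLq.K_mem_Hsigma hq hz hq2)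
    (SLq.Kinv_mem_Hsigma hq hz hq2) (SLq.Hsigma_eq hq hz hq2) subset_rfl
  obtain ⟨Dl, hl⟩ := SLq.exists_isSubHopf hq hz
    (fun i => SLq.Hl_eq hq hz hq2 ▸ Algebra.subset_adjoin (K_mem_genSet _ i))
    (fun i => SLq.Hl_eq hq hz hq2 ▸ Algebra.subset_adjoin (Kinv_mem_genSet _ i))
    (SLq.Hl_eq hq hz hq2) Set.subset_union_left
  obtain ⟨Dr, hr⟩ := SLq.exists_isSubHopf hq hz
    (fun i => SLq.Hr_eq hq hz hq2 ▸ Algebra.subset_adjoin (K_mem_genSet _ i))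
    (fun i => SLq.Hr_eq hq hz hq2 ▸ Algebra.subset_adjoin (Kinv_mem_genSet _ i))
    (SLq.Hr_eq hq hz hq2) (Set.union_subset
      (Set.subset_union_of_subset_left Set.subset_union_left _) Set.subset_union_right)
  exact ⟨SLq.hopf hq, (SLq.isCorep hq).comul, (SLq.isCorep hq).counit,
    SLq.cqt hq hz, SLq.sigma_x hq hz, SLq.Hsigma_eq_mul hq hz hq2, SLq.Hsigma_eq_mul' hq hz hq2,
    SLq.Hsigma_eq hq hz hq2, SLq.Hl_eq hq hz hq2, SLq.Hr_eq hq hz hq2,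
    SLq.isTorus_K hq hz, SLq.E_rel hq hz, SLq.F_rel hq hz hq2, SLq.EF_rel hq hz hq2,
    Dσ, Dl, Dr, hσ, hl, hr, Uext.hopf hq, BorelE.hopf hq, BorelF.hopf hq,
    ⟨Uext.torusHopf hq, Uext.eHopf hq, Uext.fHopf hq⟩, ⟨BorelE.torusHopf hq, BorelE.eHopf hq⟩,
    ⟨BorelF.torusHopf hq, BorelF.fHopf hq⟩,
    SLq.toHsigma hq hz hq2, SLq.toHl hq hz hq2, SLq.toHr hq hz hq2,
    ⟨fun i => SLq.ofUext_gen hq hz hq2 (.K i), fun i => SLq.ofUext_gen hq hz hq2 (.Kinv i),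
      fun s => SLq.ofUext_gen hq hz hq2 (.E s), fun s => SLq.ofUext_gen hq hz hq2 (.F s)⟩,
    ⟨fun i => SLq.ofBorelE_gen hq hz (.K i), fun i => SLq.ofBorelE_gen hq hz (.Kinv i),
      fun s => SLq.ofBorelE_gen hq hz (.X s)⟩,
    ⟨fun i => SLq.ofBorelF_gen hq hz hq2 (.K i), fun i => SLq.ofBorelF_gen hq hz hq2 (.Kinv i),
      fun s => SLq.ofBorelF_gen hq hz hq2 (.X s)⟩,
    ⟨SLq.toHsigma_isHom hq hz hq2 hσ, SLq.toHl_isHom hq hz hq2 hl, SLq.toHr_isHom hq hz hq2 hr⟩,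
    ⟨SLq.toHsigma_surjective hq hz hq2, SLq.toHl_surjective hq hz hq2,
      SLq.toHr_surjective hq hz hq2⟩,
    fun h => ⟨⟨AlgHom.injective_codRestrict _ _ _ |>.2 (SLq.ofUext_injective hq hz hq2 h),
        SLq.toHsigma_surjective hq hz hq2⟩,
      ⟨AlgHom.injective_codRestrict _ _ _ |>.2 (SLq.ofBorelE_injective hq hz hq2 h),
        SLq.toHl_surjective hq hz hq2⟩,
      ⟨AlgHom.injective_codRestrict _ _ _ |>.2 (SLq.ofBorelF_injective hq hz hq2 h),
        SLq.toHr_surjective hq hz hq2⟩⟩⟩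

end
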